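/- **Setting.** Let $\mathbb K=\mathbb Q[\epsilon][[\hbar]]$, $q=e^{\epsilon\hbar}$, $[n]=1+q+\dots+q^{n-1}$, $[n]!=[1][2]\cdots[n]$. Let $\mathbb D$ be the $\hbar$-adically complete $\mathbb K$-algebra topologically generated by $\mathbf y,\mathbf b,\mathbf a,\mathbf x$ with relations $$\mathbf x\mathbf y=q\,\mathbf y\mathbf x+\tfrac{1-\mathbf A\mathbf B}{\hbar},\quad[\mathbf a,\mathbf x]=\mathbf x,\quad[\mathbf b,\mathbf x]=\epsilon\mathbf x,\quad[\mathbf a,\mathbf y]=-\mathbf y,\quad[\mathbf b,\mathbf y]=-\epsilon\mathbf y,\quad[\mathbf a,\mathbf b]=0,$$ where $\mathbf A=e^{-\epsilon\hbar\mathbf a}$, $\mathbf B=e^{-\hbar\mathbf b}$. Tensor powers $\mathbb D^{\otimes J}$ ($J$ a finite set) are completed, and an index denotes the tensor factor. The Hopf algebra operations are the multiplication $m:\mathbb D^{\otimes 2}\to\mathbb D$; the algebra map $\Delta$ with $\Delta\mathbf y=\mathbf y_2+\mathbf y_1\mathbf B_2$, $\Delta\mathbf b=\mathbf b_1+\mathbf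 b_2$, $\Delta\mathbf a=\mathbf a_1+\mathbf a_2$, $\Delta\mathbf x=\mathbf x_2+\mathbf A_2\mathbf x_1$; the algebra map $\varepsilon:\mathbb D\to\mathbb K$ killing the four generators; and the anti-multiplicative map $S$ with $S\mathbf y=-\mathbf y\mathbf B^{-1}$, $S\mathbf b=-\mathbf b$, $S\mathbf a=-\mathbf a$, $S\mathbf x=-\mathbf x\mathbf A^{-1}$. Put $$\mathbf R=\sum_{m,n\ge0}\frac{\hbar^{m+n}}{[m]!\,n!}\,\mathbf y^m\mathbf b^n\otimes\mathbf a^n\mathbf x^m,\qquad \mathbf C=(\mathbf A\mathbf B)^{1/2}=e^{-\hbar(\mathbf b+\epsilon\mathbf a)/2},\qquad \mathbf v=\mathbf C^{-1}\mathbf u,$$ where $\mathbf u$ is the image of $\mathbf R$ under $r\otimes s\mapsto S(s)\,r$. The pairing is $\pi(\mathbf a^n\mathbf x^m,\mathbf y^{m'}\mathbf b^{n'})=\delta_{nn'}\delta_{mm'}\,n!\,[m]!\,\hbar^{-m-n}\in\mathbb Q[\epsilon]((\hbar))$. **Generating functions.** Write $z=(y,b,a,x)$, $\zeta=(\eta,\beta,\alpha,\xi)$.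 The $\mathbb K$-linear map $\mathbb O:\mathbb Q[\epsilon,z_J][[\hbar]]\to\mathbb D^{\otimes J}$ sends a monomial to the product over $j\in J$ of the ordered monomials $\mathbf y_j^{k}\mathbf b_j^{l}\mathbf a_j^{m}\mathbf x_j^{n}$. For finite sets $J,K$ let $\mathcal C(J,K)=\mathbb Q[\epsilon,z_K][[\hbar]][[\zeta_J]]$. The generating function of a $\mathbb K$-linear $f:\mathbb D^{\otimes J}\to\mathbb D^{\otimes K}$ is $\sum_{d}\frac{\zeta_J^d}{d!}\,\mathbb O^{-1}f(\mathbb O(z_J^d))\in\mathcal C(J,K)$, and that of the pairing, with $\mathbb A$-label $i$ and $\mathbb B$-label $j$, is $$\pi^{ij}=\sum\frac{\alpha_i^{n}\xi_i^{m}\eta_j^{m'}\beta_j^{n'}}{n!\,m!\,m'!\,n'!}\,\pi(\mathbf a^n\mathbf x^m,\mathbf y^{m'}\mathbf b^{n'}).$$ **Perturbed Gaussians.** Let $\mathcal A_j=e^{\alpha_j}$, $B_k=e^{-\hbar b_k}$, and define multiplicative weights ($\mathcal A$ and $B$ having weight $0$) by $$\begin{array}{c|cccccccccc}&y&\eta&b&\beta&a&\alpha&x&\xi&\epsilon&\hbar\\\hline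 \mathrm{wh}&1&-1&1&-1&0&0&0&0&1&-1\\ \mathrm{wt}&1&1&0&2&2&0&1&1&-4&0\end{array}$$ $\mathcal{PG}(J,K)$ is the set of elements of $\mathcal C(J,K)$ of the form $Pe^G$ such that (1) $\mathrm{wh}=0$ on all monomials of $P$ and $G$; (2) $\mathrm{wt}=2$ on all monomials of $G$ and $\mathrm{wt}\le0$ on all monomials of $P$; (3) $G=(\beta_J,a_K)G^{(1)}\binom{b_K}{\alpha_J}+(y_K,\xi_J)G^{(2)}\binom{\eta_J}{x_K}$ for matrices $G^{(1)},G^{(2)}$ with entries in $\mathbb Q[\hbar]$ and in $\mathbb Q(\mathcal A_J,B_K^{1/2})[\hbar]$ respectively; (4) $P=\sum_{l\ge0}P_l\epsilon^l$ with $P_l\in\mathbb Q(\mathcal A_J,B_K^{1/2})[z_K,\zeta_J,\hbar]$. Here the rational functions occurring are required to have an expansion in $\mathbb Q[z_K]((\hbar))[[\zeta_J]]$. $\mathcal{PG}^\pm(J,K)$ is the set of elements of $\mathbb Q[\epsilon,z_K]((\hbar))[[\zeta_J]]$ of the form $Pe^G$ satisfying (1)–(4) with $\mathbb Q[\hbar]$,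 $\mathbb Q(\mathcal A_J,B_K^{1/2})[\hbar]$, $\mathbb Q(\mathcal A_J,B_K^{1/2})[z_K,\zeta_J,\hbar]$ replaced by $\mathbb Q[\hbar^{\pm1}]$, $\mathbb Q[\mathcal A_J^{\pm1},B_K^{\pm1/2},\hbar^{\pm1}]$, $\mathbb Q[\mathcal A_J^{\pm1},B_K^{\pm1/2},z_K,\zeta_J,\hbar^{\pm1}]$, and such that moreover $e^G\in\mathbb Q[z_K,B_K^{\pm1/2},\hbar^{\pm1}][[\zeta_J]]$. $\mathcal{PG}^+(J,K)=\mathcal{PG}^\pm(J,K)\cap\mathcal C(J,K)$, the elements without negative powers of $\hbar$. **Theorem.** The maps $\mathbb O$ are bijective, the operations $m,\Delta,S,\varepsilon$ are well defined on $\mathbb D$, the elements $\mathbf R$, $\mathbf C$, $\mathbf v$ are invertible, and: 1. $\mathbb O^{-1}(\mathbf R_{ij}^{\pm1})\in\mathcal{PG}(\emptyset,\{i,j\})$ and $\mathbb O^{-1}(\mathbf v_i^{\pm1}),\ \mathbb O^{-1}(\mathbf C_i^{\pm1})\in\mathcal{PG}(\emptyset,\{i\})$ for $i\ne j$. 2.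 The generating functions of $\Delta$, $m$, $S$, $\varepsilon$ lie in $\mathcal{PG}^+(\{i\},\{j,k\})$, $\mathcal{PG}^+(\{i,j\},\{k\})$, $\mathcal{PG}^+(\{i\},\{j\})$, $\mathcal{PG}^+(\{i\},\emptyset)$ respectively. 3. $\pi^{ij}\in\mathcal{PG}^\pm(\{i,j\},\emptyset)$. -/

import Mathlib

noncomputable section

open Finset Filter

namespace PGauss

/-! ### The base ring and `q`-numbers

`ℚ[ε]` is `Polynomial ℚ` (with `ε` its variable) and `𝕂 = ℚ[ε]⟦ħ⟧` is `PowerSeries` over it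
(with `ħ = PowerSeries.X`). -/

/-- The four generators; the same names index the four families of Latin variables `y, b, a, x`
and the dual Greek variables `η, β, α, ξ`. -/
inductive Gen
  | y | b | a | x
  deriving DecidableEq

instance : Fintype Gen where
  elems := {Gen.y, Gen.b, Gen.a, Gen.x}
  complete := by intro g; cases g <;> decide

/-- `ℚ[ε]`. -/
abbrev Qe : Type := Polynomial ℚ

/-- The deformation parameter `ε`. -/
def eps : Qe := Polynomial.X

/-- `𝕂 = ℚ[ε]⟦ħ⟧`. -/
abbrev KK : Type := PowerSeries Qe

/-- The series `e^{ħ u}` in `A⟦ħ⟧`, for `u` in a (not necessarily commutative) `ℚ`-algebra `A`. -/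
def expH {A : Type} [Ring A] [Algebra ℚ A] (u : A) : PowerSeries A :=
  PowerSeries.mk fun n => ((n.factorial : ℚ)⁻¹) • u ^ n

/-- `q = e^{ε ħ}`. -/
def q : KK := expH eps

/-- `[n] = (1 - q^n) / (1 - q) = 1 + q + ⋯ + q^{n-1}`. -/
def qInt (n : ℕ) : KK := ∑ i ∈ range n, q ^ i

/-- `[n]! = [1] [2] ⋯ [n]`, a unit of `𝕂`. -/
def qFact (n : ℕ) : KK := ∏ i ∈ range n, qInt (i + 1)

/-! ### The algebra `𝔻` and its completed tensor powers -/

/-- Non-commutative polynomials over `ℚ[ε]` in `n` copies of the generators. -/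
abbrev NC (n : ℕ) : Type := FreeAlgebra Qe (Fin n × Gen)

/-- The `ħ`-adically complete free algebra `ℚ[ε]⟨y_i, b_i, a_i, x_i⟩⟦ħ⟧`. -/
abbrev Free (n : ℕ) : Type := PowerSeries (NC n)

/-- The inclusion of scalars `𝕂 → ℚ[ε]⟨…⟩⟦ħ⟧`. -/
def scal (n : ℕ) : KK →+* Free n := PowerSeries.map (algebraMap Qe (NC n))

theorem scal_comm (n : ℕ) (c : KK) (f : Free n) : scal n c * f = f * scal n c := by
  ext k
  rw [PowerSeries.coeff_mul, PowerSeries.coeff_mul,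
    ← Finset.Nat.sum_antidiagonal_swap]
  refine Finset.sum_congr rfl fun p _ => ?_
  simp only [scal, PowerSeries.coeff_map, Prod.fst_swap, Prod.snd_swap]
  exact Algebra.commutes _ _

instance (n : ℕ) : Algebra KK (Free n) := (scal n).toAlgebra' (scal_comm n)

/-- The generator `g` in the `i`-th tensor factor, as a non-commutative polynomial. -/
def nc {n : ℕ} (i : Fin n) (g : Gen) : NC n := FreeAlgebra.ι Qe (i, g)

/-- The same generator as a constant series in `ħ`. -/
def fz {n : ℕ} (i : Fin n) (g : Gen) : Free n := PowerSeries.C (nc i g)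

/-- `A_i ^ s = e^{- s ε ħ a_i}`. -/
def fA {n : ℕ} (i : Fin n) (s : ℚ) : Free n := expH (-(s • eps • nc i Gen.a))

/-- `B_i ^ s = e^{- s ħ b_i}`. -/
def fB {n : ℕ} (i : Fin n) (s : ℚ) : Free n := expH (-(s • nc i Gen.b))

/-- Division by `ħ` of a series without constant term. -/
def divH {A : Type} [Semiring A] (f : PowerSeries A) : PowerSeries A :=
  PowerSeries.mk fun n => PowerSeries.coeff (n + 1) f

/-- The defining relations of `𝔻` in each tensor factor, and commutation of different factors;
each element of the set is the difference of the two sides of a relation. -/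
inductive Rel (n : ℕ) : Free n → Prop
  | xy (i : Fin n) : Rel n (fz i Gen.x * fz i Gen.y
      - (scal n q * fz i Gen.y * fz i Gen.x + divH (1 - fA i 1 * fB i 1)))
  | ax (i : Fin n) : Rel n (fz i Gen.a * fz i Gen.x - fz i Gen.x * fz i Gen.a - fz i Gen.x)
  | bx (i : Fin n) : Rel n (fz i Gen.b * fz i Gen.x - fz i Gen.x * fz i Gen.b
      - scal n (PowerSeries.C eps) * fz i Gen.x)
  | ay (i : Fin n) : Rel n (fz i Gen.a * fz i Gen.y - fz i Gen.y * fz i Gen.a + fz i Gen.y)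
  | byy (i : Fin n) : Rel n (fz i Gen.b * fz i Gen.y - fz i Gen.y * fz i Gen.b
      + scal n (PowerSeries.C eps) * fz i Gen.y)
  | ab (i : Fin n) : Rel n (fz i Gen.a * fz i Gen.b - fz i Gen.b * fz i Gen.a)
  | comm (i j : Fin n) (g h : Gen) (hij : i ≠ j) : Rel n (fz i g * fz j h - fz j h * fz i g)

/-- The `ħ`-adic closure of the two-sided ideal generated by the relations: the intersection over
all `N` of the ideals generated by the relations together with `ħ^N`. -/
def relIdeal (n : ℕ) : TwoSidedIdeal (Free n) :=
  ⨅ N : ℕ, TwoSidedIdeal.span ({f | Rel n f} ∪ {PowerSeries.X ^ N})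

/-- The `n`-th completed tensor power `𝔻^{⊗ n}` over `𝕂`: the topological `𝕂`-algebra
`ħ`-adically generated by `y_i, b_i, a_i, x_i` subject to the relations. In particular
`𝔻 = DD 1`, and `DD 0` is `𝕂`. -/
abbrev DD (n : ℕ) : Type := (relIdeal n).ringCon.Quotient

/-- The quotient map `ℚ[ε]⟨y_i, b_i, a_i, x_i⟩⟦ħ⟧ → 𝔻^{⊗ n}`. -/
def mkD (n : ℕ) : Free n →+* DD n := (relIdeal n).ringCon.mk'

/-- The generator `g` of the `i`-th tensor factor, in `𝔻^{⊗ n}`. -/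
def dz {n : ℕ} (i : Fin n) (g : Gen) : DD n := mkD n (fz i g)

/-- `A_i ^ s` in `𝔻^{⊗ n}`. -/
def dA {n : ℕ} (i : Fin n) (s : ℚ) : DD n := mkD n (fA i s)

/-- `B_i ^ s` in `𝔻^{⊗ n}`. -/
def dB {n : ℕ} (i : Fin n) (s : ℚ) : DD n := mkD n (fB i s)

/-- Placing a series in the generators of one copy of `𝔻` in the `i`-th tensor factor. -/
def place {n : ℕ} (i : Fin n) : Free 1 →+* Free n :=
  PowerSeries.map ((FreeAlgebra.lift Qe fun p : Fin 1 × Gen => nc i p.2).toRingHom)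

/-! ### The ordering map `𝕆` -/

/-- `ℚ[ε, y_i, b_i, a_i, x_i : i < n]`. -/
abbrev LatPoly (n : ℕ) : Type := MvPolynomial (Fin n × Gen) Qe

/-- `ℚ_ħ[ε, y_i, b_i, a_i, x_i : i < n]`. -/
abbrev LatSeries (n : ℕ) : Type := PowerSeries (LatPoly n)

/-- The monomial with exponent `d`, ordered as `y b a x` in each tensor factor. -/
def ordMon {n : ℕ} (d : (Fin n × Gen) →₀ ℕ) : NC n :=
  (List.ofFn fun i : Fin n =>
    nc i Gen.y ^ d (i, Gen.y) * nc i Gen.b ^ d (i, Gen.b)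
      * nc i Gen.a ^ d (i, Gen.a) * nc i Gen.x ^ d (i, Gen.x)).prod

/-- The ordering map on polynomials. -/
def ordPoly (n : ℕ) : LatPoly n →ₗ[Qe] NC n :=
  (MvPolynomial.basisMonomials (Fin n × Gen) Qe).constr Qe ordMon

/-- The ordering map `𝕆 : ℚ_ħ[ε, y, b, a, x] → 𝔻^{⊗ n}`. -/
def OO (n : ℕ) (f : LatSeries n) : DD n :=
  mkD n (PowerSeries.mk fun k => ordPoly n (PowerSeries.coeff k f))

/-! ### The Hopf algebra operations, the `R`-matrix, the spinner and the ribbon element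

Tensor factors are numbered from `0`. -/

/-- `m` is the multiplication `𝔻 ⊗ 𝔻 → 𝔻`. -/
def IsMul (m : DD 2 →ₗ[KK] DD 1) : Prop :=
  ∀ u w : Free 1, m (mkD 2 (place 0 u * place 1 w)) = mkD 1 u * mkD 1 w

/-- `Δ` is the coproduct of `𝔻` (that of `𝔹` tensored with the opposite of that of `𝔸`). -/
def IsComul (Δ : DD 1 →ₐ[KK] DD 2) : Prop :=
  Δ (dz 0 Gen.y) = dz 1 Gen.y + dz 0 Gen.y * dB 1 1 ∧
  Δ (dz 0 Gen.b) = dz 0 Gen.b + dz 1 Gen.b ∧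
  Δ (dz 0 Gen.a) = dz 0 Gen.a + dz 1 Gen.a ∧
  Δ (dz 0 Gen.x) = dz 1 Gen.x + dA 1 1 * dz 0 Gen.x

/-- `S` is the antipode of `𝔻`: anti-multiplicative, equal to `S_𝔹` on `y, b` and to `S_𝔸⁻¹` on
`a, x`. -/
def IsAntipode (S : DD 1 →ₗ[KK] DD 1) : Prop :=
  S 1 = 1 ∧ (∀ u w, S (u * w) = S w * S u) ∧
  S (dz 0 Gen.y) = -(dz 0 Gen.y * dB 0 (-1)) ∧
  S (dz 0 Gen.b) = -dz 0 Gen.b ∧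
  S (dz 0 Gen.a) = -dz 0 Gen.a ∧
  S (dz 0 Gen.x) = -(dz 0 Gen.x * dA 0 (-1))

/-- `e` is the counit of `𝔻`. -/
def IsCounit (e : DD 1 →ₐ[KK] DD 0) : Prop := ∀ g : Gen, e (dz 0 g) = 0

/-- `φ` is the map `r ⊗ s ↦ S(s) r`, i.e. the antipode on the second tensor factor followed by
the opposite multiplication. -/
def IsAntipodeMulOp (S : DD 1 →ₗ[KK] DD 1) (φ : DD 2 →ₗ[KK] DD 1) : Prop :=
  ∀ u w : Free 1, φ (mkD 2 (place 0 u * place 1 w)) = S (mkD 1 w) * mkD 1 u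

/-- The summand `ħ^{m+n} / ([m]! n!) y^m b^n ⊗ a^n x^m` of the `R`-matrix. -/
def fRterm (m n : ℕ) : Free 2 :=
  PowerSeries.X ^ (m + n) *
    scal 2 (Ring.inverse (qFact m) * PowerSeries.C (Polynomial.C ((n.factorial : ℚ)⁻¹))) *
    (fz 0 Gen.y ^ m * fz 0 Gen.b ^ n * fz 1 Gen.a ^ n * fz 1 Gen.x ^ m)

/-- The `R`-matrix `∑_{m,n} ħ^{m+n} / ([m]! n!) y^m b^n ⊗ a^n x^m`; as the `(m, n)` summand is
divisible by `ħ^{m+n}`, only `m, n ≤ N` contribute to the coefficient of `ħ^N`. -/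
def Rmat : DD 2 :=
  mkD 2 (PowerSeries.mk fun N =>
    ∑ m ∈ range (N + 1), ∑ n ∈ range (N + 1), PowerSeries.coeff N (fRterm m n))

/-- The spinner `C = (A B)^{1/2} = e^{-ħ (b + ε a) / 2}`. -/
def spinner : DD 1 := dA 0 (1 / 2) * dB 0 (1 / 2)

/-! ### Spaces of generating functions -/

/-- `𝓒(J, K) = ℚ_ħ[ε, y_K, b_K, a_K, x_K]⟦η_J, β_J, α_J, ξ_J⟧` with `|J| = j`, `|K| = k`. -/
abbrev CC (j k : ℕ) : Type := MvPowerSeries (Fin j × Gen) (LatSeries k)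

/-- `ℚ[ε, z_K]((ħ))`. -/
abbrev LatLaurent (k : ℕ) : Type := LaurentSeries (LatPoly k)

/-- The ambient ring `ℚ[ε, z_K]((ħ))⟦ζ_J⟧`, which contains `𝓒(J, K)` and allows negative powers
of `ħ`. -/
abbrev CL (j k : ℕ) : Type := MvPowerSeries (Fin j × Gen) (LatLaurent k)

/-- The inclusion `𝓒(J, K) → ℚ[ε, z_K]((ħ))⟦ζ_J⟧`. -/
def toCL (j k : ℕ) : CC j k →+* CL j k :=
  MvPowerSeries.map (HahnSeries.ofPowerSeries ℤ (LatPoly k))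

/-- `F` is the generating function of `f : 𝔻^{⊗ J} → 𝔻^{⊗ K}`, i.e.
`F = ∑_d ζ^d / d! 𝕆⁻¹ (f (𝕆 (z^d)))`. -/
def IsGenFun {j k : ℕ} (f : DD j →ₗ[KK] DD k) (F : CC j k) : Prop :=
  ∀ d : (Fin j × Gen) →₀ ℕ,
    (∏ p, (d p).factorial) • OO k (MvPowerSeries.coeff d F)
      = f (OO j (PowerSeries.C (MvPolynomial.monomial d 1)))

/-- Coefficientwise convergence: every coefficient `ζ^d ħ^h` is eventually that of the limit. -/
def ConvTo {j k : ℕ} (u : ℕ → CL j k) (f : CL j k) : Prop :=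
  ∀ (d : (Fin j × Gen) →₀ ℕ) (h : ℤ), ∀ᶠ N in atTop,
    (MvPowerSeries.coeff d (u N)).coeff h = (MvPowerSeries.coeff d f).coeff h

/-! ### Monomials and weights -/

/-- The Latin variables `z_K` (left) and the Greek variables `ζ_J` (right). -/
abbrev Var (j k : ℕ) : Type := (Fin k × Gen) ⊕ (Fin j × Gen)

/-- The weight `wh` of the variables: `y, b ↦ 1`, `a, x ↦ 0`, `η, β ↦ -1`, `α, ξ ↦ 0`. -/
def Var.wh {j k : ℕ} : Var j k → ℤ
  | .inl (_, .y) => 1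
  | .inl (_, .b) => 1
  | .inl (_, .a) => 0
  | .inl (_, .x) => 0
  | .inr (_, .y) => -1
  | .inr (_, .b) => -1
  | .inr (_, .a) => 0
  | .inr (_, .x) => 0

/-- The weight `wt` of the variables: `y, x, η, ξ ↦ 1`, `b, α ↦ 0`, `a, β ↦ 2`. -/
def Var.wt {j k : ℕ} : Var j k → ℤ
  | .inl (_, .y) => 1
  | .inl (_, .b) => 0
  | .inl (_, .a) => 2
  | .inl (_, .x) => 1
  | .inr (_, .y) => 1
  | .inr (_, .b) => 2
  | .inr (_, .a) => 0
  | .inr (_, .x) => 1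

/-- A Latin polynomial as an element of `ℚ[ε, z_K]((ħ))`. -/
def latC {k : ℕ} (p : LatPoly k) : LatLaurent k := HahnSeries.C p

/-- `ħ^h`, `h ∈ ℤ`. -/
def hpow (k : ℕ) (h : ℤ) : LatLaurent k := HahnSeries.single h 1

/-- `B_i^{s/2} = e^{- s ħ b_i / 2}`, `s ∈ ℤ`. -/
def Bhalf {k : ℕ} (i : Fin k) (s : ℤ) : LatLaurent k :=
  HahnSeries.ofPowerSeries ℤ (LatPoly k)
    (expH (-((s / 2 : ℚ) • (MvPolynomial.X (i, Gen.b) : LatPoly k))))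

/-- `𝒜_i^s = e^{s α_i}`, `s ∈ ℤ`. -/
def calA {j k : ℕ} (i : Fin j) (s : ℤ) : CL j k := fun d =>
  if d = Finsupp.single (i, Gen.a) (d (i, Gen.a)) then
    algebraMap ℚ (LatLaurent k) ((s : ℚ) ^ d (i, Gen.a) / (d (i, Gen.a)).factorial)
  else 0

/-- The parameter `ε` in the ambient ring. -/
def epsCL (j k : ℕ) : CL j k := MvPowerSeries.C (latC (MvPolynomial.C eps))

/-- A variable as an element of the ambient ring. -/
def Var.toCL {j k : ℕ} : Var j k → CL j k
  | .inl p => MvPowerSeries.C (latC (MvPolynomial.X p))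
  | .inr p => MvPowerSeries.X p

/-- Exponents of a monomial in `𝒜_J^{± 1}`, `B_K^{± 1/2}`, `z_K`, `ζ_J`, `ħ^{± 1}`. -/
structure Mon (j k : ℕ) where
  /-- exponents of `𝒜_i` -/
  eA : Fin j → ℤ
  /-- exponents of `B_i^{1/2}` -/
  eB : Fin k → ℤ
  /-- exponents of the Latin and Greek variables -/
  ez : Var j k → ℕ
  /-- exponent of `ħ` -/
  eh : ℤ

/-- The monomial as an element of the ambient ring. -/
def Mon.eval {j k : ℕ} (μ : Mon j k) : CL j k :=
  (∏ i, calA i (μ.eA i)) * MvPowerSeries.C (∏ i, Bhalf i (μ.eB i)) *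
    (∏ v, v.toCL ^ μ.ez v) * MvPowerSeries.C (hpow k μ.eh)

/-- `wh` of a monomial, where `wh(ħ) = -1` and `wh(𝒜) = wh(B) = 0`. -/
def Mon.wh {j k : ℕ} (μ : Mon j k) : ℤ := (∑ v, μ.ez v * v.wh) - μ.eh

/-- `wt` of a monomial, where `wt(ħ) = 0` and `wt(𝒜) = wt(B) = 0`. -/
def Mon.wt {j k : ℕ} (μ : Mon j k) : ℤ := ∑ v, μ.ez v * v.wt

/-- A polynomial expression, `∑ c_μ μ`, as an element of the ambient ring. -/
def evalPoly {j k : ℕ} (N : Mon j k →₀ ℚ) : CL j k := N.sum fun μ c => c • μ.eval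

/-- The two kinds of coefficients: rational functions of `𝒜_J, B_K^{1/2}` and polynomial in `ħ`,
or Laurent polynomials in `𝒜_J, B_K^{1/2}` and `ħ`. -/
inductive Flavour
  | rational
  | laurent

/-- The exponents of `ħ` that are allowed. -/
def Flavour.hOK : Flavour → ℤ → Prop
  | .rational, h => 0 ≤ h
  | .laurent, _ => True

/-- The denominators that are allowed: any nonzero (Laurent) polynomial in `𝒜_J, B_K^{1/2}`,
or only `1`. -/
def Flavour.denOK (fl : Flavour) {j k : ℕ} (D : Mon j k →₀ ℚ) : Prop :=
  match fl with
  | .rational => D ≠ 0 ∧ ∀ μ ∈ D.support, μ.ez = 0 ∧ μ.eh = 0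
  | .laurent => D = Finsupp.single ⟨0, 0, 0, 0⟩ 1

/-- `f` is a polynomial in `z_K, ζ_J, ħ^{(±1)}` with coefficients of the given kind, all of whose
monomials satisfy `ok`: it is a quotient `N / D` as above (the ambient ring is a domain). -/
def IsPoly (fl : Flavour) {j k : ℕ} (ok : Mon j k → Prop) (f : CL j k) : Prop :=
  ∃ D N : Mon j k →₀ ℚ, fl.denOK D ∧ (∀ μ ∈ N.support, fl.hOK μ.eh ∧ ok μ) ∧
    evalPoly D * f = evalPoly N

/-! ### Perturbed Gaussians -/

/-- The row vector `(β_J, a_K)`. -/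
def row₁ {j k : ℕ} : Fin j ⊕ Fin k → Var j k :=
  Sum.elim (fun i => .inr (i, .b)) (fun i => .inl (i, .a))

/-- The column vector `(b_K, α_J)`. -/
def col₁ {j k : ℕ} : Fin k ⊕ Fin j → Var j k :=
  Sum.elim (fun i => .inl (i, .b)) (fun i => .inr (i, .a))

/-- The row vector `(y_K, ξ_J)`. -/
def row₂ {j k : ℕ} : Fin k ⊕ Fin j → Var j k :=
  Sum.elim (fun i => .inl (i, .y)) (fun i => .inr (i, .x))

/-- The column vector `(η_J, x_K)`. -/
def col₂ {j k : ℕ} : Fin j ⊕ Fin k → Var j k :=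
  Sum.elim (fun i => .inr (i, .y)) (fun i => .inl (i, .x))

/-- `ℚ[z_K, B_K^{± 1/2}, ħ^{± 1}]` inside `ℚ[ε, z_K]((ħ))`. -/
def latLaurentPolys (k : ℕ) : Subalgebra ℚ (LatLaurent k) :=
  Algebra.adjoin ℚ ({f | ∃ p, f = latC (MvPolynomial.X p)} ∪ {f | ∃ i s, f = Bhalf i s} ∪
    {f | ∃ h, f = hpow k h})

/-- `f` is of the form `P e^G` with `P = ∑ P_l ε^l` and `G`, such that
* `wh` vanishes on all monomials of `P` and `G`;
* `wt = 2` on all monomials of `G`, and `wt ≤ 0` on all monomials of `P` (recall `wh(ε) = 1` and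
  `wt(ε) = -4`);
* `G = (β_J, a_K) G₁ (b_K, α_J)ᵗ + (y_K, ξ_J) G₂ (η_J, x_K)ᵗ` where the entries of `G₁` are
  rational (Laurent) polynomials in `ħ` and those of `G₂` are (Laurent) polynomials in `ħ` with
  coefficients of the given kind;
* each `P_l` is a polynomial with coefficients of the given kind. -/
def IsPertGauss (fl : Flavour) {j k : ℕ} (f : CL j k) : Prop :=
  ∃ (G₁ : Fin j ⊕ Fin k → Fin k ⊕ Fin j → CL j k) (G₂ : Fin k ⊕ Fin j → Fin j ⊕ Fin k → CL j k)
    (G E P : CL j k) (Pc : ℕ → CL j k),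
    (∀ r c, ∃ N : Mon j k →₀ ℚ, (∀ μ ∈ N.support, fl.hOK μ.eh ∧
        μ.eA = 0 ∧ μ.eB = 0 ∧ μ.ez = 0 ∧
        (row₁ r).wh + μ.wh + (col₁ c).wh = 0 ∧ (row₁ r).wt + μ.wt + (col₁ c).wt = 2) ∧
      G₁ r c = evalPoly N) ∧
    (∀ r c, IsPoly fl (fun μ => μ.ez = 0 ∧
        (row₂ r).wh + μ.wh + (col₂ c).wh = 0 ∧ (row₂ r).wt + μ.wt + (col₂ c).wt = 2)
      (G₂ r c)) ∧
    G = (∑ r, ∑ c, (row₁ r).toCL * G₁ r c * (col₁ c).toCL)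
      + (∑ r, ∑ c, (row₂ r).toCL * G₂ r c * (col₂ c).toCL) ∧
    ConvTo (fun N => ∑ l ∈ range N, ((l.factorial : ℚ)⁻¹) • G ^ l) E ∧
    (∀ l : ℕ, IsPoly fl (fun μ => μ.wh + l = 0 ∧ μ.wt - 4 * l ≤ 0) (Pc l)) ∧
    ConvTo (fun N => ∑ l ∈ range N, Pc l * epsCL j k ^ l) P ∧
    -- in the Laurent case all of `e^G` is a power series in the Greek variables whose coefficients
    -- are Laurent polynomials, so that for instance `e^{ħ a b}` is excluded
    (match fl with
      | .rational => True
      | .laurent => ∀ d, MvPowerSeries.coeff d E ∈ latLaurentPolys k) ∧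
    f = P * E

/-- `𝓟𝓖(J, K)`, as a subset of `𝓒(J, K)`. -/
def PG (j k : ℕ) : Set (CC j k) := {F | IsPertGauss .rational (toCL j k F)}

/-- `𝓟𝓖^±(J, K)`. -/
def PGpm (j k : ℕ) : Set (CL j k) := {f | IsPertGauss .laurent f}

/-- `𝓟𝓖^+(J, K)`: the elements of `𝓟𝓖^±(J, K)` without negative powers of `ħ`. -/
def PGplus (j k : ℕ) : Set (CC j k) := {F | toCL j k F ∈ PGpm j k}

/-- The element `z` of `𝔻^{⊗ K}` is a perturbed Gaussian: `𝕆⁻¹(z) ∈ 𝓟𝓖(∅, K)`. -/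
def ElemPG {k : ℕ} (z : DD k) : Prop :=
  ∃ f : LatSeries k, OO k f = z ∧ MvPowerSeries.C f ∈ PG 0 k

/-! ### The pairing -/

/-- The pairing `𝔸 ⊗ 𝔹 → ℚ[ε]((ħ))` on ordered monomials:
`π(a^n x^m, y^{m'} b^{n'}) = δ_{n n'} δ_{m m'} n! [m]! / ħ^{m+n}`. -/
def pairing (n m m' n' : ℕ) : LatLaurent 0 :=
  if n = n' ∧ m = m' then
    HahnSeries.ofPowerSeries ℤ (LatPoly 0)
      (PowerSeries.map MvPolynomial.C ((n.factorial : KK) * qFact m)) * hpow 0 (-(m + n : ℤ))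
  else 0

/-- The generating function `π^{ij} = π(e^{α_i a_i + ξ_i x_i + η_j y_j + β_j b_j})` of the pairing,
with `𝔸` labelled `i = 0` and `𝔹` labelled `j = 1`. -/
def pairingGF : CL 2 0 := fun d =>
  if d (0, .y) = 0 ∧ d (0, .b) = 0 ∧ d (1, .a) = 0 ∧ d (1, .x) = 0 then
    (((∏ p, (d p).factorial : ℕ) : ℚ)⁻¹) •
      pairing (d (0, .a)) (d (0, .x)) (d (1, .y)) (d (1, .b))
  else 0

end PGauss

end

noncomputable section

set_option linter.unusedSectionVars false
set_option linter.style.haveILetI false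

open Finset Filter

namespace PGauss

/-! Every structure element of `𝔻` has an explicit normal ordered expansion whose summands are
powers of quadratic monomials divided by factorials, times a slowly varying correction. Summing such
an expansion gives a Gaussian times a perturbation, and the weights control the degree of that
perturbation.

Algebra. All infinite sums are sums `∑ ħ^k f_k` in separated complete modules, so linear maps
commute with them automatically (`map_hsum`). Bijectivity of `𝕆` is a PBW theorem. Normal ordering
of `x y^k` gives surjectivity. The same formulas define operators on families indexed by the
exponents of `y` (`opGen_rel`), and acting on a vacuum vector recovers the coefficients, which gives
injectivity (`act_OO`). PBW makes `𝔻` free of `ħ`-torsion, so the relation for `x y` may be checked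
after multiplication by `ħ`; this yields `Δ`, `S` and `ε`. The multiplication is defined bilinearly
on the PBW basis. The `q`-binomial theorem puts every product in normal order (`dp_x_mul_dp_y`,
`x_pow_mul_y_pow`). It also yields the inverse of `R`. For the ribbon element one moreover needs a
summation formula for a `q`-series (`hsum_ribTerm`), and the fact that the candidate for `v⁻¹`
commutes with `x`.

Analysis. Since `∑_i i(i-1)⋯(i-n+1) X^i / i! = X^n e^X`, inserting a polynomial of degree `D` in the
summation indices into an exponential series multiplies the exponential by a polynomial of degree at
most `D` in the quadratic terms `X` (`PolyDeg.exists_hasSum`). The corrections to the Gaussians are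
the ratios `[m]!/m!` and their inverses, powers of `q`, and exponentials of `ε ħ a` and `ε β`.
Expanded in `t = ε ħ`, the coefficient of `t^r` in `([m]!/m!)^{±1}` is a polynomial in `m` of degree
at most `2r` (`uPoly_coeff_qFactS`), and the exponents of `q` are quadratic in the indices. Each `X`
has `wt = 2`, so a power `ε^r` of `wt = -4r` exactly pays for degree `2r`. A parameter `ε a` or `ε
β` has `wt = -2`, and it comes with degree one only. Hence `wt ≤ 0` on `P`.

The weight `wh` is handled by the substitution `Psi`, that is `η ↦ ħ⁻¹ η` and `β ↦ ħ⁻¹ β`. Before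
it, only `ħ y`, `ħ b` and `ħ ε` occur and there are no negative powers of `ħ`; after it every
expression has `wh = 0`. The criterion `isPertGauss_of_hasSum` combines both weights, and
`elemPG_of_hsum` and `genFun_mem` reduce each claim of the theorem to an identity between single
summands. -/

/-! ### `ħ`-adically complete modules -/

/-- `ħ` as an element of `𝕂`. -/
abbrev hb : KK := PowerSeries.X

/-- `ħ`-adically separated and complete `𝕂`-modules. -/
class HComp (M : Type) [AddCommGroup M] [Module KK M] : Prop where
  sep : ∀ x : M, (∀ N : ℕ, ∃ y, x = hb ^ N • y) → x = 0
  comp : ∀ f : ℕ → M, ∃ s, ∀ N : ℕ, ∃ z, s = ∑ k ∈ range N, hb ^ k • f k + hb ^ N • z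

section hsum
variable {M M' : Type} [AddCommGroup M] [Module KK M] [HComp M]
  [AddCommGroup M'] [Module KK M'] [HComp M']

/-- The sum `∑ ħ^k f_k`. -/
def hsum (f : ℕ → M) : M := (HComp.comp f).choose

theorem hsum_spec (f : ℕ → M) (N : ℕ) :
    ∃ z, hsum f = ∑ k ∈ range N, hb ^ k • f k + hb ^ N • z := (HComp.comp f).choose_spec N

/-- Separatedness makes the value unique: two candidates differ by a multiple of every `ħ^N`. All
sums below are evaluated through this. -/
theorem hsum_eq {f : ℕ → M} {s : M}
    (h : ∀ N : ℕ, ∃ z, s = ∑ k ∈ range N, hb ^ k • f k + hb ^ N • z) : hsum f = s := by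
  rw [← sub_eq_zero]
  refine HComp.sep _ fun N => ?_
  obtain ⟨z, hz⟩ := hsum_spec f N
  obtain ⟨w, hw⟩ := h N
  exact ⟨z - w, by rw [hz, hw, smul_sub]; abel⟩

/-- A linear map sends the remainder `ħ^N z` to `ħ^N T z`, so `ħ`-adic continuity is automatic and
no topology on `𝔻` is needed. -/
theorem map_hsum (T : M →ₗ[KK] M') (f : ℕ → M) : T (hsum f) = hsum fun k => T (f k) := by
  refine (hsum_eq fun N => ?_).symm
  obtain ⟨z, hz⟩ := hsum_spec f N
  exact ⟨T z, by rw [hz]; simp⟩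

theorem hsum_add (f g : ℕ → M) : (hsum fun k => f k + g k) = hsum f + hsum g := by
  refine hsum_eq fun N => ?_
  obtain ⟨z, hz⟩ := hsum_spec f N
  obtain ⟨w, hw⟩ := hsum_spec g N
  exact ⟨z + w, by rw [hz, hw]; simp only [smul_add, sum_add_distrib]; abel⟩

theorem hsum_smul (c : KK) (f : ℕ → M) : (hsum fun k => c • f k) = c • hsum f :=
  (map_hsum (LinearMap.lsmul KK M c) f).symm

theorem hsum_succ (f : ℕ → M) : hsum f = f 0 + hb • hsum fun k => f (k + 1) := by
  refine hsum_eq fun N => ?_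
  cases N with
  | zero => exact ⟨_, by simp; rfl⟩
  | succ N =>
    obtain ⟨z, hz⟩ := hsum_spec (fun k => f (k + 1)) N
    refine ⟨z, ?_⟩
    rw [hz, sum_range_succ']
    simp only [smul_add, smul_sum, smul_smul, pow_succ', pow_zero, one_smul]
    abel

theorem hsum_zero : (hsum fun _ => (0 : M)) = 0 := hsum_eq fun N => ⟨0, by simp⟩

theorem hsum_of_forall_pos {f : ℕ → M} (h : ∀ k, f (k + 1) = 0) : hsum f = f 0 := by
  rw [hsum_succ]; simp [h, hsum_zero]

/-- Modulo `ħ^N` only the inner terms with `k < N - i` matter, so the double sum becomes a finite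
sum over a triangle, which may be read along its diagonals. -/
theorem hsum_hsum (f : ℕ → ℕ → M) :
    (hsum fun i => hsum (f i)) = hsum fun n => ∑ p ∈ antidiagonal n, f p.1 p.2 := by
  refine hsum_eq fun N => ?_
  obtain ⟨z, hz⟩ := hsum_spec (fun n => ∑ p ∈ antidiagonal n, f p.1 p.2) N
  have h2 : ∀ i, ∃ w, hsum (f i) = ∑ k ∈ range (N - i), hb ^ k • f i k + hb ^ (N - i) • w :=
    fun i => hsum_spec (f i) (N - i)
  choose w hw using h2
  refine ⟨z - ∑ i ∈ range N, w i, ?_⟩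
  have e1 : ∑ i ∈ range N, hb ^ i • hsum (f i) =
      ∑ i ∈ range N, ∑ k ∈ range (N - i), hb ^ (i + k) • f i k + hb ^ N • ∑ i ∈ range N, w i := by
    rw [smul_sum, ← sum_add_distrib]
    refine sum_congr rfl fun i hi => ?_
    rw [hw i, smul_add, smul_sum, smul_smul, ← pow_add,
      Nat.add_sub_cancel' (mem_range.1 hi).le]
    simp only [smul_smul, ← pow_add]
  have e2 : ∑ n ∈ range N, hb ^ n • ∑ p ∈ antidiagonal n, f p.1 p.2 =
      ∑ i ∈ range N, ∑ k ∈ range (N - i), hb ^ (i + k) • f i k := by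
    rw [← sum_range_diag_flip N fun i k => hb ^ (i + k) • f i k]
    refine sum_congr rfl fun n _ => ?_
    rw [Nat.sum_antidiagonal_eq_sum_range_succ_mk, smul_sum]
    refine sum_congr rfl fun k hk => ?_
    rw [Nat.add_sub_cancel' (mem_range_succ_iff.1 hk)]
  rw [hz, e1, e2, smul_sub]
  abel

/-- A sum whose first summand vanishes is divisible by `ħ`. -/
theorem hsum_shift {f : ℕ → M} (h : f 0 = 0) : hsum f = hb • hsum fun k => f (k + 1) := by
  rw [hsum_succ, h, zero_add]

end hsum

/-- Only the action of `ħ` as multiplication by the variable is used. This covers non-commutative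
coefficients (for `Free`) and commutative ones (for the generating series) at once. -/
theorem hcomp_powerSeries {A : Type} [Ring A] [Module KK (PowerSeries A)]
    (hX : ∀ f : PowerSeries A, hb • f = PowerSeries.X * f) : HComp (PowerSeries A) where
  sep x h := by
    ext n
    obtain ⟨y, rfl⟩ := h (n + 1)
    have : ∀ N : ℕ, hb ^ N • y = PowerSeries.X ^ N * y := by
      intro N
      induction N with
      | zero => simp
      | succ N ih => rw [pow_succ', ← smul_smul, ih, hX, pow_succ', mul_assoc]
    rw [this, PowerSeries.coeff_X_pow_mul']
    simp
  comp f := by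
    have hXN : ∀ (N : ℕ) (y : PowerSeries A), hb ^ N • y = PowerSeries.X ^ N * y := by
      intro N y
      induction N with
      | zero => simp
      | succ N ih => rw [pow_succ', ← smul_smul, ih, hX, pow_succ', mul_assoc]
    refine ⟨PowerSeries.mk fun n => ∑ k ∈ range (n + 1), PowerSeries.coeff (n - k) (f k),
      fun N => ⟨PowerSeries.mk fun n => ∑ k ∈ range (n + N + 1),
        PowerSeries.coeff (n + N - k) (f k) - ∑ k ∈ range N, if k ≤ n + N then
          PowerSeries.coeff (n + N - k) (f k) else 0, ?_⟩⟩
    ext n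
    simp only [hXN, map_add, map_sum, PowerSeries.coeff_X_pow_mul', PowerSeries.coeff_mk]
    split_ifs with h
    · simp only [Nat.sub_add_cancel h]
      abel
    · rw [add_zero, ← sum_filter]
      refine sum_congr ?_ fun _ _ => rfl
      ext k
      simp only [mem_range, mem_filter]
      omega

instance (n : ℕ) : HComp (Free n) := hcomp_powerSeries fun f => by
  rw [Algebra.smul_def]
  change scal n PowerSeries.X * f = _
  rw [scal, PowerSeries.map_X]

instance {A : Type} [CommRing A] [Algebra Qe A] : HComp (PowerSeries A) :=
  hcomp_powerSeries fun f => by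
    rw [Algebra.smul_def]
    congr 1
    exact PowerSeries.map_X _

/-! ### Universal property of `𝔻^{⊗ n}` -/

theorem mkD_surjective (n : ℕ) : Function.Surjective (mkD n) := (relIdeal n).ringCon.mk'_surjective

theorem mkD_eq_iff {n : ℕ} (f g : Free n) : mkD n f = mkD n g ↔ f - g ∈ relIdeal n := by
  rw [← TwoSidedIdeal.rel_iff]
  exact RingCon.eq _

/-- `mkD` as a `𝕂`-algebra homomorphism. -/
def mkDa (n : ℕ) : Free n →ₐ[KK] DD n := { mkD n with commutes' := fun _ => rfl }

@[simp] theorem mkDa_apply {n : ℕ} (f : Free n) : mkDa n f = mkD n f := rfl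


theorem mkD_smul {n : ℕ} (c : KK) (f : Free n) : mkD n (c • f) = c • mkD n f := rfl

theorem hb_pow_smul_free {n : ℕ} (N : ℕ) (f : Free n) : hb ^ N • f = PowerSeries.X ^ N * f := by
  rw [Algebra.smul_def, map_pow]
  congr 2
  exact PowerSeries.map_X _

/-- Separatedness is the point of closing the ideal: an element divisible by every `ħ^N` lies in
each of the ideals whose intersection is `relIdeal n`. Completeness descends from the free algebra.
-/
instance (n : ℕ) : HComp (DD n) where
  sep x h := by
    obtain ⟨f, rfl⟩ := mkD_surjective n x
    rw [← map_zero (mkD n), mkD_eq_iff, sub_zero, relIdeal, TwoSidedIdeal.mem_iInf]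
    intro N
    obtain ⟨y, hy⟩ := h N
    obtain ⟨g, rfl⟩ := mkD_surjective n y
    rw [← mkD_smul, mkD_eq_iff, relIdeal, TwoSidedIdeal.mem_iInf] at hy
    have h1 := hy N
    have h2 : hb ^ N • g ∈ TwoSidedIdeal.span ({f | Rel n f} ∪ {PowerSeries.X ^ N}) := by
      rw [hb_pow_smul_free]
      exact TwoSidedIdeal.mul_mem_right _ _ _ (TwoSidedIdeal.subset_span (Or.inr rfl))
    simpa using TwoSidedIdeal.add_mem _ h1 h2
  comp f := by
    choose g hg using fun k => mkD_surjective n (f k)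
    refine ⟨mkD n (hsum g), fun N => ?_⟩
    obtain ⟨z, hz⟩ := hsum_spec g N
    exact ⟨mkD n z, by rw [hz]; simp [mkD_smul, hg]⟩

theorem powerSeries_eq_trunc_add {A : Type} [Ring A] (f : PowerSeries A) (N : ℕ) :
    f = ∑ k ∈ range N, PowerSeries.X ^ k * PowerSeries.C (PowerSeries.coeff k f)
      + PowerSeries.X ^ N * PowerSeries.mk fun n => PowerSeries.coeff (n + N) f := by
  ext n
  simp only [map_add, map_sum, PowerSeries.coeff_X_pow_mul', PowerSeries.coeff_mk,
    PowerSeries.coeff_C]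
  by_cases h : n < N
  · rw [sum_eq_single_of_mem n (mem_range.2 h)]
    · simp [h.not_ge]
    · intro b _ hb
      split_ifs <;> first | rfl | omega
  · rw [sum_eq_zero, if_pos (by omega), Nat.sub_add_cancel (by omega), zero_add]
    intro b hb
    have := mem_range.1 hb
    split_ifs <;> first | rfl | omega

theorem hsum_C_free {n : ℕ} (f : Free n) :
    (hsum fun k => (PowerSeries.C (PowerSeries.coeff k f) : Free n)) = f :=
  hsum_eq fun N => ⟨_, by simp only [hb_pow_smul_free]; exact powerSeries_eq_trunc_add f N⟩

theorem hb_pow_smul_ps {A : Type} [CommRing A] [Algebra Qe A] (N : ℕ) (f : PowerSeries A) :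
    hb ^ N • f = PowerSeries.X ^ N * f := by
  rw [Algebra.smul_def, map_pow]
  congr 2
  exact PowerSeries.map_X _

theorem hsum_C_ps {A : Type} [CommRing A] [Algebra Qe A] (f : PowerSeries A) :
    (hsum fun k => (PowerSeries.C (PowerSeries.coeff k f) : PowerSeries A)) = f :=
  hsum_eq fun N => ⟨_, by simp only [hb_pow_smul_ps]; exact powerSeries_eq_trunc_add f N⟩

/-! ### Homomorphisms from the complete free algebra and from `𝔻^{⊗ n}` into complete algebras. -/

section lift
variable {E : Type} [Ring E] [Algebra KK E] [HComp E]

/-- The homomorphism out of non-commutative polynomials given by the images of the generators. -/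
def liftNC {n : ℕ} (v : Fin n × Gen → E) : NC n →+* E :=
  letI : Algebra Qe E := Algebra.compHom E (PowerSeries.C : Qe →+* KK)
  (FreeAlgebra.lift Qe v).toRingHom

@[simp] theorem liftNC_nc {n : ℕ} (v : Fin n × Gen → E) (i : Fin n) (g : Gen) :
    liftNC v (nc i g) = v (i, g) := by
  letI : Algebra Qe E := Algebra.compHom E (PowerSeries.C : Qe →+* KK)
  exact FreeAlgebra.lift_ι_apply v (i, g)

@[simp] theorem liftNC_algebraMap {n : ℕ} (v : Fin n × Gen → E) (c : Qe) :
    liftNC v (algebraMap Qe (NC n) c) = algebraMap KK E (PowerSeries.C c) := by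
  letI : Algebra Qe E := Algebra.compHom E (PowerSeries.C : Qe →+* KK)
  exact (FreeAlgebra.lift Qe v).commutes c

theorem hsum_mul_hsum (f g : ℕ → E) :
    hsum f * hsum g = hsum fun n => ∑ p ∈ antidiagonal n, f p.1 * g p.2 := by
  rw [← hsum_hsum fun i j => f i * g j]
  have h1 : ∀ i, (hsum fun j => f i * g j) = f i * hsum g := fun i =>
    (map_hsum (LinearMap.mulLeft KK (f i)) g).symm
  simp only [h1]
  exact map_hsum (LinearMap.mulRight KK (hsum g)) f

/-- The homomorphism out of the complete free algebra given by the images of the generators. -/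
def liftFree {n : ℕ} (v : Fin n × Gen → E) : Free n →ₐ[KK] E where
  toFun f := hsum fun k => liftNC v (PowerSeries.coeff k f)
  map_one' := by
    rw [hsum_of_forall_pos]
    · simp
    · intro k; simp [PowerSeries.coeff_one]
  map_mul' f g := by
    rw [hsum_mul_hsum]
    simp only [PowerSeries.coeff_mul, map_sum, map_mul]
  map_zero' := by simp [hsum_zero]
  map_add' f g := by simp only [map_add]; exact hsum_add _ _
  commutes' c := by
    refine hsum_eq fun N => ⟨algebraMap KK E (PowerSeries.mk fun n => PowerSeries.coeff (n + N) c),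
      ?_⟩
    conv_lhs => rw [powerSeries_eq_trunc_add c N]
    simp only [map_add, map_sum, map_mul, Algebra.smul_def]
    congr 1
    refine sum_congr rfl fun k _ => ?_
    congr 1
    rw [← liftNC_algebraMap v]
    congr 1

theorem liftFree_apply {n : ℕ} (v : Fin n × Gen → E) (f : Free n) :
    liftFree v f = hsum fun k => liftNC v (PowerSeries.coeff k f) := rfl

@[simp] theorem liftFree_C {n : ℕ} (v : Fin n × Gen → E) (w : NC n) :
    liftFree v (PowerSeries.C w) = liftNC v w := by
  rw [liftFree_apply, hsum_of_forall_pos] <;> simp [PowerSeries.coeff_C]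

@[simp] theorem liftFree_fz {n : ℕ} (v : Fin n × Gen → E) (i : Fin n) (g : Gen) :
    liftFree v (fz i g) = v (i, g) := by rw [fz, liftFree_C, liftNC_nc]

/-- The ideal generated by the relations and `ħ^N` is mapped into `ħ^N E`. An element of all these
ideals therefore maps to zero by separatedness. -/
theorem liftFree_eq_zero_of_mem {n : ℕ} (v : Fin n × Gen → E)
    (hv : ∀ f, Rel n f → liftFree v f = 0) {f : Free n} (hf : f ∈ relIdeal n) :
    liftFree v f = 0 := by
  refine HComp.sep _ fun N => ?_
  rw [relIdeal, TwoSidedIdeal.mem_iInf] at hf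
  have h := hf N
  clear hf
  induction h using TwoSidedIdeal.span_induction with
  | mem x hx =>
    rcases hx with hx | hx
    · exact ⟨0, by rw [hv x hx, smul_zero]⟩
    · refine ⟨1, ?_⟩
      rw [Set.mem_singleton_iff.1 hx, ← map_one (liftFree v), ← map_smul, hb_pow_smul_free, mul_one]
  | zero => exact ⟨0, by simp⟩
  | add x y _ _ hx hy =>
    obtain ⟨a, ha⟩ := hx
    obtain ⟨b, hb⟩ := hy
    exact ⟨a + b, by rw [map_add, ha, hb, smul_add]⟩
  | neg x _ hx =>
    obtain ⟨a, ha⟩ := hx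
    exact ⟨-a, by rw [map_neg, ha, smul_neg]⟩
  | left_absorb a x _ hx =>
    obtain ⟨b, hb⟩ := hx
    exact ⟨liftFree v a * b, by rw [map_mul, hb, mul_smul_comm]⟩
  | right_absorb b x _ hx =>
    obtain ⟨a, ha⟩ := hx
    exact ⟨a * liftFree v b, by rw [map_mul, ha, smul_mul_assoc]⟩

/-- The homomorphism out of `𝔻^{⊗ n}` given by images of the generators satisfying the
relations. -/
def liftD {n : ℕ} (v : Fin n × Gen → E) (hv : ∀ f, Rel n f → liftFree v f = 0) :
    DD n →ₐ[KK] E :=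
  { (relIdeal n).ringCon.lift (liftFree v : Free n →+* E) (by
      intro f g h
      rw [RingCon.ker_apply, ← sub_eq_zero]
      have := liftFree_eq_zero_of_mem v hv ((TwoSidedIdeal.rel_iff _ _ _).1 h)
      rwa [map_sub] at this) with
    commutes' := fun c => (liftFree v).commutes c }

@[simp] theorem liftD_mkD {n : ℕ} (v : Fin n × Gen → E) (hv) (f : Free n) :
    liftD v hv (mkD n f) = liftFree v f := rfl

@[simp] theorem liftD_dz {n : ℕ} (v : Fin n × Gen → E) (hv) (i : Fin n) (g : Gen) :
    liftD v hv (dz i g) = v (i, g) := by rw [dz, liftD_mkD, liftFree_fz]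

/-- The exponential series `∑ ħ^k u^k / k!` in a complete algebra. -/
def hexp (u : E) : E :=
    hsum fun k => algebraMap KK E (PowerSeries.C (Polynomial.C ((k.factorial : ℚ)⁻¹))) * u ^ k

theorem liftFree_expH {n : ℕ} (v : Fin n × Gen → E) (u : NC n) :
    liftFree v (expH u) = hexp (liftNC v u) := by
  rw [liftFree_apply, hexp]
  congr 1
  funext k
  rw [expH, PowerSeries.coeff_mk, Algebra.smul_def, map_mul, map_pow,
    ← liftNC_algebraMap v]
  congr 2

theorem X_mul_divH {A : Type} [Ring A] (f : PowerSeries A) (h : PowerSeries.constantCoeff f = 0) :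
    PowerSeries.X * divH f = f := by
  ext n
  cases n with
  | zero => simpa using h.symm
  | succ n => rw [PowerSeries.coeff_succ_X_mul, divH, PowerSeries.coeff_mk]

end lift

/-! ### Exponential series over commutative rings -/

section expH
variable {A A' : Type} [CommRing A] [Algebra ℚ A] [CommRing A'] [Algebra ℚ A']

theorem coeff_expH (u : A) (n : ℕ) :
    PowerSeries.coeff n (expH u) = ((n.factorial : ℚ)⁻¹) • u ^ n := PowerSeries.coeff_mk _ _

theorem expH_zero : expH (0 : A) = 1 := by
  ext n
  rw [coeff_expH, PowerSeries.coeff_one]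
  split_ifs with h
  · simp [h]
  · simp [h]

theorem expH_add (u w : A) : expH (u + w) = expH u * expH w := by
  ext n
  rw [PowerSeries.coeff_mul, coeff_expH, (Commute.all u w).add_pow', smul_sum]
  refine sum_congr rfl fun p hp => ?_
  rw [HasAntidiagonal.mem_antidiagonal] at hp
  rw [coeff_expH, coeff_expH, smul_mul_smul_comm, ← Nat.cast_smul_eq_nsmul ℚ, smul_smul]
  congr 1
  have : (n.choose p.1 : ℚ) = n.factorial / (p.1.factorial * p.2.factorial) := by
    rw [Nat.choose_eq_factorial_div_factorial (by omega), ← hp, Nat.add_sub_cancel_left,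
      Nat.cast_div (Nat.factorial_mul_factorial_dvd_factorial_add _ _) (by positivity)]
    push_cast; rfl
  rw [this]
  field_simp

theorem expH_pow (u : A) (n : ℕ) : expH u ^ n = expH (n • u) := by
  induction n with
  | zero => simp [expH_zero]
  | succ n ih => rw [pow_succ, ih, succ_nsmul, expH_add]

theorem expH_mul_neg (u : A) : expH u * expH (-u) = 1 := by
  rw [← expH_add, add_neg_cancel, expH_zero]

theorem map_expH (φ : A →+* A') (u : A) : PowerSeries.map φ (expH u) = expH (φ u) := by
  ext n
  rw [PowerSeries.coeff_map, coeff_expH, coeff_expH, map_rat_smul, map_pow]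

theorem constantCoeff_expH (u : A) : PowerSeries.constantCoeff (expH u) = 1 := by
  rw [← PowerSeries.coeff_zero_eq_constantCoeff_apply, coeff_expH]; simp

/-- `(1 - e^{ħ u}) / ħ`. -/
def hq (u : A) : PowerSeries A := divH (1 - expH u)

theorem X_mul_hq (u : A) : PowerSeries.X * hq u = 1 - expH u :=
  X_mul_divH _ (by rw [map_sub, constantCoeff_expH, map_one, sub_self])

theorem map_hq (φ : A →+* A') (u : A) : PowerSeries.map φ (hq u) = hq (φ u) := by
  ext n
  rw [PowerSeries.coeff_map, hq, hq, divH, divH, PowerSeries.coeff_mk, PowerSeries.coeff_mk,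
    map_sub, map_sub, map_sub, coeff_expH, coeff_expH, map_rat_smul, map_pow,
    PowerSeries.coeff_one, PowerSeries.coeff_one]
  simp

end expH

theorem q_eq : q = expH eps := rfl

/-! ### Series with polynomial coefficients -/

/-- `ℚ[ε][τ]⟦ħ⟧`. -/
abbrev PS (τ : Type) : Type := PowerSeries (MvPolynomial τ Qe)

section PS
variable {τ τ' : Type}

theorem algebraMap_PS (c : KK) : algebraMap KK (PS τ) c = PowerSeries.map MvPolynomial.C c := rfl

theorem algebraMap_expH (c : Qe) :
    algebraMap KK (PS τ) (expH c) = expH (MvPolynomial.C c) := map_expH _ _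

theorem algebraMap_q : algebraMap KK (PS τ) q = expH (MvPolynomial.C eps) := map_expH _ _

/-- Coefficientwise extension of an algebra homomorphism. -/
def psMap (φ : MvPolynomial τ Qe →ₐ[Qe] MvPolynomial τ' Qe) : PS τ →ₐ[KK] PS τ' :=
  { PowerSeries.map (φ : MvPolynomial τ Qe →+* MvPolynomial τ' Qe) with
    commutes' := fun c => by
      ext1 n
      change PowerSeries.coeff n (PowerSeries.map _ (algebraMap KK (PS τ) c)) = _
      rw [algebraMap_PS, algebraMap_PS, PowerSeries.coeff_map, PowerSeries.coeff_map,
        PowerSeries.coeff_map]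
      exact φ.commutes _ }

theorem psMap_apply (φ : MvPolynomial τ Qe →ₐ[Qe] MvPolynomial τ' Qe) (f : PS τ) :
    psMap φ f = PowerSeries.map (φ : MvPolynomial τ Qe →+* MvPolynomial τ' Qe) f := rfl

theorem psMap_C (φ : MvPolynomial τ Qe →ₐ[Qe] MvPolynomial τ' Qe) (p : MvPolynomial τ Qe) :
    psMap φ (PowerSeries.C p) = PowerSeries.C (φ p) := PowerSeries.map_C _ _

theorem psMap_expH (φ : MvPolynomial τ Qe →ₐ[Qe] MvPolynomial τ' Qe) (p : MvPolynomial τ Qe) :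
    psMap φ (expH p) = expH (φ p) := map_expH _ _

theorem psMap_hq (φ : MvPolynomial τ Qe →ₐ[Qe] MvPolynomial τ' Qe) (p : MvPolynomial τ Qe) :
    psMap φ (hq p) = hq (φ p) := map_hq _ _

theorem coeff_smul_ps {A : Type} [CommRing A] [Algebra Qe A] (c : KK) (f : PowerSeries A) (n : ℕ) :
    PowerSeries.coeff n (c • f) =
      ∑ p ∈ antidiagonal n, PowerSeries.coeff p.1 c • PowerSeries.coeff p.2 f := by
  rw [Algebra.smul_def, PowerSeries.coeff_mul]
  refine sum_congr rfl fun p _ => ?_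
  rw [Algebra.smul_def]
  congr 1

theorem coeff_smul_free {m : ℕ} (c : KK) (f : Free m) (n : ℕ) :
    PowerSeries.coeff n (c • f) =
      ∑ p ∈ antidiagonal n, PowerSeries.coeff p.1 c • PowerSeries.coeff p.2 f := by
  rw [Algebra.smul_def, PowerSeries.coeff_mul]
  refine sum_congr rfl fun p _ => ?_
  rw [Algebra.smul_def]
  congr 1

theorem X_pow_smul_PS (f : PS τ) : hb • f = PowerSeries.X * f := by
  simpa using hb_pow_smul_ps 1 f

/-- `𝕂`-linear maps agreeing on monomials are equal. -/
theorem ps_ext {M : Type} [AddCommGroup M] [Module KK M] [HComp M] {T T' : PS τ →ₗ[KK] M}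
    (h : ∀ d, T (PowerSeries.C (MvPolynomial.monomial d 1)) =
      T' (PowerSeries.C (MvPolynomial.monomial d 1))) : T = T' := by
  have h1 : ∀ p : MvPolynomial τ Qe, T (PowerSeries.C p) = T' (PowerSeries.C p) := by
    intro p
    induction p using MvPolynomial.induction_on' with
    | monomial d c =>
      have : (PowerSeries.C (MvPolynomial.monomial d c) : PS τ)
          = (PowerSeries.C c : KK) • PowerSeries.C (MvPolynomial.monomial d 1) := by
        rw [Algebra.smul_def, algebraMap_PS, PowerSeries.map_C, ← map_mul,
          MvPolynomial.C_mul_monomial, mul_one]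
      rw [this, map_smul, map_smul, h]
    | add p p' hp hp' => rw [map_add, map_add, map_add, hp, hp']
  ext f
  rw [← hsum_C_ps f, map_hsum, map_hsum]
  simp only [h1]

/-- The `ℚ[ε]`-linear map on polynomials with given values on monomials. -/
def polyLift {M : Type} [AddCommGroup M] [Module KK M] (v : (τ →₀ ℕ) → M) :
    MvPolynomial τ Qe →+ M :=
  letI : Module Qe M := Module.compHom M (PowerSeries.C : Qe →+* KK)
  ((MvPolynomial.basisMonomials τ Qe).constr ℕ v).toAddMonoidHom

theorem polyLift_smul {M : Type} [AddCommGroup M] [Module KK M] (v : (τ →₀ ℕ) → M) (c : Qe)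
    (p : MvPolynomial τ Qe) : polyLift v (c • p) = (PowerSeries.C c : KK) • polyLift v p := by
  letI : Module Qe M := Module.compHom M (PowerSeries.C : Qe →+* KK)
  exact ((MvPolynomial.basisMonomials τ Qe).constr ℕ v).map_smul c p

theorem polyLift_monomial {M : Type} [AddCommGroup M] [Module KK M] (v : (τ →₀ ℕ) → M)
    (d : τ →₀ ℕ) : polyLift v (MvPolynomial.monomial d 1) = v d := by
  letI : Module Qe M := Module.compHom M (PowerSeries.C : Qe →+* KK)
  have := (MvPolynomial.basisMonomials τ Qe).constr_basis ℕ v d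
  rwa [MvPolynomial.coe_basisMonomials] at this

theorem hsum_C_smul {M : Type} [AddCommGroup M] [Module KK M] [HComp M] (c : KK) (y : M) :
    (hsum fun k => (PowerSeries.C (PowerSeries.coeff k c) : KK) • y) = c • y := by
  refine hsum_eq fun N => ⟨(PowerSeries.mk fun n => PowerSeries.coeff (n + N) c) • y, ?_⟩
  conv_lhs => rw [powerSeries_eq_trunc_add c N]
  simp only [add_smul, sum_smul, mul_smul]

/-- The `𝕂`-linear map with given values on monomials. -/
def psLift {M : Type} [AddCommGroup M] [Module KK M] [HComp M] (v : (τ →₀ ℕ) → M) :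
    PS τ →ₗ[KK] M where
  toFun f := hsum fun k => polyLift v (PowerSeries.coeff k f)
  map_add' f g := by
    rw [← hsum_add]
    simp only [map_add]
  map_smul' c f := by
    rw [RingHom.id_apply, ← hsum_C_smul c (hsum _)]
    simp_rw [← hsum_smul]
    rw [hsum_hsum]
    simp_rw [coeff_smul_ps, map_sum, polyLift_smul]

theorem psLift_C {M : Type} [AddCommGroup M] [Module KK M] [HComp M] (v : (τ →₀ ℕ) → M)
    (d : τ →₀ ℕ) : psLift v (PowerSeries.C (MvPolynomial.monomial d 1)) = v d := by
  change (hsum fun k => polyLift v (PowerSeries.coeff k _)) = _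
  rw [hsum_of_forall_pos]
  · rw [PowerSeries.coeff_C, if_pos rfl, polyLift_monomial]
  · intro k
    rw [PowerSeries.coeff_C, if_neg (by omega), map_zero]

end PS

/-- The ordering map as a `𝕂`-linear map. -/
def OOl (n : ℕ) : LatSeries n →ₗ[KK] DD n where
  toFun := OO n
  map_add' f g := by
    rw [OO, OO, OO, ← map_add]
    congr 1; ext k
    simp
  map_smul' c f := by
    rw [OO, OO, RingHom.id_apply, ← mkD_smul]
    congr 1; ext k
    rw [coeff_smul_free]
    simp only [PowerSeries.coeff_mk, coeff_smul_ps, map_sum, map_smul]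

@[simp] theorem OOl_apply {n : ℕ} (f : LatSeries n) : OOl n f = OO n f := rfl

theorem ordPoly_monomial {n : ℕ} (d) : ordPoly n (MvPolynomial.monomial d 1) = ordMon d := by
  rw [ordPoly]
  have := (MvPolynomial.basisMonomials (Fin n × Gen) Qe).constr_basis Qe ordMon d
  simpa using this

theorem OO_monomial {n : ℕ} (d) :
    OO n (PowerSeries.C (MvPolynomial.monomial d 1)) = mkD n (PowerSeries.C (ordMon d)) := by
  rw [OO]
  congr 1; ext k
  rw [PowerSeries.coeff_mk, PowerSeries.coeff_C, PowerSeries.coeff_C]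
  split_ifs
  · rw [ordPoly_monomial]
  · simp

/-! ### Shift automorphisms -/

section shift
variable {τ : Type} [DecidableEq τ]

/-- The substitution `b ↦ b - ε`, `a ↦ a - 1`. -/
def shP (vb va : τ) : MvPolynomial τ Qe →ₐ[Qe] MvPolynomial τ Qe :=
  MvPolynomial.aeval fun t => MvPolynomial.X t -
    (if t = vb then MvPolynomial.C eps else if t = va then 1 else 0)

/-- The substitution `b ↦ b - ε`, `a ↦ a - 1` on series. -/
def sh (vb va : τ) : PS τ →ₐ[KK] PS τ := psMap (shP vb va)

theorem shP_X (vb va t : τ) : shP vb va (MvPolynomial.X t) = MvPolynomial.X t -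
    (if t = vb then MvPolynomial.C eps else if t = va then 1 else 0) := MvPolynomial.aeval_X _ _

theorem shP_b (vb va : τ) :
    shP vb va (MvPolynomial.X vb) = MvPolynomial.X vb - MvPolynomial.C eps := by simp [shP_X]

theorem shP_a {vb va : τ} (h : va ≠ vb) :
    shP vb va (MvPolynomial.X va) = MvPolynomial.X va - 1 := by simp [shP_X, h]

theorem shP_of_ne {vb va t : τ} (h : t ≠ vb) (h' : t ≠ va) :
    shP vb va (MvPolynomial.X t) = MvPolynomial.X t := by simp [shP_X, h, h']

theorem shP_C (vb va : τ) (c : Qe) : shP vb va (MvPolynomial.C c) = MvPolynomial.C c :=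
  (shP vb va).commutes c

theorem shP_ite (vb va vb' va' t : τ) :
    shP vb va (if t = vb' then MvPolynomial.C eps else if t = va' then 1 else 0) =
      if t = vb' then MvPolynomial.C eps else if t = va' then 1 else 0 := by
  split_ifs
  · exact shP_C _ _ _
  · exact map_one _
  · exact map_zero _

theorem shP_comm (vb va vb' va' : τ) (p : MvPolynomial τ Qe) :
    shP vb va (shP vb' va' p) = shP vb' va' (shP vb va p) := by
  have : (shP vb va).comp (shP vb' va') = (shP vb' va').comp (shP vb va) := by
    refine MvPolynomial.algHom_ext fun t => ?_
    rw [AlgHom.comp_apply, AlgHom.comp_apply, shP_X, shP_X, map_sub, map_sub, shP_ite, shP_ite,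
      shP_X, shP_X, sub_right_comm]
  exact DFunLike.congr_fun this p

end shift

/-! ### A faithful representation of `𝔻^{⊗ n}` -/

theorem map_hexp {E E' : Type} [Ring E] [Algebra KK E] [HComp E] [Ring E'] [Algebra KK E']
    [HComp E'] (φ : E →ₐ[KK] E') (u : E) : φ (hexp u) = hexp (φ u) := by
  rw [hexp, hexp, ← AlgHom.toLinearMap_apply, map_hsum]
  simp

theorem hexp_C {τ : Type} (p : MvPolynomial τ Qe) :
    hexp (PowerSeries.C p : PS τ) = expH p := by
  rw [hexp, ← hsum_C_ps (expH p)]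
  congr 1; funext k
  rw [coeff_expH, algebraMap_PS, PowerSeries.map_C, ← map_pow, ← map_mul, Algebra.smul_def]
  rfl

instance {ι M : Type} [AddCommGroup M] [Module KK M] [HComp M] : HComp (ι → M) where
  sep x h := by
    funext i
    refine HComp.sep _ fun N => ?_
    obtain ⟨y, rfl⟩ := h N
    exact ⟨y i, rfl⟩
  comp f := by
    refine ⟨fun i => hsum fun k => f k i, fun N => ?_⟩
    choose z hz using fun i => hsum_spec (fun k => f k i) N
    refine ⟨z, ?_⟩
    funext i
    simp [hz i]

theorem hsum_eq_sum_add {M : Type} [AddCommGroup M] [Module KK M] [HComp M] (f : ℕ → M) (N : ℕ) :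
    hsum f = ∑ k ∈ range N, hb ^ k • f k + hb ^ N • hsum fun k => f (k + N) := by
  induction N with
  | zero => simp
  | succ N ih =>
    rw [ih, sum_range_succ, hsum_succ, smul_add, smul_smul, ← pow_succ, zero_add, add_assoc]
    simp only [add_assoc, add_comm 1 N]

/-- Pointwise sums of linear maps are linear. Completeness is needed so that exponentials of
operators, hence `A` and `B`, act. -/
instance {M : Type} [AddCommGroup M] [Module KK M] [HComp M] : HComp (Module.End KK M) where
  sep x h := by
    ext m
    refine HComp.sep _ fun N => ?_
    obtain ⟨y, rfl⟩ := h N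
    exact ⟨y m, rfl⟩
  comp f := by
    have lin : ∀ g : ℕ → Module.End KK M, ∃ T : Module.End KK M,
        ∀ m, T m = hsum fun k => g k m := fun g =>
      ⟨{ toFun := fun m => hsum fun k => g k m
         map_add' := fun m m' => by simp only [map_add]; exact hsum_add _ _
         map_smul' := fun c m => by simp only [map_smul]; exact hsum_smul _ _ }, fun _ => rfl⟩
    obtain ⟨T, hT⟩ := lin f
    refine ⟨T, fun N => ?_⟩
    -- The remainder has to be a linear operator; pointwise choices would not do, so the tail of the
    -- series is taken.
    obtain ⟨T', hT'⟩ := lin fun k => f (k + N)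
    refine ⟨T', ?_⟩
    ext m
    rw [hT, hsum_eq_sum_add _ N, LinearMap.add_apply, LinearMap.smul_apply, hT',
      LinearMap.sum_apply]
    rfl

theorem qInt_succ (n : ℕ) : qInt (n + 1) = qInt n + q ^ n := sum_range_succ _ _

theorem qInt_succ' (n : ℕ) : qInt (n + 1) = 1 + q * qInt n := by
  rw [qInt, sum_range_succ', qInt, mul_sum]
  simp only [pow_succ', pow_zero]
  ring

section rep
variable {n : ℕ}

/-- The space of the representation: functions of the exponents of the `y_i`. -/
abbrev Rep (n : ℕ) : Type := (Fin n → ℕ) → LatSeries n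

/-- `b_i` as a polynomial variable. -/
abbrev pb (i : Fin n) : LatPoly n := MvPolynomial.X (i, Gen.b)
/-- `a_i` as a polynomial variable. -/
abbrev pa (i : Fin n) : LatPoly n := MvPolynomial.X (i, Gen.a)
/-- `x_i` as a polynomial variable. -/
abbrev px (i : Fin n) : LatPoly n := MvPolynomial.X (i, Gen.x)

/-- The substitution `b_i ↦ b_i - ε`, `a_i ↦ a_i - 1`. -/
abbrev shL (i : Fin n) : LatSeries n →ₐ[KK] LatSeries n := sh (i, Gen.b) (i, Gen.a)

/-- The exponent `p ε - ε a_i - b_i` of `q^p A_i B_i`. -/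
def wL (i : Fin n) (p : ℕ) : LatPoly n :=
  p • MvPolynomial.C eps - MvPolynomial.C eps * pa i - pb i

/-- The eigenvalues of `b_i`. -/
def evB (i : Fin n) : Rep n := fun K => PowerSeries.C (pb i - K i • MvPolynomial.C eps)
/-- The eigenvalues of `a_i`. -/
def evA (i : Fin n) : Rep n := fun K => PowerSeries.C (pa i - K i • 1)

/-- The action of `y_i`. -/
def opY (i : Fin n) : Module.End KK (Rep n) where
  toFun f K := if K i = 0 then 0 else f (Function.update K i (K i - 1))
  map_add' f g := by
    funext K
    simp only [Pi.add_apply]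
    split_ifs <;> simp
  map_smul' c f := by
    funext K
    simp only [Pi.smul_apply, RingHom.id_apply]
    split_ifs <;> simp

/-- The action of `x_i`. -/
def opX (i : Fin n) : Module.End KK (Rep n) where
  -- A function `f` stands for `∑_K y^K f_K(b, a, x)`. The formula is the normal ordering of `x y^k
  -- = q^k y^k x + [k] y^{k-1} (1 - q^{k-1} A B)/ħ`, where moving `x` past `b` and `a` shifts them
  -- by `ε` and `1`. The component at `K` receives the second term from `K_i + 1`.
  toFun f K := q ^ K i • (PowerSeries.C (px i) * shL i (f K))
    + qInt (K i + 1) • (hq (wL i (K i)) * f (Function.update K i (K i + 1)))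
  map_add' f g := by
    funext K
    simp only [Pi.add_apply, map_add, mul_add, smul_add]
    abel
  map_smul' c f := by
    funext K
    simp only [Pi.smul_apply, RingHom.id_apply, map_smul, mul_smul_comm, smul_add]
    rw [smul_comm c, smul_comm c]

/-- The action of the generators. -/
def opGen : Fin n × Gen → Module.End KK (Rep n)
  | (i, .y) => opY i
  | (i, .b) => Algebra.lmul KK (Rep n) (evB i)
  | (i, .a) => Algebra.lmul KK (Rep n) (evA i)
  | (i, .x) => opX i

theorem opY_apply (i : Fin n) (f : Rep n) (K) :
    opY i f K = if K i = 0 then 0 else f (Function.update K i (K i - 1)) := rfl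

theorem opX_apply (i : Fin n) (f : Rep n) (K) :
    opX i f K = q ^ K i • (PowerSeries.C (px i) * shL i (f K))
    + qInt (K i + 1) • (hq (wL i (K i)) * f (Function.update K i (K i + 1))) := rfl

theorem lmul_apply (g f : Rep n) (K) : Algebra.lmul KK (Rep n) g f K = g K * f K := rfl

theorem shL_evB (i j : Fin n) (K) : shL i (evB j K) =
    PowerSeries.C (pb j - K j • MvPolynomial.C eps - if j = i then MvPolynomial.C eps else 0) := by
  rw [evB, shL, sh, psMap_C, map_sub, map_nsmul, shP_C, shP_X]
  congr 1
  by_cases h : j = i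
  · simp [h]; ring
  · simp [h]

theorem shL_evA (i j : Fin n) (K) : shL i (evA j K) =
    PowerSeries.C (pa j - K j • 1 - if j = i then 1 else 0) := by
  rw [evA, shL, sh, psMap_C, map_sub, map_nsmul, map_one, shP_X]
  congr 1
  by_cases h : j = i
  · simp [h]; ring
  · simp [h]

theorem evB_update (i j : Fin n) (K : Fin n → ℕ) (m : ℕ) : evB j (Function.update K i m) =
    PowerSeries.C (pb j - (if j = i then m else K j) • MvPolynomial.C eps) := by
  rw [evB, Function.update_apply]

theorem evA_update (i j : Fin n) (K : Fin n → ℕ) (m : ℕ) : evA j (Function.update K i m) =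
    PowerSeries.C (pa j - (if j = i then m else K j) • 1) := by
  rw [evA, Function.update_apply]

theorem shP_px (i j : Fin n) : shP (i, Gen.b) (i, Gen.a) (px j) = px j :=
  shP_of_ne (by simp) (by simp)

theorem shL_hq {i j : Fin n} (h : j ≠ i) (p : ℕ) : shL i (hq (wL j p)) = hq (wL j p) := by
  rw [shL, sh, psMap_hq]
  congr 1
  rw [wL, map_sub, map_sub, map_nsmul, map_mul, shP_C, shP_of_ne, shP_of_ne] <;> simp [h]

theorem opX_comm (i j : Fin n) (h : i ≠ j) : opX i * opX j = opX j * opX i := by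
  ext1 f
  funext K
  simp only [Module.End.mul_apply, opX_apply, map_add, map_smul, map_mul,
    Function.update_of_ne h, Function.update_of_ne h.symm, shL_hq h, shL_hq h.symm]
  have e1 : ∀ i j : Fin n, shL i (PowerSeries.C (px j)) = PowerSeries.C (px j) := fun i j => by
    rw [shL, sh, psMap_C, shP_px]
  have e2 : shL i (shL j (f K)) = shL j (shL i (f K)) := by
    ext1 k
    simp only [shL, sh, psMap_apply, PowerSeries.coeff_map]
    exact shP_comm _ _ _ _ _
  rw [e1, e1, e2, Function.update_comm h]
  simp only [mul_add, Algebra.smul_def, map_pow]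
  ring

theorem opX_opY_comm (i j : Fin n) (h : i ≠ j) : opX i * opY j = opY j * opX i := by
  ext1 f
  funext K
  simp only [Module.End.mul_apply, opX_apply, opY_apply, Function.update_of_ne h,
    Function.update_of_ne h.symm]
  split_ifs
  · simp
  · rw [Function.update_comm h]

theorem opY_comm (i j : Fin n) (h : i ≠ j) : opY i * opY j = opY j * opY i := by
  ext1 f
  funext K
  simp only [Module.End.mul_apply, opY_apply, Function.update_of_ne h,
    Function.update_of_ne h.symm, Function.update_comm h]
  split_ifs <;> rfl

theorem lmul_opY (g f : Rep n) (i : Fin n) (K) :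
    Algebra.lmul KK (Rep n) g (opY i f) K - opY i (Algebra.lmul KK (Rep n) g f) K
      = (g K - g (Function.update K i (K i - 1))) * opY i f K := by
  simp only [lmul_apply, opY_apply]
  split_ifs
  · simp
  · ring

/-- Both summands of the action of `x`, the shift and the raising of the exponent of `y`, change the
eigenvalue by the same amount `D`. For `a` and `b` this `D` is `1` and `ε`. -/
theorem lmul_opX (g f : Rep n) (i : Fin n) (K) (D : LatSeries n)
    (h1 : g K - shL i (g K) = D) (h2 : g K - g (Function.update K i (K i + 1)) = D) :
    Algebra.lmul KK (Rep n) g (opX i f) K - opX i (Algebra.lmul KK (Rep n) g f) K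
      = D * opX i f K := by
  simp only [lmul_apply, opX_apply, map_mul]
  rw [← sub_eq_iff_eq_add'.2 (sub_eq_iff_eq_add.1 h1)]
  rw [show g (Function.update K i (K i + 1)) = g K - D by rw [← h2]; ring]
  simp only [Algebra.smul_def]
  ring

theorem hexp_lmul (g : Rep n) : hexp (Algebra.lmul KK (Rep n) g) =
    Algebra.lmul KK (Rep n) (hexp g) := by
  have := map_hexp (E := Rep n) (E' := Module.End KK (Rep n)) (Algebra.lmul KK (Rep n)) g
  exact this.symm

theorem hexp_neg_lmul (g : Rep n) : hexp (-(Algebra.lmul KK (Rep n) g)) =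
    Algebra.lmul KK (Rep n) (hexp (-g)) := by
  rw [← hexp_lmul]
  congr 1
  exact (map_neg (Algebra.lmul KK (Rep n)) g).symm

theorem hexp_apply (g : Rep n) (K : Fin n → ℕ) : hexp g K = hexp (g K) :=
  map_hexp (Pi.evalAlgHom KK (fun _ : Fin n → ℕ => LatSeries n) K) g

theorem smul_hb_eq_zero {τ : Type} {f : PS τ} (h : hb • f = 0) : f = 0 := by
  rw [X_pow_smul_PS] at h
  exact (mul_eq_zero.1 h).resolve_left PowerSeries.X_ne_zero

theorem liftNC_smul_Qe {E : Type} [Ring E] [Algebra KK E] [HComp E] (v : Fin n × Gen → E) (c : Qe)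
    (w : NC n) : liftNC v (c • w) = (PowerSeries.C c : KK) • liftNC v w := by
  rw [Algebra.smul_def, map_mul, liftNC_algebraMap, Algebra.smul_def]

theorem liftNC_smul_rat {E : Type} [Ring E] [Algebra KK E] [HComp E] (v : Fin n × Gen → E) (c : ℚ)
    (w : NC n) : liftNC v (c • w) = (PowerSeries.C (Polynomial.C c) : KK) • liftNC v w := by
  rw [← liftNC_smul_Qe]
  congr 1

section fAB
variable {E : Type} [Ring E] [Algebra KK E] [HComp E]

theorem liftFree_scal (v : Fin n × Gen → E) (c : KK) : liftFree v (scal n c) = algebraMap KK E c :=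
  (liftFree v).commutes c

theorem liftFree_fA (v : Fin n × Gen → E) (i : Fin n) (s : ℚ) : liftFree v (fA i s) =
    hexp (-((PowerSeries.C (Polynomial.C s * eps) : KK) • v (i, Gen.a))) := by
  rw [fA, liftFree_expH, map_neg, liftNC_smul_rat, liftNC_smul_Qe, liftNC_nc, smul_smul, ← map_mul]

theorem liftFree_fB (v : Fin n × Gen → E) (i : Fin n) (s : ℚ) : liftFree v (fB i s) =
    hexp (-((PowerSeries.C (Polynomial.C s) : KK) • v (i, Gen.b))) := by
  rw [fB, liftFree_expH, map_neg, liftNC_smul_rat, liftNC_nc]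

theorem constantCoeff_one_sub_fA_fB (i : Fin n) :
    PowerSeries.constantCoeff (1 - fA i 1 * fB i 1) = 0 := by
  simp only [map_sub, map_one, map_mul, fA, fB, expH,
    ← PowerSeries.coeff_zero_eq_constantCoeff_apply, PowerSeries.coeff_mk]
  simp

theorem hb_smul_liftFree_divH (v : Fin n × Gen → E) (i : Fin n) :
    hb • liftFree v (divH (1 - fA i 1 * fB i 1)) =
      1 - hexp (-((PowerSeries.C eps : KK) • v (i, Gen.a))) * hexp (-v (i, Gen.b)) := by
  have := congrArg (liftFree v) (X_mul_divH _ (constantCoeff_one_sub_fA_fB i))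
  rw [← pow_one PowerSeries.X, ← hb_pow_smul_free, pow_one, map_smul] at this
  rw [this, map_sub, map_one, map_mul, liftFree_fA, liftFree_fB]
  simp

end fAB

theorem opGen_comm (i j : Fin n) (g h : Gen) (hij : i ≠ j) :
    opGen (i, g) * opGen (j, h) = opGen (j, h) * opGen (i, g) := by
  have hA : ∀ i j : Fin n, i ≠ j → ∀ K m, evA j (Function.update K i m) = evA j K :=
    fun i j h K m => by rw [evA_update, evA, if_neg h.symm]
  have hB : ∀ i j : Fin n, i ≠ j → ∀ K m, evB j (Function.update K i m) = evB j K :=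
    fun i j h K m => by rw [evB_update, evB, if_neg h.symm]
  have hA' : ∀ i j : Fin n, i ≠ j → ∀ K, shL i (evA j K) = evA j K :=
    fun i j h K => by rw [shL_evA, evA, if_neg h.symm, sub_zero]
  have hB' : ∀ i j : Fin n, i ≠ j → ∀ K, shL i (evB j K) = evB j K :=
    fun i j h K => by rw [shL_evB, evB, if_neg h.symm, sub_zero]
  have cY : ∀ (g : Rep n) (i : Fin n), (∀ K m, g (Function.update K i m) = g K) →
      Algebra.lmul KK (Rep n) g * opY i = opY i * Algebra.lmul KK (Rep n) g := by
    intro g i h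
    ext1 f; funext K
    rw [← sub_eq_zero]
    exact (lmul_opY g f i K).trans (by rw [h, sub_self, zero_mul])
  have cX : ∀ (g : Rep n) (i : Fin n), (∀ K m, g (Function.update K i m) = g K) →
      (∀ K, shL i (g K) = g K) →
      Algebra.lmul KK (Rep n) g * opX i = opX i * Algebra.lmul KK (Rep n) g := by
    intro g i h h'
    ext1 f; funext K
    rw [← sub_eq_zero]
    exact (lmul_opX g f i K 0 (by rw [h', sub_self]) (by rw [h, sub_self])).trans
      (zero_mul _)
  cases g <;> cases h <;> simp only [opGen]
  · exact opY_comm i j hij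
  · exact (cY _ _ (hB i j hij)).symm
  · exact (cY _ _ (hA i j hij)).symm
  · exact (opX_opY_comm j i hij.symm).symm
  · exact cY _ _ (hB j i hij.symm)
  · rw [← map_mul, ← map_mul, mul_comm]
  · rw [← map_mul, ← map_mul, mul_comm]
  · exact cX _ _ (hB j i hij.symm) (hB' j i hij.symm)
  · exact cY _ _ (hA j i hij.symm)
  · rw [← map_mul, ← map_mul, mul_comm]
  · rw [← map_mul, ← map_mul, mul_comm]
  · exact cX _ _ (hA j i hij.symm) (hA' j i hij.symm)
  · exact opX_opY_comm i j hij
  · exact (cX _ _ (hB i j hij) (hB' i j hij)).symm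
  · exact (cX _ _ (hA i j hij) (hA' i j hij)).symm
  · exact opX_comm i j hij

/-- The operators imitate left multiplication on normal ordered series, so the relations must hold.
Only the one for `x y` needs computation, with multiplication by `ħ` removing the quotient `(1 - A
B)/ħ`. -/
theorem opGen_rel (f : Free n) (hf : Rel n f) : liftFree opGen f = 0 := by
  cases hf with
  | xy i =>
    have key := hb_smul_liftFree_divH (E := Module.End KK (Rep n)) opGen i
    simp only [map_sub, map_add, map_mul, liftFree_fz, liftFree_scal]
    refine sub_eq_zero.2 (eq_add_of_sub_eq' (G := Module.End KK (Rep n)) ?_)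
    have hX : ∀ T T' : Module.End KK (Rep n), hb • T = hb • T' → T = T' := by
      intro T T' h
      ext1 f; funext K
      have h1 := congrFun (DFunLike.congr_fun h f) K
      rw [← sub_eq_zero] at h1 ⊢
      refine smul_hb_eq_zero (Eq.trans ?_ h1)
      rw [smul_sub]; rfl
    refine hX _ _ ?_
    rw [key]
    ext1 f; funext K
    have eA : hexp (-((PowerSeries.C eps : KK) • opGen (i, Gen.a))) =
        Algebra.lmul KK (Rep n) (fun K => expH (-(MvPolynomial.C eps * (pa i - K i • 1)))) := by
      rw [opGen, ← map_smul, hexp_neg_lmul]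
      congr 1; funext K
      rw [hexp_apply, Pi.neg_apply, Pi.smul_apply, evA, Algebra.smul_def, algebraMap_PS,
        PowerSeries.map_C, ← map_mul, ← map_neg, hexp_C]
    have eB : hexp (-opGen (i, Gen.b)) =
        Algebra.lmul KK (Rep n) (fun K => expH (-(pb i - K i • MvPolynomial.C eps))) := by
      rw [opGen, hexp_neg_lmul]
      congr 1; funext K
      rw [hexp_apply, Pi.neg_apply, evB, ← map_neg, hexp_C]
    rw [eA, eB]
    simp only [opGen]
    simp only [LinearMap.smul_apply, LinearMap.sub_apply, Module.End.mul_apply, Pi.smul_apply,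
      Pi.sub_apply, Module.End.one_apply, lmul_apply, Module.algebraMap_end_apply, opX_apply,
      opY_apply, Function.update_self, Function.update_idem, Nat.add_sub_cancel,
      Nat.succ_ne_zero, if_false, Function.update_eq_self]
    rw [← mul_assoc, ← expH_add]
    have e1 : expH (-(MvPolynomial.C eps * (pa i - K i • 1)) + -(pb i - K i • MvPolynomial.C eps))
        = algebraMap KK (LatSeries n) q ^ K i * expH (wL i (K i)) := by
      rw [algebraMap_q, expH_pow, ← expH_add, wL]
      congr 1
      simp only [nsmul_eq_mul]; ring
    have e2 : ∀ m, PowerSeries.X * hq (wL i m) = 1 - expH (wL i m) := fun m => X_mul_hq _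
    rw [e1]
    -- At exponent `0` the operator `y x` contributes nothing, as `y` kills this component.
    -- Otherwise both orders contribute.
    rcases Nat.eq_zero_or_pos (K i) with h0 | h0
    · rw [h0]
      simp only [if_pos, map_zero, mul_zero, smul_zero, zero_add, sub_zero, pow_zero, one_mul,
        qInt, sum_range_one, one_smul, X_pow_smul_PS]
      rw [← mul_assoc, e2]; ring
    · obtain ⟨m, hm⟩ := Nat.exists_eq_succ_of_ne_zero h0.ne'
      rw [if_neg h0.ne', if_neg h0.ne', hm]
      have e3 : Function.update K i (m + 1) = K := by rw [← Nat.succ_eq_add_one, ← hm]; simp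
      have e4 : expH (wL i (m + 1)) = algebraMap KK (LatSeries n) q * expH (wL i m) := by
        rw [algebraMap_q, ← expH_add, wL, wL, succ_nsmul]
        congr 1; ring
      simp only [Nat.succ_eq_add_one, Nat.add_sub_cancel, e3, X_pow_smul_PS, smul_add, smul_smul,
        ← pow_succ']
      rw [add_sub_add_left_eq_sub]
      have e5 := e2 m
      have e6 := e2 (m + 1)
      rw [e4] at e6 ⊢
      have e7 := congrArg (algebraMap KK (LatSeries n)) (qInt_succ (m + 1))
      have e8 := congrArg (algebraMap KK (LatSeries n)) (qInt_succ' (m + 1))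
      rw [map_add, map_mul, map_one] at e8
      rw [map_add, map_pow] at e7
      simp only [Algebra.smul_def, map_mul]
      generalize algebraMap KK (LatSeries n) (qInt (m + 1 + 1)) = Q2 at *
      generalize algebraMap KK (LatSeries n) (qInt (m + 1)) = Q1 at *
      generalize algebraMap KK (LatSeries n) q = q' at *
      -- The constant part vanishes by `[m+2] = 1 + q [m+1]`, the part with `A B` by `[m+2] = [m+1]
      -- + q^{m+1}`.
      linear_combination Q2 * f K * e6 - q' * Q1 * f K * e5 - q' * expH (wL i m) * f K * e7
        + f K * e8
  | ax i =>
    simp only [map_sub, map_mul, liftFree_fz, opGen]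
    ext1 f; funext K
    simp only [LinearMap.sub_apply, Module.End.mul_apply, Pi.sub_apply]
    rw [lmul_opX _ _ _ _ 1, one_mul, sub_self]
    · rfl
    · rw [shL_evA, evA, ← map_sub]; simp
    · rw [evA_update, evA, ← map_sub]; simp [add_smul]
  | bx i =>
    simp only [map_sub, map_mul, liftFree_fz, opGen, liftFree_scal]
    ext1 f; funext K
    simp only [LinearMap.sub_apply, Module.End.mul_apply, Pi.sub_apply,
      Module.algebraMap_end_apply, Pi.smul_apply]
    rw [lmul_opX _ _ _ _ (algebraMap KK _ (PowerSeries.C eps)), Algebra.smul_def, sub_self]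
    · rfl
    · rw [shL_evB, evB, ← map_sub, algebraMap_PS, PowerSeries.map_C]; simp
    · rw [evB_update, evB, ← map_sub, algebraMap_PS, PowerSeries.map_C]; simp [add_smul]
  | ay i =>
    simp only [map_sub, map_add, map_mul, liftFree_fz, opGen]
    ext1 f; funext K
    simp only [LinearMap.sub_apply, LinearMap.add_apply, Module.End.mul_apply, Pi.sub_apply,
      Pi.add_apply]
    rw [lmul_opY, evA_update, evA, ← map_sub, opY_apply, if_pos rfl]
    split_ifs with h
    · simp
    · obtain ⟨m, hm⟩ := Nat.exists_eq_succ_of_ne_zero h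
      simp [hm, add_smul]
      ring
  | byy i =>
    simp only [map_sub, map_add, map_mul, liftFree_fz, opGen, liftFree_scal]
    ext1 f; funext K
    simp only [LinearMap.sub_apply, LinearMap.add_apply, Module.End.mul_apply, Pi.sub_apply,
      Pi.add_apply, Module.algebraMap_end_apply, Pi.smul_apply]
    rw [lmul_opY, evB_update, evB, ← map_sub, opY_apply, if_pos rfl,
      Algebra.smul_def (PowerSeries.C eps : KK), algebraMap_PS, PowerSeries.map_C]
    split_ifs with h
    · simp
    · obtain ⟨m, hm⟩ := Nat.exists_eq_succ_of_ne_zero h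
      simp [hm, add_smul]
      ring
  | ab i =>
    simp only [map_sub, map_mul, liftFree_fz, opGen]
    rw [← map_mul, ← map_mul, mul_comm, sub_self]
  | comm i j g h hij =>
    rw [map_sub, map_mul, map_mul, liftFree_fz, liftFree_fz]
    exact sub_eq_zero.2 (opGen_comm i j g h hij)

end rep

/-! ### Injectivity of the ordering map -/
section inj
variable {n : ℕ}

theorem opX_single (i : Fin n) {K : Fin n → ℕ} {g : LatSeries n} (hK : K i = 0)
    (hg : shL i g = g) : opX i (Pi.single K g) = Pi.single K (PowerSeries.C (px i) * g) := by
  funext K'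
  rw [opX_apply]
  have h2 : (Pi.single K g : Rep n) (Function.update K' i (K' i + 1)) = 0 := by
    apply Pi.single_eq_of_ne
    intro h
    have := congrFun h i
    simp [hK] at this
  rw [h2, mul_zero, smul_zero, add_zero]
  by_cases h : K' = K
  · subst h; simp [hK, hg]
  · simp [Pi.single_eq_of_ne h]

theorem opX_pow_single (i : Fin n) {K : Fin n → ℕ} {g : LatSeries n} (hK : K i = 0)
    (hg : shL i g = g) (m : ℕ) :
    (opX i ^ m) (Pi.single K g) = Pi.single K (PowerSeries.C (px i ^ m) * g) := by
  induction m with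
  | zero => simp
  | succ m ih =>
    rw [pow_succ', Module.End.mul_apply, ih, opX_single i hK]
    · rw [pow_succ', map_mul, mul_assoc]
    · rw [map_mul, hg, shL, sh, psMap_C, map_pow, shP_px]

theorem lmul_pow_single (g' : Rep n) {K : Fin n → ℕ} {g : LatSeries n} (m : ℕ) :
    ((Algebra.lmul KK (Rep n) g') ^ m) (Pi.single K g) = Pi.single K (g' K ^ m * g) := by
  rw [← map_pow]
  funext K'
  rw [lmul_apply]
  by_cases h : K' = K
  · subst h; simp
  · simp [Pi.single_eq_of_ne h]

theorem opY_pow_single (i : Fin n) {K : Fin n → ℕ} {g : LatSeries n} (m : ℕ) :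
    (opY i ^ m) (Pi.single K g) = Pi.single (Function.update K i (K i + m)) g := by
  induction m with
  | zero => simp
  | succ m ih =>
    rw [pow_succ', Module.End.mul_apply, ih]
    funext K'
    rw [opY_apply]
    by_cases h : K' = Function.update K i (K i + (m + 1))
    · rw [h, if_neg (by simp)]
      simp [← add_assoc]
    · rw [Pi.single_eq_of_ne h]
      split_ifs with h0
      · rfl
      · apply Pi.single_eq_of_ne
        intro h2
        apply h
        have h3 := congrFun h2 i
        rw [Function.update_self, Function.update_self] at h3
        rw [← add_assoc, ← h3, Nat.sub_add_cancel (Nat.pos_of_ne_zero h0)]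
        funext j
        by_cases hj : j = i
        · subst hj; simp
        · have := congrFun h2 j
          rw [Function.update_of_ne hj] at this ⊢
          rw [this, Function.update_of_ne hj]

/-- The part of an ordered monomial in one tensor factor. -/
def ordBlock (d : (Fin n × Gen) →₀ ℕ) (i : Fin n) : NC n :=
  nc i Gen.y ^ d (i, Gen.y) * nc i Gen.b ^ d (i, Gen.b)
      * nc i Gen.a ^ d (i, Gen.a) * nc i Gen.x ^ d (i, Gen.x)

theorem ordMon_eq (d : (Fin n × Gen) →₀ ℕ) :
    ordMon d = ((List.finRange n).map (ordBlock d)).prod := by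
  rw [ordMon, List.ofFn_eq_map]; rfl

/-- On the vacuum `Pi.single 0 1`, the block of a factor that has not acted yet finds exponent `0`
of its `y_i` and a coefficient invariant under its shift. Hence `x_i`, `a_i`, `b_i` multiply by
their variables and `y_i` moves the support. -/
theorem liftNC_ordBlocks_single (d : (Fin n × Gen) →₀ ℕ) (l : List (Fin n)) (hl : l.Nodup) :
    (liftNC opGen (l.map (ordBlock d)).prod) (Pi.single 0 1 : Rep n) =
      Pi.single (fun i => if i ∈ l then d (i, Gen.y) else 0)
        (PowerSeries.C (l.map fun i => pb i ^ d (i, Gen.b) * pa i ^ d (i, Gen.a)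
          * px i ^ d (i, Gen.x)).prod) := by
  induction l with
  | nil =>
    simp only [List.map_nil, List.prod_nil, map_one, Module.End.one_apply]
    congr 1
  | cons i l ih =>
    rw [List.nodup_cons] at hl
    rw [List.map_cons, List.prod_cons, map_mul, Module.End.mul_apply, ih hl.2, ordBlock]
    simp only [map_mul, map_pow, liftNC_nc, Module.End.mul_apply, opGen]
    rw [opX_pow_single i (by simp [hl.1]), lmul_pow_single, lmul_pow_single, opY_pow_single]
    · have e : Function.update (fun j => if j ∈ l then d (j, Gen.y) else 0) i
          ((if i ∈ l then d (i, Gen.y) else 0) + d (i, Gen.y)) =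
          fun j => if j ∈ i :: l then d (j, Gen.y) else 0 := by
        funext j
        by_cases hj : j = i
        · subst hj; simp [hl.1]
        · simp [hj]
      rw [e]
      congr 1
      rw [evB, evA, if_neg hl.1, zero_smul, sub_zero, zero_smul, sub_zero, List.map_cons,
        List.prod_cons, map_mul, map_mul, map_mul, map_pow, map_pow, map_pow]
      ring
    · rw [shL, sh, psMap_C, map_list_prod, List.map_map]
      congr 2
      refine List.map_congr_left fun j hj => ?_
      have hji : j ≠ i := fun h => hl.1 (h ▸ hj)
      simp only [Function.comp_apply, map_mul, map_pow]
      rw [shP_of_ne, shP_of_ne, shP_px] <;> simp [hji]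

/-- The representation. -/
def act (n : ℕ) : DD n →ₐ[KK] Module.End KK (Rep n) := liftD opGen opGen_rel

/-- The exponents without those of the `y_i`. -/
def eraseY (d : (Fin n × Gen) →₀ ℕ) : (Fin n × Gen) →₀ ℕ := d.filter fun p => p.2 ≠ Gen.y

/-- The part of a polynomial of degrees `K` in the `y_i`. -/
def yPart (K : Fin n → ℕ) : LatPoly n →ₗ[Qe] LatPoly n :=
  (MvPolynomial.basisMonomials (Fin n × Gen) Qe).constr Qe fun d =>
    if (fun i => d (i, Gen.y)) = K then MvPolynomial.monomial (eraseY d) 1 else 0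

theorem yPart_monomial (K : Fin n → ℕ) (d) (c : Qe) : yPart K (MvPolynomial.monomial d c) =
    if (fun i => d (i, Gen.y)) = K then MvPolynomial.monomial (eraseY d) c else 0 := by
  have := (MvPolynomial.basisMonomials (Fin n × Gen) Qe).constr_basis Qe (fun d =>
    if (fun i => d (i, Gen.y)) = K then MvPolynomial.monomial (eraseY d) (1 : Qe) else 0) d
  rw [MvPolynomial.coe_basisMonomials] at this
  have h2 : (MvPolynomial.monomial d c : LatPoly n) = c • MvPolynomial.monomial d 1 := by
    rw [MvPolynomial.smul_monomial, smul_eq_mul, mul_one]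
  rw [h2, map_smul, yPart, this]
  split_ifs
  · rw [MvPolynomial.smul_monomial, smul_eq_mul, mul_one]
  · rw [smul_zero]

/-- The exponents of `y` together with the remaining ones determine the monomial, so splitting off
the `y`-degrees loses nothing. -/
theorem coeff_yPart (d : (Fin n × Gen) →₀ ℕ) (p : LatPoly n) :
    MvPolynomial.coeff (eraseY d) (yPart (fun i => d (i, Gen.y)) p) = MvPolynomial.coeff d p := by
  induction p using MvPolynomial.induction_on' with
  | monomial e c =>
    rw [yPart_monomial, MvPolynomial.coeff_monomial]
    by_cases h : e = d
    · subst h; simp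
    · rw [if_neg h]
      split_ifs with h2
      · rw [MvPolynomial.coeff_monomial, if_neg]
        intro h3
        apply h
        ext ⟨i, g⟩
        by_cases hg : g = Gen.y
        · subst hg; exact congrFun h2 i
        · have := DFunLike.congr_fun h3 (i, g)
          rwa [eraseY, eraseY, Finsupp.filter_apply_pos _ _ (by exact hg),
            Finsupp.filter_apply_pos _ _ (by exact hg)] at this
      · simp
  | add p p' hp hp' => rw [map_add, MvPolynomial.coeff_add, hp, hp', MvPolynomial.coeff_add]

/-- `yPart` on series, for all degrees at once. -/
def yParts (n : ℕ) : LatSeries n →ₗ[KK] Rep n where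
  toFun f K := PowerSeries.mk fun k => yPart K (PowerSeries.coeff k f)
  map_add' f g := by funext K; ext1 k; simp
  map_smul' c f := by
    funext K; ext1 k
    rw [Pi.smul_apply, coeff_smul_ps]
    simp only [PowerSeries.coeff_mk, RingHom.id_apply]
    rw [coeff_smul_ps, map_sum]
    simp only [map_smul]

theorem yParts_apply (f : LatSeries n) (K) :
    yParts n f K = PowerSeries.mk fun k => yPart K (PowerSeries.coeff k f) := rfl

/-- This exhibits a left inverse of `𝕆` up to regrouping by powers of `y`: acting on the vacuum
returns the coefficients of the series. Injectivity is immediate from it. -/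
theorem act_OO (f : LatSeries n) : act n (OO n f) (Pi.single 0 1) = yParts n f := by
  have : (LinearMap.applyₗ (Pi.single 0 1 : Rep n)).comp ((act n).toLinearMap.comp (OOl n)) =
      yParts n := by
    refine ps_ext fun d => ?_
    simp only [LinearMap.comp_apply, LinearMap.applyₗ_apply_apply, AlgHom.toLinearMap_apply,
      OOl_apply, OO_monomial]
    rw [act, liftD_mkD, liftFree_C, ordMon_eq,
      liftNC_ordBlocks_single d _ (List.nodup_finRange n)]
    funext K
    ext1 k
    rw [yParts_apply, PowerSeries.coeff_mk, PowerSeries.coeff_C]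
    have e1 : (fun i => if i ∈ List.finRange n then d (i, Gen.y) else 0) =
        fun i => d (i, Gen.y) := by funext i; simp
    have e2 : ((List.finRange n).map fun i => pb i ^ d (i, Gen.b) * pa i ^ d (i, Gen.a)
          * px i ^ d (i, Gen.x)).prod = MvPolynomial.monomial (eraseY d) 1 := by
      rw [← List.ofFn_eq_map, List.prod_ofFn, MvPolynomial.monomial_eq, map_one, one_mul,
        Finsupp.prod_fintype _ _ (by simp), Fintype.prod_prod_type]
      refine prod_congr rfl fun i _ => ?_
      have : (univ : Finset Gen) = {Gen.y, Gen.b, Gen.a, Gen.x} := rfl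
      rw [this]
      simp [eraseY, Finsupp.filter_apply, mul_assoc]
    rw [e1, e2]
    by_cases hK : (fun i => d (i, Gen.y)) = K
    · subst hK
      rw [Pi.single_eq_same, PowerSeries.coeff_C]
      split_ifs
      · rw [yPart_monomial, if_pos rfl]
      · simp
    · rw [Pi.single_eq_of_ne (Ne.symm hK)]
      split_ifs
      · rw [yPart_monomial, if_neg hK]; simp
      · simp
  exact DFunLike.congr_fun this f

theorem OO_injective (n : ℕ) : Function.Injective (OO n) := by
  change Function.Injective (OOl n)
  rw [injective_iff_map_eq_zero]
  intro f hf
  have h := act_OO f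
  rw [← OOl_apply, hf, map_zero] at h
  ext k d
  have h2 := congrArg (PowerSeries.coeff k) (congrFun h fun i => d (i, Gen.y))
  rw [yParts_apply, PowerSeries.coeff_mk] at h2
  rw [← coeff_yPart, ← h2]
  simp

end inj

/-! ### Products over lists of commuting families -/
section lists
variable {E ι : Type} [Monoid E]

/-- Used to regroup an ordered monomial, which is a product over tensor factors, as all `y`, then
all `b` and `a`, then all `x`. -/
theorem list_prod_map_mul (l : List ι) (hl : l.Nodup) (f g : ι → E)
    (h : ∀ i j, i ≠ j → Commute (g i) (f j)) :
    (l.map fun i => f i * g i).prod = (l.map f).prod * (l.map g).prod := by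
  induction l with
  | nil => simp
  | cons i l ih =>
    rw [List.nodup_cons] at hl
    have hc : Commute (g i) (l.map f).prod := by
      refine Commute.list_prod_right _ _ fun x hx => ?_
      obtain ⟨j, hj, rfl⟩ := List.mem_map.1 hx
      exact h i j fun e => hl.1 (e ▸ hj)
    simp only [List.map_cons, List.prod_cons, ih hl.2]
    rw [mul_assoc, ← mul_assoc (g i), hc.eq]
    simp only [mul_assoc]

theorem list_prod_map_eq_of_forall_ne (l : List ι) (hl : l.Nodup) (f : ι → E) {i : ι}
    (hi : i ∈ l) (h : ∀ j, j ≠ i → f j = 1) : (l.map f).prod = f i := by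
  induction l with
  | nil => simp at hi
  | cons j l ih =>
    rw [List.nodup_cons] at hl
    rw [List.map_cons, List.prod_cons]
    by_cases hj : j = i
    · subst hj
      rw [List.prod_eq_one, mul_one]
      intro x hx
      obtain ⟨k, hk, rfl⟩ := List.mem_map.1 hx
      exact h k fun e => hl.1 (e ▸ hk)
    · rw [h j hj, one_mul, ih hl.2 ((List.mem_cons.1 hi).resolve_left (Ne.symm hj))]

end lists

section relations
variable {n : ℕ}

theorem mkD_eq_zero_of_rel {f : Free n} (hf : Rel n f) : mkD n f = 0 := by
  rw [← map_zero (mkD n), mkD_eq_iff, sub_zero, relIdeal, TwoSidedIdeal.mem_iInf]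
  exact fun N => TwoSidedIdeal.subset_span (Or.inl hf)

theorem mkD_scal (c : KK) : mkD n (scal n c) = algebraMap KK (DD n) c := rfl

theorem mkD_C (w : NC n) :
    mkD n (PowerSeries.C w) = liftNC (fun p : Fin n × Gen => dz p.1 p.2) w := by
  induction w using FreeAlgebra.induction with
  | grade0 r =>
    rw [liftNC_algebraMap, ← mkD_scal, scal, PowerSeries.map_C]
  | grade1 x => exact (liftNC_nc (fun p : Fin n × Gen => dz p.1 p.2) x.1 x.2).symm
  | mul a b ha hb => rw [map_mul, map_mul, map_mul, ha, hb]
  | add a b ha hb => rw [map_add, map_add, map_add, ha, hb]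

theorem mkD_eq_hsum (f : Free n) : mkD n f =
    hsum fun k => mkD n (PowerSeries.C (PowerSeries.coeff k f)) := by
  conv_lhs => rw [← hsum_C_free f]
  exact map_hsum (mkDa n).toLinearMap _

theorem mkD_eq_liftFree (f : Free n) :
    mkD n f = liftFree (fun p : Fin n × Gen => dz p.1 p.2) f := by
  rw [mkD_eq_hsum, liftFree_apply]
  simp only [mkD_C]

theorem dA_eq (i : Fin n) (s : ℚ) :
    dA i s = hexp (-((PowerSeries.C (Polynomial.C s * eps) : KK) • dz i Gen.a)) := by
  rw [dA, mkD_eq_liftFree, liftFree_fA]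

theorem dB_eq (i : Fin n) (s : ℚ) :
    dB i s = hexp (-((PowerSeries.C (Polynomial.C s) : KK) • dz i Gen.b)) := by
  rw [dB, mkD_eq_liftFree, liftFree_fB]

theorem dz_comm {i j : Fin n} (h : i ≠ j) (g g' : Gen) : Commute (dz i g) (dz j g') := by
  have := mkD_eq_zero_of_rel (Rel.comm i j g g' h)
  rw [map_sub, map_mul, map_mul, sub_eq_zero] at this
  exact this

theorem dz_ab (i : Fin n) : Commute (dz i Gen.a) (dz i Gen.b) := by
  have := mkD_eq_zero_of_rel (Rel.ab i)
  rw [map_sub, map_mul, map_mul, sub_eq_zero] at this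
  exact this

/-- `ε` as an element of `𝕂`. -/
abbrev ke : KK := PowerSeries.C eps

theorem dz_ax (i : Fin n) : dz i Gen.x * dz i Gen.a = (dz i Gen.a - 1) * dz i Gen.x := by
  have := mkD_eq_zero_of_rel (Rel.ax i)
  simp only [map_sub, map_mul, sub_eq_zero] at this
  rw [sub_mul, one_mul]
  exact (sub_eq_iff_comm.1 this).symm

theorem dz_bx (i : Fin n) :
    dz i Gen.x * dz i Gen.b = (dz i Gen.b - algebraMap KK _ ke) * dz i Gen.x := by
  have := mkD_eq_zero_of_rel (Rel.bx i)
  simp only [map_sub, map_mul, sub_eq_zero] at this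
  rw [sub_mul]
  exact (sub_eq_iff_comm.1 this).symm

theorem dz_ay (i : Fin n) : dz i Gen.a * dz i Gen.y = dz i Gen.y * (dz i Gen.a - 1) := by
  have := mkD_eq_zero_of_rel (Rel.ay i)
  simp only [map_sub, map_add, map_mul] at this
  rw [mul_sub, mul_one, ← sub_eq_zero, ← this]
  simp only [dz]; abel

theorem dz_by (i : Fin n) :
    dz i Gen.b * dz i Gen.y = dz i Gen.y * (dz i Gen.b - algebraMap KK _ ke) := by
  have := mkD_eq_zero_of_rel (Rel.byy i)
  simp only [map_sub, map_add, map_mul] at this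
  rw [mul_sub, ← sub_eq_zero, ← this, ← Algebra.commutes, ← mkD_scal]
  simp only [dz]; abel

theorem dz_xy (i : Fin n) : dz i Gen.x * dz i Gen.y =
    q • (dz i Gen.y * dz i Gen.x) + mkD n (divH (1 - fA i 1 * fB i 1)) := by
  have := mkD_eq_zero_of_rel (Rel.xy i)
  rw [map_sub, sub_eq_zero, map_add, map_mul, map_mul, map_mul, mkD_scal] at this
  rw [Algebra.smul_def, ← mul_assoc]
  exact this

end relations

/-! ### The commutative subalgebra generated by the `a_i` and `b_i` -/
section mid
variable {n : ℕ}

/-- Series in commuting variables `b_i` (`false`) and `a_i` (`true`). -/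
abbrev Mid (n : ℕ) : Type := PS (Fin n × Bool)

/-- The variable `b_i`. -/
abbrev mb (i : Fin n) : MvPolynomial (Fin n × Bool) Qe := MvPolynomial.X (i, false)
/-- The variable `a_i`. -/
abbrev ma (i : Fin n) : MvPolynomial (Fin n × Bool) Qe := MvPolynomial.X (i, true)
/-- `ε` as a constant polynomial. -/
abbrev me {τ : Type} : MvPolynomial τ Qe := MvPolynomial.C eps

/-- The substitution `b_i ↦ b_i - ε`, `a_i ↦ a_i - 1`. -/
abbrev shM (i : Fin n) : Mid n →ₐ[KK] Mid n := sh (i, false) (i, true)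

/-- The generators `b`, `a`. -/
def midGen : Bool → Gen
  | false => Gen.b
  | true => Gen.a

/-- The inclusion of series in `a_i`, `b_i` into all series. -/
def ιM : Mid n →ₐ[KK] LatSeries n := psMap (MvPolynomial.rename fun p => (p.1, midGen p.2))

/-- `∏ b_i^{e_i} a_i^{e'_i}` in `𝔻^{⊗ n}`. -/
def ba (e : (Fin n × Bool) →₀ ℕ) : DD n :=
  ((List.finRange n).map fun i => dz i Gen.b ^ e (i, false) * dz i Gen.a ^ e (i, true)).prod

/-- `∏ y_i^{K_i}` in `𝔻^{⊗ n}`. -/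
def yy (K : Fin n → ℕ) : DD n := ((List.finRange n).map fun i => dz i Gen.y ^ K i).prod

/-- `∏ x_i^{N_i}` in `𝔻^{⊗ n}`. -/
def xx (N : Fin n → ℕ) : DD n := ((List.finRange n).map fun i => dz i Gen.x ^ N i).prod

/-- Exponents assembled from those of `y`, of `b, a` and of `x`. -/
def joinExp (K : Fin n → ℕ) (e : (Fin n × Bool) →₀ ℕ) (N : Fin n → ℕ) : (Fin n × Gen) →₀ ℕ :=
  Finsupp.equivFunOnFinite.symm fun p =>
    match p with
    | (i, .y) => K i
    | (i, .b) => e (i, false)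
    | (i, .a) => e (i, true)
    | (i, .x) => N i

theorem OO_joinExp (K : Fin n → ℕ) (e : (Fin n × Bool) →₀ ℕ) (N : Fin n → ℕ) :
    OO n (PowerSeries.C (MvPolynomial.monomial (joinExp K e N) 1)) = yy K * ba e * xx N := by
  rw [OO_monomial, mkD_C, ordMon_eq, map_list_prod, List.map_map]
  have e1 : (fun i => liftNC (fun p : Fin n × Gen => dz p.1 p.2) (ordBlock (joinExp K e N) i)) =
      fun i => (dz i Gen.y ^ K i * (dz i Gen.b ^ e (i, false) * dz i Gen.a ^ e (i, true)))
        * dz i Gen.x ^ N i := by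
    funext i
    simp [ordBlock, joinExp, mul_assoc]
  have hc : ∀ (i j : Fin n), i ≠ j → ∀ g g' a b, Commute (dz i g ^ a) (dz j g' ^ b) :=
    fun i j h g g' a b => (dz_comm h g g').pow_pow a b
  change (List.map (fun i => liftNC (fun p : Fin n × Gen => dz p.1 p.2)
    (ordBlock (joinExp K e N) i)) _).prod = _
  rw [e1, list_prod_map_mul _ (List.nodup_finRange n), list_prod_map_mul _ (List.nodup_finRange n)]
  · rfl
  · intro i j h
    exact Commute.mul_left (hc i j h _ _ _ _) (hc i j h _ _ _ _)
  · intro i j h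
    exact Commute.mul_right (hc i j h _ _ _ _) (Commute.mul_right (hc i j h _ _ _ _)
      (hc i j h _ _ _ _))

theorem ba_add (e e' : (Fin n × Bool) →₀ ℕ) : ba (e + e') = ba e * ba e' := by
  rw [ba, ba, ba, ← list_prod_map_mul _ (List.nodup_finRange n)]
  · congr 2
    funext i
    simp only [Finsupp.add_apply, pow_add]
    rw [mul_assoc, mul_assoc, ← mul_assoc _ (dz i Gen.b ^ e' (i, false)),
      ← mul_assoc (dz i Gen.a ^ e (i, true)), ((dz_ab i).pow_pow _ _).eq]
    simp only [mul_assoc]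
  · intro i j h
    have hc : ∀ g g' a b, Commute (dz i g ^ a) (dz j g' ^ b) :=
      fun g g' a b => (dz_comm h g g').pow_pow a b
    exact ((hc _ _ _ _).mul_right (hc _ _ _ _)).mul_left ((hc _ _ _ _).mul_right (hc _ _ _ _))

theorem ba_zero : ba (0 : (Fin n × Bool) →₀ ℕ) = 1 := by
  rw [ba]
  exact List.prod_eq_one fun x hx => by
    obtain ⟨j, _, rfl⟩ := List.mem_map.1 hx
    simp

theorem yy_zero : yy (0 : Fin n → ℕ) = 1 :=
  List.prod_eq_one fun x hx => by
    obtain ⟨j, _, rfl⟩ := List.mem_map.1 hx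
    simp

theorem xx_zero : xx (0 : Fin n → ℕ) = 1 :=
  List.prod_eq_one fun x hx => by
    obtain ⟨j, _, rfl⟩ := List.mem_map.1 hx
    simp

theorem monomial_joinExp (K : Fin n → ℕ) (e : (Fin n × Bool) →₀ ℕ) (N : Fin n → ℕ) :
    (MvPolynomial.monomial (joinExp K e N) 1 : LatPoly n) =
      (∏ i, MvPolynomial.X (i, Gen.y) ^ K i) *
        MvPolynomial.rename (fun p : Fin n × Bool => (p.1, midGen p.2)) (MvPolynomial.monomial e 1)
        * ∏ i, MvPolynomial.X (i, Gen.x) ^ N i := by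
  rw [MvPolynomial.monomial_eq, MvPolynomial.monomial_eq, map_one, map_one, one_mul, one_mul,
    Finsupp.prod_fintype _ _ (by simp), Finsupp.prod_fintype _ _ (by simp), map_prod,
    Fintype.prod_prod_type, Fintype.prod_prod_type, ← prod_mul_distrib, ← prod_mul_distrib]
  refine prod_congr rfl fun i _ => ?_
  have : (univ : Finset Gen) = {Gen.y, Gen.b, Gen.a, Gen.x} := rfl
  rw [this, Fintype.prod_bool]
  simp [joinExp, midGen]
  ring

/-- The linear map `g ↦ ∏ b^{..} a^{..}` extended to series. -/
def midl (n : ℕ) : Mid n →ₗ[KK] DD n := psLift ba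

/-- Both sides are bilinear, so extensionality on monomials, applied in each argument, reduces this
to `ba_add`. -/
theorem midl_mul (f g : Mid n) : midl n (f * g) = midl n f * midl n g := by
  have : (LinearMap.mul KK (Mid n)).compr₂ (midl n) =
      (LinearMap.mul KK (DD n)).compl₁₂ (midl n) (midl n) := by
    refine LinearMap.ext fun f => ?_
    refine ps_ext fun e' => ?_
    have h2 : ((LinearMap.mul KK (Mid n)).compr₂ (midl n)).flip
        (PowerSeries.C (MvPolynomial.monomial e' 1)) =
      ((LinearMap.mul KK (DD n)).compl₁₂ (midl n) (midl n)).flip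
        (PowerSeries.C (MvPolynomial.monomial e' 1)) := by
      refine ps_ext fun e => ?_
      simp only [LinearMap.flip_apply, LinearMap.compr₂_apply, LinearMap.compl₁₂_apply,
        LinearMap.mul_apply']
      rw [← map_mul, MvPolynomial.monomial_mul, one_mul, midl, psLift_C, psLift_C, psLift_C,
        ba_add]
    exact DFunLike.congr_fun h2 f
  exact DFunLike.congr_fun (DFunLike.congr_fun this f) g

/-- The homomorphism from series in commuting `a_i`, `b_i` to `𝔻^{⊗ n}`. -/
def mid (n : ℕ) : Mid n →ₐ[KK] DD n :=
  AlgHom.ofLinearMap (midl n) (by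
    have : (1 : Mid n) = PowerSeries.C (MvPolynomial.monomial 0 1) := by simp
    rw [this, midl, psLift_C, ba_zero]) midl_mul

theorem mid_monomial (e : (Fin n × Bool) →₀ ℕ) :
    mid n (PowerSeries.C (MvPolynomial.monomial e 1)) = ba e := psLift_C ba e

/-- This is the dictionary between `𝕆` and `𝔻`: series in `a` and `b` may be inserted between powers
of `y` and `x`. All normal ordered expansions below are read through it. -/
theorem OO_mul (K : Fin n → ℕ) (g : Mid n) (N : Fin n → ℕ) :
    OO n (PowerSeries.C (∏ i, MvPolynomial.X (i, Gen.y) ^ K i) * ιM g *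
      PowerSeries.C (∏ i, MvPolynomial.X (i, Gen.x) ^ N i)) = yy K * mid n g * xx N := by
  have : (OOl n).comp (((LinearMap.mulRight KK (PowerSeries.C
      (∏ i, MvPolynomial.X (i, Gen.x) ^ N i) : LatSeries n)).comp
      (LinearMap.mulLeft KK (PowerSeries.C (∏ i, MvPolynomial.X (i, Gen.y) ^ K i)))).comp
        (ιM : Mid n →ₐ[KK] LatSeries n).toLinearMap) =
      ((LinearMap.mulRight KK (xx N)).comp (LinearMap.mulLeft KK (yy K))).comp
        (mid n).toLinearMap := by
    refine ps_ext fun e => ?_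
    simp only [LinearMap.comp_apply, LinearMap.mulRight_apply, LinearMap.mulLeft_apply,
      AlgHom.toLinearMap_apply, OOl_apply, mid_monomial]
    rw [← OO_joinExp, monomial_joinExp, ιM, psMap_C, map_mul, map_mul]
  exact DFunLike.congr_fun this g

theorem mid_b (i : Fin n) : mid n (PowerSeries.C (mb i)) = dz i Gen.b := by
  rw [mb, MvPolynomial.X, mid_monomial, ba,
    list_prod_map_eq_of_forall_ne _ (List.nodup_finRange n) _ (List.mem_finRange i)]
  · simp
  · intro j hj
    simp [Ne.symm hj]

theorem mid_a (i : Fin n) : mid n (PowerSeries.C (ma i)) = dz i Gen.a := by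
  rw [ma, MvPolynomial.X, mid_monomial, ba,
    list_prod_map_eq_of_forall_ne _ (List.nodup_finRange n) _ (List.mem_finRange i)]
  · simp
  · intro j hj
    simp [Ne.symm hj]

theorem mid_C (c : Qe) : mid n (PowerSeries.C (MvPolynomial.C c)) =
    algebraMap KK (DD n) (PowerSeries.C c) := by
  rw [← (mid n).commutes, algebraMap_PS, PowerSeries.map_C]

theorem mid_expH (p : MvPolynomial (Fin n × Bool) Qe) :
    mid n (expH p) = hexp (mid n (PowerSeries.C p)) := by rw [← hexp_C, map_hexp]

theorem mid_expH_a (i : Fin n) (s : ℚ) :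
    mid n (expH (-(MvPolynomial.C (Polynomial.C s * eps) * ma i))) = dA i s := by
  rw [mid_expH, dA_eq, map_neg, map_neg, map_mul, map_mul, mid_a, mid_C, Algebra.smul_def]

theorem mid_expH_b (i : Fin n) (s : ℚ) :
    mid n (expH (-(MvPolynomial.C (Polynomial.C s) * mb i))) = dB i s := by
  rw [mid_expH, dB_eq, map_neg, map_neg, map_mul, map_mul, mid_b, mid_C, Algebra.smul_def]

/-- An algebra homomorphism into `𝔻^{⊗ n}` intertwined by `z` is so if it is on generators. -/
theorem intertwine_of_gen {z : DD n} (φ : Mid n →ₐ[KK] Mid n)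
    (h : ∀ t, z * mid n (PowerSeries.C (MvPolynomial.X t)) =
      mid n (φ (PowerSeries.C (MvPolynomial.X t))) * z) (g : Mid n) :
    z * mid n g = mid n (φ g) * z := by
  have hp : ∀ p : MvPolynomial (Fin n × Bool) Qe,
      z * mid n (PowerSeries.C p) = mid n (φ (PowerSeries.C p)) * z := by
    intro p
    induction p using MvPolynomial.induction_on with
    | C c =>
      have : (PowerSeries.C (MvPolynomial.C c) : Mid n) = algebraMap KK _ (PowerSeries.C c) := by
        rw [algebraMap_PS, PowerSeries.map_C]
      rw [this, AlgHom.commutes, AlgHom.commutes, AlgHom.commutes, Algebra.commutes]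
    | add p p' hp hp' => simp only [map_add, mul_add, add_mul, hp, hp']
    | mul_X p t hp =>
      simp only [map_mul]
      rw [← mul_assoc, hp, mul_assoc, h, ← mul_assoc]
  have : (LinearMap.mulLeft KK z).comp (mid n).toLinearMap =
      (LinearMap.mulRight KK z).comp ((mid n).toLinearMap.comp φ.toLinearMap) :=
    ps_ext fun d => hp _
  exact DFunLike.congr_fun this g

theorem intertwine_of_gen' {z : DD n} (φ : Mid n →ₐ[KK] Mid n)
    (h : ∀ t, mid n (PowerSeries.C (MvPolynomial.X t)) * z =
      z * mid n (φ (PowerSeries.C (MvPolynomial.X t)))) (g : Mid n) :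
    mid n g * z = z * mid n (φ g) := by
  have hp : ∀ p : MvPolynomial (Fin n × Bool) Qe,
      mid n (PowerSeries.C p) * z = z * mid n (φ (PowerSeries.C p)) := by
    intro p
    induction p using MvPolynomial.induction_on with
    | C c =>
      have : (PowerSeries.C (MvPolynomial.C c) : Mid n) = algebraMap KK _ (PowerSeries.C c) := by
        rw [algebraMap_PS, PowerSeries.map_C]
      rw [this, AlgHom.commutes, AlgHom.commutes, AlgHom.commutes, Algebra.commutes]
    | add p p' hp hp' => simp only [map_add, mul_add, add_mul, hp, hp']
    | mul_X p t hp =>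
      simp only [map_mul]
      rw [mul_assoc, h, ← mul_assoc, hp, ← mul_assoc]
  have : (LinearMap.mulRight KK z).comp (mid n).toLinearMap =
      (LinearMap.mulLeft KK z).comp ((mid n).toLinearMap.comp φ.toLinearMap) :=
    ps_ext fun d => hp _
  exact DFunLike.congr_fun this g

theorem shM_C (i : Fin n) (p : MvPolynomial (Fin n × Bool) Qe) :
    shM i (PowerSeries.C p) = PowerSeries.C (shP (i, false) (i, true) p) := psMap_C _ _

theorem mid_comm_aux (i : Fin n) (t : Fin n × Bool) : mid n (shM i (PowerSeries.C (MvPolynomial.X t)))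
    = if t.1 = i then (if t.2 then dz i Gen.a - 1 else dz i Gen.b - algebraMap KK _ ke) else
      dz t.1 (midGen t.2) := by
  obtain ⟨j, c⟩ := t
  rw [shM_C]
  by_cases h : j = i
  · subst h
    cases c
    · rw [shP_b]
      simp [mid_b, mid_C]
    · rw [shP_a (by simp)]
      simp [mid_a]
  · rw [shP_of_ne (by simp [h]) (by simp [h])]
    cases c
    · simp [h, mid_b, midGen]
    · simp [h, mid_a, midGen]

theorem mid_X (t : Fin n × Bool) :
    mid n (PowerSeries.C (MvPolynomial.X t)) = dz t.1 (midGen t.2) := by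
  obtain ⟨j, c⟩ := t
  cases c
  · exact mid_b j
  · exact mid_a j

/-- Conjugation past `x` is the substitution `b ↦ b - ε`, `a ↦ a - 1`. It is multiplicative, so the
generators suffice. -/
theorem x_mul_mid (i : Fin n) (g : Mid n) :
    dz i Gen.x * mid n g = mid n (shM i g) * dz i Gen.x := by
  refine intertwine_of_gen (shM i) (fun t => ?_) g
  rw [mid_comm_aux, mid_X]
  obtain ⟨j, c⟩ := t
  by_cases h : j = i
  · subst h
    cases c
    · simpa [midGen] using dz_bx j
    · simpa [midGen] using dz_ax j
  · simpa [h] using (dz_comm (Ne.symm h) _ _).eq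

theorem mid_mul_y (i : Fin n) (g : Mid n) :
    mid n g * dz i Gen.y = dz i Gen.y * mid n (shM i g) := by
  refine intertwine_of_gen' (shM i) (fun t => ?_) g
  rw [mid_comm_aux, mid_X]
  obtain ⟨j, c⟩ := t
  by_cases h : j = i
  · subst h
    cases c
    · simpa [midGen] using dz_by j
    · simpa [midGen] using dz_ay j
  · simpa [h] using (dz_comm h _ _).eq

end mid

/-! ### Surjectivity of the ordering map -/
section surj
variable {n : ℕ}

/-- The exponent `p ε - ε a_i - b_i` of `q^p A_i B_i`. -/
def wM (i : Fin n) (p : ℕ) : MvPolynomial (Fin n × Bool) Qe := p • me - me * ma i - mb i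

theorem shP_wM (i : Fin n) (p : ℕ) : shP (i, false) (i, true) (wM i p) = wM i (p + 2) := by
  rw [wM, map_sub, map_sub, map_nsmul, map_mul, shP_C, shP_a (by simp), shP_b, wM]
  simp only [nsmul_eq_mul]
  push_cast
  ring

theorem shM_hq (i : Fin n) (p : ℕ) : shM i (hq (wM i p)) = hq (wM i (p + 2)) := by
  rw [shM, sh, psMap_hq, shP_wM]

theorem shM_hq_of_ne {i j : Fin n} (h : j ≠ i) (p : ℕ) : shM i (hq (wM j p)) = hq (wM j p) := by
  rw [shM, sh, psMap_hq]
  congr 1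
  rw [wM, map_sub, map_sub, map_nsmul, map_mul, shP_C, shP_of_ne, shP_of_ne] <;> simp [h]

/-- `A` and `B` are exponentials in the commutative subalgebra, and division by `ħ` only shifts
coefficients, so the two series agree coefficient by coefficient. -/
theorem mkD_divH (i : Fin n) :
    mkD n (divH (1 - fA i 1 * fB i 1)) = mid n (hq (wM i 0)) := by
  have key : ∀ k, mkD n (PowerSeries.C (PowerSeries.coeff k (fA i 1 * fB i 1))) =
      mid n (PowerSeries.C (PowerSeries.coeff k (expH (wM i 0)))) := by
    intro k
    have e : wM i 0 = -(me * ma i) + -mb i := by simp [wM]; ring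
    rw [e, expH_add, PowerSeries.coeff_mul, PowerSeries.coeff_mul]
    simp only [map_sum, map_mul]
    refine sum_congr rfl fun p _ => ?_
    have hs : ∀ (c : ℚ) (w : NC n), mkD n (PowerSeries.C (c • w)) =
        (PowerSeries.C (Polynomial.C c) : KK) • mkD n (PowerSeries.C w) := fun c w => by
      rw [mkD_C, liftNC_smul_rat, mkD_C]
    have hm : ∀ (c : ℚ) (w : MvPolynomial (Fin n × Bool) Qe), mid n (PowerSeries.C (c • w)) =
        (PowerSeries.C (Polynomial.C c) : KK) • mid n (PowerSeries.C w) := fun c w => by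
      rw [Algebra.smul_def, map_mul, map_mul, Algebra.smul_def, ← mid_C]
      rfl
    congr 1
    · rw [fA, expH, expH, PowerSeries.coeff_mk, PowerSeries.coeff_mk, hs, hm]
      simp only [map_pow, map_neg, map_mul, mid_a, mid_C, one_smul]
      rw [mkD_C, liftNC_smul_Qe, liftNC_nc, Algebra.smul_def (PowerSeries.C eps : KK)]
    · rw [fB, expH, expH, PowerSeries.coeff_mk, PowerSeries.coeff_mk, hs, hm]
      simp only [map_pow, map_neg, mid_b, one_smul]
      rfl
  rw [mkD_eq_hsum]
  conv_rhs => rw [← hsum_C_ps (hq (wM i 0))]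
  rw [← AlgHom.toLinearMap_apply, map_hsum]
  congr 1; funext k
  rw [AlgHom.toLinearMap_apply, hq, divH, divH, PowerSeries.coeff_mk, PowerSeries.coeff_mk,
    map_sub, map_sub, map_sub, map_sub, map_sub, map_sub, key, PowerSeries.coeff_one,
    PowerSeries.coeff_one]
  simp

theorem x_mul_y (i : Fin n) : dz i Gen.x * dz i Gen.y =
    q • (dz i Gen.y * dz i Gen.x) + mid n (hq (wM i 0)) := by rw [dz_xy, mkD_divH]

theorem hq_wM (i : Fin n) (p : ℕ) :
    PowerSeries.X * hq (wM i p) = 1 - algebraMap KK (Mid n) q ^ p * expH (wM i 0) := by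
  rw [X_mul_hq, algebraMap_q, expH_pow, ← expH_add]
  congr 2
  simp [wM]; ring

/-- After multiplication by `ħ` both sides are affine in `A B`, and the two coefficients are the two
recursions for `[k + 2]`. -/
theorem hq_wM_rec (i : Fin n) (k : ℕ) : (qInt (k + 2) • hq (wM i (k + 1)) : Mid n) =
    q ^ (k + 1) • hq (wM i 0) + qInt (k + 1) • hq (wM i (k + 2)) := by
  apply mul_left_cancel₀ (PowerSeries.X_ne_zero (R := MvPolynomial (Fin n × Bool) Qe))
  have h0 := hq_wM i 0
  have h1 := hq_wM i (k + 1)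
  have h2 := hq_wM i (k + 2)
  rw [mul_add, mul_smul_comm, mul_smul_comm, mul_smul_comm, h0, h1, h2]
  have e7 := congrArg (algebraMap KK (Mid n)) (qInt_succ (k + 1))
  have e8 := congrArg (algebraMap KK (Mid n)) (qInt_succ' (k + 1))
  rw [map_add, map_mul, map_one] at e8
  rw [map_add, map_pow] at e7
  simp only [Algebra.smul_def, map_pow]
  generalize algebraMap KK (Mid n) (qInt (k + 1 + 1)) = Q2 at *
  generalize algebraMap KK (Mid n) (qInt (k + 1)) = Q1 at *
  generalize algebraMap KK (Mid n) q = q' at *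
  linear_combination e7 - q' ^ (k + 1) * expH (wM i 0) * e8

/-- Appending another `y` produces a new contraction `(1 - A B)/ħ`, and shifts the old one by `q^2`
as it passes `y`. The recursion `hq_wM_rec` combines the two. -/
theorem x_mul_y_pow (i : Fin n) (k : ℕ) : dz i Gen.x * dz i Gen.y ^ (k + 1) =
    q ^ (k + 1) • (dz i Gen.y ^ (k + 1) * dz i Gen.x) +
      qInt (k + 1) • (dz i Gen.y ^ k * mid n (hq (wM i k))) := by
  induction k with
  | zero => simpa [qInt] using x_mul_y i
  | succ k ih =>
    rw [pow_succ, ← mul_assoc, ih, add_mul, smul_mul_assoc, smul_mul_assoc, mul_assoc, x_mul_y,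
      mul_assoc, mid_mul_y, shM_hq, mul_add, smul_add, mul_smul_comm, smul_smul, ← pow_succ]
    rw [← mul_assoc, ← mul_assoc, ← pow_succ, ← pow_succ, add_assoc]
    congr 1
    simp only [← mul_smul_comm, ← mul_add, ← map_smul, ← map_add]
    rw [hq_wM_rec]

theorem x_pow_mul_mid (i : Fin n) (m : ℕ) (g : Mid n) :
    dz i Gen.x ^ m * mid n g = mid n ((shM i)^[m] g) * dz i Gen.x ^ m := by
  induction m generalizing g with
  | zero => simp
  | succ m ih =>
    rw [pow_succ, mul_assoc, x_mul_mid, ← mul_assoc, ih, mul_assoc, ← pow_succ,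
      Function.iterate_succ_apply]

theorem mid_mul_y_pow (i : Fin n) (m : ℕ) (g : Mid n) :
    mid n g * dz i Gen.y ^ m = dz i Gen.y ^ m * mid n ((shM i)^[m] g) := by
  induction m generalizing g with
  | zero => simp
  | succ m ih =>
    rw [pow_succ', ← mul_assoc, mid_mul_y, mul_assoc, ih, ← mul_assoc,
      Function.iterate_succ_apply]

theorem list_prod_update (g : Gen) (i : Fin n) (K : Fin n → ℕ) (m : ℕ) :
    dz i g ^ m * ((List.finRange n).map fun j => dz j g ^ K j).prod =
      ((List.finRange n).map fun j => dz j g ^ (Function.update K i (K i + m)) j).prod := by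
  have h1 : dz i g ^ m = ((List.finRange n).map fun j => if j = i then dz i g ^ m else 1).prod := by
    rw [list_prod_map_eq_of_forall_ne _ (List.nodup_finRange n) _ (List.mem_finRange i)]
    · simp
    · intro j hj; simp [hj]
  rw [h1, ← list_prod_map_mul _ (List.nodup_finRange n)]
  · congr 2
    funext j
    by_cases hj : j = i
    · subst hj; simp [← pow_add, add_comm]
    · simp [hj]
  · intro j k hjk
    split_ifs with h
    · exact (dz_comm (by rw [← h]; exact hjk) g g).pow_pow _ _
    · exact Commute.one_right _

theorem y_pow_mul_yy (i : Fin n) (K : Fin n → ℕ) (m : ℕ) :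
    dz i Gen.y ^ m * yy K = yy (Function.update K i (K i + m)) := list_prod_update Gen.y i K m

theorem x_pow_mul_xx (i : Fin n) (N : Fin n → ℕ) (m : ℕ) :
    dz i Gen.x ^ m * xx N = xx (Function.update N i (N i + m)) := list_prod_update Gen.x i N m

theorem commute_yy {z : DD n} {K : Fin n → ℕ} (h : ∀ j, K j ≠ 0 → Commute z (dz j Gen.y)) :
    Commute z (yy K) := by
  refine Commute.list_prod_right _ _ fun x hx => ?_
  obtain ⟨j, _, rfl⟩ := List.mem_map.1 hx
  by_cases hj : K j = 0
  · rw [hj, pow_zero]; exact Commute.one_right _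
  · exact (h j hj).pow_right _

theorem yy_eq (i : Fin n) (K : Fin n → ℕ) :
    yy K = dz i Gen.y ^ K i * yy (Function.update K i 0) := by
  rw [y_pow_mul_yy]; simp

theorem mid_mul_yy (K : Fin n → ℕ) (g : Mid n) : ∃ g', mid n g * yy K = yy K * mid n g' := by
  unfold yy
  induction List.finRange n generalizing g with
  | nil => exact ⟨g, by simp⟩
  | cons i l ih =>
    obtain ⟨g', hg'⟩ := ih ((shM i)^[K i] g)
    refine ⟨g', ?_⟩
    rw [List.map_cons, List.prod_cons, ← mul_assoc, mid_mul_y_pow, mul_assoc, hg', mul_assoc]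

/-- The triples `y^K g(a, b) x^N` lie in the range of the ordering map. -/
theorem mem_range_OOl (K : Fin n → ℕ) (g : Mid n) (N : Fin n → ℕ) :
    yy K * mid n g * xx N ∈ LinearMap.range (OOl n) := ⟨_, OO_mul K g N⟩

/-- Every series is an `ħ`-adic sum of polynomials, hence of triples `y^K g x^N`, and left
multiplication commutes with such sums. -/
theorem mul_mem_range_aux (z : DD n)
    (h : ∀ K g N, z * (yy K * mid n g * xx N) ∈ LinearMap.range (OOl n)) :
    ∀ w ∈ LinearMap.range (OOl n), z * w ∈ LinearMap.range (OOl n) := by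
  have hp : ∀ p : LatPoly n, z * OOl n (PowerSeries.C p) ∈ LinearMap.range (OOl n) := by
    intro p
    induction p using MvPolynomial.induction_on' with
    | monomial d c =>
      have h1 : (PowerSeries.C (MvPolynomial.monomial d c) : LatSeries n)
          = (PowerSeries.C c : KK) • PowerSeries.C (MvPolynomial.monomial d 1) := by
        rw [Algebra.smul_def, algebraMap_PS, PowerSeries.map_C, ← map_mul,
          MvPolynomial.C_mul_monomial, mul_one]
      have h2 : d = joinExp (fun i => d (i, Gen.y)) (Finsupp.equivFunOnFinite.symm fun p =>
          d (p.1, midGen p.2)) (fun i => d (i, Gen.x)) := by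
        ext ⟨i, g⟩
        cases g <;> simp [joinExp, midGen]
      rw [h1, map_smul, mul_smul_comm, OOl_apply, h2, OO_joinExp, ← mid_monomial]
      exact Submodule.smul_mem _ _ (h _ _ _)
    | add p p' hp hp' => rw [map_add, map_add, mul_add]; exact Submodule.add_mem _ hp hp'
  rintro _ ⟨f, rfl⟩
  choose g hg using fun k => hp (PowerSeries.coeff k f)
  refine ⟨hsum g, ?_⟩
  rw [map_hsum]
  conv_rhs => rw [← hsum_C_ps f, map_hsum, ← LinearMap.mulLeft_apply (R := KK), map_hsum]
  simp only [hg, LinearMap.mulLeft_apply]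

/-- Only `x` is not obvious: it moves through `y_i^{K_i}` by `x_mul_y_pow`, giving two triples, and
commutes with the other `y_j`. -/
theorem dz_mul_mem_range (i : Fin n) (g : Gen) :
    ∀ w ∈ LinearMap.range (OOl n), dz i g * w ∈ LinearMap.range (OOl n) := by
  refine mul_mem_range_aux _ fun K m N => ?_
  have hmid : ∀ c, mid n c * (yy K * mid n m * xx N) ∈ LinearMap.range (OOl n) := by
    intro c
    obtain ⟨c', hc'⟩ := mid_mul_yy K c
    rw [← mul_assoc, ← mul_assoc, hc', mul_assoc (yy K), ← map_mul]
    exact mem_range_OOl _ _ _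
  cases g with
  | y =>
    rw [← mul_assoc, ← mul_assoc, ← pow_one (dz i Gen.y), y_pow_mul_yy]
    exact mem_range_OOl _ _ _
  | b => rw [← mid_b]; exact hmid _
  | a => rw [← mid_a]; exact hmid _
  | x =>
    -- The powers of the other `y_j`, with which `x_i` and the contraction in `a_i`, `b_i` commute.
    set K0 := Function.update K i 0 with hK0
    have hx : Commute (dz i Gen.x) (yy K0) := commute_yy fun j hj => dz_comm (by
      rintro rfl; simp [K0] at hj) _ _
    have hxN : ∀ K g, yy K * mid n g * (dz i Gen.x * xx N) ∈ LinearMap.range (OOl n) := by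
      intro K g
      rw [← pow_one (dz i Gen.x), x_pow_mul_xx]
      exact mem_range_OOl _ _ _
    have hfin : ∀ k, dz i Gen.y ^ k * yy K0 * dz i Gen.x * (mid n m * xx N) ∈
        LinearMap.range (OOl n) := by
      intro k
      rw [y_pow_mul_yy, mul_assoc, ← mul_assoc (dz i Gen.x), x_mul_mid, mul_assoc (mid n _),
        ← mul_assoc]
      exact hxN _ _
    rw [yy_eq i K, ← hK0]
    rcases Nat.eq_zero_or_pos (K i) with h0 | h0
    · rw [h0]
      have := hfin 0
      rw [pow_zero, one_mul] at this ⊢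
      rwa [mul_assoc (yy K0), ← mul_assoc, hx.eq]
    · obtain ⟨k, hk⟩ := Nat.exists_eq_succ_of_ne_zero h0.ne'
      have hh : Commute (mid n (hq (wM i k))) (yy K0) := commute_yy fun j hj => by
        have hji : i ≠ j := by rintro rfl; simp [K0] at hj
        have := mid_mul_y j (hq (wM i k))
        rw [shM_hq_of_ne hji] at this
        exact this
      have e : dz i Gen.x * (dz i Gen.y ^ K i * yy K0 * mid n m * xx N) =
          q ^ (k + 1) • (dz i Gen.y ^ (k + 1) * yy K0 * dz i Gen.x * (mid n m * xx N)) +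
          qInt (k + 1) • (dz i Gen.y ^ k * yy K0 * mid n (hq (wM i k) * m) * xx N) := by
        rw [hk, Nat.succ_eq_add_one]
        simp only [← mul_assoc]
        rw [x_mul_y_pow, map_mul]
        simp only [add_mul, smul_mul_assoc, mul_assoc]
        rw [← mul_assoc (dz i Gen.x) (yy K0), hx.eq, ← mul_assoc (mid n (hq (wM i k))) (yy K0),
          hh.eq]
        simp only [mul_assoc]
      rw [e]
      refine Submodule.add_mem _ (Submodule.smul_mem _ _ (hfin _)) (Submodule.smul_mem _ _ ?_)
      rw [y_pow_mul_yy]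
      exact mem_range_OOl _ _ _

/-- The range contains `1` and is stable under left multiplication by generators, hence contains all
non-commutative polynomials. Completeness of the source extends this to all `ħ`-adic sums. -/
theorem OO_surjective (n : ℕ) : Function.Surjective (OO n) := by
  have h1 : ∀ w : NC n, mkD n (PowerSeries.C w) ∈ LinearMap.range (OOl n) := by
    have hmul : ∀ (w : NC n), ∀ z ∈ LinearMap.range (OOl n), mkD n (PowerSeries.C w) * z ∈
        LinearMap.range (OOl n) := by
      intro w
      induction w using FreeAlgebra.induction with
      | grade0 r =>
        intro z hz
        rw [mkD_C, liftNC_algebraMap, ← Algebra.smul_def]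
        exact Submodule.smul_mem _ _ hz
      | grade1 x => exact dz_mul_mem_range x.1 x.2
      | mul a b ha hb =>
        intro z hz
        rw [map_mul, map_mul, mul_assoc]
        exact ha _ (hb _ hz)
      | add a b ha hb =>
        intro z hz
        rw [map_add, map_add, add_mul]
        exact Submodule.add_mem _ (ha _ hz) (hb _ hz)
    intro w
    have := hmul w 1 ⟨_, by
      have := OO_mul (n := n) 0 1 0
      rw [yy_zero, xx_zero, map_one (mid n), mul_one, mul_one] at this
      exact this⟩
    rwa [mul_one] at this
  intro z
  obtain ⟨f, rfl⟩ := mkD_surjective n z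
  choose g hg using fun k => h1 (PowerSeries.coeff k f)
  refine ⟨hsum g, ?_⟩
  rw [← OOl_apply, map_hsum, mkD_eq_hsum]
  simp only [hg]

theorem OO_bijective (n : ℕ) : Function.Bijective (OO n) := ⟨OO_injective n, OO_surjective n⟩

/-- The ordering map as a linear equivalence. -/
def OOe (n : ℕ) : LatSeries n ≃ₗ[KK] DD n := LinearEquiv.ofBijective (OOl n) (OO_bijective n)

@[simp] theorem OOe_apply (f : LatSeries n) : OOe n f = OO n f := rfl

/-- Freedom from torsion is read off from the series side of the PBW isomorphism. It permits
checking the relation for `x y` with `ħ` multiplied through. -/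
theorem DD_smul_hb_inj {z z' : DD n} (h : hb • z = hb • z') : z = z' := by
  obtain ⟨f, rfl⟩ := (OOe n).surjective z
  obtain ⟨f', rfl⟩ := (OOe n).surjective z'
  rw [← map_smul, ← map_smul] at h
  have := (OOe n).injective h
  rw [X_pow_smul_PS, X_pow_smul_PS] at this
  rw [mul_left_cancel₀ PowerSeries.X_ne_zero this]

end surj

/-! ### The Hopf algebra operations -/

instance {E : Type} [Ring E] [Algebra KK E] [HComp E] : HComp Eᵐᵒᵖ where
  sep x h := by
    have : x.unop = 0 := HComp.sep _ fun N => by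
      obtain ⟨y, hy⟩ := h N
      exact ⟨y.unop, by rw [hy]; rfl⟩
    exact MulOpposite.unop_injective this
  comp f := by
    refine ⟨MulOpposite.op (hsum fun k => (f k).unop), fun N => ?_⟩
    obtain ⟨z, hz⟩ := hsum_spec (fun k => (f k).unop) N
    refine ⟨MulOpposite.op z, ?_⟩
    have := congrArg (MulOpposite.opLinearEquiv KK : E ≃ₗ[KK] Eᵐᵒᵖ) hz
    rw [map_add, map_smul, map_sum] at this
    simpa using this

theorem hexp_op {E : Type} [Ring E] [Algebra KK E] [HComp E] (u : E) :
    hexp (MulOpposite.op u) = MulOpposite.op (hexp u) := by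
  rw [hexp, hexp]
  refine Eq.trans ?_ (map_hsum (MulOpposite.opLinearEquiv KK : E ≃ₗ[KK] Eᵐᵒᵖ).toLinearMap _).symm
  congr 1; funext k
  rw [LinearEquiv.coe_coe, MulOpposite.coe_opLinearEquiv, MulOpposite.op_mul, MulOpposite.op_pow,
    Algebra.commutes]
  rfl

/-- A criterion for the relations of `𝔻` to hold in a torsion-free algebra. -/
theorem liftFree_rel {E : Type} [Ring E] [Algebra KK E] [HComp E]
    (htf : ∀ z z' : E, hb • z = hb • z' → z = z') (v : Fin 1 × Gen → E)
    (hxy : hb • (v (0, .x) * v (0, .y) - q • (v (0, .y) * v (0, .x))) =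
      1 - hexp (-(ke • v (0, .a))) * hexp (-v (0, .b)))
    (hax : v (0, .a) * v (0, .x) - v (0, .x) * v (0, .a) = v (0, .x))
    (hbx : v (0, .b) * v (0, .x) - v (0, .x) * v (0, .b) = ke • v (0, .x))
    (hay : v (0, .a) * v (0, .y) - v (0, .y) * v (0, .a) = -v (0, .y))
    (hby : v (0, .b) * v (0, .y) - v (0, .y) * v (0, .b) = -(ke • v (0, .y)))
    (hab : v (0, .a) * v (0, .b) = v (0, .b) * v (0, .a)) :
    ∀ f, Rel 1 f → liftFree v f = 0 := by
  intro f hf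
  cases hf with
  | xy i =>
    obtain rfl : i = 0 := Subsingleton.elim _ _
    rw [map_sub, map_add, ← sub_sub, sub_eq_zero]
    refine htf _ _ ?_
    rw [hb_smul_liftFree_divH, ← hxy]
    simp only [map_mul, liftFree_fz, liftFree_scal, Algebra.smul_def, mul_assoc]
  | ax i =>
    obtain rfl : i = 0 := Subsingleton.elim _ _
    simp only [map_sub, map_mul, liftFree_fz]
    rw [hax, sub_self]
  | bx i =>
    obtain rfl : i = 0 := Subsingleton.elim _ _
    simp only [map_sub, map_mul, liftFree_fz, liftFree_scal, ← Algebra.smul_def]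
    rw [hbx, sub_self]
  | ay i =>
    obtain rfl : i = 0 := Subsingleton.elim _ _
    simp only [map_sub, map_add, map_mul, liftFree_fz]
    rw [hay, neg_add_cancel]
  | byy i =>
    obtain rfl : i = 0 := Subsingleton.elim _ _
    simp only [map_sub, map_add, map_mul, liftFree_fz, liftFree_scal, ← Algebra.smul_def]
    rw [hby, neg_add_cancel]
  | ab i =>
    obtain rfl : i = 0 := Subsingleton.elim _ _
    simp only [map_sub, map_mul, liftFree_fz]
    rw [hab, sub_self]
  | comm i j g h hij => exact absurd (Subsingleton.elim i j) hij

section ops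
variable {n : ℕ}

theorem mid_sub_x (i : Fin n) (p : MvPolynomial (Fin n × Bool) Qe) :
    mid n (PowerSeries.C p) * dz i Gen.x - dz i Gen.x * mid n (PowerSeries.C p) =
      mid n (PowerSeries.C (p - shP (i, false) (i, true) p)) * dz i Gen.x := by
  rw [x_mul_mid, shM_C, map_sub, map_sub, sub_mul]

theorem mid_sub_y (i : Fin n) (p : MvPolynomial (Fin n × Bool) Qe) :
    mid n (PowerSeries.C p) * dz i Gen.y - dz i Gen.y * mid n (PowerSeries.C p) =
      dz i Gen.y * mid n (PowerSeries.C (shP (i, false) (i, true) p - p)) := by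
  rw [mid_mul_y, shM_C, map_sub, map_sub, mul_sub]

theorem mid_commute (g g' : Mid n) : mid n g * mid n g' = mid n g' * mid n g := by
  rw [← map_mul, ← map_mul, mul_comm]

theorem hb_smul_mid_hq (p : MvPolynomial (Fin n × Bool) Qe) :
    hb • mid n (hq p) = 1 - mid n (expH p) := by
  rw [← map_smul, X_pow_smul_PS, X_mul_hq, map_sub, map_one]

theorem hexp_neg_dz_a (i : Fin n) : hexp (-(ke • dz i Gen.a)) = mid n (expH (-(me * ma i))) := by
  rw [mid_expH, map_neg, map_neg, map_mul, map_mul, mid_a, mid_C, Algebra.smul_def]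

theorem hexp_neg_dz_b (i : Fin n) : hexp (-dz i Gen.b) = mid n (expH (-mb i)) := by
  rw [mid_expH, map_neg, map_neg, mid_b]

/-- The inclusion of a tensor factor. -/
def placeD (i : Fin n) : DD 1 →ₐ[KK] DD n :=
  liftD (fun p => dz i p.2) (liftFree_rel (fun _ _ => DD_smul_hb_inj) _
    (by
      dsimp only
      rw [x_mul_y, add_sub_cancel_left, hb_smul_mid_hq, hexp_neg_dz_a, hexp_neg_dz_b, ← map_mul,
        ← expH_add]
      congr 3
      simp [wM]; ring)
    (by
      dsimp only
      rw [← mid_a, mid_sub_x, shP_a (by simp)]; simp)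
    (by
      dsimp only
      rw [← mid_b, mid_sub_x, shP_b, Algebra.smul_def, ← mid_C]; simp)
    (by
      dsimp only
      rw [← mid_a, mid_sub_y, shP_a (by simp)]; simp)
    (by
      dsimp only
      rw [← mid_b, mid_sub_y, shP_b, Algebra.smul_def, ← mid_C, mid_C, Algebra.commutes, ← mid_C]
      simp)
    (dz_ab i).eq)

theorem placeD_mkD (i : Fin n) (u : Free 1) : placeD i (mkD 1 u) = mkD n (place i u) := by
  rw [placeD, liftD_mkD, liftFree_apply, mkD_eq_hsum]
  congr 1; funext k
  rw [mkD_C, place, PowerSeries.coeff_map]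
  generalize PowerSeries.coeff k u = w
  induction w using FreeAlgebra.induction with
  | grade0 r =>
    rw [liftNC_algebraMap]
    refine (liftNC_algebraMap (fun p : Fin n × Gen => dz p.1 p.2) r).symm.trans (congrArg _ ?_)
    exact ((FreeAlgebra.lift Qe fun p : Fin 1 × Gen => nc i p.2).commutes r).symm
  | grade1 x =>
    refine (liftNC_nc (fun p : Fin 1 × Gen => dz i p.2) x.1 x.2).trans ?_
    refine (liftNC_nc (fun p : Fin n × Gen => dz p.1 p.2) i x.2).symm.trans (congrArg _ ?_)
    exact (FreeAlgebra.lift_ι_apply (fun p : Fin 1 × Gen => nc i p.2) x).symm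
  | mul a b ha hb => rw [map_mul, map_mul, map_mul, ha, hb]
  | add a b ha hb => rw [map_add, map_add, map_add, ha, hb]

/-- The exponents of a product of monomials in two tensor factors. -/
def pairExp (d d' : (Fin 1 × Gen) →₀ ℕ) : (Fin 2 × Gen) →₀ ℕ :=
  Finsupp.equivFunOnFinite.symm fun p => if p.1 = 0 then d (0, p.2) else d' (0, p.2)

/-- The exponents of one tensor factor. -/
def facExp (i : Fin n) (d : (Fin n × Gen) →₀ ℕ) : (Fin 1 × Gen) →₀ ℕ :=
  Finsupp.equivFunOnFinite.symm fun p => d (i, p.2)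

/-- An ordered monomial in `𝔻^{⊗ n}`. -/
def dMon (d : (Fin n × Gen) →₀ ℕ) : DD n := OO n (PowerSeries.C (MvPolynomial.monomial d 1))

/-- The part of an ordered monomial in one tensor factor. -/
def dBlock (d : (Fin n × Gen) →₀ ℕ) (i : Fin n) : DD n :=
  dz i Gen.y ^ d (i, Gen.y) * dz i Gen.b ^ d (i, Gen.b)
      * dz i Gen.a ^ d (i, Gen.a) * dz i Gen.x ^ d (i, Gen.x)

theorem dMon_eq (d : (Fin n × Gen) →₀ ℕ) : dMon d = ((List.finRange n).map (dBlock d)).prod := by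
  rw [dMon, OO_monomial, mkD_C, ordMon_eq, map_list_prod, List.map_map]
  congr 2
  funext i
  simp [ordBlock, dBlock]

theorem dMon_one (d : (Fin 1 × Gen) →₀ ℕ) : dMon d = dBlock d 0 := by
  rw [dMon_eq, List.finRange_succ]; simp

theorem dMon_two (d : (Fin 2 × Gen) →₀ ℕ) : dMon d = dBlock d 0 * dBlock d 1 := by
  rw [dMon_eq]; simp [List.finRange_succ]

theorem placeD_dMon (d : (Fin n × Gen) →₀ ℕ) (i : Fin n) :
    placeD i (dMon (facExp i d)) = dBlock d i := by
  rw [dMon_one, dBlock, dBlock]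
  simp only [map_mul, map_pow, placeD, liftD_dz]
  simp [facExp]

/-- The linear map on `𝔻 ⊗ 𝔻` given by a bilinear map. -/
def tensorLift (β : DD 1 →ₗ[KK] DD 1 →ₗ[KK] DD 1) : DD 2 →ₗ[KK] DD 1 :=
  (psLift fun d => β (dMon (facExp 0 d)) (dMon (facExp 1 d))).comp (OOe 2).symm.toLinearMap

theorem tensorLift_dMon (β : DD 1 →ₗ[KK] DD 1 →ₗ[KK] DD 1) (d) :
    tensorLift β (dMon d) = β (dMon (facExp 0 d)) (dMon (facExp 1 d)) := by
  rw [tensorLift, LinearMap.comp_apply, dMon, ← OOe_apply]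
  simp only [LinearEquiv.coe_coe, LinearEquiv.symm_apply_apply]
  rw [psLift_C]

theorem facExp_pairExp_zero (d d') : facExp 0 (pairExp d d') = d := by
  ext ⟨i, g⟩
  obtain rfl : i = 0 := Subsingleton.elim _ _
  simp [facExp, pairExp]

theorem facExp_pairExp_one (d d') : facExp 1 (pairExp d d') = d' := by
  ext ⟨i, g⟩
  obtain rfl : i = 0 := Subsingleton.elim _ _
  simp [facExp, pairExp]

theorem dd_ext {M : Type} [AddCommGroup M] [Module KK M] [HComp M] {T T' : DD n →ₗ[KK] M}
    (h : ∀ d, T (dMon d) = T' (dMon d)) : T = T' := by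
  have : T.comp (OOl n) = T'.comp (OOl n) := ps_ext h
  ext z
  obtain ⟨f, rfl⟩ := OO_surjective n z
  exact DFunLike.congr_fun this f

/-- Both sides are bilinear, so ordered monomials suffice. For these, the product of the two placed
monomials is itself the ordered monomial with exponents `pairExp`, on which `tensorLift` is defined.
-/
theorem tensorLift_place (β : DD 1 →ₗ[KK] DD 1 →ₗ[KK] DD 1) (u w : Free 1) :
    tensorLift β (mkD 2 (place 0 u * place 1 w)) = β (mkD 1 u) (mkD 1 w) := by
  rw [map_mul, ← placeD_mkD, ← placeD_mkD]
  have : ((LinearMap.mul KK (DD 2)).compl₁₂ (placeD 0).toLinearMap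
      (placeD 1).toLinearMap).compr₂ (tensorLift β) = β := by
    refine LinearMap.ext fun U => dd_ext fun d' => ?_
    have h2 : (((LinearMap.mul KK (DD 2)).compl₁₂ (placeD 0).toLinearMap
      (placeD 1).toLinearMap).compr₂ (tensorLift β)).flip (dMon d') = β.flip (dMon d') := by
      refine dd_ext fun d => ?_
      simp only [LinearMap.flip_apply, LinearMap.compr₂_apply, LinearMap.compl₁₂_apply,
        LinearMap.mul_apply', AlgHom.toLinearMap_apply]
      have e := tensorLift_dMon β (pairExp d d')
      rw [facExp_pairExp_zero, facExp_pairExp_one] at e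
      rw [← e, dMon_two, ← placeD_dMon, ← placeD_dMon, facExp_pairExp_zero, facExp_pairExp_one]
    exact DFunLike.congr_fun h2 U
  exact DFunLike.congr_fun (DFunLike.congr_fun this (mkD 1 u)) (mkD 1 w)

/-- Multiplication. -/
def mulD : DD 2 →ₗ[KK] DD 1 := tensorLift (LinearMap.mul KK (DD 1))

theorem isMul_mulD : IsMul mulD := tensorLift_place _

theorem mulD_dMon (d) : mulD (dMon d) = dMon (facExp 0 d) * dMon (facExp 1 d) :=
  tensorLift_dMon _ d

/-! #### The counit -/

/-- The counit. -/
def counitD : DD 1 →ₐ[KK] DD 0 :=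
  liftD (fun _ => 0) (liftFree_rel (fun _ _ => DD_smul_hb_inj) _
    (by
      have : hexp (0 : DD 0) = 1 := by
        have := mid_expH (n := 0) 0
        rw [expH_zero, map_one, map_zero, map_zero] at this
        exact this.symm
      simp [this])
    (by simp) (by simp) (by simp) (by simp) (by simp))

theorem isCounit_counitD : IsCounit counitD := fun _ => liftD_dz _ _ _ _

/-! #### Iterated shifts -/

/-- The substitution `b_i ↦ b_i - m ε`, `a_i ↦ a_i - m`. -/
def shPm (i : Fin n) (m : ℕ) :
    MvPolynomial (Fin n × Bool) Qe →ₐ[Qe] MvPolynomial (Fin n × Bool) Qe :=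
  MvPolynomial.aeval fun t => MvPolynomial.X t -
    if t = (i, false) then m • me else if t = (i, true) then m • 1 else 0

theorem shPm_b (i : Fin n) (m : ℕ) : shPm i m (mb i) = mb i - m • me := by
  simp [shPm, mb]

theorem shPm_a (i : Fin n) (m : ℕ) : shPm i m (ma i) = ma i - m • 1 := by
  simp [shPm, ma]

theorem shPm_b_of_ne {i j : Fin n} (h : j ≠ i) (m : ℕ) : shPm i m (mb j) = mb j := by
  simp [shPm, mb, h]

theorem shPm_a_of_ne {i j : Fin n} (h : j ≠ i) (m : ℕ) : shPm i m (ma j) = ma j := by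
  simp [shPm, ma, h]

theorem shPm_C (i : Fin n) (m : ℕ) (c : Qe) :
    shPm i m (MvPolynomial.C c) = MvPolynomial.C c := MvPolynomial.aeval_C _ _

/-- The `m`-fold shift in the `i`-th factor. -/
def shMm (i : Fin n) (m : ℕ) : Mid n →ₐ[KK] Mid n := psMap (shPm i m)

theorem shMm_C (i : Fin n) (m : ℕ) (p : MvPolynomial (Fin n × Bool) Qe) :
    shMm i m (PowerSeries.C p) = PowerSeries.C (shPm i m p) := psMap_C _ _

theorem shMm_expH (i : Fin n) (m : ℕ) (p : MvPolynomial (Fin n × Bool) Qe) :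
    shMm i m (expH p) = expH (shPm i m p) := psMap_expH _ _

theorem shP_comp_shPm (i : Fin n) (m : ℕ) (p : MvPolynomial (Fin n × Bool) Qe) :
    shPm i m (shP (i, false) (i, true) p) = shPm i (m + 1) p := by
  suffices (shPm i m).comp (shP (i, false) (i, true)) = shPm i (m + 1) from
    DFunLike.congr_fun this p
  refine MvPolynomial.algHom_ext fun ⟨j, c⟩ => ?_
  rw [AlgHom.comp_apply]
  by_cases h : j = i
  · subst h
    cases c
    · rw [shP_b, map_sub, shPm_C]
      change shPm j m (mb j) - me = shPm j (m + 1) (mb j)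
      rw [shPm_b, shPm_b, add_smul, one_smul]; ring
    · rw [shP_a (by simp), map_sub, map_one]
      change shPm j m (ma j) - 1 = shPm j (m + 1) (ma j)
      rw [shPm_a, shPm_a, add_smul, one_smul]; ring
  · rw [shP_of_ne (by simp [h]) (by simp [h])]
    simp [shPm, h]

theorem shM_iterate (i : Fin n) (m : ℕ) (g : Mid n) : (shM i)^[m] g = shMm i m g := by
  induction m generalizing g with
  | zero =>
    have : shPm i 0 = AlgHom.id Qe _ := MvPolynomial.algHom_ext fun t => by simp [shPm]
    ext k : 1
    rw [shMm, psMap_apply, PowerSeries.coeff_map, this]; rfl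
  | succ m ih =>
    rw [Function.iterate_succ_apply, ih]
    ext k : 1
    rw [shMm, shMm, shM, sh, psMap_apply, psMap_apply, psMap_apply, PowerSeries.coeff_map,
      PowerSeries.coeff_map, PowerSeries.coeff_map]
    exact shP_comp_shPm _ _ _

theorem x_pow_mid (i : Fin n) (m : ℕ) (g : Mid n) :
    dz i Gen.x ^ m * mid n g = mid n (shMm i m g) * dz i Gen.x ^ m := by
  rw [x_pow_mul_mid, shM_iterate]

theorem mid_y_pow (i : Fin n) (m : ℕ) (g : Mid n) :
    mid n g * dz i Gen.y ^ m = dz i Gen.y ^ m * mid n (shMm i m g) := by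
  rw [mid_mul_y_pow, shM_iterate]

theorem mid_x_comm (i : Fin n) (g : Mid n) :
    dz i Gen.x * mid n g = mid n (shMm i 1 g) * dz i Gen.x := by
  simpa using x_pow_mid i 1 g

theorem mid_y_comm (i : Fin n) (g : Mid n) :
    mid n g * dz i Gen.y = dz i Gen.y * mid n (shMm i 1 g) := by
  simpa using mid_y_pow i 1 g

theorem smul_mid_expH (p : MvPolynomial (Fin n × Bool) Qe) (c : Qe) :
    (expH c : KK) • mid n (expH p) = mid n (expH (MvPolynomial.C c + p)) := by
  rw [← map_smul, Algebra.smul_def, algebraMap_expH, ← expH_add]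

theorem dA_one (i : Fin n) : dA i 1 = mid n (expH (-(me * ma i))) := by
  rw [← mid_expH_a]; simp

theorem dB_one (i : Fin n) : dB i 1 = mid n (expH (-mb i)) := by
  rw [← mid_expH_b]; simp

theorem dA_neg_one (i : Fin n) : dA i (-1) = mid n (expH (me * ma i)) := by
  rw [← mid_expH_a]
  have : -(MvPolynomial.C (Polynomial.C (-1) * eps) * ma i) = me * ma i := by
    rw [me, map_neg, map_one, neg_one_mul, map_neg]; ring
  rw [this]

theorem dB_neg_one (i : Fin n) : dB i (-1) = mid n (expH (mb i)) := by
  rw [← mid_expH_b]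
  have : -(MvPolynomial.C (Polynomial.C (-1)) * mb i) = mb i := by
    rw [map_neg, map_one, map_neg, map_one]; ring
  rw [this]

/-! #### The coproduct -/

/-- The images of the generators under the coproduct. -/
def comulGen : Fin 1 × Gen → DD 2
  | (_, .y) => dz 1 Gen.y + dz 0 Gen.y * mid 2 (expH (-mb 1))
  | (_, .b) => dz 0 Gen.b + dz 1 Gen.b
  | (_, .a) => dz 0 Gen.a + dz 1 Gen.a
  | (_, .x) => dz 1 Gen.x + mid 2 (expH (-(me * ma 1))) * dz 0 Gen.x

theorem comulGen_b : comulGen (0, .b) = mid 2 (PowerSeries.C (mb 0 + mb 1)) := by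
  rw [map_add, map_add, mid_b, mid_b]; rfl

theorem comulGen_a : comulGen (0, .a) = mid 2 (PowerSeries.C (ma 0 + ma 1)) := by
  rw [map_add, map_add, mid_a, mid_a]; rfl

theorem comulGen_x_mid (p : MvPolynomial (Fin 2 × Bool) Qe)
    (h : shPm 0 1 p = shPm 1 1 p) :
    comulGen (0, .x) * mid 2 (PowerSeries.C p) =
      mid 2 (PowerSeries.C (shPm 0 1 p)) * comulGen (0, .x) := by
  rw [comulGen, add_mul, mul_add, mid_x_comm, mul_assoc, mid_x_comm, shMm_C, shMm_C, h,
    ← mul_assoc, ← mul_assoc, mid_commute]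

theorem comulGen_mid_y (p : MvPolynomial (Fin 2 × Bool) Qe)
    (h : shPm 0 1 p = shPm 1 1 p) :
    mid 2 (PowerSeries.C p) * comulGen (0, .y) =
      comulGen (0, .y) * mid 2 (PowerSeries.C (shPm 0 1 p)) := by
  rw [comulGen, add_mul, mul_add, mid_y_comm, ← mul_assoc, mid_y_comm, shMm_C, shMm_C, h,
    mul_assoc, mul_assoc, mid_commute]

theorem shPm_add_b (i : Fin 2) : shPm i 1 (mb 0 + mb 1) = mb 0 + mb 1 - me := by
  fin_cases i
  · have := shPm_b (0 : Fin 2) 1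
    have h2 := shPm_b_of_ne (show (1 : Fin 2) ≠ 0 by decide) 1
    simp only [Fin.zero_eta, map_add, this, h2, one_smul]; ring
  · have := shPm_b (1 : Fin 2) 1
    have h2 := shPm_b_of_ne (show (0 : Fin 2) ≠ 1 by decide) 1
    simp only [Fin.mk_one, map_add, this, h2, one_smul]; ring

theorem shPm_add_a (i : Fin 2) : shPm i 1 (ma 0 + ma 1) = ma 0 + ma 1 - 1 := by
  fin_cases i
  · have := shPm_a (0 : Fin 2) 1
    have h2 := shPm_a_of_ne (show (1 : Fin 2) ≠ 0 by decide) 1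
    simp only [Fin.zero_eta, map_add, this, h2, one_smul]; ring
  · have := shPm_a (1 : Fin 2) 1
    have h2 := shPm_a_of_ne (show (0 : Fin 2) ≠ 1 by decide) 1
    simp only [Fin.mk_one, map_add, this, h2, one_smul]; ring

/-- The cross terms cancel because `x_1` and `y_0 B_1`, as well as `A_1 x_0` and `y_1`, commute up
to `q`. What remains telescopes after multiplication by `ħ`: `(1 - A_1 B_1) + A_1 B_1 (1 - A_0 B_0)
= 1 - A_0 A_1 B_0 B_1`. -/
theorem comulGen_xy : comulGen (0, .x) * comulGen (0, .y) - q • (comulGen (0, .y) *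
    comulGen (0, .x)) =
    mid 2 (hq (wM 1 0)) + mid 2 (expH (wM 1 0)) * mid 2 (hq (wM 0 0)) := by
  have h01 : (0 : Fin 2) ≠ 1 := by decide
  have h10 : (1 : Fin 2) ≠ 0 := by decide
  have hq2 : q • mid 2 (expH (-mb 1)) = mid 2 (expH (-(mb 1 - me))) := by
    rw [q_eq, smul_mid_expH]; congr 2; ring
  have hq3 : q • mid 2 (expH (-(me * ma 1))) = mid 2 (expH (-(me * (ma 1 - 1)))) := by
    rw [q_eq, smul_mid_expH]; congr 2; rw [me]; ring
  have hw : mid 2 (expH (wM 1 0)) = mid 2 (expH (-(me * ma 1))) * mid 2 (expH (-mb 1)) := by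
    rw [← map_mul, ← expH_add]; congr 2; simp [wM]; ring
  have e1 : dz 1 Gen.x * (dz 0 Gen.y * mid 2 (expH (-mb 1))) =
      q • (dz 0 Gen.y * mid 2 (expH (-mb 1)) * dz 1 Gen.x) := by
    rw [← mul_assoc, (dz_comm h10 _ _).eq, mul_assoc, mid_x_comm, shMm_expH, map_neg, shPm_b,
      one_smul, ← hq2]
    simp only [smul_mul_assoc, mul_smul_comm, mul_assoc]
  have e2 : mid 2 (expH (-(me * ma 1))) * dz 0 Gen.x * dz 1 Gen.y =
      q • (dz 1 Gen.y * (mid 2 (expH (-(me * ma 1))) * dz 0 Gen.x)) := by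
    rw [mul_assoc, (dz_comm h01 _ _).eq, ← mul_assoc, mid_y_comm, shMm_expH, map_neg, map_mul,
      me, shPm_C, shPm_a, one_smul, ← me, ← hq3]
    simp only [smul_mul_assoc, mul_smul_comm, mul_assoc]
  have hb1 : mid 2 (expH (-mb 1)) * dz 0 Gen.x = dz 0 Gen.x * mid 2 (expH (-mb 1)) := by
    rw [mid_x_comm, shMm_expH, map_neg, shPm_b_of_ne h10]
  have ha1 : mid 2 (expH (-(me * ma 1))) * dz 0 Gen.y =
      dz 0 Gen.y * mid 2 (expH (-(me * ma 1))) := by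
    rw [mid_y_comm, shMm_expH, map_neg, map_mul, me, shPm_C, shPm_a_of_ne h10]
  have e3 : mid 2 (expH (-(me * ma 1))) * dz 0 Gen.x * (dz 0 Gen.y * mid 2 (expH (-mb 1))) =
      q • (dz 0 Gen.y * mid 2 (expH (-mb 1)) * (mid 2 (expH (-(me * ma 1))) * dz 0 Gen.x)) +
        mid 2 (expH (wM 1 0)) * mid 2 (hq (wM 0 0)) := by
    rw [mul_assoc, ← mul_assoc (dz 0 Gen.x), x_mul_y, add_mul, mul_add, hw,
      mid_commute (hq _), ← mul_assoc, ← mul_assoc, mul_smul_comm, smul_mul_assoc]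
    congr 2
    simp only [mul_assoc]
    rw [← hb1, ← mul_assoc, ha1, mul_assoc, ← mul_assoc (mid 2 _) (mid 2 _), mid_commute, mul_assoc]
  rw [comulGen, comulGen, add_mul, mul_add, mul_add, e1, e2, e3, x_mul_y, add_mul, mul_add,
    mul_add, smul_add, smul_add, smul_add]
  abel

/-- The coproduct. -/
def comulD : DD 1 →ₐ[KK] DD 2 :=
  liftD comulGen (liftFree_rel (fun _ _ => DD_smul_hb_inj) _
    (by
      rw [comulGen_xy, smul_add, ← mul_smul_comm, hb_smul_mid_hq, hb_smul_mid_hq, mul_sub, mul_one,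
        sub_add_sub_cancel, ← map_mul, ← expH_add, comulGen_a, comulGen_b]
      have h1 : hexp (-(ke • mid 2 (PowerSeries.C (ma 0 + ma 1)))) =
          mid 2 (expH (-(me * (ma 0 + ma 1)))) := by
        rw [mid_expH, map_neg, map_neg, map_mul, map_mul, me, mid_C, Algebra.smul_def]
      have h2 : hexp (-(mid 2 (PowerSeries.C (mb 0 + mb 1)))) = mid 2 (expH (-(mb 0 + mb 1))) := by
        rw [mid_expH, map_neg, map_neg]
      rw [h1, h2, ← map_mul, ← expH_add]
      congr 3
      simp only [wM, zero_smul]; ring)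
    (by
      rw [comulGen_a, comulGen_x_mid _ (by rw [shPm_add_a, shPm_add_a]), shPm_add_a, ← sub_mul,
        ← map_sub, ← map_sub]
      simp)
    (by
      rw [comulGen_b, comulGen_x_mid _ (by rw [shPm_add_b, shPm_add_b]), shPm_add_b, ← sub_mul,
        ← map_sub, ← map_sub, Algebra.smul_def, ke, ← mid_C]
      simp [me])
    (by
      rw [comulGen_a, comulGen_mid_y _ (by rw [shPm_add_a, shPm_add_a]), shPm_add_a, ← mul_sub,
        ← map_sub, ← map_sub]
      simp)
    (by
      rw [comulGen_b, comulGen_mid_y _ (by rw [shPm_add_b, shPm_add_b]), shPm_add_b, ← mul_sub,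
        ← map_sub, ← map_sub, Algebra.smul_def, Algebra.commutes, ke, ← mid_C]
      simp [me])
    (by rw [comulGen_a, comulGen_b, mid_commute]))

theorem comulD_dz (i : Fin 1) (g : Gen) : comulD (dz i g) = comulGen (i, g) := liftD_dz _ _ _ _

theorem isComul_comulD : IsComul comulD := by
  refine ⟨?_, ?_, ?_, ?_⟩ <;> rw [comulD_dz]
  · rw [dB_one]; rfl
  · rfl
  · rfl
  · rw [dA_one]; rfl

/-! #### The antipode -/

/-- The images of the generators under the antipode. -/
def antiGen : Fin 1 × Gen → DD 1
  | (_, .y) => -(dz 0 Gen.y * mid 1 (expH (mb 0)))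
  | (_, .b) => -dz 0 Gen.b
  | (_, .a) => -dz 0 Gen.a
  | (_, .x) => -(dz 0 Gen.x * mid 1 (expH (me * ma 0)))

/-- The order of the products is reversed, as the antipode maps to the opposite algebra. Multiplied
by `ħ`, the right side is `-(1 - A B)(A B)⁻¹ = 1 - (A B)⁻¹`, the image of `1 - A B`. -/
theorem antiGen_yx : antiGen (0, .y) * antiGen (0, .x) - q • (antiGen (0, .x) * antiGen (0, .y)) =
    -(mid 1 (hq (wM 0 0)) * mid 1 (expH (me * ma 0 + mb 0))) := by
  have ha : shPm (0 : Fin 1) 1 (me * ma 0) = -me + me * ma 0 := by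
    rw [map_mul, me, shPm_C, shPm_a, one_smul]; ring
  have hab : shPm (0 : Fin 1) 1 (me * ma 0 + mb 0) = -me + (-me + (me * ma 0 + mb 0)) := by
    rw [map_add, ha, shPm_b, one_smul]; ring
  have hqs : ∀ p, q • mid 1 (expH (-me + p)) = mid 1 (expH p) := fun p => by
    rw [q_eq, smul_mid_expH, ← me, add_neg_cancel_left]
  have e1 : dz (0 : Fin 1) Gen.x * mid 1 (expH (me * ma 0)) * (dz 0 Gen.y * mid 1 (expH (mb 0))) =
      dz 0 Gen.x * dz 0 Gen.y * mid 1 (expH (-me + (me * ma 0 + mb 0))) := by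
    rw [mul_assoc, ← mul_assoc (mid 1 _), mid_y_comm, mul_assoc (dz 0 Gen.y), ← map_mul, shMm_expH,
      ← expH_add, ha, ← mul_assoc, add_assoc]
  have e2 : dz (0 : Fin 1) Gen.y * mid 1 (expH (mb 0)) * (dz 0 Gen.x * mid 1 (expH (me * ma 0))) =
      dz 0 Gen.y * (mid 1 (expH (-me + (me * ma 0 + mb 0))) * dz 0 Gen.x) := by
    rw [mid_x_comm, mul_assoc, ← mul_assoc (mid 1 _) (mid 1 _), ← map_mul, shMm_expH,
      ← expH_add, ha, add_comm (mb 0), add_assoc]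
  have e3 := hqs (me * ma 0 + mb 0)
  have e4 : q • (dz 0 Gen.y * dz 0 Gen.x * mid 1 (expH (me * ma 0 + mb 0))) =
      dz 0 Gen.y * (mid 1 (expH (-me + (me * ma 0 + mb 0))) * dz 0 Gen.x) := by
    rw [mul_assoc, mid_x_comm, ← mul_smul_comm, ← smul_mul_assoc, shMm_expH, hab, hqs]
  rw [antiGen, antiGen, neg_mul_neg, neg_mul_neg, e1, e2, ← mul_smul_comm, e3, x_mul_y, add_mul,
    smul_mul_assoc, e4]
  abel

/-- The antipode as a homomorphism to the opposite algebra. -/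
def antiOp : DD 1 →ₐ[KK] (DD 1)ᵐᵒᵖ :=
  liftD (fun p => MulOpposite.op (antiGen p)) (liftFree_rel
    (fun _ _ h => MulOpposite.unop_injective (DD_smul_hb_inj (congrArg MulOpposite.unop h))) _
    (by
      apply MulOpposite.unop_injective
      simp only [← MulOpposite.op_mul, ← MulOpposite.op_smul, ← MulOpposite.op_sub,
        ← MulOpposite.op_neg, hexp_op]
      rw [antiGen_yx, ← MulOpposite.op_one, ← MulOpposite.op_sub,
        MulOpposite.unop_op, MulOpposite.unop_op, smul_neg, ← smul_mul_assoc, hb_smul_mid_hq,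
        sub_mul, one_mul, ← map_mul, ← expH_add]
      have h1 : hexp (-(ke • antiGen (0, .a))) = mid 1 (expH (me * ma 0)) := by
        rw [mid_expH, map_mul, map_mul, me, mid_C, mid_a, antiGen, Algebra.smul_def, mul_neg,
          neg_neg]
      have h2 : hexp (-antiGen (0, .b)) = mid 1 (expH (mb 0)) := by
        rw [mid_expH, mid_b, antiGen, neg_neg]
      rw [h1, h2, ← map_mul, ← expH_add, add_comm (mb 0)]
      have : wM (0 : Fin 1) 0 + (me * ma 0 + mb 0) = 0 := by simp only [wM, zero_smul]; ring
      rw [this, expH_zero, map_one, neg_sub])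
    (by
      apply MulOpposite.unop_injective
      simp only [MulOpposite.unop_sub, MulOpposite.unop_mul, MulOpposite.unop_op]
      simp only [antiGen, neg_mul_neg]
      rw [mul_assoc, ← mid_a, mid_commute, ← mul_assoc, ← mul_assoc, ← sub_mul, ← neg_sub,
        mid_sub_x, shP_a (by simp)]
      simp)
    (by
      apply MulOpposite.unop_injective
      simp only [MulOpposite.unop_sub, MulOpposite.unop_mul, MulOpposite.unop_op,
        MulOpposite.unop_smul]
      simp only [antiGen, neg_mul_neg]
      rw [mul_assoc, ← mid_b, mid_commute, ← mul_assoc, ← mul_assoc, ← sub_mul, ← neg_sub,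
        mid_sub_x, shP_b, smul_neg, Algebra.smul_def, ke, ← mid_C]
      simp [mul_assoc])
    (by
      apply MulOpposite.unop_injective
      simp only [MulOpposite.unop_sub, MulOpposite.unop_mul, MulOpposite.unop_op,
        MulOpposite.unop_neg]
      simp only [antiGen, neg_mul_neg]
      rw [mul_assoc, ← mid_a, mid_commute, ← mul_assoc, ← mul_assoc, ← sub_mul, ← neg_sub,
        mid_sub_y, shP_a (by simp)]
      simp)
    (by
      apply MulOpposite.unop_injective
      simp only [MulOpposite.unop_sub, MulOpposite.unop_mul, MulOpposite.unop_op,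
        MulOpposite.unop_neg, MulOpposite.unop_smul]
      simp only [antiGen, neg_mul_neg]
      rw [mul_assoc, ← mid_b, mid_commute, ← mul_assoc, ← mul_assoc, ← sub_mul, ← neg_sub,
        mid_sub_y, shP_b, smul_neg, Algebra.smul_def, ← mul_assoc, Algebra.commutes, ke, ← mid_C]
      simp)
    (by
      rw [← MulOpposite.op_mul, ← MulOpposite.op_mul, antiGen, antiGen, neg_mul_neg, neg_mul_neg,
        (dz_ab 0).eq]))

/-- The antipode. -/
def antiD : DD 1 →ₗ[KK] DD 1 :=
  (MulOpposite.opLinearEquiv KK).symm.toLinearMap.comp antiOp.toLinearMap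

theorem antiD_apply (z : DD 1) : antiD z = (antiOp z).unop := rfl

theorem antiD_mul (u w : DD 1) : antiD (u * w) = antiD w * antiD u := by
  simp [antiD_apply]

theorem antiD_one : antiD 1 = 1 := by simp [antiD_apply]

theorem antiD_pow (u : DD 1) (k : ℕ) : antiD (u ^ k) = antiD u ^ k := by
  simp [antiD_apply]

theorem antiD_dz (i : Fin 1) (g : Gen) : antiD (dz i g) = antiGen (i, g) := by
  rw [antiD_apply, antiOp, liftD_dz, MulOpposite.unop_op]

theorem isAntipode_antiD : IsAntipode antiD := by
  refine ⟨antiD_one, antiD_mul, ?_, ?_, ?_, ?_⟩ <;> rw [antiD_dz]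
  · rw [dB_neg_one]; rfl
  · rfl
  · rfl
  · rw [dA_neg_one]; rfl

/-- The map `r ⊗ s ↦ S(s) r`. -/
def antiMulD : DD 2 →ₗ[KK] DD 1 := tensorLift ((LinearMap.mul KK (DD 1)).comp antiD).flip

theorem isAntipodeMulOp_antiMulD : IsAntipodeMulOp antiD antiMulD := tensorLift_place _

end ops

/-! ### `q`-factorials and divided powers -/

theorem constantCoeff_q : PowerSeries.constantCoeff q = 1 := constantCoeff_expH _

theorem isUnit_qInt_succ (n : ℕ) : IsUnit (qInt (n + 1)) := by
  rw [PowerSeries.isUnit_iff_constantCoeff, qInt, map_sum]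
  simp only [map_pow, constantCoeff_q, one_pow, sum_const, card_range, nsmul_eq_mul, mul_one]
  have : ((n + 1 : ℕ) : Qe) = Polynomial.C ((n + 1 : ℕ) : ℚ) := by simp
  rw [this, Polynomial.isUnit_C]
  exact IsUnit.mk0 _ (by positivity)

theorem isUnit_qFact (n : ℕ) : IsUnit (qFact n) := by
  rw [qFact, IsUnit.prod_iff]
  exact fun i _ => isUnit_qInt_succ i

/-- The inverse of `[n]!`. -/
def qf (n : ℕ) : KK := Ring.inverse (qFact n)

theorem qFact_mul_qf (n : ℕ) : qFact n * qf n = 1 := Ring.mul_inverse_cancel _ (isUnit_qFact n)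

theorem qFact_succ (n : ℕ) : qFact (n + 1) = qFact n * qInt (n + 1) := prod_range_succ _ _

theorem qf_zero : qf 0 = 1 := by simp [qf, qFact]

theorem qInt_zero : qInt 0 = 0 := by simp [qInt]

theorem qInt_mul_qf (n : ℕ) : qInt (n + 1) * qf (n + 1) = qf n := by
  have h := qFact_mul_qf (n + 1)
  rw [qFact_succ] at h
  calc qInt (n + 1) * qf (n + 1)
      = (qFact n * qf n) * (qInt (n + 1) * qf (n + 1)) := by rw [qFact_mul_qf, one_mul]
    _ = qf n * (qFact n * qInt (n + 1) * qf (n + 1)) := by ring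
    _ = qf n := by rw [h, mul_one]

theorem qInt_add (m n : ℕ) : qInt (m + n) = qInt m + q ^ m * qInt n := by
  rw [qInt, sum_range_add, qInt, qInt, mul_sum]
  simp only [pow_add]

theorem smul_qInt_cancel {M : Type} [AddCommGroup M] [Module KK M] {n : ℕ} {z z' : M}
    (h : qInt (n + 1) • z = qInt (n + 1) • z') : z = z' := (isUnit_qInt_succ n).smul_left_cancel.1 h

/-! ### The `q`-binomial theorem for products and its vanishing alternating sum. -/

section rothe
variable {A : Type} [CommRing A] [Algebra KK A]

/-- The `q`-binomial theorem for `∏_{p < k} (1 - q^p w)`. -/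
theorem qf_smul_prod_one_sub (w : A) (k : ℕ) :
    qf k • ∏ p ∈ range k, (1 - q ^ p • w) = ∑ c ∈ antidiagonal k,
      ((-1) ^ c.1 * qf c.1 * qf c.2 * q ^ (c.1.choose 2)) • w ^ c.1 := by
  induction k with
  | zero => simp [qf_zero]
  | succ k ih =>
    refine smul_qInt_cancel (n := k) ?_
    rw [smul_smul, qInt_mul_qf, prod_range_succ, ← smul_mul_assoc, ih, mul_sub, mul_one]
    -- The factor `[k+1]` is split as `[c_2] + q^{c_2} [c_1]`. The first part reproduces the sum for
    -- `k`, the second its product with `-q^k w`.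
    have e : ∀ c ∈ antidiagonal (k + 1), qInt (k + 1) •
        (((-1) ^ c.1 * qf c.1 * qf c.2 * q ^ (c.1.choose 2)) • w ^ c.1) =
        (qInt c.2 * ((-1) ^ c.1 * qf c.1 * qf c.2 * q ^ (c.1.choose 2))) • w ^ c.1 +
        (q ^ c.2 * qInt c.1 * ((-1) ^ c.1 * qf c.1 * qf c.2 * q ^ (c.1.choose 2))) • w ^ c.1 := by
      intro c hc
      rw [HasAntidiagonal.mem_antidiagonal] at hc
      rw [smul_smul, ← add_smul, ← hc, add_comm c.1, qInt_add]
      congr 1; ring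
    rw [smul_sum, sum_congr rfl e, sum_add_distrib, sub_eq_add_neg]
    congr 1
    · rw [Nat.sum_antidiagonal_succ', qInt_zero, zero_mul, zero_smul, zero_add]
      refine sum_congr rfl fun c _ => ?_
      rw [← qInt_mul_qf c.2]
      congr 1; ring
    · rw [Nat.sum_antidiagonal_succ, qInt_zero, mul_zero, zero_mul, zero_smul, zero_add, sum_mul,
        ← sum_neg_distrib]
      refine sum_congr rfl fun c hc => ?_
      rw [HasAntidiagonal.mem_antidiagonal] at hc
      rw [← qInt_mul_qf c.1, Nat.choose_succ_succ', Nat.choose_one_right, ← hc, smul_mul_smul_comm,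
        ← neg_smul, ← pow_succ]
      congr 1
      simp only [pow_add]; ring

/-- At `w = 1` the factor with `p = 0` of the product vanishes. This identity is behind both
inverses, that of `R` and that of the ribbon element. -/
theorem sum_qf_alternating {N : ℕ} (h : N ≠ 0) :
    ∑ c ∈ antidiagonal N, (-1) ^ c.1 * qf c.1 * qf c.2 * q ^ (c.1.choose 2) = 0 := by
  have := qf_smul_prod_one_sub (1 : KK) N
  obtain ⟨M, rfl⟩ := Nat.exists_eq_succ_of_ne_zero h
  rw [Nat.succ_eq_add_one, prod_range_succ', pow_zero, one_smul, sub_self, mul_zero,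
    smul_zero] at this
  simpa using this.symm

end rothe

section qbinomial
variable {A : Type} [Ring A] [Algebra KK A]

/-- The divided power `z^k / [k]!`. -/
def dp (z : A) (k : ℕ) : A := qf k • z ^ k

theorem dp_zero (z : A) : dp z 0 = 1 := by simp [dp, qf_zero]

theorem mul_dp (z : A) (k : ℕ) : z * dp z k = qInt (k + 1) • dp z (k + 1) := by
  rw [dp, dp, smul_smul, qInt_mul_qf, mul_smul_comm, ← pow_succ']

theorem pow_eq_dp (z : A) (k : ℕ) : z ^ k = qFact k • dp z k := by
  rw [dp, smul_smul, qFact_mul_qf, one_smul]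

/-- The `q`-binomial theorem for `q`-commuting elements. -/
theorem dp_add {Y Z : A} (h : Z * Y = q • (Y * Z)) (k : ℕ) :
    dp (Y + Z) k = ∑ c ∈ antidiagonal k, dp Y c.1 * dp Z c.2 := by
  have hp : ∀ i, Z * dp Y i = q ^ i • (dp Y i * Z) := by
    intro i
    have : ∀ i, Z * Y ^ i = q ^ i • (Y ^ i * Z) := by
      intro i
      induction i with
      | zero => simp
      | succ i ih =>
        rw [pow_succ Y, ← mul_assoc, ih, smul_mul_assoc, mul_assoc, h, mul_smul_comm, smul_smul,
          ← pow_succ, mul_assoc]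
    rw [dp, mul_smul_comm, this, smul_comm, smul_mul_assoc]
  induction k with
  | zero => simp [dp_zero]
  | succ k ih =>
    refine smul_qInt_cancel (n := k) ?_
    rw [← mul_dp, ih, add_mul, mul_sum, mul_sum]
    have e : ∀ c ∈ antidiagonal (k + 1), qInt (k + 1) • (dp Y c.1 * dp Z c.2) =
        qInt c.1 • (dp Y c.1 * dp Z c.2) + (q ^ c.1 * qInt c.2) • (dp Y c.1 * dp Z c.2) := by
      intro c hc
      rw [HasAntidiagonal.mem_antidiagonal] at hc
      rw [← add_smul, ← hc, qInt_add]
    rw [smul_sum, sum_congr rfl e, sum_add_distrib, Nat.sum_antidiagonal_succ,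
      Nat.sum_antidiagonal_succ', qInt_zero, mul_zero, zero_smul, zero_smul, zero_add, zero_add]
    congr 1
    · refine sum_congr rfl fun c _ => ?_
      rw [← mul_assoc, mul_dp, smul_mul_assoc]
    · refine sum_congr rfl fun c _ => ?_
      rw [← mul_assoc, hp, smul_mul_assoc, mul_assoc, mul_dp, mul_smul_comm, smul_smul]

end qbinomial

/-! ### Normal ordering of `x^m y^n` -/

section normalOrder
variable {n : ℕ} (i : Fin n)

/-- `∏_{p < k} (1 - q^{s + p} A B) / ħ`. -/
def hProd (s k : ℕ) : Mid n := ∏ p ∈ range k, hq (wM i (s + p))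

theorem hProd_succ (s k : ℕ) : hProd i s (k + 1) = hProd i s k * hq (wM i (s + k)) :=
  prod_range_succ _ _

theorem hProd_succ' (s k : ℕ) : hProd i s (k + 1) = hq (wM i s) * hProd i (s + 1) k := by
  have : ∏ p ∈ range k, hq (wM i (s + (p + 1))) = ∏ p ∈ range k, hq (wM i (s + 1 + p)) :=
    prod_congr rfl fun p _ => by rw [show s + (p + 1) = s + 1 + p by ring]
  unfold hProd
  rw [prod_range_succ', this, add_zero, mul_comm]

theorem shM_hProd (s k : ℕ) : shM i (hProd i s k) = hProd i (s + 2) k := by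
  rw [hProd, map_prod, hProd]
  refine prod_congr rfl fun p _ => ?_
  rw [shM_hq]; congr 2; ring

/-- With `ħ` multiplied through, the two coefficients in `A B` are the decompositions of `[a + k]`
that start from either end. -/
theorem hq_wM_three (a b k : ℕ) : (qInt (a + k) • hq (wM i (a + b)) : Mid n) =
    qInt a • hq (wM i (a + b + k)) + (q ^ a * qInt k) • hq (wM i b) := by
  apply mul_left_cancel₀ (PowerSeries.X_ne_zero (R := MvPolynomial (Fin n × Bool) Qe))
  rw [mul_add, mul_smul_comm, mul_smul_comm, mul_smul_comm, hq_wM, hq_wM, hq_wM]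
  have e1 := congrArg (algebraMap KK (Mid n)) (qInt_add a k)
  have e2 := congrArg (algebraMap KK (Mid n)) (qInt_add k a)
  rw [add_comm k a] at e2
  simp only [map_add, map_mul, map_pow] at e1 e2
  simp only [Algebra.smul_def, map_mul, map_pow]
  generalize algebraMap KK (Mid n) (qInt (a + k)) = Q2 at *
  generalize algebraMap KK (Mid n) (qInt a) = Q1 at *
  generalize algebraMap KK (Mid n) (qInt k) = Q0 at *
  generalize algebraMap KK (Mid n) q = q' at *
  linear_combination e1 - q' ^ (a + b) * expH (wM i 0) * e2

/-- Multiplying `hq_wM_three` by the `k - 1` factors common to all three products gives this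
recursion, which drives the induction for the normal ordering. -/
theorem hProd_rec (a b k : ℕ) : (qInt (a + k) • hProd i (a + b) k : Mid n) =
    qInt a • hProd i (a + b + 1) k + (q ^ a * qInt k) •
      (hq (wM i b) * hProd i (a + b + 1) (k - 1)) := by
  cases k with
  | zero => simp [hProd, qInt_zero]
  | succ k =>
    rw [hProd_succ', hProd_succ, Nat.add_sub_cancel, mul_comm (hProd _ _ _), ← smul_mul_assoc,
      ← smul_mul_assoc, ← smul_mul_assoc, hq_wM_three, add_mul]
    congr 5
    ring

theorem x_mul_dp_y (k : ℕ) : dz i Gen.x * dp (dz i Gen.y) (k + 1) =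
    q ^ (k + 1) • (dp (dz i Gen.y) (k + 1) * dz i Gen.x) +
      dp (dz i Gen.y) k * mid n (hq (wM i k)) := by
  rw [dp, mul_smul_comm, x_mul_y_pow, smul_add, smul_smul (qf _) (qInt _), mul_comm (qf _) (qInt _),
    qInt_mul_qf, dp, smul_mul_assoc, smul_mul_assoc, smul_comm]

/-- The triples `(a, b, k)` with `a + k = m` and `b + k = l`. -/
def triples (m l : ℕ) : Finset (ℕ × ℕ × ℕ) :=
  (range (m + 1) ×ˢ range (l + 1) ×ˢ range (m + 1)).filter
    fun t => t.1 + t.2.2 = m ∧ t.2.1 + t.2.2 = l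

theorem mem_triples {m l : ℕ} {t : ℕ × ℕ × ℕ} :
    t ∈ triples m l ↔ t.1 + t.2.2 = m ∧ t.2.1 + t.2.2 = l := by
  simp only [triples, mem_filter, mem_product, mem_range]
  constructor
  · exact fun h => h.2
  · intro h; exact ⟨⟨by omega, by omega, by omega⟩, h⟩

theorem sum_triples_succ_left {M : Type} [AddCommMonoid M] (m l : ℕ) (f : ℕ × ℕ × ℕ → M)
    (h : ∀ b k, f (0, b, k) = 0) :
    ∑ t ∈ triples m l, f (t.1 + 1, t.2) = ∑ t ∈ triples (m + 1) l, f t := by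
  refine sum_of_injOn (fun t => (t.1 + 1, t.2)) ?_ ?_ ?_ fun _ _ => rfl
  · rintro ⟨a, b, k⟩ _ ⟨a', b', k'⟩ _ h; simpa using h
  · rintro ⟨a, b, k⟩ ht
    simp only [mem_coe, mem_triples] at ht ⊢
    omega
  · rintro ⟨a, b, k⟩ ht hn
    cases a with
    | zero => exact h _ _
    | succ a =>
      refine absurd ⟨(a, b, k), ?_, rfl⟩ hn
      simp only [mem_coe, mem_triples] at ht ⊢
      omega

theorem sum_triples_shift {M : Type} [AddCommMonoid M] (m l : ℕ) (f g : ℕ × ℕ × ℕ → M)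
    (h : ∀ a b, f (a, b, 0) = 0) (hg : ∀ a k, g (a, 0, k) = 0)
    (hfg : ∀ a b k, g (a, b + 1, k) = f (a, b, k + 1)) :
    ∑ t ∈ triples m l, g t = ∑ t ∈ triples (m + 1) l, f t := by
  rw [← sum_filter_of_ne (s := triples (m + 1) l) (p := fun t => t.2.2 ≠ 0) (f := f)]
  · symm
    refine sum_of_injOn (fun t => (t.1, t.2.1 + 1, t.2.2 - 1)) ?_ ?_ ?_ ?_
    · rintro ⟨a, b, k⟩ h1 ⟨a', b', k'⟩ h2 h
      simp only [coe_filter, Set.mem_ofPred_eq] at h1 h2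
      simp only [Prod.mk.injEq] at h ⊢
      omega
    · rintro ⟨a, b, k⟩ ht
      simp only [coe_filter, Set.mem_ofPred_eq, mem_coe, mem_triples] at ht ⊢
      omega
    · rintro ⟨a, b, k⟩ ht hn
      cases b with
      | zero => exact hg _ _
      | succ b =>
        refine absurd ⟨(a, b, k + 1), ?_, rfl⟩ hn
        simp only [coe_filter, Set.mem_ofPred_eq, mem_triples] at ht ⊢
        omega
    · rintro ⟨a, b, k⟩ ht
      simp only [mem_filter] at ht
      obtain ⟨k, rfl⟩ := Nat.exists_eq_succ_of_ne_zero ht.2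
      exact (hfg a b k).symm
  · rintro ⟨a, b, k⟩ _ hne rfl
    exact hne (h _ _)

/-- Normal ordering of divided powers. -/
theorem dp_x_mul_dp_y (m l : ℕ) : dp (dz i Gen.x) m * dp (dz i Gen.y) l =
    ∑ t ∈ triples m l, (q ^ (t.1 * t.2.1) * qf t.2.2) •
      (dp (dz i Gen.y) t.2.1 * mid n (hProd i (t.1 + t.2.1) t.2.2) * dp (dz i Gen.x) t.1) := by
  induction m with
  | zero =>
    have : triples 0 l = {(0, l, 0)} := by
      ext ⟨a, b, k⟩
      simp only [mem_triples, mem_singleton, Prod.mk.injEq]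
      omega
    rw [this, sum_singleton]
    simp [hProd, qf_zero, dp_zero]
  | succ m ih =>
    refine smul_qInt_cancel (n := m) ?_
    rw [← smul_mul_assoc, ← mul_dp, mul_assoc, ih, mul_sum, smul_sum]
    -- Here `α` collects the terms in which the new `x` passes all the `y`, and `γ` those in which
    -- it contracts with one `y`. `β` is `γ` indexed by the resulting triple, with one `y` less and
    -- one contraction more.
    let α : ℕ × ℕ × ℕ → DD n := fun t => (q ^ (t.1 * t.2.1) * qf t.2.2 * qInt t.1) •
      (dp (dz i Gen.y) t.2.1 * mid n (hProd i (t.1 + t.2.1 + 1) t.2.2) * dp (dz i Gen.x) t.1)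
    let β : ℕ × ℕ × ℕ → DD n := fun t => (q ^ (t.1 * t.2.1 + t.1) * (qInt t.2.2 * qf t.2.2)) •
      (dp (dz i Gen.y) t.2.1 * mid n (hq (wM i t.2.1) * hProd i (t.1 + t.2.1 + 1) (t.2.2 - 1))
        * dp (dz i Gen.x) t.1)
    let γ : ℕ × ℕ × ℕ → DD n := fun t => if t.2.1 = 0 then 0 else β (t.1, t.2.1 - 1, t.2.2 + 1)
    have e1 : ∀ t ∈ triples m l, dz i Gen.x * ((q ^ (t.1 * t.2.1) * qf t.2.2) •
      (dp (dz i Gen.y) t.2.1 * mid n (hProd i (t.1 + t.2.1) t.2.2) * dp (dz i Gen.x) t.1)) =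
        α (t.1 + 1, t.2) + γ t := by
      rintro ⟨a, b, k⟩ -
      have hα : α (a + 1, b, k) = (q ^ (a * b) * qf k) • (q ^ b • (dp (dz i Gen.y) b *
          (dz i Gen.x * mid n (hProd i (a + b) k)) * dp (dz i Gen.x) a)) := by
        rw [x_mul_mid, shM_hProd, ← mul_assoc, mul_assoc _ (dz i Gen.x), mul_dp, mul_smul_comm,
          smul_smul, smul_smul]
        simp only [α]
        rw [show a + 1 + b + 1 = a + b + 2 by ring]
        congr 1
        ring
      rw [hα]
      cases b with
      | zero => simp [γ, dp_zero, mul_assoc]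
      | succ b =>
        have hγ : γ (a, b + 1, k) = (q ^ (a * (b + 1)) * qf k) • (dp (dz i Gen.y) b *
            mid n (hq (wM i b)) * mid n (hProd i (a + (b + 1)) k) * dp (dz i Gen.x) a) := by
          simp only [γ, β, Nat.add_sub_cancel, qInt_mul_qf, if_neg (Nat.succ_ne_zero b), map_mul]
          rw [show a + b + 1 = a + (b + 1) by ring, show a * b + a = a * (b + 1) by ring]
          simp only [mul_assoc]
        rw [hγ, ← smul_add, mul_smul_comm]
        congr 1
        simp only [← mul_assoc]
        rw [x_mul_dp_y, add_mul, add_mul, smul_mul_assoc, smul_mul_assoc]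
    rw [sum_congr rfl e1, sum_add_distrib, sum_triples_succ_left m l α (by simp [α, qInt_zero]),
      sum_triples_shift m l β γ (by simp [β, qInt_zero]) (by simp [γ]) (by simp [γ]),
      ← sum_add_distrib]
    refine sum_congr rfl ?_
    rintro ⟨a, b, k⟩ ht
    have hm : a + k = m + 1 := (mem_triples.1 ht).1
    dsimp only [α, β]
    rw [← hm, smul_comm, ← smul_mul_assoc (qInt (a + k)), ← mul_smul_comm (qInt (a + k)),
      ← map_smul, hProd_rec, map_add, map_smul, map_smul, mul_add, add_mul, smul_add,
      mul_smul_comm, mul_smul_comm, smul_mul_assoc, smul_mul_assoc, smul_smul, smul_smul]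
    congr 2
    rw [pow_add]; ring

end normalOrder

/-! ### The operations on ordered monomials -/

theorem choose_two_add (a b : ℕ) : (a + b).choose 2 = a.choose 2 + b.choose 2 + a * b := by
  induction b with
  | zero => simp
  | succ b ih =>
    rw [← add_assoc, Nat.choose_succ_succ' (a + b), Nat.choose_succ_succ' b, ih,
      Nat.choose_one_right, Nat.choose_one_right]
    ring

theorem two_mul_choose_two {A : Type} [CommRing A] (a : ℕ) :
    2 * (a.choose 2 : A) = a * a - a := by
  induction a with
  | zero => simp
  | succ b ih =>
    rw [Nat.choose_succ_succ' b, Nat.choose_one_right]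
    push_cast
    linear_combination ih

theorem q_pow_smul_expH {τ : Type} (k : ℕ) (p : MvPolynomial τ Qe) :
    (q ^ k • expH p : PS τ) = expH (k • MvPolynomial.C eps + p) := by
  rw [Algebra.smul_def, map_pow, algebraMap_q, expH_pow, expH_add]

section
variable {n : ℕ} (i : Fin n)

theorem wM_eq (p : ℕ) : wM i p = p • me + wM i 0 := by
  simp only [wM, zero_smul]; ring

theorem hb_pow_smul_hProd (s k : ℕ) : (hb ^ k • hProd i s k : Mid n) =
    ∏ p ∈ range k, (1 - q ^ p • expH (wM i s)) := by
  induction k with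
  | zero => simp [hProd]
  | succ k ih =>
    rw [hProd_succ, pow_succ, mul_smul, prod_range_succ, ← ih, smul_mul_assoc, ← mul_smul_comm hb,
      X_pow_smul_PS, X_mul_hq, q_pow_smul_expH, wM_eq i (s + k), wM_eq i s, add_smul, me]
    congr 3
    ring_nf

/-- The factor `ħ^k` clears the denominators of the `k` contractions, and the `q`-binomial theorem
with `w = q^s A B` expands the product into powers of `A B`. -/
theorem hProd_expand (s k : ℕ) : (hb ^ k • qf k • hProd i s k : Mid n) =
    ∑ c ∈ antidiagonal k, ((-1) ^ c.1 * qf c.1 * qf c.2 * q ^ (c.1.choose 2 + s * c.1)) •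
      expH (c.1 • wM i 0) := by
  rw [smul_comm, hb_pow_smul_hProd, qf_smul_prod_one_sub]
  refine sum_congr rfl fun c _ => ?_
  rw [expH_pow, pow_add, ← mul_assoc, mul_smul _ (q ^ (s * c.1)), q_pow_smul_expH, wM_eq i s, me]
  congr 2
  simp only [nsmul_eq_mul]
  push_cast
  ring

/-- The quadruples `(a, b, r, s)` with `a + r + s = m` and `b + r + s = l`. -/
def quads (m l : ℕ) : Finset (Fin 4 → ℕ) :=
  (Fintype.piFinset fun _ => range (m + l + 1)).filter
    fun v => v 0 + v 2 + v 3 = m ∧ v 1 + v 2 + v 3 = l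

theorem mem_quads {m l : ℕ} {v : Fin 4 → ℕ} :
    v ∈ quads m l ↔ v 0 + v 2 + v 3 = m ∧ v 1 + v 2 + v 3 = l := by
  simp only [quads, mem_filter, Fintype.mem_piFinset, mem_range]
  constructor
  · exact fun h => h.2
  · refine fun h => ⟨fun j => ?_, h⟩
    fin_cases j <;> simp <;> omega

theorem sum_triples_antidiagonal {M : Type} [AddCommMonoid M] (m l : ℕ) (f : (Fin 4 → ℕ) → M) :
    ∑ t ∈ triples m l, ∑ c ∈ antidiagonal t.2.2, f ![t.1, t.2.1, c.1, c.2] =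
      ∑ v ∈ quads m l, f v := by
  rw [sum_sigma']
  refine sum_nbij' (fun p => ![p.1.1, p.1.2.1, p.2.1, p.2.2])
    (fun v => ⟨(v 0, v 1, v 2 + v 3), (v 2, v 3)⟩) ?_ ?_ ?_ ?_ ?_
  · rintro ⟨⟨a, b, k⟩, c⟩ h
    simp only [mem_sigma, mem_triples, HasAntidiagonal.mem_antidiagonal] at h
    simp only [mem_quads, Matrix.cons_val]
    omega
  · intro v h
    rw [mem_quads] at h
    simp only [mem_sigma, mem_triples, HasAntidiagonal.mem_antidiagonal, and_true]
    rwa [← add_assoc, ← add_assoc]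
  · rintro ⟨⟨a, b, k⟩, c⟩ h
    simp only [mem_sigma, mem_triples, HasAntidiagonal.mem_antidiagonal] at h
    obtain ⟨-, rfl⟩ := h
    rfl
  · intro v _
    ext j
    fin_cases j <;> rfl
  · intros; rfl

/-- The coefficients in the normal ordering of `x^m y^l`. -/
def quadCoeff (v : Fin 4 → ℕ) : KK :=
  qFact (v 0 + v 2 + v 3) * qFact (v 1 + v 2 + v 3) * (qf (v 0) * qf (v 1) * qf (v 2) * qf (v 3)) *
    ((-1) ^ v 2 * q ^ (v 0 * v 1 + (v 2).choose 2 + (v 0 + v 1) * v 2))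

/-- In a quadruple, the entries count the surviving `x`, the surviving `y`, and the contractions
contributing `-A B` and `1`. Of the factor `ħ^l`, the contractions absorb `ħ^k` and the surviving
`y` keep `ħ^b`. This is the reason for treating `ħ y` as the variable later on. -/
theorem x_pow_mul_y_pow (m l : ℕ) : hb ^ l • (dz i Gen.x ^ m * dz i Gen.y ^ l) =
    ∑ v ∈ quads m l, (quadCoeff v * hb ^ v 1) •
      (dz i Gen.y ^ v 1 * mid n (expH (v 2 • wM i 0)) * dz i Gen.x ^ v 0) := by
  rw [← sum_triples_antidiagonal m l, pow_eq_dp (dz i Gen.x) m, pow_eq_dp (dz i Gen.y) l,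
      smul_mul_smul_comm,
    dp_x_mul_dp_y, smul_sum, smul_sum]
  refine sum_congr rfl ?_
  rintro ⟨a, b, k⟩ ht
  obtain ⟨hm, hl⟩ : a + k = m ∧ b + k = l := mem_triples.1 ht
  have h1 : hb ^ l • (qFact m * qFact l) • (q ^ (a * b) * qf k) •
      (dp (dz i Gen.y) b * mid n (hProd i (a + b) k) * dp (dz i Gen.x) a) =
      (hb ^ b * (qFact m * qFact l) * q ^ (a * b) * qf a * qf b) •
      (dz i Gen.y ^ b * mid n (hb ^ k • qf k • hProd i (a + b) k) * dz i Gen.x ^ a) := by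
    rw [dp, dp, map_smul, map_smul]
    simp only [smul_mul_assoc, mul_smul_comm, smul_smul, ← hl]
    refine congrArg (· • _) ?_
    ring
  dsimp only
  rw [h1, hProd_expand, map_sum, mul_sum, sum_mul, smul_sum]
  refine sum_congr rfl fun c hc => ?_
  rw [HasAntidiagonal.mem_antidiagonal] at hc
  simp only [map_smul, smul_mul_assoc, mul_smul_comm, smul_smul, Matrix.cons_val]
  refine congrArg (· • _) ?_
  rw [quadCoeff]
  simp only [Matrix.cons_val]
  rw [add_assoc, add_assoc b, hc, hm, hl]
  simp only [pow_add]
  ring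

end

/-! #### The antipode -/

theorem x_mul_mid_pow (M : ℕ) : (dz (0 : Fin 1) Gen.x * mid 1 (expH (me * ma 0))) ^ M =
    mid 1 (expH (M • (me * ma 0) - (M + 1).choose 2 • me)) * dz 0 Gen.x ^ M := by
  induction M with
  | zero => simp [expH_zero]
  | succ M ih =>
    rw [pow_succ', ih, mul_assoc, ← mul_assoc (mid 1 _) (mid 1 _), ← map_mul, ← expH_add,
      ← mul_assoc, mid_x_comm, mul_assoc, ← pow_succ', shMm_expH, map_add, map_sub, map_nsmul,
      map_nsmul, map_mul, me, shPm_C, shPm_a, Nat.choose_succ_succ' (M + 1), Nat.choose_one_right]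
    congr 3
    simp only [nsmul_eq_mul]
    push_cast
    ring

theorem y_mul_mid_pow (N : ℕ) : (dz (0 : Fin 1) Gen.y * mid 1 (expH (mb 0))) ^ N =
    dz 0 Gen.y ^ N * mid 1 (expH (N • mb 0 - N.choose 2 • me)) := by
  induction N with
  | zero => simp [expH_zero]
  | succ N ih =>
    rw [pow_succ, ih, mul_assoc, ← mul_assoc (mid 1 _), mid_y_comm, mul_assoc (dz 0 Gen.y),
      ← map_mul, ← mul_assoc, ← pow_succ, shMm_expH, ← expH_add, map_sub, map_nsmul,
      map_nsmul, me, shPm_C, shPm_b, Nat.choose_succ_succ' N, Nat.choose_one_right]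
    congr 3
    simp only [nsmul_eq_mul, me]
    push_cast
    ring

theorem shMm_shMm {n : ℕ} (i : Fin n) (k l : ℕ) (g : Mid n) :
    shMm i k (shMm i l g) = shMm i (k + l) g := by
  rw [← shM_iterate, ← shM_iterate, ← Function.iterate_add_apply, shM_iterate]

theorem dz_x_pow_mid_y_pow (M N : ℕ) (g : Mid 1) :
    hb ^ N • (dz (0 : Fin 1) Gen.x ^ M * mid 1 g * dz 0 Gen.y ^ N) =
    ∑ v ∈ quads M N, (quadCoeff v * hb ^ v 1) • (dz 0 Gen.y ^ v 1 *
      mid 1 (shMm 0 (M + v 1) g * expH (v 2 • wM 0 0)) * dz 0 Gen.x ^ v 0) := by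
  rw [x_pow_mid, mul_assoc, ← mul_smul_comm, x_pow_mul_y_pow, mul_sum]
  refine sum_congr rfl fun v _ => ?_
  rw [mul_smul_comm, ← mul_assoc, ← mul_assoc, mid_y_pow, mul_assoc (dz 0 Gen.y ^ _), ← map_mul,
    shMm_shMm, add_comm (v 1) M]

/-- The middle part of a summand of the antipode of an ordered monomial. -/
def antiMid (v : Fin 4 → ℕ) (l m : ℕ) : Mid 1 :=
  let M := v 0 + v 2 + v 3
  let N := v 1 + v 2 + v 3
  expH (M • (me * (ma 0 - v 1 • 1)) - (M + 1).choose 2 • me + (N • (mb 0 - v 0 • me) -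
    N.choose 2 • me) + v 2 • wM 0 0) *
    PowerSeries.C ((-(ma 0 - (N + v 0) • 1)) ^ m * (-(mb 0 - (N + v 0) • me)) ^ l)

/-- Anti-multiplicativity turns `y b a x` into `S(x) S(a) S(b) S(y)`. The powers of `S(x)` and
`S(y)` are first brought to exponentials times powers, and then `x_pow_mul_y_pow` restores normal
order. -/
theorem antiD_dBlock (d : (Fin 1 × Gen) →₀ ℕ) :
    hb ^ d (0, .y) • antiD (dMon d) = ∑ v ∈ quads (d (0, .x)) (d (0, .y)),
      ((-1) ^ (d (0, .x) + d (0, .y)) * quadCoeff v * hb ^ v 1) • (dz 0 Gen.y ^ v 1 *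
        mid 1 (antiMid v (d (0, .b)) (d (0, .a))) * dz 0 Gen.x ^ v 0) := by
  rw [dMon_one, dBlock]
  simp only [antiD_mul, antiD_pow, antiD_dz, antiGen]
  generalize d (0, Gen.x) = M
  generalize d (0, Gen.y) = N
  generalize d (0, Gen.a) = m
  generalize d (0, Gen.b) = l
  have h1 : (-dz (0 : Fin 1) Gen.a) ^ m * ((-dz 0 Gen.b) ^ l) =
      mid 1 (PowerSeries.C ((-ma 0) ^ m * (-mb 0) ^ l)) := by
    simp only [map_mul, map_pow, map_neg, mid_a, mid_b]
  rw [neg_pow, neg_pow (dz 0 Gen.y * _), x_mul_mid_pow, y_mul_mid_pow]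
  have h2 : (-1 : DD 1) ^ M * (mid 1 (expH (M • (me * ma 0) - (M + 1).choose 2 • me)) *
      dz 0 Gen.x ^ M) * ((-dz 0 Gen.a) ^ m * ((-dz 0 Gen.b) ^ l * ((-1) ^ N * (dz 0 Gen.y ^ N *
        mid 1 (expH (N • mb 0 - N.choose 2 • me)))))) = ((-1 : KK) ^ (M + N)) •
      (mid 1 (expH (M • (me * ma 0) - (M + 1).choose 2 • me)) * (dz 0 Gen.x ^ M *
        mid 1 (PowerSeries.C ((-ma 0) ^ m * (-mb 0) ^ l)) * dz 0 Gen.y ^ N) *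
        mid 1 (expH (N • mb 0 - N.choose 2 • me))) := by
    rw [← h1, Algebra.smul_def ((-1 : KK) ^ (M + N)), map_pow, map_neg, map_one, pow_add]
    have hc : ∀ z w : DD 1, z * ((-1 : DD 1) ^ N * w) = (-1) ^ N * (z * w) := fun z w => by
      rw [← mul_assoc, ← ((Commute.neg_one_left z).pow_left N).eq, mul_assoc]
    rw [hc, hc, mul_assoc ((-1) ^ M), hc]
    simp only [mul_assoc]
  rw [h2, smul_comm, ← smul_mul_assoc (hb ^ N), ← mul_smul_comm (hb ^ N), dz_x_pow_mid_y_pow,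
      mul_sum, sum_mul,
    smul_sum]
  refine sum_congr rfl fun v hv => ?_
  obtain ⟨hM, hN⟩ := mem_quads.1 hv
  rw [mul_smul_comm, smul_mul_assoc, smul_smul, ← mul_assoc ((-1) ^ (M + N))]
  refine congrArg (_ • ·) ?_
  rw [← mul_assoc, ← mul_assoc, mid_y_pow, mul_assoc (dz 0 Gen.y ^ _), ← map_mul, mul_assoc,
    x_pow_mid, ← mul_assoc, mul_assoc (dz 0 Gen.y ^ _), ← map_mul]
  refine congrArg (fun g => dz 0 Gen.y ^ v 1 * mid 1 g * dz 0 Gen.x ^ v 0) ?_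
  rw [antiMid, hM, hN, shMm_expH, shMm_expH, shMm_C]
  -- Both equal the sum of the four entries of `v`, the total shift of the polynomial in `a` and
  -- `b`.
  have e : M + v 1 = N + v 0 := by omega
  rw [e, mul_assoc, mul_assoc, ← expH_add, mul_left_comm, ← expH_add, mul_comm]
  refine congrArg₂ (· * ·) (congrArg expH ?_) (congrArg PowerSeries.C ?_)
  · simp only [map_sub, map_nsmul, map_mul, me, shPm_C, shPm_a, shPm_b]
    abel
  · simp only [map_mul, map_pow, map_neg, shPm_a, shPm_b]

/-! #### The coproduct -/

/-- The quadruples with `v 0 + v 1 = k` and `v 2 + v 3 = l`. -/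
def duos (k l : ℕ) : Finset (Fin 4 → ℕ) :=
  (Fintype.piFinset fun _ => range (k + l + 1)).filter
    fun v => v 0 + v 1 = k ∧ v 2 + v 3 = l

theorem mem_duos {k l : ℕ} {v : Fin 4 → ℕ} :
    v ∈ duos k l ↔ v 0 + v 1 = k ∧ v 2 + v 3 = l := by
  simp only [duos, mem_filter, Fintype.mem_piFinset, mem_range]
  constructor
  · exact fun h => h.2
  · refine fun h => ⟨fun j => ?_, h⟩
    fin_cases j <;> simp <;> omega

theorem sum_antidiagonal_antidiagonal {M : Type} [AddCommMonoid M] (k l : ℕ)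
    (f : (Fin 4 → ℕ) → M) :
    ∑ c ∈ antidiagonal k, ∑ c' ∈ antidiagonal l, f ![c.1, c.2, c'.1, c'.2] =
      ∑ v ∈ duos k l, f v := by
  rw [← sum_product']
  refine sum_nbij' (fun p => ![p.1.1, p.1.2, p.2.1, p.2.2])
    (fun v => ((v 0, v 1), (v 2, v 3))) ?_ ?_ ?_ ?_ ?_
  · rintro ⟨c, c'⟩ h
    simp only [mem_product, HasAntidiagonal.mem_antidiagonal] at h
    simpa only [mem_duos, Matrix.cons_val] using h
  · intro v h
    simpa only [mem_product, HasAntidiagonal.mem_antidiagonal] using mem_duos.1 h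
  · rintro ⟨c, c'⟩ _
    rfl
  · intro v _
    ext j
    fin_cases j <;> rfl
  · intros; rfl

theorem yy_two (K : Fin 2 → ℕ) : yy K = dz 0 Gen.y ^ K 0 * dz 1 Gen.y ^ K 1 := by
  rw [yy]; simp [List.finRange_succ]

theorem xx_two (K : Fin 2 → ℕ) : xx K = dz 0 Gen.x ^ K 0 * dz 1 Gen.x ^ K 1 := by
  rw [xx]; simp [List.finRange_succ]

theorem yy_one (K : Fin 1 → ℕ) : yy K = dz 0 Gen.y ^ K 0 := by
  rw [yy]; simp [List.finRange_succ]

theorem xx_one (K : Fin 1 → ℕ) : xx K = dz 0 Gen.x ^ K 0 := by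
  rw [xx]; simp [List.finRange_succ]

/-- The coefficients of the coproduct of an ordered monomial. -/
def duoCoeff (v : Fin 4 → ℕ) : KK :=
  qFact (v 0 + v 1) * qFact (v 2 + v 3) * (qf (v 0) * qf (v 1) * qf (v 2) * qf (v 3))

/-- The middle part of a summand of the coproduct of an ordered monomial. -/
def duoMid (v : Fin 4 → ℕ) (l m : ℕ) : Mid 2 :=
  expH (-(v 1 • mb 1) - v 2 • (me * ma 1)) *
    PowerSeries.C ((mb 0 + mb 1) ^ l * (ma 0 + ma 1) ^ m)

theorem mid_pow_expH {n : ℕ} (k : ℕ) (p : MvPolynomial (Fin n × Bool) Qe) :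
    mid n (expH p) ^ k = mid n (expH (k • p)) := by rw [← map_pow, expH_pow]

/-- The two summands of `Δ y` commute up to `q`, and so do those of `Δ x`, so `dp_add` applies. The
entries of `v` are the exponents of `y_1`, `y_0 B_1`, `A_1 x_0` and `x_1`. -/
theorem comulD_dMon (d : (Fin 1 × Gen) →₀ ℕ) :
    comulD (dMon d) = ∑ v ∈ duos (d (0, .y)) (d (0, .x)),
      duoCoeff v • (yy ![v 1, v 0] * mid 2 (duoMid v (d (0, .b)) (d (0, .a))) *
        xx ![v 2, v 3]) := by
  rw [dMon_one, dBlock]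
  simp only [map_mul, map_pow, comulD_dz]
  generalize d (0, Gen.x) = N
  generalize d (0, Gen.y) = k
  generalize d (0, Gen.a) = m
  generalize d (0, Gen.b) = l
  have h10 : (1 : Fin 2) ≠ 0 := by decide
  have h01 : (0 : Fin 2) ≠ 1 := by decide
  have hB : Commute (dz (0 : Fin 2) Gen.y) (mid 2 (expH (-mb 1))) := by
    have := mid_y_comm (0 : Fin 2) (expH (-mb 1))
    rw [shMm_expH, map_neg, shPm_b_of_ne h10] at this
    exact this.symm
  have hA : Commute (mid 2 (expH (-(me * ma 1)))) (dz (0 : Fin 2) Gen.x) := by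
    have := mid_x_comm (0 : Fin 2) (expH (-(me * ma 1)))
    rw [shMm_expH, map_neg, map_mul, me, shPm_C, shPm_a_of_ne h10] at this
    exact this.symm
  have hY : (dz 0 Gen.y * mid 2 (expH (-mb 1))) * dz 1 Gen.y =
      q • (dz 1 Gen.y * (dz 0 Gen.y * mid 2 (expH (-mb 1)))) := by
    rw [mul_assoc, mid_y_comm, ← mul_assoc, ← mul_assoc, (dz_comm h01 _ _).eq, shMm_expH, map_neg,
      shPm_b, ← mul_smul_comm, q_eq, smul_mid_expH, one_smul, neg_sub', sub_neg_eq_add, add_comm,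
          me]
  have hX : dz 1 Gen.x * (mid 2 (expH (-(me * ma 1))) * dz 0 Gen.x) =
      q • ((mid 2 (expH (-(me * ma 1))) * dz 0 Gen.x) * dz 1 Gen.x) := by
    rw [← mul_assoc, mid_x_comm, mul_assoc, mul_assoc, (dz_comm h10 _ _).eq, shMm_expH, map_neg,
      map_mul, me, shPm_C, shPm_a, ← smul_mul_assoc, q_eq, smul_mid_expH, one_smul]
    refine congrArg (fun p => mid 2 (expH p) * _) ?_
    ring
  have h1 : comulGen (0, .y) ^ k = qFact k • ∑ c ∈ antidiagonal k,
      (qf c.1 * qf c.2) • (yy ![c.2, c.1] * mid 2 (expH (-(c.2 • mb 1)))) := by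
    rw [pow_eq_dp, comulGen, dp_add hY]
    refine congrArg (_ • ·) (sum_congr rfl fun c _ => ?_)
    rw [dp, dp, hB.mul_pow, smul_mul_smul_comm, ← mul_assoc, mid_pow_expH, yy_two, smul_neg,
      ((dz_comm h10 _ _).pow_pow _ _).eq]
    rfl
  have h2 : comulGen (0, .x) ^ N = qFact N • ∑ c ∈ antidiagonal N,
      (qf c.1 * qf c.2) • (mid 2 (expH (-(c.1 • (me * ma 1)))) * xx ![c.1, c.2]) := by
    rw [pow_eq_dp, comulGen, add_comm, dp_add hX]
    refine congrArg (_ • ·) (sum_congr rfl fun c _ => ?_)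
    rw [dp, dp, hA.mul_pow, smul_mul_smul_comm, mul_assoc, mid_pow_expH, xx_two, smul_neg]
    rfl
  rw [← sum_antidiagonal_antidiagonal k N, h1, h2, comulGen_a, comulGen_b, mul_assoc (qFact k • _),
    ← map_pow, ← map_pow, ← map_pow, ← map_pow, ← map_mul, ← map_mul, smul_mul_assoc, sum_mul,
    smul_mul_assoc, sum_mul, smul_sum]
  refine sum_congr rfl fun c hc => ?_
  rw [mul_smul_comm, mul_sum, smul_sum, smul_sum]
  refine sum_congr rfl fun c' hc' => ?_
  rw [HasAntidiagonal.mem_antidiagonal] at hc hc'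
  simp only [smul_mul_assoc, mul_smul_comm, smul_smul, duoCoeff, duoMid, Matrix.cons_val]
  have key : ∀ (u w : DD 2) (f g h : Mid 2), u * mid 2 f * mid 2 g * (mid 2 h * w) =
      u * mid 2 (f * h * g) * w := fun u w f g h => by
    rw [← mul_assoc, mul_assoc u, mul_assoc u, ← map_mul, ← map_mul, mul_right_comm]
  rw [hc, hc', sub_eq_add_neg, expH_add, key]
  exact congrArg (· • _) (by ring)

/-! #### Invertibility -/

/-- The inverse is the geometric series `∑ ħ^k (-z)^k`. -/
theorem isUnit_one_add_hb_smul {E : Type} [Ring E] [Algebra KK E] [HComp E] (z : E) :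
    IsUnit (1 + hb • z) := by
  have hs : hsum (fun k => (-z) ^ k) = 1 + hb • hsum (fun k => (-z) ^ (k + 1)) := by
    rw [hsum_succ, pow_zero]
  have hl : hsum (fun k => (-z) ^ (k + 1)) = -(z * hsum fun k => (-z) ^ k) := by
    have := map_hsum (LinearMap.mulLeft KK (-z)) (fun k => (-z) ^ k)
    simp only [LinearMap.mulLeft_apply, ← pow_succ'] at this
    rw [← this, neg_mul]
  have hr : hsum (fun k => (-z) ^ (k + 1)) = -((hsum fun k => (-z) ^ k) * z) := by
    have := map_hsum (LinearMap.mulRight KK (-z)) (fun k => (-z) ^ k)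
    simp only [LinearMap.mulRight_apply, ← pow_succ] at this
    rw [← this, mul_neg]
  refine ⟨⟨1 + hb • z, hsum fun k => (-z) ^ k, ?_, ?_⟩, rfl⟩
  · rw [add_mul, one_mul, smul_mul_assoc]
    nth_rewrite 1 [hs]
    rw [hl, smul_neg, neg_add_cancel_right]
  · rw [mul_add, mul_one, mul_smul_comm]
    nth_rewrite 1 [hs]
    rw [hr, smul_neg, neg_add_cancel_right]

theorem hsum_eq_one_add {E : Type} [Ring E] [Algebra KK E] [HComp E] (f : ℕ → E)
    (h : ∃ z, f 0 = 1 + hb • z) : ∃ z, hsum f = 1 + hb • z := by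
  obtain ⟨z, hz⟩ := h
  exact ⟨z + hsum fun k => f (k + 1), by rw [hsum_succ, hz, smul_add, add_assoc]⟩

theorem mid_expH_eq_one_add {n : ℕ} (p : MvPolynomial (Fin n × Bool) Qe) :
    ∃ z, mid n (expH p) = 1 + hb • z :=
  ⟨-mid n (hq p), by rw [smul_neg, hb_smul_mid_hq]; abel⟩

/-- If `f * g = 1` and `f` is `1` modulo `ħ` then `f` is invertible with inverse `g`. -/
theorem exists_unit_of_mul_eq_one {E : Type} [Ring E] [Algebra KK E] [HComp E] {f g : E}
    (h : ∃ z, f = 1 + hb • z) (hfg : f * g = 1) : ∃ u : Eˣ, (u : E) = f ∧ ((u⁻¹ : Eˣ) : E) = g := by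
  obtain ⟨z, rfl⟩ := h
  obtain ⟨u, hu⟩ := isUnit_one_add_hb_smul z
  refine ⟨u, hu, ?_⟩
  rw [← hu] at hfg
  exact Units.inv_eq_of_mul_eq_one_right hfg

/-! ### The `R`-matrix -/

theorem coeff_hsum_free {n : ℕ} (f : ℕ → Free n) (N : ℕ) : PowerSeries.coeff N (hsum f) =
    ∑ k ∈ range (N + 1), PowerSeries.coeff N (hb ^ k • f k) := by
  obtain ⟨z, hz⟩ := hsum_spec f (N + 1)
  rw [hz, map_add, map_sum, hb_pow_smul_free (N + 1), PowerSeries.coeff_X_pow_mul']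
  simp

/-- The inverse of `n!` in the base ring. -/
def kf (n : ℕ) : KK := PowerSeries.C (Polynomial.C ((n.factorial : ℚ)⁻¹))

/-- The summand of the `R`-matrix without the power of `ħ`. -/
def rTerm (m n : ℕ) : Free 2 :=
  (qf m * kf n) • (fz 0 Gen.y ^ m * fz 0 Gen.b ^ n * fz 1 Gen.a ^ n * fz 1 Gen.x ^ m)

theorem fRterm_eq (m n : ℕ) : fRterm m n = hb ^ (m + n) • rTerm m n := by
  rw [hb_pow_smul_free, rTerm, fRterm, mul_assoc]
  rfl

/-- The coefficientwise definition of `R` sums over a square of indices, the iterated sum over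
triangles. The difference consists of summands divisible by too high a power of `ħ`. -/
theorem Rmat_eq : Rmat = hsum fun m => hsum fun n => mkD 2 (rTerm m n) := by
  have h : (PowerSeries.mk fun N => ∑ m ∈ range (N + 1), ∑ n ∈ range (N + 1),
      PowerSeries.coeff N (fRterm m n)) = hsum fun m => hsum fun n => rTerm m n := by
    rw [hsum_hsum]
    ext N : 1
    rw [coeff_hsum_free, PowerSeries.coeff_mk, ← sum_product']
    have e : ∀ k, PowerSeries.coeff N (hb ^ k • ∑ p ∈ antidiagonal k, rTerm p.1 p.2) =
        ∑ p ∈ antidiagonal k, PowerSeries.coeff N (fRterm p.1 p.2) := by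
      intro k
      rw [smul_sum, map_sum]
      refine sum_congr rfl fun p hp => ?_
      rw [HasAntidiagonal.mem_antidiagonal] at hp
      rw [fRterm_eq, hp]
    simp only [e]
    rw [sum_sigma']
    symm
    refine sum_of_injOn (fun t => t.2) ?_ ?_ ?_ fun _ _ => rfl
    · rintro ⟨k, p⟩ h1 ⟨k', p'⟩ h2 h
      simp only [mem_coe, mem_sigma, HasAntidiagonal.mem_antidiagonal] at h1 h2 h
      obtain ⟨-, rfl⟩ := h1
      obtain ⟨-, rfl⟩ := h2
      subst h
      rfl
    · rintro ⟨k, p⟩ h1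
      simp only [mem_coe, mem_sigma, HasAntidiagonal.mem_antidiagonal, mem_range, mem_product]
        at h1 ⊢
      omega
    · rintro ⟨a, b⟩ h1 h2
      have : N < a + b := by
        by_contra hc
        refine h2 ⟨⟨a + b, (a, b)⟩, ?_, rfl⟩
        simp only [mem_coe, mem_sigma, HasAntidiagonal.mem_antidiagonal, mem_range, and_true]
        omega
      rw [fRterm_eq, hb_pow_smul_free, PowerSeries.coeff_X_pow_mul', if_neg (by omega)]
  rw [Rmat, h, ← mkDa_apply, ← AlgHom.toLinearMap_apply, map_hsum]
  congr 1; funext m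
  rw [map_hsum]
  rfl

theorem kf_smul_hsum {n : ℕ} (p : MvPolynomial (Fin n × Bool) Qe) :
    (hsum fun k => kf k • mid n (PowerSeries.C (p ^ k))) = mid n (expH p) := by
  rw [mid_expH, hexp]
  congr 1; funext k
  rw [Algebra.smul_def, map_pow, map_pow, kf]

theorem hsum_mul_left_right {E : Type} [Ring E] [Algebra KK E] [HComp E] (u w : E) (f : ℕ → E) :
    u * hsum f * w = hsum fun k => u * f k * w :=
  (map_hsum ((LinearMap.mulRight KK w).comp (LinearMap.mulLeft KK u)) f)

/-- Summation over `n` turns `b^n ⊗ a^n / n!` into the exponential of `ħ b_0 a_1`. -/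
theorem Rmat_eq_hsum : Rmat = hsum fun m => qf m •
    (dz 0 Gen.y ^ m * mid 2 (expH (mb 0 * ma 1)) * dz 1 Gen.x ^ m) := by
  rw [Rmat_eq]
  congr 1; funext m
  rw [← kf_smul_hsum, hsum_mul_left_right, ← hsum_smul]
  congr 1; funext k
  rw [rTerm, mkD_smul, mul_smul, mul_smul_comm, smul_mul_assoc, mul_pow, map_mul, map_mul, map_mul,
    map_mul, map_mul, map_pow, map_pow, map_pow, map_pow, map_pow, map_pow, map_pow, map_pow,
    mid_a, mid_b]
  simp only [mul_assoc]
  rfl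

/-- The inverse of the `R`-matrix. -/
def RmatInv : DD 2 := hsum fun m => ((-1) ^ m * qf m) •
  (dz 0 Gen.y ^ m * mid 2 (expH (-(m.choose 2 • me) + m • mb 0 + m • (me * ma 1) - mb 0 * ma 1)) *
    dz 1 Gen.x ^ m)

/-- In the product of the summands `m` and `n`, everything except a sign and `q^{m(m-1)/2} / ([m]!
[n]!)` depends on `m + n` alone. Hence `sum_qf_alternating` leaves only the term with `m + n = 0`.
-/
theorem Rmat_mul_RmatInv : Rmat * RmatInv = 1 := by
  have h10 : (1 : Fin 2) ≠ 0 := by decide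
  have h01 : (0 : Fin 2) ≠ 1 := by decide
  rw [Rmat_eq_hsum, RmatInv, hsum_mul_hsum]
  have key : ∀ N : ℕ, ∀ p ∈ antidiagonal N,
      (qf p.1 • (dz 0 Gen.y ^ p.1 * mid 2 (expH (mb 0 * ma 1)) * dz 1 Gen.x ^ p.1)) *
      (((-1) ^ p.2 * qf p.2) • (dz 0 Gen.y ^ p.2 * mid 2 (expH (-(p.2.choose 2 • me) + p.2 • mb 0 +
        p.2 • (me * ma 1) - mb 0 * ma 1)) * dz 1 Gen.x ^ p.2)) =
      (-1 : KK) ^ N • (((-1) ^ p.1 * qf p.1 * qf p.2 * q ^ (p.1.choose 2)) •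
        (dz 0 Gen.y ^ N * mid 2 (expH (N • mb 0 - N.choose 2 • me)) * dz 1 Gen.x ^ N)) := by
    rintro N ⟨m, n⟩ hp
    rw [HasAntidiagonal.mem_antidiagonal] at hp
    dsimp only at hp ⊢
    subst hp
    have e1 : ∀ G, dz (0 : Fin 2) Gen.y ^ m * mid 2 (expH (mb 0 * ma 1)) * dz 1 Gen.x ^ m *
        (dz 0 Gen.y ^ n * mid 2 G * dz 1 Gen.x ^ n) = dz 0 Gen.y ^ (m + n) *
        mid 2 (shMm 0 n (expH (mb 0 * ma 1)) * shMm 1 m G) * dz 1 Gen.x ^ (m + n) := by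
      intro G
      rw [← mul_assoc, ← mul_assoc, mul_assoc _ (dz 1 Gen.x ^ m),
        ((dz_comm h10 Gen.x Gen.y).pow_pow m n).eq, ← mul_assoc, mul_assoc _ (dz 1 Gen.x ^ m),
        x_pow_mid, mul_assoc (dz 0 Gen.y ^ m), mid_y_pow, ← mul_assoc (dz 0 Gen.y ^ m), ← pow_add,
        mul_assoc, mul_assoc (mid 2 (shMm 1 m G)), ← pow_add, ← mul_assoc,
        mul_assoc (dz 0 Gen.y ^ (m + n)), ← map_mul]
    rw [smul_mul_smul_comm, e1, shMm_expH, shMm_expH, ← expH_add]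
    -- The terms in `b_0 a_1` cancel, and the shifts produced by the powers of `y_0` and `x_1`
    -- complete the triangular number of `m + n`.
    have e2 : shPm 0 n (mb 0 * ma 1) + shPm 1 m (-(n.choose 2 • me) + n • mb 0 +
        n • (me * ma 1) - mb 0 * ma 1) = m.choose 2 • MvPolynomial.C eps +
          ((m + n) • mb 0 - (m + n).choose 2 • (me : MvPolynomial (Fin 2 × Bool) Qe)) := by
      simp only [map_add, map_sub, map_neg, map_nsmul, map_mul, me, shPm_C, shPm_b, shPm_a,
        shPm_a_of_ne h10, shPm_b_of_ne h01, choose_two_add]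
      simp only [nsmul_eq_mul]
      push_cast
      ring
    rw [e2, ← q_pow_smul_expH, map_smul, mul_smul_comm, smul_mul_assoc, smul_smul, smul_smul]
    refine congrArg (· • _) ?_
    have : (-1 : KK) ^ (m + n) * (-1) ^ m = (-1) ^ n := by
      rw [← pow_add, show m + n + m = n + 2 * m by ring, pow_add, pow_mul]; simp
    rw [← this]; ring
  have h0 : ∀ N : ℕ, (∑ p ∈ antidiagonal N,
      (qf p.1 • (dz 0 Gen.y ^ p.1 * mid 2 (expH (mb 0 * ma 1)) * dz 1 Gen.x ^ p.1)) *
      (((-1) ^ p.2 * qf p.2) • (dz 0 Gen.y ^ p.2 * mid 2 (expH (-(p.2.choose 2 • me) + p.2 • mb 0 +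
        p.2 • (me * ma 1) - mb 0 * ma 1)) * dz 1 Gen.x ^ p.2))) = if N = 0 then 1 else 0 := by
    intro N
    rw [sum_congr rfl (key N), ← smul_sum, ← sum_smul]
    split_ifs with h
    · subst h
      simp [qf_zero, expH_zero]
    · rw [sum_qf_alternating h, zero_smul, smul_zero]
  simp only [h0]
  rw [hsum_of_forall_pos (by simp)]
  rfl

theorem exists_unit_Rmat : ∃ u : (DD 2)ˣ, (u : DD 2) = Rmat ∧
    ((u⁻¹ : (DD 2)ˣ) : DD 2) = RmatInv := by
  refine exists_unit_of_mul_eq_one ?_ Rmat_mul_RmatInv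
  rw [Rmat_eq_hsum]
  refine hsum_eq_one_add _ ?_
  simpa [qf_zero] using mid_expH_eq_one_add (n := 2) _

/-! ### The spinner and the ribbon element -/

/-- Half the exponent of `A B`. -/
def halfW : MvPolynomial (Fin 1 × Bool) Qe := MvPolynomial.C (Polynomial.C (1 / 2)) * wM 0 0

theorem two_mul_halfW : 2 * halfW = wM 0 0 := by
  rw [halfW, ← mul_assoc]
  have : (2 : MvPolynomial (Fin 1 × Bool) Qe) * MvPolynomial.C (Polynomial.C (1 / 2)) = 1 := by
    have h2 : (2 : MvPolynomial (Fin 1 × Bool) Qe) = MvPolynomial.C (Polynomial.C 2) := by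
      rw [map_ofNat, map_ofNat]
    rw [h2, ← map_mul, ← map_mul]; norm_num
  rw [this, one_mul]

theorem spinner_eq : spinner = mid 1 (expH halfW) := by
  rw [spinner, ← mid_expH_a, ← mid_expH_b, ← map_mul, ← expH_add]
  refine congrArg (fun p => mid 1 (expH p)) ?_
  rw [halfW, wM, zero_smul, map_mul, me]
  ring

theorem exists_unit_spinner : ∃ u : (DD 1)ˣ, (u : DD 1) = spinner ∧
    ((u⁻¹ : (DD 1)ˣ) : DD 1) = mid 1 (expH (-halfW)) := by
  have h1 : mid 1 (expH halfW) * mid 1 (expH (-halfW)) = 1 := by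
    rw [← map_mul, expH_mul_neg, map_one]
  exact ⟨⟨mid 1 (expH halfW), mid 1 (expH (-halfW)), h1, by rw [mid_commute, h1]⟩, spinner_eq.symm,
    rfl⟩

/-- The summand of the series `∑ (-1)^k [i+k choose k] q^{-k(k+1)/2-ik} V^{-k} (V; q)_k` for
`V = q^p A B`. -/
def ribTerm (i p k : ℕ) : Mid 1 := ((-1) ^ k * (qFact (i + k) * qf k * qf i)) •
  (expH (-(((k + 1).choose 2 + i * k) • me) - k • wM 0 p) * hProd 0 p k)

theorem hb_smul_hq_mid {n : ℕ} (p : MvPolynomial (Fin n × Bool) Qe) :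
    (hb • hq p : Mid n) = 1 - expH p := by rw [X_pow_smul_PS, X_mul_hq]

/-- The `q`-Pascal rule for the binomial coefficient of `i + k + 2` over `k + 1`, multiplied out of
`[i + k + 2] = [k + 1] + q^{k+1} [i + 1]`. -/
theorem qFact_Pascal (i k : ℕ) : qFact (i + 1 + (k + 1)) * qf (k + 1) * qf (i + 1) =
    q ^ (k + 1) * (qFact (i + (k + 1)) * qf (k + 1) * qf i) +
      qFact (i + 1 + k) * qf k * qf (i + 1) := by
  rw [← qInt_mul_qf i, ← qInt_mul_qf k, show i + 1 + (k + 1) = (i + k + 1) + 1 by ring, qFact_succ,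
    show i + (k + 1) = i + k + 1 by ring, show i + 1 + k = i + k + 1 by ring,
    show i + k + 1 + 1 = (k + 1) + (i + 1) by ring, qInt_add]
  ring

/-- The second summand has the same exponential and the same product as the first, so that only the
binomial coefficients have to be added by the `q`-Pascal rule. -/
theorem ribTerm_succ_succ (i p k : ℕ) : ribTerm (i + 1) p (k + 1) +
    hq (wM 0 p) * expH (-((i + 2) • me) - wM 0 p) * ribTerm (i + 1) (p + 1) k =
      ribTerm i p (k + 1) := by
  have e1 : expH (-(((k + 2).choose 2 + (i + 1) * (k + 1)) • me) - (k + 1) • wM 0 p) *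
      hProd 0 p (k + 1) =
      hq (wM (0 : Fin 1) p) * expH (-((i + 2) • me) - wM 0 p) *
        (expH (-(((k + 1).choose 2 + (i + 1) * k) • me) - k • wM 0 (p + 1)) *
          hProd 0 (p + 1) k) := by
    rw [hProd_succ']
    have : expH (-(((k + 2).choose 2 + (i + 1) * (k + 1)) • me) - (k + 1) • wM (0 : Fin 1) p) =
      expH (-((i + 2) • me) - wM 0 p) *
        expH (-(((k + 1).choose 2 + (i + 1) * k) • me) - k • wM 0 (p + 1)) := by
      rw [← expH_add]
      refine congrArg expH ?_
      rw [Nat.choose_succ_succ' (k + 1), Nat.choose_one_right, wM_eq 0 (p + 1), wM_eq 0 p]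
      simp only [nsmul_eq_mul]
      push_cast
      ring
    rw [this]
    ring
  have e2 : expH (-(((k + 2).choose 2 + i * (k + 1)) • me) - (k + 1) • wM (0 : Fin 1) p) =
      q ^ (k + 1) • expH (-(((k + 2).choose 2 + (i + 1) * (k + 1)) • me) - (k + 1) • wM 0 p) := by
    rw [q_pow_smul_expH, ← me]
    refine congrArg expH ?_
    simp only [nsmul_eq_mul]
    push_cast
    ring
  rw [ribTerm, ribTerm, ribTerm, mul_smul_comm, ← e1, e2, smul_mul_assoc, smul_smul, ← add_smul,
    qFact_Pascal]
  refine congrArg (· • _) ?_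
  rw [pow_succ]
  ring

theorem ribTerm_zero_succ (p k : ℕ) : ribTerm 0 p (k + 1) +
    hq (wM 0 p) * expH (-(1 • me) - wM 0 p) * ribTerm 0 (p + 1) k = 0 := by
  have e : expH (-(((k + 2).choose 2 + 0 * (k + 1)) • me) - (k + 1) • wM (0 : Fin 1) p) =
      expH (-(1 • me) - wM 0 p) *
        expH (-(((k + 1).choose 2 + 0 * k) • me) - k • wM 0 (p + 1)) := by
    rw [← expH_add]
    refine congrArg expH ?_
    rw [Nat.choose_succ_succ' (k + 1), Nat.choose_one_right, wM_eq 0 (p + 1), wM_eq 0 p]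
    simp only [nsmul_eq_mul]
    push_cast
    ring
  have e' : expH (-(1 • me) - wM 0 p) * expH (-(((k + 1).choose 2 + 0 * k) • me) -
      k • wM (0 : Fin 1) (p + 1)) * (hq (wM 0 p) * hProd 0 (p + 1) k) =
      hq (wM 0 p) * expH (-(1 • me) - wM 0 p) * (expH (-(((k + 1).choose 2 + 0 * k) • me) -
      k • wM 0 (p + 1)) * hProd 0 (p + 1) k) := by ring
  rw [ribTerm, ribTerm, hProd_succ', e, mul_smul_comm, e', ← add_smul, zero_add, zero_add,
    qFact_mul_qf, qFact_mul_qf, qf_zero, pow_succ]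
  have : ∀ c : KK, c * -1 * (1 * 1) + c * (1 * 1) = 0 := fun c => by ring
  rw [this, zero_smul]

theorem ribTerm_zero (i p : ℕ) : ribTerm i p 0 = 1 := by
  simp [ribTerm, hProd, qf_zero, qFact_mul_qf, expH_zero]

/-- A recursion modulo powers of `ħ` has at most one solution. -/
theorem eq_of_hb_rec {M : Type} [AddCommGroup M] [Module KK M] [HComp M] {S V U : ℕ → M}
    {T : ℕ → M →ₗ[KK] M} (hS : ∀ p, S p + hb • T p (S (p + 1)) = U p)
    (hV : ∀ p, V p + hb • T p (V (p + 1)) = U p) (p : ℕ) : S p = V p := by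
  rw [← sub_eq_zero]
  refine HComp.sep _ fun N => ?_
  induction N generalizing p with
  | zero => exact ⟨S p - V p, by simp⟩
  | succ N ih =>
    obtain ⟨y, hy⟩ := ih (p + 1)
    refine ⟨-T p y, ?_⟩
    rw [pow_succ', mul_smul, smul_neg, smul_neg, ← map_smul, ← hy, map_sub, smul_sub,
      eq_sub_of_add_eq (hS p), eq_sub_of_add_eq (hV p)]
    abel

/-- With `V = q^p A B`, both sides satisfy `S_i(V) + (1 - V) q^{-(i+1)} V⁻¹ S_i(q V) = S_{i-1}(V)`,
where `S_{-1} = 1`. Since `1 - V` is divisible by `ħ`, iterating the recursion gains powers of `ħ`,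
so its solution is unique (`eq_of_hb_rec`). -/
theorem hsum_ribTerm (i p : ℕ) : (hsum fun k => ribTerm i p k) = expH ((i + 1) • wM 0 p) := by
  have hadd : ∀ (g : Mid 1) (f f' : ℕ → Mid 1), hsum f + g * hsum f' =
      hsum fun k => f k + g * f' k := by
    intro g f f'
    rw [hsum_add]
    exact congrArg _ (map_hsum (LinearMap.mulLeft KK g) f')
  have hE : ∀ (i p : ℕ), expH (-((i + 1) • me) - wM 0 p) * expH ((i + 1) • wM (0 : Fin 1) (p + 1)) =
      expH (i • wM 0 p) := by
    intro i p
    rw [← expH_add]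
    refine congrArg expH ?_
    rw [wM_eq 0 (p + 1), wM_eq 0 p]
    simp only [nsmul_eq_mul]
    push_cast
    ring
  have hV : ∀ i p : ℕ, expH ((i + 1) • wM (0 : Fin 1) p) + hb • LinearMap.mulLeft KK (hq (wM 0 p) *
      expH (-((i + 1) • me) - wM 0 p)) (expH ((i + 1) • wM 0 (p + 1))) = expH (i • wM 0 p) := by
    intro i p
    rw [LinearMap.mulLeft_apply, mul_assoc, hE, ← smul_mul_assoc, hb_smul_hq_mid, add_smul,
      one_smul, expH_add]
    ring
  induction i generalizing p with
  | zero =>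
    refine eq_of_hb_rec (S := fun p => hsum fun k => ribTerm 0 p k) (fun p => ?_) (hV 0) p
    rw [LinearMap.mulLeft_apply, hsum_succ, ribTerm_zero, zero_smul, expH_zero, add_assoc,
      ← smul_add, hadd]
    simp only [zero_add, ribTerm_zero_succ, hsum_zero, smul_zero, add_zero]
  | succ i ih =>
    refine eq_of_hb_rec (S := fun p => hsum fun k => ribTerm (i + 1) p k) (fun p => ?_)
      (hV (i + 1)) p
    rw [LinearMap.mulLeft_apply, hsum_succ, ribTerm_zero, ← ih, hsum_succ fun k => ribTerm i p k,
      ribTerm_zero, add_assoc, ← smul_add, hadd]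
    simp only [ribTerm_succ_succ]

theorem place_fz {n : ℕ} (i : Fin n) (g : Gen) : place i (fz 0 g) = fz i g := by
  rw [place, fz, PowerSeries.map_C, fz]
  refine congrArg PowerSeries.C ?_
  exact FreeAlgebra.lift_ι_apply (fun p : Fin 1 × Gen => nc i p.2) _

theorem rTerm_eq (m n : ℕ) : rTerm m n = (qf m * kf n) •
    (place 0 (fz 0 Gen.y ^ m * fz 0 Gen.b ^ n) * place 1 (fz 0 Gen.a ^ n * fz 0 Gen.x ^ m)) := by
  simp only [rTerm, map_mul, map_pow, place_fz, mul_assoc]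

/-- The exponent of the middle part of the Drinfeld element. -/
def uExp (m : ℕ) : MvPolynomial (Fin 1 × Bool) Qe := -((ma 0 - m • 1) * mb 0)

/-- The factor `(-a)^n` from `S(a^n)` moves past `y^m`, becoming `(-(a - m))^n`; together with `b^n
/ n!` it sums to the exponential of `-ħ (a - m) b`. -/
theorem antiMulD_Rmat_eq : antiMulD Rmat = hsum fun m => ((-1) ^ m * qf m) •
    (mid 1 (expH (m • (me * ma 0) - (m + 1).choose 2 • me)) * (dz 0 Gen.x ^ m * dz 0 Gen.y ^ m) *
      mid 1 (expH (uExp m))) := by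
  rw [Rmat_eq, map_hsum]
  congr 1; funext m
  rw [map_hsum, ← kf_smul_hsum (uExp m), ← mul_one (_ * hsum _), hsum_mul_left_right, ← hsum_smul]
  congr 1; funext k
  have h1 : antiD (mkD 1 (fz 0 Gen.a ^ k * fz 0 Gen.x ^ m)) *
      mkD 1 (fz 0 Gen.y ^ m * fz 0 Gen.b ^ k)
      = (-1 : KK) ^ m • (mid 1 (expH (m • (me * ma 0) - (m + 1).choose 2 • me)) *
        (dz 0 Gen.x ^ m * dz 0 Gen.y ^ m) * mid 1 (PowerSeries.C (uExp m ^ k))) := by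
    rw [map_mul (mkD 1), map_mul (mkD 1), map_pow (mkD 1), map_pow (mkD 1), map_pow (mkD 1),
      map_pow (mkD 1)]
    change antiD (dz 0 Gen.a ^ k * dz 0 Gen.x ^ m) * (dz 0 Gen.y ^ m * dz 0 Gen.b ^ k) = _
    rw [antiD_mul, antiD_pow, antiD_pow, antiD_dz, antiD_dz, antiGen, antiGen, neg_pow,
      x_mul_mid_pow, ← mid_a, ← mid_b, ← map_neg, ← map_neg, ← map_pow, ← map_pow, ← map_pow,
      ← map_pow]
    rw [mul_assoc, ← mul_assoc (mid 1 (PowerSeries.C ((-ma 0) ^ k))), mid_y_pow, shMm_C, map_pow,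
      map_neg, shPm_a, mul_assoc (dz 0 Gen.y ^ m), ← map_mul, ← map_mul, ← mul_pow,
      Algebra.smul_def ((-1 : KK) ^ m), map_pow (algebraMap KK (DD 1)),
          map_neg (algebraMap KK (DD 1)),
      map_one (algebraMap KK (DD 1))]
    have : -(ma 0 - m • 1) * mb 0 = uExp m := by rw [uExp]; ring
    rw [this]
    simp only [mul_assoc]
  rw [rTerm_eq, mkD_smul, map_smul, isAntipodeMulOp_antiMulD, h1, smul_smul, mul_one,
    mul_smul_comm, smul_smul]
  exact congrArg (· • _) (by ring)

theorem sum_triples_diag {M : Type} [AddCommMonoid M] (m : ℕ) (f : ℕ × ℕ × ℕ → M) :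
    ∑ t ∈ triples m m, f t = ∑ c ∈ antidiagonal m, f (c.1, c.1, c.2) := by
  symm
  refine sum_nbij' (fun c => (c.1, c.1, c.2)) (fun t => (t.1, t.2.2)) ?_ ?_ ?_ ?_ ?_
  · intro c h
    rw [HasAntidiagonal.mem_antidiagonal] at h
    exact mem_triples.2 ⟨h, h⟩
  · rintro ⟨a, b, k⟩ h
    exact HasAntidiagonal.mem_antidiagonal.2 (mem_triples.1 h).1
  · intros; rfl
  · rintro ⟨a, b, k⟩ h
    have := mem_triples.1 h
    dsimp only at this ⊢
    rw [show a = b by omega]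
  · intros; rfl

theorem shMm_uExp (i m : ℕ) : shPm 0 i (uExp m) = -((ma 0 - i • 1 - m • 1) * (mb 0 - i • me)) := by
  rw [uExp]
  simp only [map_neg, map_mul, map_sub, map_nsmul, map_one, shPm_a, shPm_b]

/-- The Drinfeld element in normal order. -/
theorem antiMulD_Rmat_normal : antiMulD Rmat = hsum fun i => ((-1) ^ i * qf i) •
    (dz 0 Gen.y ^ i * mid 1 (expH (-(ma 0 * mb 0) + wM 0 0 - i • wM 0 0 + i • me -
      i.choose 2 • me)) * dz 0 Gen.x ^ i) := by
  -- The part of `x^{i+k} y^{i+k}` with `i` surviving pairs and `k` contractions. The contractions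
  -- start at `V = q^{2i} A B`, so that at fixed `i` the sum over `k` is given by `hsum_ribTerm`.
  let τ : ℕ → ℕ → DD 1 := fun i k => ((-1) ^ i * qf i) • (dz 0 Gen.y ^ i * mid 1 (
    expH ((i * i) • me + (-(ma 0 * mb 0) - (2 * i) • wM 0 0 - ((i + 1).choose 2 + 3 * (i * i)) • me)) *
      ribTerm i (2 * i) k) * dz 0 Gen.x ^ i)
  have hτ : ∀ i, hsum (τ i) = ((-1) ^ i * qf i) •
    (dz 0 Gen.y ^ i * mid 1 (expH (-(ma 0 * mb 0) + wM 0 0 - i • wM 0 0 + i • me -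
      i.choose 2 • me)) * dz 0 Gen.x ^ i) := by
    intro i
    dsimp only [τ]
    simp only [map_mul, ← mul_assoc (dz 0 Gen.y ^ i)]
    rw [hsum_smul, ← hsum_mul_left_right]
    have h1 : (hsum fun k => mid 1 (ribTerm i (2 * i) k)) =
        mid 1 (expH ((i + 1) • wM 0 (2 * i))) := by
      rw [← hsum_ribTerm]
      exact (map_hsum (mid 1).toLinearMap _).symm
    rw [h1, mul_assoc (dz 0 Gen.y ^ i), ← map_mul, ← expH_add]
    refine congrArg (fun p => _ • (dz 0 Gen.y ^ i * mid 1 (expH p) * dz 0 Gen.x ^ i)) ?_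
    rw [wM_eq 0 (2 * i), Nat.choose_succ_succ' i, Nat.choose_one_right]
    simp only [nsmul_eq_mul]
    push_cast
    ring
  have key : ∀ m : ℕ, ((-1) ^ m * qf m) •
    (mid 1 (expH (m • (me * ma 0) - (m + 1).choose 2 • me)) * (dz 0 Gen.x ^ m * dz 0 Gen.y ^ m) *
      mid 1 (expH (uExp m))) = ∑ c ∈ antidiagonal m, τ c.1 c.2 := by
    intro m
    rw [pow_eq_dp (dz 0 Gen.x), pow_eq_dp (dz 0 Gen.y), smul_mul_smul_comm, dp_x_mul_dp_y,
      sum_triples_diag, smul_sum, mul_sum, sum_mul, smul_sum]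
    refine sum_congr rfl fun c hc => ?_
    rw [HasAntidiagonal.mem_antidiagonal] at hc
    obtain ⟨i, k⟩ := c
    dsimp only at hc ⊢
    subst hc
    dsimp only [τ]
    have e1 : ∀ H : Mid 1, mid 1 (expH ((i + k) • (me * ma 0) - (i + k + 1).choose 2 • me)) *
        (dz 0 Gen.y ^ i * mid 1 H * dz 0 Gen.x ^ i) * mid 1 (expH (uExp (i + k))) =
        dz 0 Gen.y ^ i * mid 1 (expH (shPm 0 i ((i + k) • (me * ma 0) - (i + k + 1).choose 2 • me) +
          shPm 0 i (uExp (i + k))) * H) * dz 0 Gen.x ^ i := by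
      intro H
      rw [← mul_assoc, ← mul_assoc, mid_y_pow, mul_assoc _ (dz 0 Gen.x ^ i), x_pow_mid, ← mul_assoc,
        mul_assoc (dz 0 Gen.y ^ i), mul_assoc (dz 0 Gen.y ^ i), ← map_mul, ← map_mul, shMm_expH,
        shMm_expH, mul_right_comm, ← expH_add]
    have e2 : shPm 0 i ((i + k) • (me * ma 0) - (i + k + 1).choose 2 • me) +
          shPm 0 i (uExp (i + k)) = (-(ma 0 * mb 0) - (2 * i) • wM 0 0 -
            ((i + 1).choose 2 + 3 * (i * i)) • me) +
          (-(((k + 1).choose 2 + i * k) • me) - k • wM 0 (2 * i)) := by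
      rw [shMm_uExp]
      simp only [map_sub, map_nsmul, map_mul, me, shPm_C, shPm_a]
      rw [wM_eq 0 (2 * i), show i + k + 1 = i + (k + 1) by ring, choose_two_add, wM,
        Nat.choose_succ_succ' i, Nat.choose_one_right]
      simp only [nsmul_eq_mul, me]
      push_cast
      ring
    rw [dp, dp]
    simp only [smul_mul_assoc, mul_smul_comm, smul_smul]
    rw [e1, e2, me, ← q_pow_smul_expH, ← me, ribTerm, two_mul]
    simp only [smul_mul_assoc, mul_smul_comm, smul_smul, map_smul]
    rw [expH_add, mul_assoc (expH _) (expH _)]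
    refine congrArg (· • _) ?_
    have h3 : ∀ c : KK, qf (i + k) * (qFact (i + k) * qFact (i + k) * c) = qFact (i + k) * c := by
      intro c
      have := qFact_mul_qf (i + k)
      linear_combination (qFact (i + k) * c) * this
    rw [pow_add]
    linear_combination ((-1) ^ i * (-1) ^ k) * h3 (q ^ (i * i) * qf k * (qf i * qf i))
  rw [antiMulD_Rmat_eq]
  simp only [key, ← hτ]
  rw [hsum_hsum]

/-- The ribbon element in normal order. -/
def ribbon : DD 1 := hsum fun i => ((-1) ^ i * qf i) •
    (dz 0 Gen.y ^ i * mid 1 (expH (-(ma 0 * mb 0) + halfW - i • wM 0 0 - i.choose 2 • me)) *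
      dz 0 Gen.x ^ i)

/-- The inverse of the ribbon element in normal order. -/
def ribbonInv : DD 1 := hsum fun i => qf i •
    (dz 0 Gen.y ^ i * mid 1 (expH (ma 0 * mb 0 - halfW)) * dz 0 Gen.x ^ i)

theorem shPm_wM (i p : ℕ) : shPm (0 : Fin 1) i (wM 0 p) = wM 0 p + (2 * i) • me := by
  rw [wM, map_sub, map_sub, map_nsmul, map_mul, me, shPm_C, shPm_a, shPm_b]
  simp only [nsmul_eq_mul, me]
  push_cast
  ring

theorem shPm_halfW (i : ℕ) : shPm (0 : Fin 1) i halfW = halfW + i • me := by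
  have h2 : (MvPolynomial.C (Polynomial.C (1 / 2)) : MvPolynomial (Fin 1 × Bool) Qe) * 2 = 1 := by
    have h2 : (2 : MvPolynomial (Fin 1 × Bool) Qe) = MvPolynomial.C (Polynomial.C 2) := by
      rw [map_ofNat, map_ofNat]
    rw [h2, ← map_mul, ← map_mul]; norm_num
  rw [halfW, map_mul, shPm_C, shPm_wM]
  simp only [nsmul_eq_mul]
  push_cast
  linear_combination (i * me) * h2

/-- Moving `C⁻¹` past `y^i` costs `q^{-i}`, which cancels the power `q^i` in the Drinfeld element,
and halves the exponent of the free factor `A B`. -/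
theorem spinner_inv_mul : mid 1 (expH (-halfW)) * antiMulD Rmat = ribbon := by
  rw [antiMulD_Rmat_normal, ribbon, ← mul_one (_ * hsum _), hsum_mul_left_right]
  congr 1; funext i
  rw [mul_one, mul_smul_comm, ← mul_assoc, ← mul_assoc, mid_y_pow, mul_assoc (dz 0 Gen.y ^ i),
    ← map_mul, shMm_expH, ← expH_add, map_neg, shPm_halfW]
  refine congrArg (fun p => _ • (dz 0 Gen.y ^ i * mid 1 (expH p) * dz 0 Gen.x ^ i)) ?_
  rw [← two_mul_halfW]
  ring

/-- Moving `x` through the divided power of `y` gives `q^i A B` times the summand, and a contraction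
lowering `i`. After reindexing, the contraction acquires a factor `ħ` and becomes `1 - q^i A B`, so
the two parts add up. Of the centrality of the ribbon element only this is needed. -/
theorem x_mul_ribbonInv : dz 0 Gen.x * ribbonInv = ribbonInv * dz 0 Gen.x := by
  set E : Mid 1 := expH (ma 0 * mb 0 - halfW) with hE
  have hsh : shMm 0 1 E = expH (wM 0 0) * E := by
    rw [hE, shMm_expH, ← expH_add]
    refine congrArg expH ?_
    rw [map_sub, map_mul, shPm_a, shPm_b, shPm_halfW, wM]
    simp only [one_smul, zero_smul]
    ring
  have h1 : ribbonInv = hsum fun i => dp (dz 0 Gen.y) i * mid 1 E * dz 0 Gen.x ^ i := by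
    rw [ribbonInv]
    simp only [dp, smul_mul_assoc]
    rfl
  have hl : dz 0 Gen.x * ribbonInv = hsum fun i =>
      dz 0 Gen.x * (dp (dz 0 Gen.y) i * mid 1 E * dz 0 Gen.x ^ i) := by
    rw [h1]; exact map_hsum (LinearMap.mulLeft KK (dz 0 Gen.x)) _
  have hr : ribbonInv * dz 0 Gen.x = hsum fun i =>
      (dp (dz 0 Gen.y) i * mid 1 E * dz 0 Gen.x ^ i) * dz 0 Gen.x := by
    rw [h1]; exact map_hsum (LinearMap.mulRight KK (dz 0 Gen.x)) _
  have hx : ∀ i, dz 0 Gen.x * (dp (dz 0 Gen.y) i * mid 1 E * dz 0 Gen.x ^ i) =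
      dp (dz 0 Gen.y) i * mid 1 (q ^ i • (expH (wM 0 0) * E)) * dz 0 Gen.x ^ (i + 1) +
      if i = 0 then 0 else dp (dz 0 Gen.y) (i - 1) * mid 1 (hq (wM 0 (i - 1)) * E) *
          dz 0 Gen.x ^ i := by
    intro i
    cases i with
    | zero =>
      simp only [dp_zero, one_mul, pow_zero, mul_one, one_smul, if_true, add_zero, zero_add,
          pow_one]
      rw [mid_x_comm, hsh]
    | succ i =>
      rw [← mul_assoc, ← mul_assoc, x_mul_dp_y, add_mul, add_mul, smul_mul_assoc,
        mul_assoc _ (dz 0 Gen.x) (mid 1 E), mid_x_comm, hsh, if_neg (Nat.succ_ne_zero i),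
        Nat.add_sub_cancel, map_mul (mid 1) (hq _), ← mul_assoc (dp _ i),
            ← mul_assoc (dp _ (i + 1)),
        smul_mul_assoc, mul_assoc _ (dz 0 Gen.x), ← pow_succ', map_smul, mul_smul_comm,
        smul_mul_assoc]
  rw [hl, hr]
  simp only [hx]
  -- The contraction terms begin at `i = 1`; the shift of the index supplies the factor `ħ`.
  rw [hsum_add, hsum_shift (f := fun i => if i = 0 then 0 else dp (dz 0 Gen.y) (i - 1) *
    mid 1 (hq (wM 0 (i - 1)) * E) * dz 0 Gen.x ^ i) (by simp), ← hsum_smul, ← hsum_add]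
  congr 1; funext i
  have hs : ∀ (u w : DD 1) (g : Mid 1), hb • (u * mid 1 g * w) = u * mid 1 (hb • g) * w := by
    intro u w g
    rw [map_smul, mul_smul_comm, smul_mul_assoc]
  rw [if_neg (Nat.succ_ne_zero i), Nat.add_sub_cancel, hs, ← add_mul, ← mul_add, ← map_add,
      mul_assoc, mul_assoc, ← pow_succ, ← mul_assoc]
  refine congrArg (fun g => dp (dz 0 Gen.y) i * mid 1 g * dz 0 Gen.x ^ (i + 1)) ?_
  rw [← smul_mul_assoc, ← smul_mul_assoc, hb_smul_hq_mid, ← add_mul, q_pow_smul_expH, ← me, ← wM_eq]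
  ring

/-- Since `x` commutes with the second factor, the powers of `x` can be collected on the right with
no contraction. As for `R`, the summands then depend on `i + j` except for an alternating
`q`-binomial coefficient. -/
theorem ribbon_mul_ribbonInv : ribbon * ribbonInv = 1 := by
  have hcomm : ∀ i : ℕ, dz 0 Gen.x ^ i * ribbonInv = ribbonInv * dz 0 Gen.x ^ i := fun i =>
    (Commute.pow_left x_mul_ribbonInv i)
  rw [ribbon, ← one_mul (hsum _), hsum_mul_left_right]
  have h1 : ∀ i : ℕ, 1 * (((-1) ^ i * qf i) • (dz 0 Gen.y ^ i *
      mid 1 (expH (-(ma 0 * mb 0) + halfW - i • wM 0 0 - i.choose 2 • me)) * dz 0 Gen.x ^ i)) *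
        ribbonInv = hsum fun j => ((-1 : KK) ^ i * qf i * qf j * q ^ (i.choose 2)) •
        (dz 0 Gen.y ^ (i + j) * mid 1 (expH ((i + j) • me - ((i + j) * (i + j)) • me -
          (i + j) • wM 0 0)) * dz 0 Gen.x ^ (i + j)) := by
    intro i
    rw [one_mul, smul_mul_assoc, mul_assoc, hcomm, ← mul_assoc, ribbonInv, hsum_mul_left_right,
      ← hsum_smul]
    congr 1; funext j
    have e : shPm 0 j (-(ma 0 * mb 0) + halfW - i • wM 0 0 - i.choose 2 • me) +
        (ma 0 * mb 0 - halfW) = i.choose 2 • MvPolynomial.C eps + ((i + j) • me -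
          ((i + j) * (i + j)) • me - (i + j) • wM (0 : Fin 1) 0) := by
      rw [map_sub, map_sub, map_add, map_neg, map_mul, map_nsmul, map_nsmul, shPm_a, shPm_b,
        shPm_halfW, shPm_wM, me, shPm_C]
      have := two_mul_choose_two (A := MvPolynomial (Fin 1 × Bool) Qe) i
      rw [wM, me]
      simp only [nsmul_eq_mul]
      push_cast
      linear_combination (-MvPolynomial.C eps) * this
    have e3 : ∀ f g : Mid 1,
        dz 0 Gen.y ^ i * mid 1 f * (dz 0 Gen.y ^ j * mid 1 g * dz 0 Gen.x ^ j) *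
        dz 0 Gen.x ^ i = dz 0 Gen.y ^ (i + j) * mid 1 (shMm 0 j f * g) * dz 0 Gen.x ^ (i + j) := by
      intro f g
      simp only [mul_assoc]
      rw [← mul_assoc (mid 1 f), mid_y_pow, ← pow_add, add_comm j i]
      simp only [mul_assoc]
      rw [← mul_assoc (mid 1 _) (mid 1 _), ← map_mul, ← mul_assoc (dz 0 Gen.y ^ i), ← pow_add]
    rw [mul_smul_comm, smul_mul_assoc, smul_smul, e3, shMm_expH, ← expH_add, e, ← q_pow_smul_expH,
      map_smul, mul_smul_comm, smul_mul_assoc, smul_smul]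
  simp only [h1]
  rw [hsum_hsum]
  have h0 : ∀ N : ℕ, (∑ p ∈ antidiagonal N,
      ((-1 : KK) ^ p.1 * qf p.1 * qf p.2 * q ^ (p.1.choose 2)) •
        (dz (0 : Fin 1) Gen.y ^ (p.1 + p.2) * mid 1 (expH ((p.1 + p.2) • me -
          ((p.1 + p.2) * (p.1 + p.2)) • me - (p.1 + p.2) • wM 0 0)) * dz 0 Gen.x ^ (p.1 + p.2))) =
      if N = 0 then 1 else 0 := by
    intro N
    have : ∀ p ∈ antidiagonal N, ((-1 : KK) ^ p.1 * qf p.1 * qf p.2 * q ^ (p.1.choose 2)) •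
        (dz (0 : Fin 1) Gen.y ^ (p.1 + p.2) * mid 1 (expH ((p.1 + p.2) • me -
          ((p.1 + p.2) * (p.1 + p.2)) • me - (p.1 + p.2) • wM 0 0)) * dz 0 Gen.x ^ (p.1 + p.2)) =
        ((-1 : KK) ^ p.1 * qf p.1 * qf p.2 * q ^ (p.1.choose 2)) •
        (dz (0 : Fin 1) Gen.y ^ N * mid 1 (expH (N • me -
          (N * N) • me - N • wM 0 0)) * dz 0 Gen.x ^ N) := by
      intro p hp
      rw [HasAntidiagonal.mem_antidiagonal.1 hp]
    rw [sum_congr rfl this, ← sum_smul]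
    split_ifs with h
    · subst h
      simp [qf_zero, expH_zero]
    · rw [sum_qf_alternating h, zero_smul]
  simp only [h0]
  rw [hsum_of_forall_pos (by simp)]
  rfl

theorem exists_unit_ribbon : ∃ u : (DD 1)ˣ, (u : DD 1) = ribbon ∧
    ((u⁻¹ : (DD 1)ˣ) : DD 1) = ribbonInv := by
  refine exists_unit_of_mul_eq_one ?_ ribbon_mul_ribbonInv
  refine hsum_eq_one_add _ ?_
  simpa [qf_zero] using mid_expH_eq_one_add (n := 1) _

/-! ### Exponentials and evaluation of series in filtered rings -/

/-- A topological commutative `ℚ`-algebra with a filtration such that families tending to zero in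
the filtration are summable. -/
class FilRing (A : Type) [CommRing A] [Algebra ℚ A] [TopologicalSpace A] where
  /-- the filtration -/
  Fil : ℕ → Ideal A
  fil_zero : Fil 0 = ⊤
  fil_mul : ∀ {m n : ℕ} {x y : A}, x ∈ Fil m → y ∈ Fil n → x * y ∈ Fil (m + n)
  summable : ∀ {ι : Type} (f : ι → A) (w : ι → ℕ), (∀ N, {i | w i < N}.Finite) →
    (∀ i, f i ∈ Fil (w i)) → Summable f

section filRing
open FilRing
variable {A : Type} [CommRing A] [Algebra ℚ A] [TopologicalSpace A] [IsTopologicalRing A]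
  [T2Space A] [FilRing A]

theorem fil_zero_mem (x : A) : x ∈ Fil (A := A) 0 := by rw [fil_zero]; trivial

theorem fil_mul_left {n : ℕ} (x : A) {y : A} (hy : y ∈ Fil (A := A) n) :
    x * y ∈ Fil (A := A) n := Ideal.mul_mem_left _ _ hy

theorem fil_mul_right {n : ℕ} (x : A) {y : A} (hy : y ∈ Fil (A := A) n) :
    y * x ∈ Fil (A := A) n := Ideal.mul_mem_right _ _ hy

theorem fil_smul {n : ℕ} (c : ℚ) {y : A} (hy : y ∈ Fil (A := A) n) : c • y ∈ Fil (A := A) n := by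
  rw [Algebra.smul_def]; exact fil_mul_left _ hy

theorem fil_pow {x : A} (hx : x ∈ Fil (A := A) 1) (n : ℕ) : x ^ n ∈ Fil (A := A) n := by
  induction n with
  | zero => exact fil_zero_mem _
  | succ n ih => rw [pow_succ]; exact fil_mul ih hx

theorem fil_prod {c : Type} (t : Finset c) {f : c → A} {w : c → ℕ}
    (h : ∀ i, f i ∈ Fil (A := A) (w i)) : ∏ i ∈ t, f i ∈ Fil (A := A) (∑ i ∈ t, w i) := by
  classical
  induction t using Finset.induction_on with
  | empty => exact fil_zero_mem _
  | insert i t hi ih => rw [prod_insert hi, sum_insert hi]; exact fil_mul (h i) ih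

/-- The exponential series. -/
def cexp (g : A) : A := ∑' l : ℕ, ((l.factorial : ℚ)⁻¹) • g ^ l

theorem finite_lt_nat (N : ℕ) : {i : ℕ | i < N}.Finite := Set.finite_lt_nat N

theorem hasSum_cexp {g : A} (hg : g ∈ Fil (A := A) 1) :
    HasSum (fun l : ℕ => ((l.factorial : ℚ)⁻¹) • g ^ l) (cexp g) :=
  (FilRing.summable _ id finite_lt_nat fun l => fil_smul _ (fil_pow hg l)).hasSum

/-! ### Exponential series in several variables and polynomial functions of the summation indices.
-/

section multi
variable {c : Type} [Fintype c] [DecidableEq c]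

theorem finite_sum_lt (N : ℕ) : {i : c → ℕ | ∑ j, i j < N}.Finite := by
  refine (Fintype.piFinset fun _ : c => range N).finite_toSet.subset fun i hi => ?_
  simp only [mem_coe, Fintype.mem_piFinset, mem_range]
  exact fun j => lt_of_le_of_lt (single_le_sum (fun _ _ => Nat.zero_le _) (mem_univ j)) hi

/-- The monomial `∏ X_j^{i_j} / i_j!`. -/
def expMon (X : c → A) (i : c → ℕ) : A := ∏ j, (((i j).factorial : ℚ)⁻¹) • X j ^ i j

theorem expMon_mem {X : c → A} (hX : ∀ j, X j ∈ Fil (A := A) 1) (i : c → ℕ) :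
    expMon X i ∈ Fil (A := A) (∑ j, i j) := fil_prod _ fun j => fil_smul _ (fil_pow (hX j) _)

theorem hasSum_fiberwise_finset {β γ : Type} {f : β → A} {a : A} (hf : HasSum f a) (g : β → γ)
    (t : γ → Finset β) (ht : ∀ l b, b ∈ t l ↔ g b = l) : HasSum (fun l => ∑ b ∈ t l, f b) a := by
  refine ((Equiv.sigmaFiberEquiv g).hasSum_iff.mpr hf).sigma fun l => ?_
  exact (Equiv.hasSum_iff (Equiv.subtypeEquivRight fun b => (ht l b).symm :
    {b // g b = l} ≃ ((t l : Set β) : Type))).mpr (Finset.hasSum (t l) f)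

/-- The multinomial theorem identifies the part of total degree `l` of the multiple series with the
`l`-th term of the exponential series. -/
theorem hasSum_expMon {X : c → A} (hX : ∀ j, X j ∈ Fil (A := A) 1) :
    HasSum (expMon X) (cexp (∑ j, X j)) := by
  have hs : Summable (expMon X) := FilRing.summable _ _ finite_sum_lt (expMon_mem hX)
  have h1 := hasSum_fiberwise_finset hs.hasSum (fun i => ∑ j, i j) (fun l => piAntidiag univ l)
    (by intro l b; simp [mem_piAntidiag])
  have h2 := hasSum_cexp (g := ∑ j, X j) (Ideal.sum_mem _ fun j _ => hX j)
  have h3 : ∀ l : ℕ, ((l.factorial : ℚ)⁻¹) • (∑ j, X j) ^ l =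
      ∑ i ∈ piAntidiag univ l, expMon X i := by
    intro l
    rw [sum_pow_eq_sum_piAntidiag, smul_sum]
    refine sum_congr rfl fun i hi => ?_
    rw [mem_piAntidiag] at hi
    rw [expMon, Finset.prod_smul, ← nsmul_eq_mul, ← Nat.cast_smul_eq_nsmul ℚ, smul_smul]
    congr 1
    rw [Nat.multinomial, hi.1]
    rw [Nat.cast_div (by rw [← hi.1]; exact Nat.prod_factorial_dvd_factorial_sum _ _) (by
      exact_mod_cast (prod_pos fun j _ => Nat.factorial_pos (i j)).ne'), prod_inv_distrib]
    push_cast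
    have := Nat.factorial_ne_zero l
    field_simp
  simp only [h3] at h2
  rw [← h1.unique h2]
  exact hs.hasSum

theorem hasSum_mul_fil {β γ : Type} {f : β → A} {g : γ → A} {a b : A} (hf : HasSum f a)
    (hg : HasSum g b) (w : β → ℕ) (w' : γ → ℕ) (hw : ∀ N, {i | w i < N}.Finite)
    (hw' : ∀ N, {i | w' i < N}.Finite) (hfw : ∀ i, f i ∈ Fil (A := A) (w i))
    (hgw : ∀ i, g i ∈ Fil (A := A) (w' i)) :
    HasSum (fun p : β × γ => f p.1 * g p.2) (a * b) := by
  refine hf.mul hg (FilRing.summable _ (fun p => w p.1 + w' p.2) (fun N => ?_)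
    fun p => fil_mul (hfw _) (hgw _))
  refine ((hw N).prod (hw' N)).subset fun p hp => ?_
  have hp' : w p.1 + w' p.2 < N := hp
  exact ⟨show w p.1 < N by omega, show w' p.2 < N by omega⟩

theorem cexp_add {g h : A} (hg : g ∈ Fil (A := A) 1) (hh : h ∈ Fil (A := A) 1) :
    cexp (g + h) = cexp g * cexp h := by
  have h1 := hasSum_mul_fil (hasSum_cexp hg) (hasSum_cexp hh) id id finite_lt_nat finite_lt_nat
    (fun l => fil_smul _ (fil_pow hg l)) (fun l => fil_smul _ (fil_pow hh l))
  have h2 := hasSum_expMon (c := Bool) (X := fun b => if b then g else h)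
    (by intro j; cases j <;> simpa)
  rw [Fintype.sum_bool] at h2
  simp only [if_true] at h2
  -- Functions on `Bool` correspond to pairs with the value at `false` first, while `g` belongs to
  -- `true`; hence the negation.
  have e : (fun p : ℕ × ℕ => ((p.1.factorial : ℚ)⁻¹) • g ^ p.1 *
      ((p.2.factorial : ℚ)⁻¹) • h ^ p.2) =
      expMon (c := Bool) (fun b => if b then g else h) ∘ (Equiv.boolArrowEquivProd ℕ).symm.trans
        (Equiv.arrowCongr Equiv.boolNot (Equiv.refl ℕ)) := by
    funext p
    simp [expMon, Equiv.boolArrowEquivProd]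
  rw [e, Equiv.hasSum_iff] at h1
  exact h2.unique h1

theorem cexp_zero : cexp (0 : A) = 1 := by
  refine (hasSum_cexp (Ideal.zero_mem _)).unique ?_
  have := hasSum_single (f := fun l : ℕ => ((l.factorial : ℚ)⁻¹) • (0 : A) ^ l) 0
    (fun l hl => by simp [hl])
  simpa using this

theorem cexp_sum {X : c → A} (hX : ∀ j, X j ∈ Fil (A := A) 1) (t : Finset c) :
    cexp (∑ j ∈ t, X j) = ∏ j ∈ t, cexp (X j) := by
  induction t using Finset.induction_on with
  | empty => simp [cexp_zero]
  | insert i t hi ih =>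
    rw [sum_insert hi, prod_insert hi, cexp_add (hX i) (Ideal.sum_mem _ fun j _ => hX j), ih]

/-- Functions of `i` that are polynomials of degree at most `D`. -/
inductive PolyDeg : ℕ → ((c → ℕ) → ℚ) → Prop
  | const (q : ℚ) : PolyDeg 0 fun _ => q
  | coord (j : c) : PolyDeg 1 fun i => i j
  | add {D : ℕ} {f g : (c → ℕ) → ℚ} : PolyDeg D f → PolyDeg D g → PolyDeg D (f + g)
  | mul {D E : ℕ} {f g : (c → ℕ) → ℚ} : PolyDeg D f → PolyDeg E g → PolyDeg (D + E) (f * g)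
  | mono {D E : ℕ} {f : (c → ℕ) → ℚ} : D ≤ E → PolyDeg D f → PolyDeg E f

/-- The basis of polynomial functions given by products of falling factorials. -/
def descFun (n i : c → ℕ) : ℚ := ∏ j, ((i j).descFactorial (n j) : ℚ)

/-- From `i = (i - n) + n`, where `i - n` is the next factor of the falling factorial. If `i < n`,
both falling factorials vanish. -/
theorem coord_mul_descFun (j : c) (n i : c → ℕ) :
    (i j : ℚ) * descFun n i = descFun (n + Pi.single j 1) i + n j * descFun n i := by
  have h1 : ∀ m : c → ℕ, descFun m i = ((i j).descFactorial (m j) : ℚ) *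
      ∏ l ∈ univ.erase j, ((i l).descFactorial (m l) : ℚ) := fun m =>
    (mul_prod_erase univ (fun l => ((i l).descFactorial (m l) : ℚ)) (mem_univ j)).symm
  have h2 : ∏ l ∈ univ.erase j, ((i l).descFactorial ((n + Pi.single j 1 : c → ℕ) l) : ℚ) =
      ∏ l ∈ univ.erase j, ((i l).descFactorial (n l) : ℚ) := by
    refine prod_congr rfl fun l hl => ?_
    rw [Pi.add_apply, Pi.single_eq_of_ne (ne_of_mem_erase hl), add_zero]
  rw [h1 n, h1 (n + _), h2, Pi.add_apply, Pi.single_eq_same, Nat.descFactorial_succ]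
  rcases lt_or_ge (i j) (n j) with h | h
  · rw [Nat.descFactorial_eq_zero_iff_lt.mpr h]; simp
  · rw [Nat.cast_mul, Nat.cast_sub h]; ring

/-- The span of the falling factorials of degree at most `D`. -/
def descSpan (c : Type) [Fintype c] [DecidableEq c] (D : ℕ) : Submodule ℚ ((c → ℕ) → ℚ) :=
  Submodule.span ℚ {f | ∃ n : c → ℕ, ∑ j, n j ≤ D ∧ f = descFun n}

theorem descSpan_mono {D E : ℕ} (h : D ≤ E) : descSpan c D ≤ descSpan c E :=
  Submodule.span_mono fun _ ⟨n, hn, hf⟩ => ⟨n, hn.trans h, hf⟩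

/-- Stating this as stability under multiplication by `p`, for all degrees `E`, lets the induction
pass through products without a formula for products of falling factorials. -/
theorem PolyDeg.mul_mem_descSpan {D : ℕ} {p : (c → ℕ) → ℚ} (hp : PolyDeg D p) :
    ∀ (E : ℕ) (h : (c → ℕ) → ℚ), h ∈ descSpan c E → p * h ∈ descSpan c (D + E) := by
  induction hp with
  | const q =>
    intro E h hh
    have : (fun _ : c → ℕ => q) * h = q • h := by funext i; simp
    rw [this, zero_add]
    exact Submodule.smul_mem _ _ hh
  | coord j =>
    intro E h hh
    induction hh using Submodule.span_induction with
    | mem f hf =>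
      obtain ⟨n, hn, rfl⟩ := hf
      have : (fun i : c → ℕ => (i j : ℚ)) * descFun n =
          descFun (n + Pi.single j 1) + (n j : ℚ) • descFun n := by
        funext i
        simpa using coord_mul_descFun j n i
      rw [this]
      refine Submodule.add_mem _ (Submodule.subset_span ⟨_, ?_, rfl⟩)
        (Submodule.smul_mem _ _ (Submodule.subset_span ⟨n, by omega, rfl⟩))
      simp only [Pi.add_apply, sum_add_distrib, sum_pi_single', mem_univ, if_true]
      omega
    | zero => rw [mul_zero]; exact Submodule.zero_mem _
    | add f g _ _ hf hg => rw [mul_add]; exact Submodule.add_mem _ hf hg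
    | smul a f _ hf => rw [mul_smul_comm]; exact Submodule.smul_mem _ _ hf
  | add _ _ hf hg =>
    intro E h hh
    rw [add_mul]
    exact Submodule.add_mem _ (hf E h hh) (hg E h hh)
  | mul _ _ hf hg =>
    intro E h hh
    rw [mul_assoc, add_assoc]
    exact hf _ _ (hg _ _ hh)
  | mono hDE _ hf =>
    intro E h hh
    exact descSpan_mono (by omega) (hf E h hh)

theorem PolyDeg.mem_descSpan {D : ℕ} {p : (c → ℕ) → ℚ} (hp : PolyDeg D p) :
    p ∈ descSpan c D := by
  have := hp.mul_mem_descSpan 0 1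
    (Submodule.subset_span ⟨0, by simp, by funext i; simp [descFun]⟩)
  simpa using this

/-- The span of the monomials of degree at most `D` in the elements `X_j`. -/
def monSpan (X : c → A) (D : ℕ) : Submodule ℚ A :=
  Submodule.span ℚ {f | ∃ n : c → ℕ, ∑ j, n j ≤ D ∧ f = ∏ j, X j ^ n j}

/-- A falling factorial cancels the top factors of `i!`, and the substitution `i ↦ i + n` extracts
`X^n`; smaller indices contribute zero. So polynomials in the index become polynomials in `X` of the
same degree. -/
theorem hasSum_descFun_expMon {X : c → A} (hX : ∀ j, X j ∈ Fil (A := A) 1) (n : c → ℕ) :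
    HasSum (fun i => descFun n i • expMon X i) ((∏ j, X j ^ n j) * cexp (∑ j, X j)) := by
  have h1 := (hasSum_expMon hX).mul_left (∏ j, X j ^ n j)
  have hinj : Function.Injective fun i : c → ℕ => i + n := fun _ _ h => add_right_cancel h
  rw [← hinj.hasSum_iff]
  · refine (congrArg (HasSum · _) (funext fun i => ?_)).mpr h1
    simp only [Function.comp_apply, descFun, expMon, Pi.add_apply, Finset.prod_smul]
    rw [mul_smul_comm, smul_smul, ← prod_mul_distrib, ← prod_mul_distrib]
    refine congrArg₂ (· • ·) (prod_congr rfl fun j _ => ?_) (prod_congr rfl fun j _ => ?_)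
    · have h2 := Nat.factorial_mul_descFactorial (Nat.le_add_left (n j) (i j))
      rw [Nat.add_sub_cancel] at h2
      rw [← h2]
      have h3 : ((i j + n j).descFactorial (n j) : ℚ) ≠ 0 := by
        rw [Nat.cast_ne_zero, Ne, Nat.descFactorial_eq_zero_iff_lt]; omega
      have h4 : ((i j).factorial : ℚ) ≠ 0 := by exact_mod_cast Nat.factorial_ne_zero _
      push_cast
      field_simp
    · rw [pow_add, mul_comm]
  · intro i hi
    have : ∃ j, i j < n j := by
      by_contra! h
      exact hi ⟨i - n, by funext j; exact Nat.sub_add_cancel (h j)⟩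
    obtain ⟨j, hj⟩ := this
    rw [descFun, prod_eq_zero (mem_univ j) (by
      rw [Nat.descFactorial_eq_zero_iff_lt.mpr hj, Nat.cast_zero]), zero_smul]

/-- Insertion of a polynomial in the summation index into the exponential series. -/
theorem PolyDeg.exists_hasSum {X : c → A} (hX : ∀ j, X j ∈ Fil (A := A) 1) {D : ℕ}
    {p : (c → ℕ) → ℚ} (hp : PolyDeg D p) : ∃ Q ∈ monSpan X D,
      HasSum (fun i => p i • expMon X i) (Q * cexp (∑ j, X j)) := by
  have h := hp.mem_descSpan
  clear hp
  induction h using Submodule.span_induction with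
  | mem f hf =>
    obtain ⟨n, hn, rfl⟩ := hf
    exact ⟨_, Submodule.subset_span ⟨n, hn, rfl⟩, hasSum_descFun_expMon hX n⟩
  | zero =>
    refine ⟨0, Submodule.zero_mem _, ?_⟩
    simp [hasSum_zero]
  | add f g _ _ hf hg =>
    obtain ⟨Q, hQ, h⟩ := hf
    obtain ⟨Q', hQ', h'⟩ := hg
    refine ⟨Q + Q', Submodule.add_mem _ hQ hQ', ?_⟩
    simpa only [Pi.add_apply, add_smul, add_mul] using h.add h'
  | smul a f _ hf =>
    obtain ⟨Q, hQ, h⟩ := hf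
    refine ⟨a • Q, Submodule.smul_mem _ _ hQ, ?_⟩
    have := h.mul_left (algebraMap ℚ A a)
    simpa only [Pi.smul_apply, smul_assoc, ← Algebra.smul_def, smul_mul_assoc] using this

variable {e : Type} [Fintype e] [DecidableEq e]

theorem finite_finsupp_degree_lt (N : ℕ) : {r : e →₀ ℕ | r.degree < N}.Finite :=
  (Finsupp.finite_of_degree_le N).subset fun r (hr : r.degree < N) => hr.le

/-- `f i` is a series in the elements `s_e`, whose coefficients are polynomials in `i`, of degree
bounded by the weighted degree of the monomial in `s`. -/
def PolyFam (s : e → A) (ω : e → ℕ) (f : (c → ℕ) → A) : Prop :=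
  ∃ p : (e →₀ ℕ) → (c → ℕ) → ℚ, (∀ r, PolyDeg (∑ l, r l * ω l) (p r)) ∧
    ∀ i, HasSum (fun r => p r i • ∏ l, s l ^ r l) (f i)

variable {s : e → A} {ω : e → ℕ}

theorem prod_pow_mem (hs : ∀ l, s l ∈ Fil (A := A) 1) (r : e →₀ ℕ) :
    ∏ l, s l ^ r l ∈ Fil (A := A) r.degree := by
  rw [Finsupp.degree_eq_sum]
  exact fil_prod _ fun l => fil_pow (hs l) _

theorem PolyDeg.sum {ι : Type} (t : Finset ι) {D : ℕ} {f : ι → (c → ℕ) → ℚ}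
    (h : ∀ i ∈ t, PolyDeg D (f i)) : PolyDeg D (∑ i ∈ t, f i) := by
  classical
  induction t using Finset.induction_on with
  | empty => exact .mono (Nat.zero_le _) (.const 0)
  | insert i t hi ih =>
    rw [sum_insert hi]
    exact .add (h _ (mem_insert_self _ _)) (ih fun l hl => h _ (mem_insert_of_mem hl))

/-- Degrees add as the exponents of the small parameters do, because the bound is linear in the
exponent vector. Thus the corrections can be treated factor by factor. -/
theorem PolyFam.mul (hs : ∀ l, s l ∈ Fil (A := A) 1) {f g : (c → ℕ) → A} (hf : PolyFam s ω f)
    (hg : PolyFam s ω g) : PolyFam s ω (f * g) := by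
  obtain ⟨p, hp, hf⟩ := hf
  obtain ⟨p', hp', hg⟩ := hg
  refine ⟨fun r => ∑ x ∈ HasAntidiagonal.antidiagonal r, p x.1 * p' x.2, fun r => ?_, fun i => ?_⟩
  · refine PolyDeg.sum _ fun x hx => ?_
    rw [HasAntidiagonal.mem_antidiagonal] at hx
    have := (hp x.1).mul (hp' x.2)
    rw [← sum_add_distrib] at this
    convert this using 2 with l
    rw [← hx, Finsupp.add_apply, add_mul]
  · have h1 := hasSum_mul_fil (hf i) (hg i) _ _ finite_finsupp_degree_lt finite_finsupp_degree_lt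
      (fun r => fil_smul _ (prod_pow_mem hs r)) (fun r => fil_smul _ (prod_pow_mem hs r))
    have h2 := hasSum_fiberwise_finset h1 (fun x => x.1 + x.2)
      HasAntidiagonal.antidiagonal (fun l b => HasAntidiagonal.mem_antidiagonal)
    refine (congrArg (HasSum · _) (funext fun r => ?_)).mpr h2
    beta_reduce
    rw [Finset.sum_apply, sum_smul]
    refine sum_congr rfl fun x hx => ?_
    rw [HasAntidiagonal.mem_antidiagonal] at hx
    rw [← hx, smul_mul_smul_comm, ← prod_mul_distrib]
    simp only [Finsupp.add_apply, pow_add, Pi.mul_apply]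

/-- A series in one of the elements `s_e`. -/
theorem PolyFam.ofSeries (l : e) {f : (c → ℕ) → A} (g : ℕ → (c → ℕ) → ℚ)
    (hg : ∀ n, PolyDeg (n * ω l) (g n)) (hf : ∀ i, HasSum (fun n => g n i • s l ^ n) (f i)) :
    PolyFam s ω f := by
  refine ⟨fun r => if r = Finsupp.single l (r l) then g (r l) else 0, fun r => ?_, fun i => ?_⟩
  · beta_reduce
    split_ifs with h
    · rw [sum_eq_single l (fun b _ hb => by rw [h, Finsupp.single_eq_of_ne hb, zero_mul])
        (by simp)]
      exact hg _
    · exact .mono (Nat.zero_le _) (.const 0)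
  · rw [← (Finsupp.single_injective l).hasSum_iff]
    · refine (congrArg (HasSum · _) (funext fun n => ?_)).mpr (hf i)
      simp only [Function.comp_apply, Finsupp.single_eq_same, if_true]
      rw [prod_eq_single l (fun b _ hb => by rw [Finsupp.single_eq_of_ne hb, pow_zero])
        (by simp), Finsupp.single_eq_same]
    · intro r hr
      beta_reduce
      rw [if_neg fun h : r = Finsupp.single l (r l) => hr ⟨_, h.symm⟩, Pi.zero_apply, zero_smul]

/-- Summation of an exponential series against a polynomial family. -/
theorem PolyFam.exists_hasSum {X : c → A} (hX : ∀ j, X j ∈ Fil (A := A) 1)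
    (hs : ∀ l, s l ∈ Fil (A := A) 1) {f : (c → ℕ) → A} (hf : PolyFam s ω f) {f₀ : A}
    (hf₀ : HasSum (fun i => expMon X i * f i) f₀) :
    ∃ (Q : (e →₀ ℕ) → A) (P : A), (∀ r, Q r ∈ monSpan X (∑ l, r l * ω l)) ∧
      HasSum (fun r => Q r * ∏ l, s l ^ r l) P ∧ f₀ = P * cexp (∑ j, X j) := by
  obtain ⟨p, hp, hf⟩ := hf
  choose Q hQ hQs using fun r => (hp r).exists_hasSum hX
  have hP : Summable fun r => Q r * ∏ l, s l ^ r l :=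
    FilRing.summable _ _ finite_finsupp_degree_lt fun r => fil_mul_left _ (prod_pow_mem hs r)
  refine ⟨Q, _, hQ, hP.hasSum, ?_⟩
  have hsum : Summable fun x : (c → ℕ) × (e →₀ ℕ) =>
      expMon X x.1 * (p x.2 x.1 • ∏ l, s l ^ x.2 l) := by
    refine FilRing.summable _ (fun x => (∑ j, x.1 j) + x.2.degree) (fun N => ?_)
      fun x => fil_mul (expMon_mem hX _) (fil_smul _ (prod_pow_mem hs _))
    refine ((finite_sum_lt N).prod (finite_finsupp_degree_lt N)).subset fun x hx => ?_
    have hx' : (∑ j, x.1 j) + x.2.degree < N := hx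
    exact ⟨show ∑ j, x.1 j < N by omega, show x.2.degree < N by omega⟩
  -- The absolutely convergent double family is summed in both orders: over `r` first it gives `f₀`,
  -- over `i` first it gives `Q_r` times the exponential.
  have h1 := hsum.hasSum.prod_fiberwise fun i => (hf i).mul_left (expMon X i)
  have h2 := (((Equiv.prodComm _ _).hasSum_iff (f := fun x : (c → ℕ) × (e →₀ ℕ) =>
      expMon X x.1 * (p x.2 x.1 • ∏ l, s l ^ x.2 l))).mpr hsum.hasSum).prod_fiberwise
    (g := fun r => Q r * cexp (∑ j, X j) * ∏ l, s l ^ r l) fun r => by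
      refine (congrArg (HasSum · _) (funext fun i => ?_)).mpr ((hQs r).mul_right _)
      simp only [Function.comp_apply, Equiv.prodComm_apply, Prod.swap_prod_mk]
      rw [mul_smul_comm, smul_mul_assoc]
  have h3 := hP.hasSum.mul_right (cexp (∑ j, X j))
  simp only [mul_right_comm] at h2 h3
  rw [h1.unique hf₀] at h2
  exact h2.unique h3

end multi
end filRing

open scoped MvPowerSeries.WithPiTopology

/-! ### The filtered ring of generating functions -/

instance (k : ℕ) : TopologicalSpace (LatPoly k) := ⊥

instance (k : ℕ) : DiscreteTopology (LatPoly k) := ⟨rfl⟩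

section
variable {j k : ℕ}

theorem hasSum_cc_iff {ι : Type} {f : ι → CC j k} {g : CC j k} :
    HasSum f g ↔ ∀ d h, HasSum
      (fun i => PowerSeries.coeff h (MvPowerSeries.coeff d (f i)))
      (PowerSeries.coeff h (MvPowerSeries.coeff d g)) := by
  rw [MvPowerSeries.WithPiTopology.hasSum_iff_hasSum_coeff]
  exact forall_congr' fun d => PowerSeries.WithPiTopology.hasSum_iff_hasSum_coeff _

/-- Elements of total degree at least `N` in `ħ` and the Greek variables. -/
def ccFilSub (j k N : ℕ) : AddSubgroup (CC j k) where
  carrier := {f | ∀ d h, d.degree + h < N →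
    PowerSeries.coeff h (MvPowerSeries.coeff d f) = 0}
  zero_mem' := fun d h _ => by simp
  add_mem' := fun hf hg d h hN => by rw [map_add, map_add, hf d h hN, hg d h hN, add_zero]
  neg_mem' := fun hf d h hN => by rw [map_neg, map_neg, hf d h hN, neg_zero]

theorem ccFilSub_mul {m n : ℕ} {f g : CC j k} (hf : f ∈ ccFilSub j k m)
    (hg : g ∈ ccFilSub j k n) : f * g ∈ ccFilSub j k (m + n) := by
  intro d h hN
  rw [MvPowerSeries.coeff_mul, map_sum]
  refine sum_eq_zero fun x hx => ?_
  rw [PowerSeries.coeff_mul]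
  refine sum_eq_zero fun y hy => ?_
  rw [HasAntidiagonal.mem_antidiagonal] at hx hy
  have hd : x.1.degree + x.2.degree = d.degree := by rw [← hx, map_add]
  by_cases h1 : x.1.degree + y.1 < m
  · rw [hf _ _ h1, zero_mul]
  · rw [hg _ _ (by omega), mul_zero]

/-- The filtration by total degree in `ħ` and the Greek variables. -/
def ccFil (j k N : ℕ) : Ideal (CC j k) where
  __ := ccFilSub j k N
  smul_mem' := fun f g hg => by
    have := ccFilSub_mul (m := 0) (f := f) (fun d h hN => absurd hN (by omega)) hg
    rwa [zero_add] at this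

theorem mem_ccFil {N : ℕ} {f : CC j k} : f ∈ ccFil j k N ↔ ∀ d h, d.degree + h < N →
    PowerSeries.coeff h (MvPowerSeries.coeff d f) = 0 := Iff.rfl

/-- Each coefficient has finite total degree in `ħ` and the Greek variables, so only finitely many
members of a family tending to zero in the filtration contribute to it. -/
instance : FilRing (CC j k) where
  Fil := ccFil j k
  fil_zero := by
    ext f
    simp [mem_ccFil]
  fil_mul := ccFilSub_mul
  summable := fun {ι} f w hw hf => by
    have : ∀ d h, Summable fun i => PowerSeries.coeff h (MvPowerSeries.coeff d (f i)) := by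
      intro d h
      refine summable_of_hasFiniteSupport ?_
      refine (hw (d.degree + h + 1)).subset fun i hi => ?_
      by_contra hN
      exact hi (hf i d h (by have : ¬ w i < d.degree + h + 1 := hN; omega))
    choose a ha using this
    exact ⟨fun d => PowerSeries.mk fun h => a d h, hasSum_cc_iff.mpr fun d h => by
      have := ha d h
      rwa [show PowerSeries.coeff h (MvPowerSeries.coeff d (fun d => PowerSeries.mk fun h => a d h
        : CC j k)) = a d h from PowerSeries.coeff_mk _ _]⟩

theorem mem_fil_cc {N : ℕ} {f : CC j k} : f ∈ FilRing.Fil (A := CC j k) N ↔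
    ∀ d h, d.degree + h < N → PowerSeries.coeff h (MvPowerSeries.coeff d f) = 0 := Iff.rfl

theorem mem_fil_cc_one {f : CC j k} (h : PowerSeries.coeff 0 (MvPowerSeries.coeff 0 f) = 0) :
    f ∈ FilRing.Fil (A := CC j k) 1 := by
  refine mem_fil_cc.mpr fun d n hd => ?_
  obtain rfl : n = 0 := by omega
  obtain rfl : d = 0 := (Finsupp.degree_eq_zero_iff d).mp (by omega)
  exact h

/-- `u ħ` for a Latin polynomial `u`. -/
def hC (u : LatPoly k) : CC j k := MvPowerSeries.C (PowerSeries.X * PowerSeries.C u)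

theorem hC_mem (u : LatPoly k) : (hC u : CC j k) ∈ FilRing.Fil (A := CC j k) 1 :=
  mem_fil_cc_one (by simp [hC])

theorem X_mem (p : Fin j × Gen) :
    (MvPowerSeries.X p : CC j k) ∈ FilRing.Fil (A := CC j k) 1 :=
  mem_fil_cc_one (by simp)

theorem hC_smul (c : ℚ) (u : LatPoly k) : (hC (c • u) : CC j k) = c • hC u := by
  rw [hC, map_rat_smul, mul_smul_comm, map_rat_smul, hC]

theorem hasSum_C_mk (a : ℕ → LatPoly k) :
    HasSum (fun n => (MvPowerSeries.C (PowerSeries.X ^ n * PowerSeries.C (a n)) : CC j k))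
      (MvPowerSeries.C (PowerSeries.mk a)) := by
  rw [hasSum_cc_iff]
  intro d h
  have e : ∀ n, PowerSeries.coeff h (MvPowerSeries.coeff d
      (MvPowerSeries.C (PowerSeries.X ^ n * PowerSeries.C (a n)) : CC j k)) =
      if n = h then (if d = 0 then a h else 0) else 0 := by
    intro n
    classical
    rw [MvPowerSeries.coeff_C]
    split_ifs with hd hn hn
    · rw [hn, mul_comm, PowerSeries.coeff_C_mul, PowerSeries.coeff_X_pow, if_pos rfl, mul_one]
    · rw [mul_comm, PowerSeries.coeff_C_mul, PowerSeries.coeff_X_pow, if_neg (Ne.symm hn), mul_zero]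
    · simp
    · simp
  simp only [e]
  have := hasSum_ite_eq h (if d = 0 then a h else 0)
  convert this using 1
  classical
  rw [MvPowerSeries.coeff_C]
  split_ifs <;> simp

theorem cexp_hC (u : LatPoly k) : cexp (hC u : CC j k) = MvPowerSeries.C (expH u) := by
  refine (hasSum_cexp (hC_mem u)).unique ?_
  refine (congrArg (HasSum · _) (funext fun n => ?_)).mpr (hasSum_C_mk _)
  rw [hC, ← map_pow, ← map_rat_smul, mul_pow, ← map_pow, ← mul_smul_comm, ← map_rat_smul]

/-- The scalars `𝕂` in `𝓒(J, K)`. -/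
def kC (j k : ℕ) : KK →+* CC j k :=
  (MvPowerSeries.C).comp (PowerSeries.map MvPolynomial.C)

/-- `ħ ε`. -/
def tC (j k : ℕ) : CC j k := hC (MvPolynomial.C eps)

/-- The substitution `t = ε ħ`. -/
def subT : PowerSeries ℚ →+* KK :=
  (PowerSeries.rescale eps).comp (PowerSeries.map (algebraMap ℚ Qe))

theorem hasSum_kC_subT (g : PowerSeries ℚ) :
    HasSum (fun n => PowerSeries.coeff n g • tC j k ^ n) (kC j k (subT g)) := by
  have := hasSum_C_mk (j := j) (k := k) fun n => PowerSeries.coeff n g • MvPolynomial.C (eps ^ n)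
  refine (congrArg₂ HasSum (funext fun n => ?_) ?_).mpr this
  · rw [tC, hC, ← map_pow, ← map_rat_smul, mul_pow, ← map_pow, ← mul_smul_comm, ← map_rat_smul,
      map_pow]
  · refine congrArg MvPowerSeries.C ?_
    ext1 n
    rw [PowerSeries.coeff_map, PowerSeries.coeff_mk, subT, RingHom.comp_apply,
      PowerSeries.coeff_rescale, PowerSeries.coeff_map, mul_comm, ← Algebra.smul_def, map_rat_smul]

/-- `∏_p u_p^{d_p} / d_p!` as the coefficients of a power series. -/
theorem coeff_cexp_sum (u : Fin j × Gen → LatSeries k) (d : (Fin j × Gen) →₀ ℕ) :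
    MvPowerSeries.coeff d (cexp (∑ p, MvPowerSeries.X p * MvPowerSeries.C (u p)) : CC j k) =
      ∏ p, (((d p).factorial : ℚ)⁻¹) • u p ^ d p := by
  have h := hasSum_expMon (X := fun p => (MvPowerSeries.X p * MvPowerSeries.C (u p) : CC j k))
    fun p => fil_mul_right _ (X_mem p)
  rw [MvPowerSeries.WithPiTopology.hasSum_iff_hasSum_coeff] at h
  refine (h d).unique ?_
  have e : ∀ i : Fin j × Gen → ℕ, expMon (fun p =>
      (MvPowerSeries.X p * MvPowerSeries.C (u p) : CC j k)) i =
      MvPowerSeries.monomial (Finsupp.equivFunOnFinite.symm i)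
        (∏ p, (((i p).factorial : ℚ)⁻¹) • u p ^ i p) := by
    intro i
    rw [expMon]
    have : ∀ p, (((i p).factorial : ℚ)⁻¹) • (MvPowerSeries.X p * MvPowerSeries.C (u p) : CC j k) ^ i p =
        MvPowerSeries.X p ^ i p * MvPowerSeries.C ((((i p).factorial : ℚ)⁻¹) • u p ^ i p) := by
      intro p
      rw [mul_pow, ← map_pow, map_rat_smul, mul_smul_comm]
    rw [prod_congr rfl fun p _ => this p, prod_mul_distrib, ← map_prod,
      MvPowerSeries.monomial_eq', Finsupp.prod_fintype _ _ fun _ => pow_zero _, mul_comm]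
    rfl
  have h0 := hasSum_single (f := fun i => MvPowerSeries.coeff d (expMon (fun p =>
      (MvPowerSeries.X p * MvPowerSeries.C (u p) : CC j k)) i)) (⇑d) fun i hi => by
    rw [e, MvPowerSeries.coeff_monomial_ne]
    rintro rfl
    exact hi (by simp)
  rw [e, Finsupp.equivFunOnFinite_symm_coe, MvPowerSeries.coeff_monomial_same] at h0
  exact h0

theorem prod_gen {M : Type} [CommMonoid M] (f : Gen → M) :
    ∏ g, f g = f .y * f .b * f .a * f .x := by
  rw [show (univ : Finset Gen) = {Gen.y, Gen.b, Gen.a, Gen.x} from rfl,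
    prod_insert (by decide), prod_insert (by decide), prod_insert (by decide), prod_singleton]
  simp only [mul_assoc]

theorem sum_gen {M : Type} [AddCommMonoid M] (f : Gen → M) :
    ∑ g, f g = f .y + f .b + f .a + f .x := by
  rw [show (univ : Finset Gen) = {Gen.y, Gen.b, Gen.a, Gen.x} from rfl,
    sum_insert (by decide), sum_insert (by decide), sum_insert (by decide), sum_singleton]
  simp only [add_assoc]

/-- Summation of a generating function whose coefficients are finite sums of products of powers. -/
theorem hasSum_of_coeff {ι : Type} (F : CC j k) (δy δx : ι → Fin j → ℕ)
    (V : ((Fin j × Gen) →₀ ℕ) → Finset ι)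
    (hV : ∀ d v, v ∈ V d ↔ ∀ i, δy v i = d (i, .y) ∧ δx v i = d (i, .x))
    (T : ι → LatSeries k) (Lb La : ι → Fin j → LatSeries k)
    (hF : ∀ d, MvPowerSeries.coeff d F = ∑ v ∈ V d, T v * ∏ i,
      ((((d (i, .b)).factorial : ℚ)⁻¹) • Lb v i ^ d (i, .b)) *
        ((((d (i, .a)).factorial : ℚ)⁻¹) • La v i ^ d (i, .a))) :
    HasSum (fun v => (∏ i, MvPowerSeries.X (i, .y) ^ δy v i * MvPowerSeries.X (i, .x) ^ δx v i) *
      MvPowerSeries.C (T v) * cexp (∑ i, (MvPowerSeries.X (i, .b) * MvPowerSeries.C (Lb v i) +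
        MvPowerSeries.X (i, .a) * MvPowerSeries.C (La v i)))) F := by
  classical
  rw [MvPowerSeries.WithPiTopology.hasSum_iff_hasSum_coeff]
  intro d
  let e : ι → (Fin j × Gen) →₀ ℕ := fun v => Finsupp.equivFunOnFinite.symm fun p =>
    match p.2 with
    | .y => δy v p.1
    | .x => δx v p.1
    | _ => 0
  let u : ι → Fin j × Gen → LatSeries k := fun v p =>
    match p.2 with
    | .b => Lb v p.1
    | .a => La v p.1
    | _ => 0
  have key : ∀ v, MvPowerSeries.coeff d ((∏ i, MvPowerSeries.X (i, .y) ^ δy v i *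
      MvPowerSeries.X (i, .x) ^ δx v i) *
      MvPowerSeries.C (T v) * cexp (∑ i, (MvPowerSeries.X (i, .b) * MvPowerSeries.C (Lb v i) +
        MvPowerSeries.X (i, .a) * MvPowerSeries.C (La v i))) : CC j k) =
      if v ∈ V d then T v * ∏ i, ((((d (i, .b)).factorial : ℚ)⁻¹) • Lb v i ^ d (i, .b)) *
        ((((d (i, .a)).factorial : ℚ)⁻¹) • La v i ^ d (i, .a)) else 0 := by
    intro v
    have h1 : (∏ i, MvPowerSeries.X (i, .y) ^ δy v i *
        MvPowerSeries.X (i, .x) ^ δx v i : CC j k) * MvPowerSeries.C (T v) =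
        MvPowerSeries.monomial (e v) (T v) := by
      rw [MvPowerSeries.monomial_eq', Finsupp.prod_fintype _ _ fun _ => pow_zero _, mul_comm,
        Fintype.prod_prod_type]
      refine congrArg (MvPowerSeries.C (T v) * ·) (prod_congr rfl fun i _ => ?_)
      rw [prod_gen]
      simp [e]
    have h2 : (∑ i, (MvPowerSeries.X (i, .b) * MvPowerSeries.C (Lb v i) +
        MvPowerSeries.X (i, .a) * MvPowerSeries.C (La v i)) : CC j k) =
        ∑ p, MvPowerSeries.X p * MvPowerSeries.C (u v p) := by
      rw [Fintype.sum_prod_type]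
      refine sum_congr rfl fun i _ => ?_
      rw [sum_gen]
      simp [u]
    rw [h1, h2, MvPowerSeries.coeff_monomial_mul, coeff_cexp_sum]
    by_cases hv : v ∈ V d
    · have hv' := (hV d v).mp hv
      have hle : e v ≤ d := by
        rintro ⟨i, g⟩
        cases g <;> simp [e, hv' i]
      rw [if_pos hv, if_pos hle, Fintype.prod_prod_type]
      refine congrArg (T v * ·) (prod_congr rfl fun i _ => ?_)
      rw [prod_gen]
      simp [e, u, hv' i]
    · rw [if_neg hv]
      split_ifs with hle
      · rw [hV, not_forall] at hv
        obtain ⟨i, hi⟩ := hv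
        have hy : δy v i ≤ d (i, .y) := hle (i, .y)
        have hx : δx v i ≤ d (i, .x) := hle (i, .x)
        -- If the powers of `η` and `ξ` carried by `v` fall short of those in `d`, the missing ones
        -- would have to come from the exponential, which contains neither variable.
        have h3 : ∃ p, u v p = 0 ∧ (d - e v) p ≠ 0 := by
          by_cases h : δy v i = d (i, .y)
          · refine ⟨(i, .x), rfl, ?_⟩
            simp only [e, Finsupp.tsub_apply, Finsupp.equivFunOnFinite_symm_apply_apply]
            have : δx v i ≠ d (i, .x) := fun h' => hi ⟨h, h'⟩
            omega
          · refine ⟨(i, .y), rfl, ?_⟩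
            simp only [e, Finsupp.tsub_apply, Finsupp.equivFunOnFinite_symm_apply_apply]
            omega
        obtain ⟨p, hp, hp'⟩ := h3
        rw [prod_eq_zero (mem_univ p) (by rw [hp, zero_pow hp', smul_zero]), mul_zero]
      · rfl
  simp only [key, hF]
  have := hasSum_sum_of_ne_finset_zero (L := SummationFilter.unconditional ι) (s := V d) 
      (f := fun v => if v ∈ V d then T v * ∏ i,
      ((((d (i, .b)).factorial : ℚ)⁻¹) • Lb v i ^ d (i, .b)) *
        ((((d (i, .a)).factorial : ℚ)⁻¹) • La v i ^ d (i, .a)) else 0)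
    fun v hv => by rw [if_neg hv]
  rwa [sum_congr rfl fun v hv => if_pos hv] at this

end

/-! ### From rescaled generating functions to the ambient ring -/

section
variable {j k : ℕ}

instance (priority := 2000) : Module ℚ (CL j k) := Algebra.toModule

theorem hpow_add (a b : ℤ) : hpow k (a + b) = hpow k a * hpow k b := by
  rw [hpow, hpow, hpow, HahnSeries.single_mul_single, one_mul]

theorem hpow_zero : hpow k 0 = 1 := rfl

theorem hpow_nsmul (a : ℤ) (n : ℕ) : hpow k (n * a) = hpow k a ^ n := by
  induction n with
  | zero => simp [hpow_zero]
  | succ n ih => rw [pow_succ, ← ih, ← hpow_add]; push_cast; ring_nf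

theorem hpow_sum {ι : Type} (t : Finset ι) (a : ι → ℤ) :
    hpow k (∑ i ∈ t, a i) = ∏ i ∈ t, hpow k (a i) := by
  classical
  induction t using Finset.induction_on with
  | empty => simp [hpow_zero]
  | insert i t hi ih => rw [sum_insert hi, prod_insert hi, hpow_add, ih]

/-- The inclusion into the ambient ring, followed by `η ↦ ħ⁻¹ η`, `β ↦ ħ⁻¹ β`. -/
def Psi : CC j k →+* CL j k :=
  (MvPowerSeries.rescale fun p => hpow k (Var.wh (j := j) (k := k) (.inr p))).comp (toCL j k)

theorem coeff_Psi (f : CC j k) (d : (Fin j × Gen) →₀ ℕ) : MvPowerSeries.coeff d (Psi f) =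
    hpow k (∑ p, d p * Var.wh (j := j) (k := k) (.inr p)) *
      HahnSeries.ofPowerSeries ℤ (LatPoly k) (MvPowerSeries.coeff d f) := by
  rw [Psi, RingHom.comp_apply, MvPowerSeries.coeff_rescale, toCL, MvPowerSeries.coeff_map,
    Finsupp.prod_fintype _ _ fun _ => pow_zero _, hpow_sum]
  simp only [hpow_nsmul]

theorem coeff_coeff_Psi (f : CC j k) (d : (Fin j × Gen) →₀ ℕ) (h : ℤ) :
    (MvPowerSeries.coeff d (Psi f)).coeff h =
      if h - ∑ p, d p * Var.wh (j := j) (k := k) (.inr p) < 0 then 0 else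
        PowerSeries.coeff (h - ∑ p, d p * Var.wh (j := j) (k := k) (.inr p)).natAbs
          (MvPowerSeries.coeff d f) := by
  rw [coeff_Psi, hpow, HahnSeries.coeff_single_mul, one_mul, PowerSeries.coeff_coe]

/-- On each coefficient `ζ^d` the map `Psi` is a shift by a fixed power of `ħ`, so coefficientwise
convergence carries over in spite of the negative powers. -/
theorem convTo_Psi {f : ℕ → CC j k} {a : CC j k} (hf : HasSum f a) :
    ConvTo (fun N => ∑ l ∈ range N, Psi (f l)) (Psi a) := by
  intro d h
  have h1 := hf.tendsto_sum_nat
  set w := h - ∑ p, d p * Var.wh (j := j) (k := k) (.inr p) with hw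
  have h2 := (hasSum_cc_iff.mp hf d w.natAbs).tendsto_sum_nat
  rw [nhds_discrete, tendsto_pure] at h2
  filter_upwards [h2] with N hN
  rw [← map_sum, coeff_coeff_Psi, coeff_coeff_Psi, ← hw, map_sum, map_sum, hN]

theorem Psi_C (f : LatSeries k) : (Psi (MvPowerSeries.C f) : CL j k) =
    MvPowerSeries.C (HahnSeries.ofPowerSeries ℤ (LatPoly k) f) := by
  classical
  ext1 d
  rw [coeff_Psi, MvPowerSeries.coeff_C, MvPowerSeries.coeff_C]
  split_ifs with h
  · subst h; simp [hpow_zero]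
  · rw [map_zero, mul_zero]

theorem Psi_X (p : Fin j × Gen) : (Psi (MvPowerSeries.X p) : CL j k) =
    MvPowerSeries.C (hpow k (Var.wh (j := j) (k := k) (.inr p))) * MvPowerSeries.X p := by
  classical
  ext1 d
  rw [coeff_Psi, MvPowerSeries.coeff_C_mul, MvPowerSeries.coeff_X, MvPowerSeries.coeff_X]
  split_ifs with h
  · subst h
    rw [sum_eq_single p (fun b _ hb => by rw [Finsupp.single_eq_of_ne hb]; simp) (by simp)]
    simp
  · simp

/-- A variable in `𝓒(J, K)`, the variables `y` and `b` being multiplied by `ħ`. -/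
def Var.cc : Var j k → CC j k
  | .inl (i, .y) => hC (MvPolynomial.X (i, .y))
  | .inl (i, .b) => hC (MvPolynomial.X (i, .b))
  | .inl (i, .a) => MvPowerSeries.C (PowerSeries.C (MvPolynomial.X (i, .a)))
  | .inl (i, .x) => MvPowerSeries.C (PowerSeries.C (MvPolynomial.X (i, .x)))
  | .inr p => MvPowerSeries.X p

theorem ofPowerSeries_X_eq : HahnSeries.ofPowerSeries ℤ (LatPoly k) PowerSeries.X = hpow k 1 :=
  HahnSeries.ofPowerSeries_X

theorem Psi_hC (u : LatPoly k) : (Psi (hC u) : CL j k) =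
    MvPowerSeries.C (hpow k 1) * MvPowerSeries.C (latC u) := by
  rw [hC, Psi_C, map_mul, ofPowerSeries_X_eq, HahnSeries.ofPowerSeries_C, map_mul]
  rfl

/-- The rescaled variables become `ħ^{wh v} v`, of total weight `wh = 0`. This is what makes
condition (1) on `wh` automatic. -/
theorem Psi_cc (v : Var j k) : Psi v.cc = MvPowerSeries.C (hpow k v.wh) * v.toCL := by
  rcases v with ⟨i, g⟩ | p
  · cases g
    · exact Psi_hC _
    · exact Psi_hC _
    · rw [Var.cc, Psi_C, HahnSeries.ofPowerSeries_C, Var.wh, hpow_zero, map_one, one_mul, Var.toCL,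
        latC]
    · rw [Var.cc, Psi_C, HahnSeries.ofPowerSeries_C, Var.wh, hpow_zero, map_one, one_mul, Var.toCL,
        latC]
  · exact Psi_X p

/-- `𝒜_i^s` in `𝓒(J, K)`. -/
def expA (i : Fin j) (s : ℤ) : CC j k := cexp ((s : ℚ) • MvPowerSeries.X (i, .a))

/-- `B_i^{s/2}` in `𝓒(J, K)`. -/
def expB (i : Fin k) (s : ℤ) : CC j k := cexp ((-(s / 2 : ℚ)) • hC (MvPolynomial.X (i, .b)))

theorem Psi_expA (i : Fin j) (s : ℤ) : (Psi (expA i s) : CL j k) = calA i s := by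
  classical
  have h : (((s : ℚ) • MvPowerSeries.X (i, .a) : CC j k)) = ∑ p, MvPowerSeries.X p *
      MvPowerSeries.C (if p = (i, Gen.a) then algebraMap ℚ (LatSeries k) s else 0) := by
    rw [sum_eq_single (i, Gen.a) (fun b _ hb => by rw [if_neg hb, map_zero, mul_zero]) (by simp),
      if_pos rfl, mul_comm, Algebra.algebraMap_eq_smul_one, map_rat_smul, map_one,
      smul_mul_assoc, one_mul]
  ext1 d
  rw [coeff_Psi, expA, h, coeff_cexp_sum]
  change _ = if d = Finsupp.single (i, Gen.a) (d (i, Gen.a)) then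
    algebraMap ℚ (LatLaurent k) ((s : ℚ) ^ d (i, Gen.a) / (d (i, Gen.a)).factorial) else 0
  split_ifs with hd
  · have h0 : ∀ p, p ≠ (i, Gen.a) → d p = 0 := fun p hp => by
      rw [hd, Finsupp.single_eq_of_ne hp]
    rw [sum_eq_zero fun p _ => ?_, prod_eq_single (i, Gen.a) ?_ (by simp), if_pos rfl, hpow_zero,
      one_mul, ← map_pow, Algebra.smul_def, ← map_mul]
    · rw [div_eq_inv_mul]
      exact DFunLike.congr_fun (RingHom.ext_rat ((HahnSeries.ofPowerSeries ℤ (LatPoly k)).comp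
        (algebraMap ℚ (LatSeries k))) (algebraMap ℚ (LatLaurent k))) _
    · intro p _ hp
      rw [h0 p hp]; simp
    · by_cases hp : p = (i, Gen.a)
      · subst hp; simp [Var.wh]
      · rw [h0 p hp]; simp
  · have : ∃ p, p ≠ (i, Gen.a) ∧ d p ≠ 0 := by
      by_contra! h
      refine hd (Finsupp.ext fun p => ?_)
      by_cases hp : p = (i, Gen.a)
      · rw [hp, Finsupp.single_eq_same]
      · rw [Finsupp.single_eq_of_ne hp, h p hp]
    obtain ⟨p, hp, hp'⟩ := this
    rw [prod_eq_zero (mem_univ p) (by rw [if_neg hp, zero_pow hp', smul_zero]), map_zero, mul_zero]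

theorem Psi_expB (i : Fin k) (s : ℤ) : (Psi (expB i s) : CL j k) = MvPowerSeries.C (Bhalf i s) := by
  rw [expB, ← hC_smul, cexp_hC, Psi_C, Bhalf, neg_smul]

theorem smul_X_mem (c : ℚ) (p : Fin j × Gen) :
    (c • MvPowerSeries.X p : CC j k) ∈ FilRing.Fil (A := CC j k) 1 := fil_smul _ (X_mem p)

theorem smul_hC_mem (c : ℚ) (u : LatPoly k) :
    (c • hC u : CC j k) ∈ FilRing.Fil (A := CC j k) 1 := fil_smul _ (hC_mem u)

theorem expA_add (i : Fin j) (s t : ℤ) : (expA i (s + t) : CC j k) = expA i s * expA i t := by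
  rw [expA, expA, expA, ← cexp_add (smul_X_mem _ _) (smul_X_mem _ _), ← add_smul, Int.cast_add]

theorem expA_zero (i : Fin j) : (expA i 0 : CC j k) = 1 := by
  rw [expA, Int.cast_zero, zero_smul, cexp_zero]

theorem expB_add (i : Fin k) (s t : ℤ) : (expB i (s + t) : CC j k) = expB i s * expB i t := by
  rw [expB, expB, expB, ← cexp_add (smul_hC_mem _ _) (smul_hC_mem _ _), ← add_smul, Int.cast_add]
  ring_nf

theorem expB_zero (i : Fin k) : (expB i 0 : CC j k) = 1 := by
  rw [expB, Int.cast_zero, zero_div, neg_zero, zero_smul, cexp_zero]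

theorem C_Bhalf_add (i : Fin k) (s t : ℤ) :
    (MvPowerSeries.C (Bhalf i (s + t)) : CL j k) =
      MvPowerSeries.C (Bhalf i s) * MvPowerSeries.C (Bhalf i t) := by
  rw [← Psi_expB, ← Psi_expB, ← Psi_expB, expB_add, map_mul]

theorem calA_add (i : Fin j) (s t : ℤ) : (calA i (s + t) : CL j k) = calA i s * calA i t := by
  rw [← Psi_expA, ← Psi_expA, ← Psi_expA, expA_add, map_mul]

/-! ### Weights of monomials -/

/-- The product of two monomials. -/
def Mon.add (μ ν : Mon j k) : Mon j k := ⟨μ.eA + ν.eA, μ.eB + ν.eB, μ.ez + ν.ez, μ.eh + ν.eh⟩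

theorem Mon.eval_add (μ ν : Mon j k) : (μ.add ν).eval = μ.eval * ν.eval := by
  simp only [Mon.eval, Mon.add, Pi.add_apply, map_prod, calA_add, C_Bhalf_add, prod_mul_distrib,
    pow_add, hpow_add, map_mul]
  ring

theorem Mon.wh_add (μ ν : Mon j k) : (μ.add ν).wh = μ.wh + ν.wh := by
  simp only [Mon.wh, Mon.add, Pi.add_apply, Nat.cast_add, add_mul, sum_add_distrib]
  ring

theorem Mon.wt_add (μ ν : Mon j k) : (μ.add ν).wt = μ.wt + ν.wt := by
  simp only [Mon.wt, Mon.add, Pi.add_apply, Nat.cast_add, add_mul, sum_add_distrib]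

theorem Mon.eval_mk_zero (α : Fin j → ℤ) (β : Fin k → ℤ) (h : ℤ) :
    (⟨α, β, 0, h⟩ : Mon j k).eval = Psi ((∏ i, expA i (α i)) * ∏ i, expB i (β i)) *
      MvPowerSeries.C (hpow k h) := by
  simp only [Mon.eval, Pi.zero_apply, pow_zero, prod_const_one, mul_one, map_mul, map_prod,
    Psi_expA, Psi_expB]

theorem Mon.eval_zero : (⟨0, 0, 0, 0⟩ : Mon j k).eval = 1 := by
  rw [Mon.eval_mk_zero]
  simp [expA_zero, expB_zero, hpow_zero]

/-- The combinations of monomials of weight `wh = w` and `wt ≤ t`. -/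
def wtSpan (fl : Flavour) (j k : ℕ) (w t : ℤ) : Submodule ℚ (CL j k) :=
  Submodule.span ℚ (Mon.eval '' {μ : Mon j k | fl.hOK μ.eh ∧ μ.wh = w ∧ μ.wt ≤ t})

variable {fl : Flavour}

theorem hOK_add {a b : ℤ} (ha : fl.hOK a) (hb : fl.hOK b) : fl.hOK (a + b) := by
  cases fl
  · exact add_nonneg (show (0 : ℤ) ≤ a from ha) (show (0 : ℤ) ≤ b from hb)
  · trivial

theorem hOK_of_nonneg {a : ℤ} (ha : 0 ≤ a) : fl.hOK a := by
  cases fl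
  · exact ha
  · trivial

theorem wtSpan_mono {w t t' : ℤ} (h : t ≤ t') : wtSpan fl j k w t ≤ wtSpan fl j k w t' :=
  Submodule.span_mono (Set.image_mono fun _ hμ => ⟨hμ.1, hμ.2.1, hμ.2.2.trans h⟩)

theorem wtSpan_mul {w t w' t' : ℤ} {x y : CL j k} (hx : x ∈ wtSpan fl j k w t)
    (hy : y ∈ wtSpan fl j k w' t') : x * y ∈ wtSpan fl j k (w + w') (t + t') := by
  have := Submodule.mul_mem_mul hx hy
  rw [wtSpan, wtSpan, Submodule.span_mul_span] at this
  refine Submodule.span_mono ?_ this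
  rintro _ ⟨_, ⟨μ, hμ, rfl⟩, _, ⟨ν, hν, rfl⟩, rfl⟩
  exact ⟨μ.add ν, ⟨hOK_add hμ.1 hν.1, by rw [Mon.wh_add, hμ.2.1, hν.2.1],
    by rw [Mon.wt_add]; exact add_le_add hμ.2.2 hν.2.2⟩, Mon.eval_add μ ν⟩

theorem one_mem_wtSpan : (1 : CL j k) ∈ wtSpan fl j k 0 0 :=
  Submodule.subset_span ⟨⟨0, 0, 0, 0⟩, ⟨hOK_of_nonneg le_rfl, by simp [Mon.wh], by simp [Mon.wt]⟩,
    Mon.eval_zero⟩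

theorem wtSpan_pow {w t : ℤ} {x : CL j k} (hx : x ∈ wtSpan fl j k w t) (n : ℕ) :
    x ^ n ∈ wtSpan fl j k (n * w) (n * t) := by
  induction n with
  | zero => simpa using one_mem_wtSpan
  | succ n ih =>
    rw [pow_succ, Nat.cast_succ, add_mul, add_mul, one_mul, one_mul]
    exact wtSpan_mul ih hx

theorem wtSpan_prod {ι : Type} (s : Finset ι) {w t : ι → ℤ} {x : ι → CL j k}
    (hx : ∀ i ∈ s, x i ∈ wtSpan fl j k (w i) (t i)) :
    ∏ i ∈ s, x i ∈ wtSpan fl j k (∑ i ∈ s, w i) (∑ i ∈ s, t i) := by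
  classical
  induction s using Finset.induction_on with
  | empty => simpa using one_mem_wtSpan
  | insert i s hi ih =>
    rw [prod_insert hi, sum_insert hi, sum_insert hi]
    exact wtSpan_mul (hx _ (mem_insert_self _ _)) (ih fun l hl => hx _ (mem_insert_of_mem hl))

theorem denOK_one : fl.denOK (Finsupp.single (⟨0, 0, 0, 0⟩ : Mon j k) 1) := by
  cases fl
  · refine ⟨by simp, fun μ hμ => ?_⟩
    have := Finsupp.support_single_subset hμ
    rw [mem_singleton] at this
    subst this
    exact ⟨rfl, rfl⟩
  · rfl

theorem evalPoly_single (μ : Mon j k) (c : ℚ) : evalPoly (Finsupp.single μ c) = c • μ.eval :=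
  Finsupp.sum_single_index (zero_smul _ _)

/-- Denominator `1` suffices, in the rational case too: all perturbed Gaussians constructed here
have Laurent polynomial coefficients in `𝒜` and `B^{1/2}`. -/
theorem isPoly_of_mem_span {s : Set (Mon j k)} {ok : Mon j k → Prop} {f : CL j k}
    (hf : f ∈ Submodule.span ℚ (Mon.eval '' s)) (hs : ∀ μ ∈ s, fl.hOK μ.eh ∧ ok μ) :
    IsPoly fl ok f := by
  obtain ⟨N, hN, rfl⟩ := (Finsupp.mem_span_image_iff_linearCombination ℚ).mp hf
  refine ⟨_, N, denOK_one, fun μ hμ => hs μ (hN hμ), ?_⟩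
  rw [evalPoly_single, one_smul, Mon.eval_zero, one_mul]
  rfl

end

/-! ### A criterion for perturbed Gaussians -/

section
variable {j k : ℕ}

/-- The small parameters `ε ħ`, `ε ħ a_i` and `ε ħ β_i`. -/
def smallPar : Option (Fin k ⊕ Fin j) → CC j k
  | none => tC j k
  | some (.inl i) => hC (MvPolynomial.C eps * MvPolynomial.X (i, .a))
  | some (.inr i) => tC j k * MvPowerSeries.X (i, .b)

/-- The degree, in the summation indices, allowed for the coefficients of the small parameters. -/
def smallDeg : Option (Fin k ⊕ Fin j) → ℕ
  | none => 2
  | some _ => 1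

theorem smallPar_mem (e : Option (Fin k ⊕ Fin j)) :
    (smallPar e : CC j k) ∈ FilRing.Fil (A := CC j k) 1 := by
  rcases e with _ | (i | i)
  · exact hC_mem _
  · exact hC_mem _
  · exact fil_mul_left _ (X_mem _)

/-- The small parameters divided by `ε`, in the ambient ring. -/
def smallParCL : Option (Fin k ⊕ Fin j) → CL j k
  | none => MvPowerSeries.C (hpow k 1)
  | some (.inl i) => Var.toCL (.inl (i, .a)) * MvPowerSeries.C (hpow k 1)
  | some (.inr i) => Var.toCL (.inr (i, .b))

/-- Each small parameter contains `ε` exactly once, so the power of `ε` in a product is the total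
exponent of the small parameters. -/
theorem Psi_smallPar (e : Option (Fin k ⊕ Fin j)) :
    (Psi (smallPar e) : CL j k) = epsCL j k * smallParCL e := by
  rcases e with _ | (i | i)
  · rw [smallPar, tC, Psi_hC, mul_comm]; rfl
  · rw [smallPar, Psi_hC, latC, map_mul, map_mul, smallParCL, epsCL, Var.toCL, latC, latC]; ring
  · rw [smallPar, map_mul, tC, Psi_hC, Psi_X, mul_comm (MvPowerSeries.C (hpow k 1)), mul_assoc,
      ← mul_assoc (MvPowerSeries.C (hpow k 1)), ← map_mul, ← hpow_add,
      show (1 + Var.wh (j := j) (k := k) (.inr (i, .b))) = 0 from rfl, hpow_zero, map_one, one_mul]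
    rfl

/-- `wt` of the small parameters, divided by `ε`. -/
def smallWt : Option (Fin k ⊕ Fin j) → ℤ
  | none => 0
  | some _ => 2

variable {fl : Flavour}

theorem Mon.eval_var (v : Var j k) (h : ℤ) :
    (⟨0, 0, Pi.single v 1, h⟩ : Mon j k).eval = v.toCL * MvPowerSeries.C (hpow k h) := by
  classical
  have h0 : (∏ w, w.toCL ^ (Pi.single v 1 : Var j k → ℕ) w) = v.toCL := by
    rw [prod_eq_single v (fun b _ hb => by rw [Pi.single_eq_of_ne hb, pow_zero]) (by simp),
      Pi.single_eq_same, pow_one]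
  have h1 := Mon.eval_mk_zero (j := j) (k := k) 0 0 h
  simp only [Pi.zero_apply, expA_zero, expB_zero, prod_const_one, one_mul, map_one, Mon.eval,
    pow_zero, mul_one] at h1 ⊢
  rw [h0, mul_right_comm, h1, mul_comm]

theorem wh_var (v : Var j k) (h : ℤ) : (⟨0, 0, Pi.single v 1, h⟩ : Mon j k).wh = v.wh - h := by
  rw [Mon.wh, sum_eq_single v (fun b _ hb => by simp [Pi.single_eq_of_ne hb]) (by simp)]
  simp

theorem wt_var (v : Var j k) (h : ℤ) : (⟨0, 0, Pi.single v 1, h⟩ : Mon j k).wt = v.wt := by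
  rw [Mon.wt, sum_eq_single v (fun b _ hb => by simp [Pi.single_eq_of_ne hb]) (by simp)]
  simp

theorem smallParCL_mem (e : Option (Fin k ⊕ Fin j)) :
    (smallParCL e : CL j k) ∈ wtSpan fl j k (-1) (smallWt e) := by
  rcases e with _ | (i | i)
  · refine Submodule.subset_span ⟨⟨0, 0, 0, 1⟩, ⟨hOK_of_nonneg (by norm_num), ?_, ?_⟩, ?_⟩
    · simp [Mon.wh]
    · simp [Mon.wt, smallWt]
    · rw [Mon.eval_mk_zero]
      simp [expA_zero, expB_zero, smallParCL]
  · refine Submodule.subset_span ⟨⟨0, 0, Pi.single (.inl (i, .a)) 1, 1⟩,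
      ⟨hOK_of_nonneg (by norm_num), ?_, ?_⟩, Mon.eval_var _ _⟩
    · rw [wh_var]; rfl
    · rw [wt_var]; exact le_rfl
  · refine Submodule.subset_span ⟨⟨0, 0, Pi.single (.inr (i, .b)) 1, 0⟩,
      ⟨hOK_of_nonneg (by norm_num), ?_, ?_⟩, (Mon.eval_var _ _).trans ?_⟩
    · rw [wh_var]; rfl
    · rw [wt_var]; exact le_rfl
    · rw [hpow_zero, map_one, mul_one]; rfl

/-- A quadratic term `κ v w 𝒜^α B^{β/2}` of the exponent, `v` and `w` being entries of the vectors
`(y_K, ξ_J)` and `(η_J, x_K)`. -/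
structure GTerm (j k : ℕ) where
  /-- the index of `v` -/
  r : Fin k ⊕ Fin j
  /-- the index of `w` -/
  c : Fin j ⊕ Fin k
  /-- the coefficient -/
  coef : ℚ
  /-- exponents of `𝒜` -/
  α : Fin j → ℤ
  /-- exponents of `B^{1/2}` -/
  β : Fin k → ℤ

/-- A Gaussian term as a rescaled generating function. -/
def GTerm.cc (t : GTerm j k) : CC j k :=
  t.coef • ((row₂ t.r).cc * (col₂ t.c).cc * ((∏ i, expA i (t.α i)) * ∏ i, expB i (t.β i)))

/-- The factor of a Gaussian term that is a matrix entry. -/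
def GTerm.entry (t : GTerm j k) : CL j k :=
  t.coef • (⟨t.α, t.β, 0, (row₂ t.r).wh + (col₂ t.c).wh⟩ : Mon j k).eval

theorem GTerm.Psi_cc (t : GTerm j k) :
    Psi t.cc = (row₂ t.r).toCL * t.entry * (col₂ t.c).toCL := by
  rw [GTerm.cc, map_rat_smul, map_mul, map_mul, PGauss.Psi_cc, PGauss.Psi_cc, GTerm.entry,
    Mon.eval_mk_zero, hpow_add, map_mul, mul_smul_comm, smul_mul_assoc]
  refine congrArg (t.coef • ·) ?_
  simp only [map_mul]
  ring

theorem row₂_mem (r : Fin k ⊕ Fin j) :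
    ((row₂ r).cc : CC j k) ∈ FilRing.Fil (A := CC j k) 1 := by
  rcases r with i | i
  · exact hC_mem _
  · exact X_mem _

theorem col₁_mem (r : Fin k ⊕ Fin j) :
    ((col₁ r).cc : CC j k) ∈ FilRing.Fil (A := CC j k) 1 := by
  rcases r with i | i
  · exact hC_mem _
  · exact X_mem _

theorem GTerm.cc_mem (t : GTerm j k) : t.cc ∈ FilRing.Fil (A := CC j k) 1 :=
  fil_smul _ (fil_mul_right _ (fil_mul_right _ (row₂_mem _)))

/-- The conditions on a product of two variables in the exponent: no negative powers of `ħ`, or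
presence of a Greek variable. -/
def Flavour.pairOK (fl : Flavour) (v w : Var j k) : Prop :=
  match fl with
  | .rational => 0 ≤ v.wh + w.wh
  | .laurent => v.isRight ∨ w.isRight

theorem hOK_of_pairOK {v w : Var j k} (h : fl.pairOK v w) : fl.hOK (v.wh + w.wh) := by
  cases fl
  · exact h
  · trivial

theorem GTerm.Psi_cc_mem {t : GTerm j k} (h : fl.pairOK (row₂ t.r) (col₂ t.c)) :
    Psi t.cc ∈ wtSpan fl j k 0 2 := by
  rw [GTerm.Psi_cc, GTerm.entry, mul_smul_comm, smul_mul_assoc]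
  refine Submodule.smul_mem _ _ ?_
  refine Submodule.subset_span ⟨((⟨0, 0, Pi.single (row₂ t.r) 1, 0⟩ : Mon j k).add
    ⟨t.α, t.β, 0, (row₂ t.r).wh + (col₂ t.c).wh⟩).add ⟨0, 0, Pi.single (col₂ t.c) 1, 0⟩,
    ⟨?_, ?_, ?_⟩, ?_⟩
  · have := hOK_of_pairOK h
    simpa only [Mon.add, zero_add, add_zero] using this
  · rw [Mon.wh_add, Mon.wh_add, wh_var, wh_var]
    simp [Mon.wh]
  · rw [Mon.wt_add, Mon.wt_add, wt_var, wt_var]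
    rcases t with ⟨r | r, c | c, -⟩ <;> simp [Mon.wt, row₂, col₂, Var.wt]
  · rw [Mon.eval_add, Mon.eval_add, Mon.eval_var, Mon.eval_var, hpow_zero, map_one, mul_one,
      mul_one]

/-- The quadratic form `(β_J, a_K) M (b_K, α_J)ᵗ` with rational coefficients. -/
def quadForm (M : Fin j ⊕ Fin k → Fin k ⊕ Fin j → ℚ) : CC j k :=
  ∑ r, ∑ c, M r c • ((row₁ r).cc * (col₁ c).cc)

theorem quadForm_mem (M : Fin j ⊕ Fin k → Fin k ⊕ Fin j → ℚ) :
    quadForm M ∈ FilRing.Fil (A := CC j k) 1 :=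
  Ideal.sum_mem _ fun _ _ => Ideal.sum_mem _ fun _ _ => fil_smul _ (fil_mul_left _ (col₁_mem _))

theorem Psi_quadForm (M : Fin j ⊕ Fin k → Fin k ⊕ Fin j → ℚ) :
    Psi (quadForm M) = ∑ r, ∑ c, (row₁ r).toCL *
      (M r c • (⟨0, 0, 0, (row₁ r).wh + (col₁ c).wh⟩ : Mon j k).eval) * (col₁ c).toCL := by
  simp only [quadForm, map_sum]
  refine sum_congr rfl fun r _ => sum_congr rfl fun c _ => ?_
  rw [map_rat_smul, map_mul, Psi_cc, Psi_cc, Mon.eval_mk_zero, hpow_add, map_mul, mul_smul_comm,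
    smul_mul_assoc]
  refine congrArg (M r c • ·) ?_
  simp only [Pi.zero_apply, expA_zero, expB_zero, prod_const_one, one_mul, map_one, map_mul]
  ring

/-! #### Coefficients of exponentials -/

theorem coeff_rat_smul (c : ℚ) (f : CL j k) (d : (Fin j × Gen) →₀ ℕ) :
    MvPowerSeries.coeff d (c • f) =
      algebraMap ℚ (LatLaurent k) c * MvPowerSeries.coeff d f := by
  letI : Module ℚ (LatLaurent k) := Algebra.toModule
  rw [← Algebra.smul_def]
  exact map_rat_smul (MvPowerSeries.coeff d) c f

/-- The series whose coefficients are Laurent polynomials. -/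
def laurentCoeffs (j k : ℕ) : Subsemiring (CL j k) where
  carrier := {f | ∀ d, MvPowerSeries.coeff d f ∈ latLaurentPolys k}
  mul_mem' := fun hf hg d => by
    rw [MvPowerSeries.coeff_mul]
    exact Subalgebra.sum_mem _ fun x _ => Subalgebra.mul_mem _ (hf _) (hg _)
  one_mem' := fun d => by
    classical
    rw [MvPowerSeries.coeff_one]
    split_ifs
    · exact Subalgebra.one_mem _
    · exact Subalgebra.zero_mem _
  add_mem' := fun hf hg d => by rw [map_add]; exact Subalgebra.add_mem _ (hf d) (hg d)
  zero_mem' := fun d => by rw [map_zero]; exact Subalgebra.zero_mem _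

theorem smul_mem_laurentCoeffs (c : ℚ) {f : CL j k} (hf : f ∈ laurentCoeffs j k) :
    c • f ∈ laurentCoeffs j k := fun d => by
  rw [coeff_rat_smul]; exact Subalgebra.mul_mem _ (Subalgebra.algebraMap_mem _ _) (hf d)

theorem C_mem_laurentCoeffs {f : LatLaurent k} (hf : f ∈ latLaurentPolys k) :
    (MvPowerSeries.C f : CL j k) ∈ laurentCoeffs j k := fun d => by
  classical
  rw [MvPowerSeries.coeff_C]
  split_ifs
  · exact hf
  · exact Subalgebra.zero_mem _

theorem toCL_mem_laurentCoeffs (v : Var j k) : v.toCL ∈ laurentCoeffs j k := by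
  rcases v with p | p
  · exact C_mem_laurentCoeffs (Algebra.subset_adjoin (.inl (.inl ⟨p, rfl⟩)))
  · intro d
    classical
    rw [Var.toCL, MvPowerSeries.coeff_X]
    split_ifs
    · exact Subalgebra.one_mem _
    · exact Subalgebra.zero_mem _

theorem Mon.eval_mem_laurentCoeffs (μ : Mon j k) : μ.eval ∈ laurentCoeffs j k := by
  refine mul_mem (mul_mem (mul_mem (prod_mem fun i _ => ?_) ?_) (prod_mem fun v _ => pow_mem ?_ _))
    ?_
  · intro d
    change (if d = _ then _ else _) ∈ _
    split_ifs
    · exact Subalgebra.algebraMap_mem _ _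
    · exact Subalgebra.zero_mem _
  · exact C_mem_laurentCoeffs (prod_mem fun i _ =>
      Algebra.subset_adjoin (.inl (.inr ⟨i, _, rfl⟩)))
  · exact toCL_mem_laurentCoeffs v
  · exact C_mem_laurentCoeffs (Algebra.subset_adjoin (.inr ⟨_, rfl⟩))

/-- Without a term free of Greek variables, `G^l` contributes to `ζ^d` only for `l ≤ |d|`. Each
coefficient of `e^G` is then a finite sum of Laurent polynomials. -/
theorem mem_laurentCoeffs_of_exp {G E : CL j k} (hG : G ∈ laurentCoeffs j k)
    (h0 : MvPowerSeries.constantCoeff G = 0)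
    (hE : ConvTo (fun N => ∑ l ∈ range N, ((l.factorial : ℚ)⁻¹) • G ^ l) E) :
    E ∈ laurentCoeffs j k := by
  intro d
  have h1 : ∀ l, d.degree + 1 ≤ l → MvPowerSeries.coeff d (G ^ l) = 0 := fun l hl =>
    MvPowerSeries.coeff_eq_zero_of_constantCoeff_nilpotent (m := 1) (by rw [h0, pow_one]) (by omega)
  have h2 : MvPowerSeries.coeff d E = MvPowerSeries.coeff d
      (∑ l ∈ range (d.degree + 1), ((l.factorial : ℚ)⁻¹) • G ^ l) := by
    refine HahnSeries.ext (funext fun h => ?_)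
    obtain ⟨N, hN⟩ := ((hE d h).and (eventually_ge_atTop (d.degree + 1))).exists
    rw [← hN.1]
    beta_reduce
    rw [← sum_range_add_sum_Ico _ hN.2, map_add, map_sum _ _ (Ico _ _),
      sum_eq_zero (s := Ico _ _), add_zero]
    intro l hl
    rw [coeff_rat_smul, h1 l (mem_Ico.mp hl).1, mul_zero]
  rw [h2]
  have h3 : ∑ l ∈ range (d.degree + 1), ((l.factorial : ℚ)⁻¹) • G ^ l ∈ laurentCoeffs j k :=
    sum_mem fun l _ => smul_mem_laurentCoeffs _ (pow_mem hG l)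
  exact h3 d

/-! #### The criterion -/

/-- Several Gaussian terms may belong to the same pair of variables, as for `(1 - B) ξ η / ħ`; the
matrix entry collects them. -/
theorem sum_entry {c : Type} [Fintype c] (X : c → GTerm j k) :
    ∑ r, ∑ s, (row₂ r).toCL * (∑ t, if (X t).r = r ∧ (X t).c = s then (X t).entry else 0) *
      (col₂ s).toCL = ∑ t, Psi (X t).cc := by
  simp only [mul_sum, sum_mul]
  rw [sum_congr rfl fun r _ => sum_comm, sum_comm]
  refine sum_congr rfl fun t _ => ?_
  rw [sum_eq_single (X t).r, sum_eq_single (X t).c, if_pos ⟨rfl, rfl⟩, GTerm.Psi_cc]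
  · intro s _ hs
    rw [if_neg fun h => hs h.2.symm, mul_zero, zero_mul]
  · simp
  · intro r _ hr
    refine sum_eq_zero fun s _ => ?_
    rw [if_neg fun h => hr h.1.symm, mul_zero, zero_mul]
  · simp

/-- Each Gaussian term has `wt = 2` and `wh = 0`, so a polynomial of degree `D` in them has `wt ≤
2D`. -/
theorem Psi_mem_wtSpan {c : Type} [Fintype c] [DecidableEq c] {X : c → GTerm j k}
    (hX : ∀ t, fl.pairOK (row₂ (X t).r) (col₂ (X t).c)) {D : ℕ} {Q : CC j k}
    (hQ : Q ∈ monSpan (fun t => (X t).cc) D) : Psi Q ∈ wtSpan fl j k 0 (2 * D) := by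
  induction hQ using Submodule.span_induction with
  | mem f hf =>
    obtain ⟨n, hn, rfl⟩ := hf
    rw [map_prod]
    have := wtSpan_prod univ fun t _ => wtSpan_pow (GTerm.Psi_cc_mem (hX t)) (n t)
    simp only [mul_zero, sum_const_zero, ← sum_mul] at this
    simp only [map_pow]
    refine wtSpan_mono ?_ this
    rw [mul_comm]
    exact_mod_cast Nat.mul_le_mul_left 2 hn
  | zero => rw [map_zero]; exact Submodule.zero_mem _
  | add f g _ _ hf hg => rw [map_add]; exact Submodule.add_mem _ hf hg
  | smul a f _ hf => rw [map_rat_smul]; exact Submodule.smul_mem _ _ hf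

theorem constantCoeff_cc {v : Var j k} (h : v.isRight) : MvPowerSeries.constantCoeff v.cc = 0 := by
  rcases v with p | p
  · simp at h
  · exact MvPowerSeries.constantCoeff_X p

theorem constantCoeff_pair {v w : Var j k} (h : Flavour.laurent.pairOK v w) :
    MvPowerSeries.constantCoeff (v.cc * w.cc) = 0 := by
  rw [map_mul]
  rcases h with h | h
  · rw [constantCoeff_cc h, zero_mul]
  · rw [constantCoeff_cc h, mul_zero]

/-- The sum over indices is `P e^{∑ X}` by `PolyFam.exists_hasSum`. The quadratic form in `β, a` and
`b, α` joins the exponent, and the half-integral powers of `B` join `P`. -/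
theorem isPertGauss_of_hasSum {c : Type} [Fintype c] [DecidableEq c] (X : c → GTerm j k)
    (hX : ∀ t, fl.pairOK (row₂ (X t).r) (col₂ (X t).c))
    (M : Fin j ⊕ Fin k → Fin k ⊕ Fin j → ℚ)
    (hM : ∀ r s, M r s ≠ 0 → fl.pairOK (row₁ (j := j) (k := k) r) (col₁ s)) (pre : Fin k → ℤ)
    {f : (c → ℕ) → CC j k} (hf : PolyFam smallPar smallDeg f) {F : CC j k}
    (hF : HasSum (fun i => expMon (fun t => (X t).cc) i * f i) F) :
    IsPertGauss fl (Psi ((∏ i, expB i (pre i)) * F * cexp (quadForm M))) := by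
  obtain ⟨Q, P, hQ, hP, hFP⟩ := hf.exists_hasSum (fun t => (X t).cc_mem) smallPar_mem hF
  set pB : CC j k := ∏ i, expB i (pre i) with hpB
  have hG1 : ∑ t, (X t).cc ∈ FilRing.Fil (A := CC j k) 1 :=
    Ideal.sum_mem _ fun t _ => (X t).cc_mem
  have hE : ConvTo (fun N => ∑ l ∈ range N, ((l.factorial : ℚ)⁻¹) •
      Psi (∑ t, (X t).cc + quadForm M) ^ l) (Psi (cexp (∑ t, (X t).cc + quadForm M))) := by
    have := convTo_Psi (hasSum_cexp (Ideal.add_mem _ hG1 (quadForm_mem M)))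
    simpa only [map_rat_smul, map_pow] using this
  have hG : Psi (∑ t, (X t).cc + quadForm M) =
      (∑ r, ∑ s, (row₁ r).toCL *
        (M r s • (⟨0, 0, 0, (row₁ r).wh + (col₁ s).wh⟩ : Mon j k).eval) * (col₁ s).toCL) +
      ∑ r, ∑ s, (row₂ r).toCL * (∑ t, if (X t).r = r ∧ (X t).c = s then (X t).entry else 0) *
        (col₂ s).toCL := by
    rw [map_add, Psi_quadForm, sum_entry, map_sum, add_comm]
  -- The coefficient of `ε^l` gathers the finitely many monomials of total exponent `l` in the small
  -- parameters.
  refine ⟨_, _, _, _, Psi (pB * P), fun l => Psi pB * ∑ r ∈ finsuppAntidiag univ l,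
    Psi (Q r) * ∏ e, smallParCL e ^ r e, ?_, ?_, hG, hE, ?_, ?_, ?_, ?_⟩
  · intro r s
    refine ⟨Finsupp.single ⟨0, 0, 0, (row₁ r).wh + (col₁ s).wh⟩ (M r s), fun μ hμ => ?_,
      (evalPoly_single _ _).symm⟩
    rw [Finsupp.mem_support_single] at hμ
    obtain ⟨rfl, h0⟩ := hμ
    refine ⟨hOK_of_pairOK (hM r s h0), rfl, rfl, rfl, ?_, ?_⟩
    · simp [Mon.wh]
    · rcases r with r | r <;> rcases s with s | s <;> simp [Mon.wt, row₁, col₁, Var.wt]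
  · intro r s
    refine isPoly_of_mem_span (s := {μ : Mon j k | fl.hOK μ.eh ∧ μ.ez = 0 ∧
      (row₂ r).wh + μ.wh + (col₂ s).wh = 0 ∧ (row₂ r).wt + μ.wt + (col₂ s).wt = 2})
      (Submodule.sum_mem _ fun t _ => ?_) fun μ hμ => hμ
    split_ifs with h
    · refine Submodule.smul_mem _ _ (Submodule.subset_span ⟨_, ⟨hOK_of_pairOK (hX t), rfl, ?_, ?_⟩,
        rfl⟩)
      · rw [h.1, h.2]; simp [Mon.wh]
      · rcases r with r | r <;> rcases s with s | s <;> simp [Mon.wt, row₂, col₂, Var.wt]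
    · exact Submodule.zero_mem _
  · intro l
    have h1 : Psi pB ∈ wtSpan fl j k 0 0 := by
      refine Submodule.subset_span ⟨⟨0, pre, 0, 0⟩, ⟨hOK_of_nonneg le_rfl, by simp [Mon.wh],
        by simp [Mon.wt]⟩, ?_⟩
      rw [Mon.eval_mk_zero]
      simp [expA_zero, hpow_zero, hpB]
    have h2 : ∀ r ∈ finsuppAntidiag (univ : Finset (Option (Fin k ⊕ Fin j))) l,
        Psi (Q r) * ∏ e, smallParCL e ^ r e ∈ wtSpan fl j k (-l) (4 * l) := by
      intro r hr
      rw [mem_finsuppAntidiag] at hr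
      have := wtSpan_mul (Psi_mem_wtSpan hX (hQ r))
        (wtSpan_prod univ fun e _ => wtSpan_pow (smallParCL_mem (fl := fl) e) (r e))
      convert this using 2
      -- Each small parameter, with its `ε` removed, has `wh = -1`, which gives the total `-l`.
      · rw [← sum_mul, ← hr.1]; push_cast; ring
      · rw [← hr.1]
        push_cast
        rw [mul_sum, mul_sum, ← sum_add_distrib]
        refine sum_congr rfl fun e _ => ?_
        -- For `ε ħ` the degree `2` costs `2 · 2 + 0`; for `ε ħ a` and `ε ħ β` the degree `1` costs
        -- `2 · 1 + 2`. In every case this is the `4` paid for by one `ε`.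
        rcases e with _ | e <;> simp only [smallDeg, smallWt] <;> push_cast <;> ring
    have h3 := wtSpan_mul h1 (Submodule.sum_mem _ h2)
    refine isPoly_of_mem_span h3 fun μ hμ => ⟨hμ.1, ?_, ?_⟩
    · rw [hμ.2.1]; ring
    · have := hμ.2.2; linarith
  · have h1 := (hasSum_fiberwise_finset hP Finsupp.degree (finsuppAntidiag univ)
      (fun l r => by simp [mem_finsuppAntidiag, Finsupp.degree_eq_sum])).mul_left pB
    have h2 := convTo_Psi h1
    refine (congrArg (ConvTo · _) (funext fun N => sum_congr rfl fun l _ => ?_)).mpr h2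
    beta_reduce
    rw [map_mul, map_sum, mul_assoc, sum_mul]
    refine congrArg (Psi pB * ·) (sum_congr rfl fun r hr => ?_)
    rw [mem_finsuppAntidiag] at hr
    rw [map_mul, map_prod, mul_assoc]
    refine congrArg (Psi (Q r) * ·) ?_
    simp only [map_pow, Psi_smallPar, mul_pow, prod_mul_distrib, prod_pow_eq_pow_sum]
    rw [hr.1, mul_comm]
  · cases fl
    · trivial
    · refine mem_laurentCoeffs_of_exp (G := Psi (∑ t, (X t).cc + quadForm M)) ?_ ?_ hE
      · rw [map_add, map_sum, Psi_quadForm]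
        refine add_mem (sum_mem fun t _ => ?_) (sum_mem fun r _ => sum_mem fun s _ => ?_)
        · rw [GTerm.Psi_cc]
          exact mul_mem (mul_mem (toCL_mem_laurentCoeffs _) (smul_mem_laurentCoeffs _
            (Mon.eval_mem_laurentCoeffs _))) (toCL_mem_laurentCoeffs _)
        · exact mul_mem (mul_mem (toCL_mem_laurentCoeffs _) (smul_mem_laurentCoeffs _
            (Mon.eval_mem_laurentCoeffs _))) (toCL_mem_laurentCoeffs _)
      · have h1 : ∑ t, MvPowerSeries.constantCoeff (X t).cc = 0 := sum_eq_zero fun t _ => by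
          rw [GTerm.cc, map_rat_smul, map_mul, constantCoeff_pair (hX t), zero_mul, smul_zero]
        have h2 : MvPowerSeries.constantCoeff (quadForm M) = 0 := by
          rw [quadForm, map_sum]
          refine sum_eq_zero fun r _ => ?_
          rw [map_sum]
          refine sum_eq_zero fun s _ => ?_
          by_cases h : M r s = 0
          · rw [h, zero_smul, map_zero]
          · rw [map_rat_smul, constantCoeff_pair (hM r s h), smul_zero]
        rw [← MvPowerSeries.coeff_zero_eq_constantCoeff_apply, coeff_Psi,
          MvPowerSeries.coeff_zero_eq_constantCoeff_apply, map_add, map_sum, h1, h2, zero_add,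
          map_zero, mul_zero]
  · rw [← map_mul, hFP, cexp_add hG1 (quadForm_mem M)]
    refine congrArg Psi ?_
    ring

end

/-! ### Quantum factorials as polynomial families -/

/-- Functions on `ℕ` given by a polynomial of degree at most `D`. -/
def UPoly (D : ℕ) (f : ℕ → ℚ) : Prop :=
  ∃ p : Polynomial ℚ, p.natDegree ≤ D ∧ ∀ n : ℕ, f n = p.eval (n : ℚ)

theorem UPoly.mono {D E : ℕ} {f : ℕ → ℚ} (h : D ≤ E) (hf : UPoly D f) : UPoly E f :=
  let ⟨p, hp, e⟩ := hf
  ⟨p, hp.trans h, e⟩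

theorem UPoly.add {D : ℕ} {f g : ℕ → ℚ} (hf : UPoly D f) (hg : UPoly D g) :
    UPoly D fun n => f n + g n := by
  obtain ⟨p, hp, e⟩ := hf
  obtain ⟨p', hp', e'⟩ := hg
  exact ⟨p + p', Polynomial.natDegree_add_le_of_degree_le hp hp', fun n => by
    simp only [e, e', Polynomial.eval_add]⟩

theorem UPoly.mul {D E : ℕ} {f g : ℕ → ℚ} (hf : UPoly D f) (hg : UPoly E g) :
    UPoly (D + E) fun n => f n * g n := by
  obtain ⟨p, hp, e⟩ := hf
  obtain ⟨p', hp', e'⟩ := hg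
  exact ⟨p * p', Polynomial.natDegree_mul_le_of_le hp hp', fun n => by
    simp only [e, e', Polynomial.eval_mul]⟩

theorem UPoly.const (D : ℕ) (c : ℚ) : UPoly D fun _ => c :=
  ⟨Polynomial.C c, by simp, fun n => by simp⟩

theorem UPoly.sum {ι : Type} (t : Finset ι) {D : ℕ} {f : ι → ℕ → ℚ}
    (h : ∀ i ∈ t, UPoly D (f i)) : UPoly D fun n => ∑ i ∈ t, f i n := by
  classical
  induction t using Finset.induction_on with
  | empty => simpa using UPoly.const D 0
  | insert i t hi ih =>
    simp only [sum_insert hi]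
    exact .add (h _ (mem_insert_self _ _)) (ih fun l hl => h _ (mem_insert_of_mem hl))

theorem UPoly.pow (D : ℕ) : UPoly D fun n => (n : ℚ) ^ D :=
  ⟨Polynomial.X ^ D, by simp, fun n => by simp⟩

theorem UPoly.sum_range_pow (a : ℕ) : UPoly (a + 1) fun n => ∑ l ∈ range n, (l : ℚ) ^ a := by
  simp only [_root_.sum_range_pow]
  refine UPoly.sum _ fun i hi => ?_
  rw [mem_range] at hi
  have := ((UPoly.const i (bernoulli i * ((a + 1).choose i) / (a + 1))).mul
    (UPoly.pow (a + 1 - i)))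
  rw [Nat.add_sub_cancel' hi.le] at this
  convert this using 2
  ring

theorem UPoly.sum_range {D : ℕ} {f : ℕ → ℚ} (hf : UPoly D f) :
    UPoly (D + 1) fun n => ∑ l ∈ range n, f l := by
  obtain ⟨p, hp, e⟩ := hf
  simp only [e, Polynomial.eval_eq_sum_range' (Nat.lt_succ_of_le hp)]
  simp only [sum_comm (s := range _) (t := range (D + 1)), ← mul_sum]
  refine UPoly.sum _ fun a ha => ?_
  rw [mem_range] at ha
  have := (UPoly.const 0 (p.coeff a)).mul (UPoly.sum_range_pow a)
  exact this.mono (by omega)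

/-- `[n + 1] / (n + 1)` as a series in `t = ε ħ`. -/
def qIntS (n : ℕ) : PowerSeries ℚ :=
  PowerSeries.C ((n + 1 : ℚ)⁻¹) * ∑ l ∈ range (n + 1), PowerSeries.exp ℚ ^ l

/-- `[m]! / m!` as a series in `t = ε ħ`. -/
def qFactS (m : ℕ) : PowerSeries ℚ := ∏ i ∈ range m, qIntS i

theorem coeff_qIntS (n a : ℕ) : PowerSeries.coeff a (qIntS n) =
    (n + 1 : ℚ)⁻¹ * ((a.factorial : ℚ)⁻¹ * ∑ l ∈ range (n + 1), (l : ℚ) ^ a) := by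
  rw [qIntS, PowerSeries.coeff_C_mul, map_sum, mul_sum (range (n + 1)) _ (a.factorial : ℚ)⁻¹]
  refine congrArg ((n + 1 : ℚ)⁻¹ * ·) (sum_congr rfl fun l _ => ?_)
  rw [PowerSeries.exp_pow_eq_rescale_exp, PowerSeries.coeff_rescale, PowerSeries.coeff_exp]
  simp [mul_comm]

theorem coeff_zero_qIntS (n : ℕ) : PowerSeries.coeff 0 (qIntS n) = 1 := by
  have : (n + 1 : ℚ) ≠ 0 := by positivity
  rw [coeff_qIntS]
  simp [this]

/-- By Faulhaber's formula, the sum of `l^a` over `l ≤ n` has degree `a + 1` in `n + 1` and is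
divisible by `n + 1`. -/
theorem uPoly_coeff_qIntS (a : ℕ) : UPoly a fun n => PowerSeries.coeff a (qIntS n) := by
  simp only [coeff_qIntS, _root_.sum_range_pow, mul_sum]
  refine UPoly.sum _ fun i hi => ?_
  rw [mem_range] at hi
  have h1 : UPoly 1 fun n => (n : ℚ) + 1 := by
    simpa using (UPoly.pow 1).add (UPoly.const 1 1)
  have h2 : ∀ b, UPoly b fun n => ((n : ℚ) + 1) ^ b := by
    intro b
    induction b with
    | zero => simpa using UPoly.const 0 1
    | succ b ih => simpa only [pow_succ] using ih.mul h1
  refine UPoly.mono (Nat.sub_le a i) ?_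
  have := (UPoly.const 0 ((a.factorial : ℚ)⁻¹ * (bernoulli i * ((a + 1).choose i) / (a + 1)))).mul
    (h2 (a - i))
  rw [zero_add] at this
  convert this using 2 with n
  have hn : (n + 1 : ℚ) ≠ 0 := by positivity
  rw [show a + 1 - i = a - i + 1 by omega, pow_succ]
  push_cast
  field_simp

theorem qFactS_succ (m : ℕ) : qFactS (m + 1) = qFactS m * qIntS m := prod_range_succ _ _

theorem coeff_zero_qFactS (m : ℕ) : PowerSeries.coeff 0 (qFactS m) = 1 := by
  rw [PowerSeries.coeff_zero_eq_constantCoeff_apply, qFactS, map_prod]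
  refine prod_eq_one fun i _ => ?_
  rw [← PowerSeries.coeff_zero_eq_constantCoeff_apply, coeff_zero_qIntS]

/-- The increment from `m` to `m + 1` involves the coefficients of order `a < r` only, of degree at
most `2a + (r - a) ≤ 2r - 1`; summation raises the degree by one. This quadratic growth is what
`wt(ε) = -4` is made for. -/
theorem uPoly_coeff_qFactS (r : ℕ) : UPoly (2 * r) fun m => PowerSeries.coeff r (qFactS m) := by
  induction r using Nat.strong_induction_on with
  | _ r ih =>
    rcases Nat.eq_zero_or_pos r with rfl | hr
    · simp only [coeff_zero_qFactS]
      exact UPoly.const _ 1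
    have hstep : ∀ m, PowerSeries.coeff r (qFactS (m + 1)) = PowerSeries.coeff r (qFactS m) +
        ∑ a ∈ range r, PowerSeries.coeff a (qFactS m) * PowerSeries.coeff (r - a) (qIntS m) := by
      intro m
      rw [qFactS_succ, PowerSeries.coeff_mul, Nat.sum_antidiagonal_eq_sum_range_succ_mk,
        sum_range_succ, Nat.sub_self, coeff_zero_qIntS, mul_one, add_comm]
    have hsum : ∀ m, PowerSeries.coeff r (qFactS m) = ∑ l ∈ range m,
        ∑ a ∈ range r, PowerSeries.coeff a (qFactS l) * PowerSeries.coeff (r - a) (qIntS l) := by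
      intro m
      induction m with
      | zero => simp [qFactS, PowerSeries.coeff_one, hr.ne']
      | succ m ihm => rw [hstep, sum_range_succ, ihm]
    simp only [hsum]
    refine UPoly.mono (show 2 * r - 1 + 1 ≤ 2 * r by omega) (UPoly.sum_range (UPoly.sum _ ?_))
    intro a ha
    rw [mem_range] at ha
    exact ((ih a ha).mul (uPoly_coeff_qIntS (r - a))).mono (by omega)

theorem qFactS_mul_inv (m : ℕ) : qFactS m * (qFactS m)⁻¹ = 1 :=
  PowerSeries.mul_inv_cancel _ (by
    rw [← PowerSeries.coeff_zero_eq_constantCoeff_apply, coeff_zero_qFactS]; exact one_ne_zero)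

/-- The recursion for the coefficients of an inverse series preserves the bound `2r`, which is
additive in `r`. -/
theorem uPoly_coeff_qFactS_inv (r : ℕ) :
    UPoly (2 * r) fun m => PowerSeries.coeff r (qFactS m)⁻¹ := by
  induction r using Nat.strong_induction_on with
  | _ r ih =>
    have h : ∀ m, PowerSeries.coeff r (qFactS m)⁻¹ = (if r = 0 then 1 else 0) +
        ∑ a ∈ range r, (-1) * (PowerSeries.coeff a (qFactS m)⁻¹ *
          PowerSeries.coeff (r - a) (qFactS m)) := by
      intro m
      have h1 := congrArg (PowerSeries.coeff r) (qFactS_mul_inv m)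
      rw [mul_comm, PowerSeries.coeff_mul, Nat.sum_antidiagonal_eq_sum_range_succ_mk,
        sum_range_succ, Nat.sub_self, coeff_zero_qFactS, mul_one, PowerSeries.coeff_one] at h1
      rw [← mul_sum, ← h1]
      ring
    simp only [h]
    refine (UPoly.const _ _).add (UPoly.sum _ fun a ha => ?_)
    rw [mem_range] at ha
    exact ((UPoly.const 0 (-1)).mul ((ih a ha).mul (uPoly_coeff_qFactS (r - a)))).mono (by omega)

theorem subT_exp : subT (PowerSeries.exp ℚ) = q := by
  ext1 n
  rw [subT, RingHom.comp_apply, PowerSeries.coeff_rescale, PowerSeries.coeff_map,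
    PowerSeries.coeff_exp, q, expH, PowerSeries.coeff_mk, mul_comm, ← Algebra.smul_def]
  simp

theorem algebraMap_rat_kk (c : ℚ) : algebraMap ℚ KK c = subT (PowerSeries.C c) :=
  DFunLike.congr_fun (RingHom.ext_rat (algebraMap ℚ KK) (subT.comp PowerSeries.C)) c

theorem qFact_eq (m : ℕ) : qFact m = algebraMap ℚ KK m.factorial * subT (qFactS m) := by
  induction m with
  | zero => simp [qFact, qFactS]
  | succ m ih =>
    have h : qInt (m + 1) = algebraMap ℚ KK (m + 1) * subT (qIntS m) := by
      have hm : (m + 1 : ℚ) ≠ 0 := by positivity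
      rw [algebraMap_rat_kk, ← map_mul, qIntS, ← mul_assoc, ← map_mul, mul_inv_cancel₀ hm, map_one,
        one_mul, map_sum, qInt]
      simp only [map_pow, subT_exp]
    rw [qFact, prod_range_succ, ← qFact, ih, h, qFactS_succ, map_mul, Nat.factorial_succ]
    push_cast
    ring

theorem qf_eq (m : ℕ) : qf m = algebraMap ℚ KK (m.factorial : ℚ)⁻¹ * subT (qFactS m)⁻¹ := by
  have h1 : qFact m * (algebraMap ℚ KK (m.factorial : ℚ)⁻¹ * subT (qFactS m)⁻¹) = 1 := by
    have hm : (m.factorial : ℚ) ≠ 0 := by exact_mod_cast m.factorial_ne_zero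
    rw [qFact_eq, mul_mul_mul_comm, ← map_mul, ← map_mul, qFactS_mul_inv, mul_inv_cancel₀ hm,
      map_one, map_one, one_mul]
  calc qf m = qf m * (qFact m * (algebraMap ℚ KK (m.factorial : ℚ)⁻¹ * subT (qFactS m)⁻¹)) := by
        rw [h1, mul_one]
    _ = _ := by rw [← mul_assoc, mul_comm (qf m), qFact_mul_qf, one_mul]

/-! ### Corrections to the Gaussians as polynomial families in the small parameters. -/

section
variable {j k : ℕ} {c : Type} [Fintype c] [DecidableEq c]

theorem PolyDeg.pow {D : ℕ} {f : (c → ℕ) → ℚ} (hf : PolyDeg D f) (n : ℕ) :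
    PolyDeg (n * D) (f ^ n) := by
  induction n with
  | zero => rw [zero_mul, pow_zero]; exact PolyDeg.const 1
  | succ n ih => rw [pow_succ, Nat.succ_mul]; exact ih.mul hf

theorem PolyDeg.smul {D : ℕ} {f : (c → ℕ) → ℚ} (hf : PolyDeg D f) (a : ℚ) :
    PolyDeg D (a • f) := by
  have := (PolyDeg.const (c := c) a).mul hf
  rw [zero_add] at this
  exact this

theorem UPoly.polyDeg_comp {D : ℕ} {f : ℕ → ℚ} (hf : UPoly D f) {L : (c → ℕ) → ℕ}
    (hL : PolyDeg 1 fun i => (L i : ℚ)) : PolyDeg D fun i => f (L i) := by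
  obtain ⟨p, hp, e⟩ := hf
  have : (fun i => f (L i)) = ∑ a ∈ range (D + 1), p.coeff a • (fun i => (L i : ℚ)) ^ a := by
    funext i
    rw [e, Polynomial.eval_eq_sum_range' (Nat.lt_succ_of_le hp)]
    simp
  rw [this]
  refine PolyDeg.sum _ fun a ha => (PolyDeg.mono ?_ (hL.pow a)).smul _
  rw [mem_range] at ha
  omega

/-- `[m]! / m!` in `𝓒(J, K)`. -/
def qFactC (j k m : ℕ) : CC j k := kC j k (subT (qFactS m))

/-- `m! / [m]!` in `𝓒(J, K)`. -/
def qFactInvC (j k m : ℕ) : CC j k := kC j k (subT (qFactS m)⁻¹)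

/-- Only the parameter `ε ħ` occurs, and the bound `2n` on its `n`-th coefficient is exactly the
degree `2` allotted to it. -/
theorem polyFam_qFactC {L : (c → ℕ) → ℕ} (hL : PolyDeg 1 fun i => (L i : ℚ)) :
    PolyFam smallPar smallDeg fun i => qFactC j k (L i) :=
  .ofSeries none (fun n i => PowerSeries.coeff n (qFactS (L i)))
    (fun n => by
      have := (uPoly_coeff_qFactS n).polyDeg_comp hL
      rwa [mul_comm] at this)
    fun i => hasSum_kC_subT _

theorem polyFam_qFactInvC {L : (c → ℕ) → ℕ} (hL : PolyDeg 1 fun i => (L i : ℚ)) :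
    PolyFam smallPar smallDeg fun i => qFactInvC j k (L i) :=
  .ofSeries none (fun n i => PowerSeries.coeff n (qFactS (L i))⁻¹)
    (fun n => by
      have := (uPoly_coeff_qFactS_inv n).polyDeg_comp hL
      rwa [mul_comm] at this)
    fun i => hasSum_kC_subT _

/-- The `n`-th coefficient is `Q^n / n!`. Thus a quadratic exponent of `q` is admissible, while `ε ħ
a` and `ε ħ β` may only be multiplied by linear functions of the indices. -/
theorem polyFam_cexp (e : Option (Fin k ⊕ Fin j)) {Q : (c → ℕ) → ℚ}
    (hQ : PolyDeg (smallDeg e) Q) :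
    PolyFam smallPar smallDeg fun i => (cexp (Q i • smallPar e) : CC j k) :=
  .ofSeries e (fun n i => (n.factorial : ℚ)⁻¹ * Q i ^ n)
    (fun n => (hQ.pow n).smul _) fun i => by
      have := hasSum_cexp (fil_smul (Q i) (smallPar_mem (j := j) (k := k) e))
      simpa only [smul_pow, smul_smul] using this

end

/-! ### Normal ordered series as perturbed Gaussians -/

section
variable {j k : ℕ}

/-- Polynomials in `a, b` as elements of `𝓒(J, K)`. -/
def abC (j k : ℕ) : MvPolynomial (Fin k × Bool) Qe →+* CC j k :=
  (MvPowerSeries.C.comp PowerSeries.C).comp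
    (MvPolynomial.rename fun p : Fin k × Bool => (p.1, midGen p.2)).toRingHom

/-- `ħ u` for a polynomial `u` in `a, b`. -/
def uC (j k : ℕ) : MvPolynomial (Fin k × Bool) Qe →+ CC j k :=
  (AddMonoidHom.mulLeft (MvPowerSeries.C PowerSeries.X)).comp (abC j k).toAddMonoidHom

theorem uC_eq_hC (u : MvPolynomial (Fin k × Bool) Qe) :
    uC j k u = hC (MvPolynomial.rename (fun p => (p.1, midGen p.2)) u) :=
  (map_mul (MvPowerSeries.C (σ := Fin j × Gen) (R := LatSeries k)) _ _).symm

theorem uC_mem (u : MvPolynomial (Fin k × Bool) Qe) : uC j k u ∈ FilRing.Fil (A := CC j k) 1 := by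
  rw [uC_eq_hC]; exact hC_mem _

theorem uC_mb (i : Fin k) : uC j k (mb i) = Var.cc (.inl (i, .b)) := by
  rw [uC_eq_hC, mb, MvPolynomial.rename_X]; rfl

theorem abC_ma (i : Fin k) : abC j k (ma i) = Var.cc (.inl (i, .a)) := by
  change MvPowerSeries.C (PowerSeries.C (MvPolynomial.rename _ (ma i))) = _
  rw [ma, MvPolynomial.rename_X]; rfl

theorem uC_me : uC j k me = smallPar none := by
  rw [uC_eq_hC, me, MvPolynomial.rename_C]; rfl

theorem uC_me_ma (i : Fin k) : uC j k (me * ma i) = smallPar (some (.inl i)) := by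
  rw [uC_eq_hC, me, ma, map_mul, MvPolynomial.rename_C, MvPolynomial.rename_X]; rfl

theorem uC_mul (u v : MvPolynomial (Fin k × Bool) Qe) : uC j k (u * v) = abC j k u * uC j k v := by
  change MvPowerSeries.C PowerSeries.X * abC j k (u * v) =
    abC j k u * (MvPowerSeries.C PowerSeries.X * abC j k v)
  rw [map_mul]
  ring

/-- `y_i` and `x_i` in `𝓒(J, K)`. -/
def latG (j : ℕ) {k : ℕ} (p : Fin k × Gen) : CC j k :=
  MvPowerSeries.C (PowerSeries.C (MvPolynomial.X p))

theorem cc_y (i : Fin k) : (Var.cc (.inl (i, .y)) : CC j k) = kC j k hb * latG j (i, .y) := by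
  rw [Var.cc, hC, map_mul, kC, RingHom.comp_apply, hb, PowerSeries.map_X]; rfl

theorem cc_x (i : Fin k) : (Var.cc (.inl (i, .x)) : CC j k) = latG j (i, .x) := rfl

/-- The series `y^K e^{ħ u} x^N`. -/
def norS (K : Fin k → ℕ) (g : Mid k) (N : Fin k → ℕ) : LatSeries k :=
  PowerSeries.C (∏ i, MvPolynomial.X (i, Gen.y) ^ K i) * ιM g *
    PowerSeries.C (∏ i, MvPolynomial.X (i, Gen.x) ^ N i)

theorem ιM_expH (u : MvPolynomial (Fin k × Bool) Qe) :
    ιM (expH u) = expH (MvPolynomial.rename (fun p => (p.1, midGen p.2)) u) := psMap_expH _ _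

theorem ιM_C (u : MvPolynomial (Fin k × Bool) Qe) :
    ιM (PowerSeries.C u) =
      PowerSeries.C (MvPolynomial.rename (fun p => (p.1, midGen p.2)) u) := psMap_C _ _

theorem C_smul (s : KK) (f : LatSeries k) :
    (MvPowerSeries.C (s • f) : CC j k) = kC j k s * MvPowerSeries.C f := by
  rw [Algebra.smul_def, map_mul]; rfl

theorem C_norS (K : Fin k → ℕ) (u : MvPolynomial (Fin k × Bool) Qe) (N : Fin k → ℕ) :
    (MvPowerSeries.C (norS K (expH u) N) : CC j k) =
      (∏ i, latG j (i, .y) ^ K i) * (∏ i, latG j (i, .x) ^ N i) * cexp (uC j k u) := by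
  rw [norS, map_mul, map_mul, ιM_expH, uC_eq_hC, cexp_hC, mul_right_comm]
  simp only [map_prod, map_pow]
  rfl

theorem OO_norS (s : KK) (K : Fin k → ℕ) (g : Mid k) (N : Fin k → ℕ) :
    OOe k (s • norS K g N) = s • (yy K * mid k g * xx N) := by
  rw [map_smul, OOe_apply, norS, OO_mul]

/-- Connects the two notions of infinite sum: the `m`-th term is divisible by `ħ^m`, so each
coefficient of the `ħ`-adic sum is a finite sum. -/
theorem hasSum_C_hsum (g : ℕ → LatSeries k) :
    HasSum (fun m => (MvPowerSeries.C (hb ^ m • g m) : CC j k)) (MvPowerSeries.C (hsum g)) := by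
  classical
  rw [hasSum_cc_iff]
  intro d h
  obtain ⟨z, hz⟩ := hsum_spec g (h + 1)
  have e : PowerSeries.coeff h (MvPowerSeries.coeff d (MvPowerSeries.C (hsum g) : CC j k)) =
      ∑ m ∈ range (h + 1), PowerSeries.coeff h (MvPowerSeries.coeff d
        (MvPowerSeries.C (hb ^ m • g m) : CC j k)) := by
    simp only [MvPowerSeries.coeff_C]
    split_ifs
    · rw [hz, map_add, map_sum, hb_pow_smul_ps (h + 1), PowerSeries.coeff_X_pow_mul']
      simp
    · simp
  rw [e]
  refine hasSum_sum_of_ne_finset_zero fun m hm => ?_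
  rw [mem_range, not_lt] at hm
  rw [MvPowerSeries.coeff_C]
  split_ifs
  · rw [hb_pow_smul_ps, PowerSeries.coeff_X_pow_mul', if_neg (by omega)]
  · simp

theorem toCL_C (f : LatSeries k) : toCL 0 k (MvPowerSeries.C f) = Psi (MvPowerSeries.C f) := by
  rw [Psi_C, toCL, MvPowerSeries.map_C]

/-- A criterion for elements given by normal ordered series. -/
theorem elemPG_of_hsum (z : DD k) (s : ℕ → KK) (K N : ℕ → Fin k → ℕ)
    (u : ℕ → MvPolynomial (Fin k × Bool) Qe)
    (hz : z = hsum fun m => s m • (yy (K m) * mid k (expH (u m)) * xx (N m)))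
    (X : GTerm 0 k) (hX : Flavour.rational.pairOK (row₂ X.r) (col₂ X.c))
    (M : Fin 0 ⊕ Fin k → Fin k ⊕ Fin 0 → ℚ)
    (hM : ∀ r s, M r s ≠ 0 → Flavour.rational.pairOK (row₁ (j := 0) (k := k) r) (col₁ s))
    (pre : Fin k → ℤ) {f : (Unit → ℕ) → CC 0 k} (hf : PolyFam smallPar smallDeg f)
    (hterm : ∀ i : Unit → ℕ, kC 0 k (hb ^ i () * s (i ())) *
      ((∏ l, latG 0 (l, .y) ^ K (i ()) l) * (∏ l, latG 0 (l, .x) ^ N (i ()) l) *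
        cexp (uC 0 k (u (i ())))) =
      (∏ l, expB l (pre l)) * (expMon (fun _ => X.cc) i * f i) * cexp (quadForm M)) :
    ElemPG z := by
  refine ⟨hsum fun m => s m • norS (K m) (expH (u m)) (N m), ?_, ?_⟩
  · have := map_hsum (OOe k).toLinearMap fun m => s m • norS (K m) (expH (u m)) (N m)
    refine this.trans ?_
    rw [hz]
    refine congrArg hsum (funext fun m => ?_)
    exact OO_norS _ _ _ _
  · obtain ⟨F, hF⟩ : Summable fun i => expMon (fun _ => X.cc) i * f i :=
      FilRing.summable _ _ finite_sum_lt fun i => fil_mul_right _ (expMon_mem (fun _ => X.cc_mem) i)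
    have h1 := isPertGauss_of_hasSum (fl := .rational) (fun _ => X) (fun _ => hX) M hM pre hf hF
    have h2 := (hF.mul_left (∏ l, expB l (pre l))).mul_right (cexp (quadForm M))
    have h3 := hasSum_C_hsum (j := 0) fun m => s m • norS (K m) (expH (u m)) (N m)
    rw [← (Equiv.funUnique Unit ℕ).hasSum_iff] at h3
    have h4 := h3.unique ((congrArg (HasSum · _) (funext fun i => ?_)).mpr h2)
    · change IsPertGauss _ (toCL 0 k _)
      rw [toCL_C, h4]
      exact h1
    · rw [← hterm, Function.comp_apply, smul_smul, C_smul, C_norS]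
      rfl

/-- The generating function of a linear map. -/
def genFun (f : DD j →ₗ[KK] DD k) : CC j k := fun d =>
  ((∏ p, (d p).factorial : ℕ) : ℚ)⁻¹ • (OOe k).symm (f (dMon d))

theorem coeff_genFun (f : DD j →ₗ[KK] DD k) (d : (Fin j × Gen) →₀ ℕ) :
    MvPowerSeries.coeff d (genFun f) =
      ((∏ p, (d p).factorial : ℕ) : ℚ)⁻¹ • (OOe k).symm (f (dMon d)) := rfl

theorem isGenFun_genFun (f : DD j →ₗ[KK] DD k) : IsGenFun f (genFun f) := by
  intro d
  have h0 : ((∏ p, (d p).factorial : ℕ) : ℚ) ≠ 0 :=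
    Nat.cast_ne_zero.mpr (prod_ne_zero_iff.mpr fun p _ => Nat.factorial_ne_zero _)
  rw [coeff_genFun, ← OOe_apply, ← map_nsmul, ← Nat.cast_smul_eq_nsmul ℚ, smul_smul,
    mul_inv_cancel₀ h0, one_smul, LinearEquiv.apply_symm_apply]
  rfl

/-- The rescaled generating function of a linear map. -/
def genFun' (f : DD j →ₗ[KK] DD k) : CC j k := fun d =>
  hb ^ (∑ i, (d (i, .y) + d (i, .b))) • MvPowerSeries.coeff d (genFun f)

theorem coeff_genFun' (f : DD j →ₗ[KK] DD k) (d : (Fin j × Gen) →₀ ℕ) :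
    MvPowerSeries.coeff d (genFun' f) = hb ^ (∑ i, (d (i, .y) + d (i, .b))) •
      MvPowerSeries.coeff d (genFun f) := rfl

/-- The powers of `ħ` inserted for `η` and `β` are exactly those removed by `Psi`. -/
theorem Psi_genFun' (f : DD j →ₗ[KK] DD k) : Psi (genFun' f) = toCL j k (genFun f) := by
  ext1 d
  rw [coeff_Psi, toCL, MvPowerSeries.coeff_map, coeff_genFun', hb_pow_smul_ps, map_mul, map_pow,
      ofPowerSeries_X_eq, ← hpow_nsmul, ← mul_assoc, ← hpow_add]
  have : (∑ p, (d p : ℤ) * Var.wh (j := j) (k := k) (.inr p)) +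
      ((∑ i, (d (i, .y) + d (i, .b)) : ℕ) : ℤ) * 1 = 0 := by
    rw [Fintype.sum_prod_type]
    push_cast
    rw [mul_one, ← sum_add_distrib]
    refine sum_eq_zero fun i _ => ?_
    rw [sum_gen]
    simp only [Var.wh]
    ring
  rw [this, hpow_zero, one_mul]

theorem prod_smul_pow (b a : Fin j → ℕ) (p r : Fin j → LatPoly k) :
    (∏ i, ((((b i).factorial : ℚ)⁻¹) • (PowerSeries.X * PowerSeries.C (p i)) ^ b i) *
        ((((a i).factorial : ℚ)⁻¹) • PowerSeries.C (r i) ^ a i) : LatSeries k) =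
      (∏ i, ((b i).factorial : ℚ) * (a i).factorial)⁻¹ •
        (PowerSeries.X ^ (∑ i, b i) * PowerSeries.C (∏ i, p i ^ b i * r i ^ a i)) := by
  simp only [smul_mul_smul_comm, mul_pow, Finset.prod_smul, ← mul_inv, prod_inv_distrib]
  refine congrArg (_ • ·) ?_
  rw [map_prod, ← prod_pow_eq_pow_sum, ← prod_mul_distrib]
  refine prod_congr rfl fun i _ => ?_
  rw [map_mul, map_pow, map_pow, mul_assoc]

/-- A criterion for linear maps given by normal ordered series. -/
theorem genFun_mem {c : Type} [Fintype c] [DecidableEq c] (f : DD j →ₗ[KK] DD k)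
    (δy δx : (c → ℕ) → Fin j → ℕ) (V : ((Fin j × Gen) →₀ ℕ) → Finset (c → ℕ))
    (hV : ∀ d v, v ∈ V d ↔ ∀ i, δy v i = d (i, .y) ∧ δx v i = d (i, .x))
    (s : (c → ℕ) → KK) (K N : (c → ℕ) → Fin k → ℕ)
    (u : (c → ℕ) → MvPolynomial (Fin k × Bool) Qe)
    (lb la : (c → ℕ) → Fin j → MvPolynomial (Fin k × Bool) Qe)
    (hf : ∀ d, hb ^ (∑ i, d (i, .y)) • f (dMon d) = ∑ v ∈ V d, s v • (yy (K v) *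
      mid k (expH (u v) * PowerSeries.C (∏ i, lb v i ^ d (i, .b) * la v i ^ d (i, .a))) * xx (N v)))
    (X : c → GTerm j k) (hX : ∀ t, Flavour.laurent.pairOK (row₂ (X t).r) (col₂ (X t).c))
    (M : Fin j ⊕ Fin k → Fin k ⊕ Fin j → ℚ)
    (hM : ∀ r s, M r s ≠ 0 → Flavour.laurent.pairOK (row₁ (j := j) (k := k) r) (col₁ s))
    {g : (c → ℕ) → CC j k} (hg : PolyFam smallPar smallDeg g)
    (hterm : ∀ v, (∏ i, MvPowerSeries.X (i, .y) ^ δy v i * MvPowerSeries.X (i, .x) ^ δx v i) *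
      ((∏ i, ((δy v i).factorial : ℚ) * (δx v i).factorial)⁻¹ • (kC j k (s v) *
        ((∏ l, latG j (l, .y) ^ K v l) * (∏ l, latG j (l, .x) ^ N v l) * cexp (uC j k (u v))))) *
      cexp (∑ i, (MvPowerSeries.X (i, .b) * uC j k (lb v i) +
        MvPowerSeries.X (i, .a) * abC j k (la v i))) =
      expMon (fun t => (X t).cc) v * g v * cexp (quadForm M)) :
    ∃ F ∈ PGplus j k, IsGenFun f F := by
  refine ⟨genFun f, ?_, isGenFun_genFun f⟩
  change IsPertGauss _ (toCL j k _)
  rw [← Psi_genFun']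
  obtain ⟨F, hF⟩ : Summable fun i => expMon (fun t => (X t).cc) i * g i :=
    FilRing.summable _ _ finite_sum_lt fun i =>
      fil_mul_right _ (expMon_mem (fun t => (X t).cc_mem) i)
  have h1 := isPertGauss_of_hasSum (fl := .laurent) X hX M hM 0 hg hF
  simp only [Pi.zero_apply, expB_zero, prod_const_one, one_mul] at h1
  have h2 := hF.mul_right (cexp (quadForm M))
  have h3 := hasSum_of_coeff (genFun' f) δy δx V hV
    -- The factorials of the exponents of `η` and `ξ` go into the summand; those of `β` and `α` are
    -- absorbed by the exponentials of `β` and `α`.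
    (fun v => (∏ i, ((δy v i).factorial : ℚ) * (δx v i).factorial)⁻¹ •
      (s v • norS (K v) (expH (u v)) (N v)))
    (fun v i => PowerSeries.X * PowerSeries.C
      (MvPolynomial.rename (fun p => (p.1, midGen p.2)) (lb v i)))
    (fun v i => PowerSeries.C (MvPolynomial.rename (fun p => (p.1, midGen p.2)) (la v i))) ?_
  · have h4 := h3.unique ((congrArg (HasSum · _) (funext fun v => ?_)).mpr h2)
    · rw [h4]; exact h1
    · rw [← hterm v, map_rat_smul, C_smul, C_norS]
      simp only [uC_eq_hC]
      rfl
  · intro d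
    have h0 : ∀ v ∈ V d, ((∏ p, (d p).factorial : ℕ) : ℚ) =
        (∏ i, ((δy v i).factorial : ℚ) * (δx v i).factorial) *
          ∏ i, ((d (i, .b)).factorial : ℚ) * (d (i, .a)).factorial := by
      intro v hv
      rw [Fintype.prod_prod_type]
      push_cast
      rw [← prod_mul_distrib]
      refine prod_congr rfl fun i _ => ?_
      rw [prod_gen, ((hV d v).mp hv i).1, ((hV d v).mp hv i).2]
      ring
    have h5 : (OOe k).symm (hb ^ (∑ i, d (i, .y)) • f (dMon d)) = ∑ v ∈ V d, s v • norS (K v)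
        (expH (u v) * PowerSeries.C (∏ i, lb v i ^ d (i, .b) * la v i ^ d (i, .a))) (N v) := by
      rw [hf, map_sum]
      refine sum_congr rfl fun v _ => ?_
      rw [← OO_norS, LinearEquiv.symm_apply_apply]
    rw [coeff_genFun', coeff_genFun, sum_add_distrib, add_comm (∑ i, d (i, .y)), pow_add, mul_smul,
      ← smul_comm (_ : ℚ) (hb ^ (∑ i, d (i, .y))), ← map_smul, h5, smul_sum, smul_sum]
    refine sum_congr rfl fun v hv => ?_
    rw [h0 v hv, prod_smul_pow, norS, norS, map_mul, ιM_C, hb_pow_smul_ps, mul_inv, mul_smul,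
      smul_mul_smul_comm, mul_smul, mul_smul_comm, mul_smul_comm]
    refine congrArg (fun p : LatSeries k => _ • _ • p) ?_
    rw [smul_mul_assoc, mul_smul_comm]
    refine congrArg (fun p : LatSeries k => s v • p) ?_
    simp only [map_prod, map_mul, map_pow]
    ring

end

/-! ### Bookkeeping for exponents, scalar factors and quadratic forms. -/

section
variable {j k : ℕ}

theorem cexp_nsmul {g : CC j k} (hg : g ∈ FilRing.Fil (A := CC j k) 1) (n : ℕ) :
    cexp (n • g) = cexp g ^ n := by
  induction n with
  | zero => rw [zero_smul, cexp_zero, pow_zero]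
  | succ n ih =>
    rw [succ_nsmul, cexp_add (Submodule.smul_of_tower_mem _ n hg) hg, ih, pow_succ]

theorem cexp_add₃ {a b c : CC j k} (ha : a ∈ FilRing.Fil (A := CC j k) 1)
    (hb : b ∈ FilRing.Fil (A := CC j k) 1) (hc : c ∈ FilRing.Fil (A := CC j k) 1) :
    cexp (a + b + c) = cexp a * cexp b * cexp c := by
  rw [cexp_add (Ideal.add_mem _ ha hb) hc, cexp_add ha hb]

theorem cexp_add₄ {a b c d : CC j k} (ha : a ∈ FilRing.Fil (A := CC j k) 1)
    (hb : b ∈ FilRing.Fil (A := CC j k) 1) (hc : c ∈ FilRing.Fil (A := CC j k) 1)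
    (hd : d ∈ FilRing.Fil (A := CC j k) 1) :
    cexp (a + b + c + d) = cexp a * cexp b * cexp c * cexp d := by
  rw [cexp_add (Ideal.add_mem _ (Ideal.add_mem _ ha hb) hc) hd, cexp_add₃ ha hb hc]

/-- The exponent of the factors `𝒜` and `B` of a Gaussian term. -/
def GTerm.expo (t : GTerm j k) : CC j k :=
  ∑ i, (t.α i : ℚ) • MvPowerSeries.X (i, .a) +
    ∑ i, (-(t.β i / 2 : ℚ)) • Var.cc (.inl (i, .b))

theorem GTerm.expo_mem (t : GTerm j k) : t.expo ∈ FilRing.Fil (A := CC j k) 1 :=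
  Ideal.add_mem _ (Ideal.sum_mem _ fun _ _ => smul_X_mem _ _)
    (Ideal.sum_mem _ fun _ _ => smul_hC_mem _ _)

theorem smul_b_mem (c : ℚ) (i : Fin k) :
    (c • Var.cc (.inl (i, .b)) : CC j k) ∈ FilRing.Fil (A := CC j k) 1 := smul_hC_mem _ _

theorem GTerm.cc_eq (t : GTerm j k) :
    t.cc = t.coef • ((row₂ t.r).cc * (col₂ t.c).cc * cexp t.expo) := by
  rw [GTerm.cc, GTerm.expo, cexp_add (Ideal.sum_mem _ fun _ _ => smul_X_mem _ _)
    (Ideal.sum_mem _ fun _ _ => smul_b_mem _ _), cexp_sum fun i => smul_X_mem _ _,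
    cexp_sum fun i => smul_b_mem _ _]
  rfl

theorem sum_nsmul_expo_mem {c : Type} [Fintype c] (X : c → GTerm j k) (v : c → ℕ) :
    ∑ t, v t • (X t).expo ∈ FilRing.Fil (A := CC j k) 1 :=
  Ideal.sum_mem _ fun t _ => Submodule.smul_of_tower_mem _ _ (X t).expo_mem

/-- Separates the scalars, the variables and one exponential of a linear form, so that the termwise
identities reduce to an identity of exponents and a monomial identity. -/
theorem expMon_gterm {c : Type} [Fintype c] [DecidableEq c] (X : c → GTerm j k) (v : c → ℕ) :
    expMon (fun t => (X t).cc) v = (∏ t, algebraMap ℚ (CC j k)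
      ((((v t).factorial : ℚ)⁻¹) * (X t).coef ^ v t)) *
      (∏ t, ((row₂ (X t).r).cc * (col₂ (X t).c).cc) ^ v t) * cexp (∑ t, v t • (X t).expo) := by
  rw [expMon, cexp_sum fun t => Submodule.smul_of_tower_mem _ _ (X t).expo_mem,
    ← prod_mul_distrib, ← prod_mul_distrib]
  refine prod_congr rfl fun t _ => ?_
  rw [GTerm.cc_eq, smul_pow, mul_pow, smul_smul, Algebra.smul_def, cexp_nsmul (X t).expo_mem,
    mul_assoc]

theorem kC_algebraMap (c : ℚ) : kC j k (algebraMap ℚ KK c) = algebraMap ℚ (CC j k) c :=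
  DFunLike.congr_fun (RingHom.ext_rat ((kC j k).comp (algebraMap ℚ KK)) (algebraMap ℚ (CC j k))) c

theorem kC_qFact (m : ℕ) : kC j k (qFact m) = algebraMap ℚ (CC j k) m.factorial * qFactC j k m := by
  rw [qFact_eq, map_mul, kC_algebraMap]; rfl

theorem kC_qf (m : ℕ) :
    kC j k (qf m) = algebraMap ℚ (CC j k) (m.factorial : ℚ)⁻¹ * qFactInvC j k m := by
  rw [qf_eq, map_mul, kC_algebraMap]; rfl

/-- The matrix with a single entry. -/
def matSingle (r : Fin j ⊕ Fin k) (s : Fin k ⊕ Fin j) (c : ℚ) :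
    Fin j ⊕ Fin k → Fin k ⊕ Fin j → ℚ := fun r' s' => if r' = r ∧ s' = s then c else 0

theorem quadForm_single (r : Fin j ⊕ Fin k) (s : Fin k ⊕ Fin j) (c : ℚ) :
    quadForm (matSingle r s c) = c • ((row₁ r).cc * (col₁ s).cc) := by
  rw [quadForm, sum_eq_single r, sum_eq_single s, matSingle, if_pos ⟨rfl, rfl⟩]
  · intro s' _ h
    rw [matSingle, if_neg fun h' => h h'.2, zero_smul]
  · simp
  · intro r' _ h
    refine sum_eq_zero fun s' _ => ?_
    rw [matSingle, if_neg fun h' => h h'.1, zero_smul]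
  · simp

theorem quadForm_add (M M' : Fin j ⊕ Fin k → Fin k ⊕ Fin j → ℚ) :
    quadForm (M + M') = quadForm M + quadForm M' := by
  simp only [quadForm, Pi.add_apply, add_smul, sum_add_distrib]

theorem quadForm_zero : quadForm (0 : Fin j ⊕ Fin k → Fin k ⊕ Fin j → ℚ) = 0 := by
  simp [quadForm]

/-- Without Greek variables the only entries are `a_i b_l`, where `wh = 1` means a single factor
`ħ`. -/
theorem pairOK_rational (r : Fin 0 ⊕ Fin k) (s : Fin k ⊕ Fin 0) :
    Flavour.rational.pairOK (row₁ (j := 0) (k := k) r) (col₁ s) := by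
  rcases r with r | r
  · exact r.elim0
  · rcases s with s | s
    · exact (by norm_num : (0 : ℤ) ≤ 0 + 1)
    · exact s.elim0

theorem polyDeg_choose_two {c : Type} [Fintype c] [DecidableEq c] {L : (c → ℕ) → ℕ}
    (hL : PolyDeg 1 fun i => (L i : ℚ)) : PolyDeg 2 fun i => ((L i).choose 2 : ℚ) := by
  have : UPoly 2 fun n => (n.choose 2 : ℚ) := by
    refine ⟨Polynomial.C (1 / 2) * (Polynomial.X ^ 2 - Polynomial.X), ?_, fun n => ?_⟩
    · compute_degree
    · beta_reduce
      rw [Nat.cast_choose_two]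
      simp
      ring
  exact this.polyDeg_comp hL

end

/-! ### The `R`-matrix, the spinner and the ribbon element -/

/-- The term `κ y_i x_l B_i^{β}`. -/
def yxTerm {k : ℕ} (i l : Fin k) (κ : ℚ) (β : Fin k → ℤ) : GTerm 0 k := ⟨.inl i, .inr l, κ, 0, β⟩

theorem yxTerm_ok {k : ℕ} (i l : Fin k) (κ : ℚ) (β : Fin k → ℤ) :
    Flavour.rational.pairOK (row₂ (yxTerm i l κ β).r) (col₂ (yxTerm i l κ β).c) :=
  (by norm_num : (0 : ℤ) ≤ 1 + 0)

theorem expMon_yxTerm {k : ℕ} (i l : Fin k) (κ : ℚ) (β : Fin k → ℤ) (v : Unit → ℕ) :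
    expMon (fun _ => (yxTerm i l κ β).cc) v =
      algebraMap ℚ (CC 0 k) ((((v ()).factorial : ℚ)⁻¹) * κ ^ v ()) *
      (kC 0 k hb * latG 0 (i, .y) * latG 0 (l, .x)) ^ v () *
        cexp (v () • ∑ i, (-(β i / 2 : ℚ)) • Var.cc (.inl (i, .b))) := by
  rw [expMon_gterm]
  simp only [univ_unique, prod_singleton, sum_singleton]
  rw [← cc_y, ← cc_x, GTerm.expo]
  simp [yxTerm, row₂, col₂]

theorem cexp_prod_expB {k : ℕ} (pre : Fin k → ℤ) : (∏ l, expB l (pre l) : CC 0 k) =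
    cexp (∑ i, (-(pre i / 2 : ℚ)) • Var.cc (.inl (i, .b))) := by
  rw [cexp_sum fun i => smul_b_mem _ _]; rfl

theorem polyDeg_coord_unit : PolyDeg 1 fun i : Unit → ℕ => (i () : ℚ) := PolyDeg.coord ()

/-- Here `G = ħ b_0 a_1 + ħ y_0 x_1`, and the only correction is `m!/[m]!`. -/
theorem elemPG_Rmat : ElemPG Rmat := by
  refine elemPG_of_hsum Rmat qf (fun m => ![m, 0]) (fun m => ![0, m]) (fun _ => mb 0 * ma 1) ?_
    (yxTerm 0 1 1 0) (yxTerm_ok _ _ _ _) (matSingle (.inr 1) (.inl 0) 1)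
    (fun r s _ => pairOK_rational r s) 0 (polyFam_qFactInvC polyDeg_coord_unit) fun i => ?_
  · rw [Rmat_eq_hsum]
    refine congrArg hsum (funext fun m => ?_)
    rw [yy_two, xx_two]
    simp
  · rw [expMon_yxTerm, cexp_prod_expB, quadForm_single, map_mul, kC_qf, mul_comm (mb 0), uC_mul,
      abC_ma, uC_mb]
    simp only [Fin.prod_univ_two, Pi.zero_apply, Int.cast_zero, zero_div, neg_zero, zero_smul,
      sum_const_zero, smul_zero, cexp_zero, Matrix.cons_val_zero, Matrix.cons_val_one, pow_zero,
      one_pow, mul_one, one_mul, one_smul, map_pow, mul_pow, row₁, col₁, Sum.elim_inl, Sum.elim_inr]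
    ring

/-- Here `G = -ħ b_0 a_1 - ħ B_0⁻¹ y_0 x_1`. The factors `q^{-m(m-1)/2}` and `A_1^{-m}` are
corrections, the former quadratic and the latter linear in `m`. -/
theorem elemPG_RmatInv : ElemPG RmatInv := by
  refine elemPG_of_hsum RmatInv (fun m => (-1) ^ m * qf m) (fun m => ![m, 0]) (fun m => ![0, m])
    (fun m => -(m.choose 2 • me) + m • mb 0 + m • (me * ma 1) - mb 0 * ma 1) ?_
    (yxTerm 0 1 (-1) ![-2, 0]) (yxTerm_ok _ _ _ _) (matSingle (.inr 1) (.inl 0) (-1))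
    (fun r s _ => pairOK_rational r s) 0 (((polyFam_qFactInvC polyDeg_coord_unit).mul smallPar_mem
      (polyFam_cexp none ((polyDeg_choose_two polyDeg_coord_unit).smul (-1)))).mul smallPar_mem
      (polyFam_cexp (some (.inl 1)) polyDeg_coord_unit)) fun i => ?_
  · rw [RmatInv]
    refine congrArg hsum (funext fun m => ?_)
    rw [yy_two, xx_two]
    simp
  · have hE : cexp (uC 0 2 (-((i ()).choose 2 • me) + i () • mb 0 + i () • (me * ma 1) -
        mb 0 * ma 1)) = cexp (i () • ∑ l : Fin 2, (-(((![-2, 0] : Fin 2 → ℤ) l : ℤ) / 2 : ℚ)) •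
          Var.cc (.inl (l, .b))) * cexp (((-1 : ℚ) • fun i : Unit → ℕ => ((i ()).choose 2 : ℚ)) i •
          smallPar none) * cexp ((i () : ℚ) • smallPar (some (.inl 1))) *
          cexp (quadForm (matSingle (.inr 1) (.inl 0) (-1))) := by
      rw [← cexp_add₄ (Submodule.smul_of_tower_mem _ _ (Ideal.sum_mem _ fun _ _ => smul_b_mem _ _))
        (fil_smul _ (smallPar_mem _)) (fil_smul _ (smallPar_mem _)) (quadForm_mem _)]
      refine congrArg cexp ?_
      rw [map_sub, map_add, map_add, map_neg, map_nsmul, map_nsmul, map_nsmul, uC_me, uC_me_ma,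
        uC_mb, mul_comm (mb 0), uC_mul, abC_ma, uC_mb, quadForm_single]
      simp only [Fin.sum_univ_two, Matrix.cons_val_zero, Matrix.cons_val_one, row₁, col₁,
        Sum.elim_inl, Sum.elim_inr, Pi.smul_apply]
      norm_num [Algebra.smul_def]
      ring
    rw [expMon_yxTerm, cexp_prod_expB, map_mul, map_mul, kC_qf, hE]
    simp only [Pi.mul_apply]
    simp only [Fin.prod_univ_two, Pi.zero_apply, Int.cast_zero, zero_div, neg_zero, zero_smul,
      sum_const_zero, cexp_zero, Matrix.cons_val_zero, Matrix.cons_val_one, pow_zero,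
      mul_one, one_mul, map_pow, map_neg, map_one, mul_pow, map_mul]
    ring

theorem uC_halfW : uC 0 1 halfW =
    (-(1 / 2 : ℚ)) • Var.cc (.inl (0, .b)) + (-(1 / 2 : ℚ)) • smallPar (some (.inl 0)) := by
  have h : (2 : ℕ) • uC 0 1 halfW = -(smallPar (some (.inl 0))) - Var.cc (.inl (0, .b)) := by
    rw [← map_nsmul, nsmul_eq_mul, Nat.cast_ofNat, two_mul_halfW, wM, zero_smul, map_sub, map_sub,
      map_zero, uC_me_ma, uC_mb, zero_sub]
  have h2 : uC 0 1 halfW = algebraMap ℚ (CC 0 1) (1 / 2) * ((2 : ℕ) • uC 0 1 halfW) := by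
    rw [nsmul_eq_mul, ← mul_assoc, Nat.cast_ofNat, ← map_ofNat (algebraMap ℚ (CC 0 1)), ← map_mul]
    norm_num
  rw [h2, h, Algebra.smul_def, Algebra.smul_def, map_neg]
  ring

/-- There is no sum: `0 ^ m` keeps only `m = 0`, the Gaussian term has coefficient zero, and the
whole of `A^{c/2}` belongs to the perturbation. -/
theorem elemPG_mid_expH {u : MvPolynomial (Fin 1 × Bool) Qe} (c : ℤ)
    (hu : uC 0 1 u = (-(c / 2 : ℚ)) • Var.cc (.inl (0, .b)) +
      (-(c / 2 : ℚ)) • smallPar (some (.inl 0))) : ElemPG (mid 1 (expH u)) := by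
  refine elemPG_of_hsum _ (fun m => 0 ^ m) (fun _ => ![0]) (fun _ => ![0]) (fun _ => u) ?_
    (yxTerm 0 0 0 0) (yxTerm_ok _ _ _ _) 0
    (fun r s _ => pairOK_rational r s) ![c] (polyFam_cexp (some (.inl 0))
      (.mono (Nat.zero_le _) (.const (-(c / 2 : ℚ))))) fun i => ?_
  · rw [hsum_of_forall_pos fun m => by rw [zero_pow (Nat.succ_ne_zero m), zero_smul]]
    rw [yy_one, xx_one]
    simp
  · rw [expMon_yxTerm, cexp_prod_expB, quadForm_zero, cexp_zero, hu,
      cexp_add (smul_b_mem _ _) (fil_smul _ (smallPar_mem _))]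
    rcases Nat.eq_zero_or_pos (i ()) with h | h
    · simp [h, cexp_zero]
    · simp [h.ne']

theorem elemPG_spinner : ElemPG spinner := by
  rw [spinner_eq]
  exact elemPG_mid_expH 1 (by rw [uC_halfW, Int.cast_one])

theorem elemPG_spinnerInv : ElemPG (mid 1 (expH (-halfW))) :=
  elemPG_mid_expH (-1) (by
    rw [map_neg, uC_halfW, neg_add, ← neg_smul, ← neg_smul]
    norm_num)

/-- The element is `B^{-1/2}` times a perturbation of the Gaussian with `G = ħ a b + ħ y x`; the
factor `A^{-1/2}` is a correction. -/
theorem elemPG_ribbonInv : ElemPG ribbonInv := by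
  refine elemPG_of_hsum ribbonInv qf (fun m => ![m]) (fun m => ![m])
    (fun _ => ma 0 * mb 0 - halfW) ?_
    (yxTerm 0 0 1 0) (yxTerm_ok _ _ _ _) (matSingle (.inr 0) (.inl 0) 1)
    (fun r s _ => pairOK_rational r s) ![-1] ((polyFam_qFactInvC polyDeg_coord_unit).mul
      smallPar_mem (polyFam_cexp (some (.inl 0)) (.mono (Nat.zero_le _) (.const (1 / 2)))))
    fun i => ?_
  · rw [ribbonInv]
    refine congrArg hsum (funext fun m => ?_)
    rw [yy_one, xx_one]
    simp
  · have hE : cexp (uC 0 1 (ma 0 * mb 0 - halfW)) =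
        cexp (∑ i : Fin 1, (-(((![-1] : Fin 1 → ℤ) i : ℤ) / 2 : ℚ)) • Var.cc (.inl (i, .b))) *
          cexp ((1 / 2 : ℚ) • smallPar (some (.inl 0))) *
          cexp (quadForm (matSingle (.inr 0) (.inl 0) 1)) := by
      rw [← cexp_add₃ (Ideal.sum_mem _ fun _ _ => smul_b_mem _ _)
        (fil_smul _ (smallPar_mem _)) (quadForm_mem _)]
      refine congrArg cexp ?_
      rw [map_sub, uC_halfW, uC_mul, abC_ma, uC_mb, quadForm_single]
      simp only [Fin.sum_univ_one, Matrix.cons_val_zero, row₁, col₁, Sum.elim_inl, Sum.elim_inr]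
      norm_num [Algebra.smul_def]
      ring
    rw [expMon_yxTerm, cexp_prod_expB, map_mul, kC_qf, hE]
    simp only [Pi.mul_apply]
    simp only [Fin.prod_univ_one, Pi.zero_apply, Int.cast_zero, zero_div, neg_zero, zero_smul,
      sum_const_zero, smul_zero, cexp_zero, Matrix.cons_val_zero, one_pow, mul_one, map_pow,
      mul_pow]
    ring

/-- Here `G = -ħ a b - ħ B⁻¹ y x` with prefactor `B^{1/2}`. Of `(A B)^{1/2 - i}`, the powers of `B`
enter the Gaussian and the prefactor, those of `A` the corrections. -/
theorem elemPG_ribbon : ElemPG ribbon := by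
  refine elemPG_of_hsum ribbon (fun m => (-1) ^ m * qf m) (fun m => ![m]) (fun m => ![m])
    (fun i => -(ma 0 * mb 0) + halfW - i • wM 0 0 - i.choose 2 • me) ?_
    (yxTerm 0 0 (-1) ![-2]) (yxTerm_ok _ _ _ _) (matSingle (.inr 0) (.inl 0) (-1))
    (fun r s _ => pairOK_rational r s) ![1] (((polyFam_qFactInvC polyDeg_coord_unit).mul
      smallPar_mem (polyFam_cexp none ((polyDeg_choose_two polyDeg_coord_unit).smul (-1)))).mul
      smallPar_mem (polyFam_cexp (some (.inl 0)) (polyDeg_coord_unit.add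
        (.mono (Nat.zero_le _) (.const (-(1 / 2))))))) fun i => ?_
  · rw [ribbon]
    refine congrArg hsum (funext fun m => ?_)
    rw [yy_one, xx_one]
    simp
  · have hE : cexp (uC 0 1 (-(ma 0 * mb 0) + halfW - i () • wM 0 0 - (i ()).choose 2 • me)) =
        cexp (∑ i : Fin 1, (-(((![1] : Fin 1 → ℤ) i : ℤ) / 2 : ℚ)) • Var.cc (.inl (i, .b))) *
        cexp (i () • ∑ i : Fin 1, (-(((![-2] : Fin 1 → ℤ) i : ℤ) / 2 : ℚ)) •
          Var.cc (.inl (i, .b))) *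
          (cexp (((-1 : ℚ) • fun i : Unit → ℕ => ((i ()).choose 2 : ℚ)) i • smallPar none) *
          cexp (((fun i => (i () : ℚ)) + (fun _ => -(1 / 2 : ℚ)) : (Unit → ℕ) → ℚ) i •
            smallPar (some (.inl 0)))) *
          cexp (quadForm (matSingle (.inr 0) (.inl 0) (-1))) := by
      rw [← cexp_add (fil_smul _ (smallPar_mem _)) (fil_smul _ (smallPar_mem _)),
        ← cexp_add₄ (Ideal.sum_mem _ fun _ _ => smul_b_mem _ _)
        (Submodule.smul_of_tower_mem _ _ (Ideal.sum_mem _ fun _ _ => smul_b_mem _ _))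
        (Ideal.add_mem _ (fil_smul _ (smallPar_mem _)) (fil_smul _ (smallPar_mem _)))
        (quadForm_mem _)]
      refine congrArg cexp ?_
      rw [map_sub, map_sub, map_add, map_neg, map_nsmul, map_nsmul, uC_halfW, uC_mul, abC_ma, uC_mb,
        uC_me, wM, zero_smul, map_sub, map_sub, map_zero, uC_me_ma, uC_mb, quadForm_single]
      simp only [Fin.sum_univ_one, Matrix.cons_val_zero, row₁, col₁, Sum.elim_inl, Sum.elim_inr,
        Pi.smul_apply, Pi.add_apply]
      norm_num [Algebra.smul_def]
      ring
    rw [expMon_yxTerm, cexp_prod_expB, map_mul, map_mul, kC_qf, hE]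
    simp only [Pi.mul_apply]
    simp only [Fin.prod_univ_one, Matrix.cons_val_zero, map_pow, map_neg, map_one, mul_pow, map_mul]
    ring

/-! ### The generating functions of the operations -/

section
variable {j k : ℕ}

theorem PolyDeg.natCast_add {c : Type} [Fintype c] [DecidableEq c] {D : ℕ} {L L' : (c → ℕ) → ℕ}
    (hL : PolyDeg D fun i => (L i : ℚ)) (hL' : PolyDeg D fun i => (L' i : ℚ)) :
    PolyDeg D fun i => ((L i + L' i : ℕ) : ℚ) := by
  have : (fun i => ((L i + L' i : ℕ) : ℚ)) = (fun i => (L i : ℚ)) + fun i => (L' i : ℚ) := by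
    funext i; push_cast; rfl
  rw [this]; exact hL.add hL'

theorem PolyDeg.natCast_mul {c : Type} [Fintype c] [DecidableEq c] {L L' : (c → ℕ) → ℕ}
    (hL : PolyDeg 1 fun i => (L i : ℚ)) (hL' : PolyDeg 1 fun i => (L' i : ℚ)) :
    PolyDeg 2 fun i => ((L i * L' i : ℕ) : ℚ) := by
  have : (fun i => ((L i * L' i : ℕ) : ℚ)) = (fun i => (L i : ℚ)) * fun i => (L' i : ℚ) := by
    funext i; push_cast; rfl
  rw [this]; exact hL.mul hL'

/-- The factorials dividing the coefficients of a generating function turn the quantum factorials of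
the normal ordering formulas into the corrections `[m]!/m!`. -/
theorem inv_smul_kC_qFact (r : ℚ) (m n : ℕ) (s : KK) (w : CC j k) :
    (r * ((m.factorial : ℚ) * n.factorial))⁻¹ • (kC j k (qFact m * qFact n * s) * w) =
      algebraMap ℚ (CC j k) r⁻¹ * (qFactC j k m * qFactC j k n * (kC j k s * w)) := by
  have hm : (m.factorial : ℚ) ≠ 0 := by exact_mod_cast m.factorial_ne_zero
  have hn : (n.factorial : ℚ) ≠ 0 := by exact_mod_cast n.factorial_ne_zero
  have h : algebraMap ℚ (CC j k) r⁻¹ = algebraMap ℚ (CC j k)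
      (r * ((m.factorial : ℚ) * n.factorial))⁻¹ * algebraMap ℚ (CC j k) m.factorial *
        algebraMap ℚ (CC j k) n.factorial := by
    rw [← map_mul, ← map_mul]
    refine congrArg _ ?_
    rw [mul_inv, mul_inv]
    field_simp
  rw [h, map_mul, map_mul, kC_qFact, kC_qFact, Algebra.smul_def]
  ring

theorem kC_q_pow (n : ℕ) : kC j k (q ^ n) = cexp ((n : ℚ) • smallPar none) := by
  rw [Nat.cast_smul_eq_nsmul, cexp_nsmul (smallPar_mem _), map_pow]
  refine congrArg (· ^ n) ?_
  rw [smallPar, tC, cexp_hC]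
  refine congrArg MvPowerSeries.C ?_
  exact map_expH (MvPolynomial.C : Qe →+* LatPoly k) eps

end

/-- The Gaussian terms of the coproduct. -/
def comulTerm : Fin 4 → GTerm 1 2 :=
  ![⟨.inl 1, .inl 0, 1, 0, 0⟩, ⟨.inl 0, .inl 0, 1, 0, ![0, 2]⟩, ⟨.inr 0, .inr 0, 1, 0, 0⟩,
    ⟨.inr 0, .inr 1, 1, 0, 0⟩]

/-- Here `G = β (b_0 + b_1) + α (a_0 + a_1) + η (y_1 + y_0 B_1) + ξ (x_0 + x_1)`. The factor `A_1`
in `Δ x` is a correction in `ε ħ a_1`. -/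
theorem genFun_comulD_mem : ∃ F ∈ PGplus 1 2, IsGenFun comulD.toLinearMap F := by
  refine genFun_mem (c := Fin 4) comulD.toLinearMap (fun v _ => v 0 + v 1) (fun v _ => v 2 + v 3)
    (fun d => duos (d (0, .y)) (d (0, .x))) ?_
    (fun v => qFact (v 0 + v 1) * qFact (v 2 + v 3) *
      (qf (v 0) * qf (v 1) * qf (v 2) * qf (v 3) * hb ^ (v 0 + v 1)))
    (fun v => ![v 1, v 0]) (fun v => ![v 2, v 3])
    (fun v => -(v 1 • mb 1) - v 2 • (me * ma 1)) (fun _ _ => mb 0 + mb 1) (fun _ _ => ma 0 + ma 1)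
    ?_ comulTerm ?_
    (matSingle (.inl 0) (.inl 0) 1 + matSingle (.inl 0) (.inl 1) 1 +
      matSingle (.inr 0) (.inr 0) 1 + matSingle (.inr 1) (.inr 0) 1) ?_
    (((((((polyFam_qFactC ((PolyDeg.coord 0).natCast_add (.coord 1))).mul smallPar_mem
      (polyFam_qFactC ((PolyDeg.coord 2).natCast_add (.coord 3)))).mul smallPar_mem
      (polyFam_qFactInvC (.coord 0))).mul smallPar_mem
      (polyFam_qFactInvC (.coord 1))).mul smallPar_mem
      (polyFam_qFactInvC (.coord 2))).mul smallPar_mem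
      (polyFam_qFactInvC (.coord 3))).mul smallPar_mem
      (polyFam_cexp (some (.inl 1)) ((PolyDeg.coord 2).smul (-1)))) fun v => ?_
  · intro d v
    rw [mem_duos, Fin.forall_fin_one]
  · intro d
    rw [AlgHom.toLinearMap_apply, comulD_dMon, smul_sum, Fin.sum_univ_one]
    refine sum_congr rfl fun v hv => ?_
    rw [smul_smul, duoMid, Fin.prod_univ_one, duoCoeff, ← (mem_duos.1 hv).1]
    refine congrArg (· • _) ?_
    ring
  · intro t
    fin_cases t
    · exact .inr rfl
    · exact .inr rfl
    · exact .inl rfl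
    · exact .inl rfl
  · rintro (r | r) (s | s) h
    · exact .inl rfl
    · exact .inl rfl
    · simp [matSingle] at h
    · exact .inr rfl
  · have hE : cexp (uC 1 2 (-(v 1 • mb 1) - v 2 • (me * ma 1))) *
        cexp (∑ i : Fin 1, (MvPowerSeries.X (i, .b) * uC 1 2 (mb 0 + mb 1) +
          MvPowerSeries.X (i, .a) * abC 1 2 (ma 0 + ma 1))) =
        cexp (∑ t, v t • (comulTerm t).expo) *
        cexp (((-1 : ℚ) • fun i : Fin 4 → ℕ => (i 2 : ℚ)) v • smallPar (some (.inl 1))) *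
        cexp (quadForm (matSingle (.inl 0) (.inl 0) 1 + matSingle (.inl 0) (.inl 1) 1 +
          matSingle (.inr 0) (.inr 0) 1 + matSingle (.inr 1) (.inr 0) 1)) := by
      rw [← cexp_add₃ (sum_nsmul_expo_mem _ _) (fil_smul _ (smallPar_mem _)) (quadForm_mem _),
        ← cexp_add (uC_mem _) (Ideal.sum_mem _ fun _ _ => Ideal.add_mem _
          (fil_mul_right _ (X_mem _)) (fil_mul_right _ (X_mem _)))]
      refine congrArg cexp ?_
      simp only [map_sub, map_add, map_neg, map_nsmul, uC_mb, uC_me_ma, abC_ma, quadForm_add,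
        quadForm_single, Fin.sum_univ_one, Fin.sum_univ_four, GTerm.expo, Fin.sum_univ_two,
            comulTerm,
        Matrix.cons_val, row₁, col₁, Sum.elim_inl, Sum.elim_inr, Pi.smul_apply]
      norm_num [Algebra.smul_def, Var.cc]
      ring
    have h0 := inv_smul_kC_qFact (j := 1) (k := 2) 1 (v 0 + v 1) (v 2 + v 3)
    simp only [one_mul, inv_one, map_one] at h0
    rw [Fin.prod_univ_one, Fin.prod_univ_one, h0, expMon_gterm]
    generalize cexp (∑ t, v t • (comulTerm t).expo) = e₁ at hE ⊢
    simp only [Pi.mul_apply, map_mul, kC_qf, map_pow, Fin.prod_univ_two, Fin.prod_univ_four,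
      comulTerm, Matrix.cons_val, row₂, col₂, Sum.elim_inl, Sum.elim_inr, cc_y, cc_x, map_one,
      one_pow]
    simp only [Var.cc]
    linear_combination (MvPowerSeries.X (0, .y) ^ (v 0 + v 1) *
      MvPowerSeries.X (0, .x) ^ (v 2 + v 3) * (qFactC 1 2 (v 0 + v 1) * qFactC 1 2 (v 2 + v 3)) *
      kC 1 2 hb ^ (v 0 + v 1) * (latG 1 (0, .y) ^ v 1 * latG 1 (1, .y) ^ v 0) *
      (latG 1 (0, .x) ^ v 2 * latG 1 (1, .x) ^ v 3) *
      (algebraMap ℚ _ ((v 0).factorial : ℚ)⁻¹ * qFactInvC 1 2 (v 0)) *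
      (algebraMap ℚ _ ((v 1).factorial : ℚ)⁻¹ * qFactInvC 1 2 (v 1)) *
      (algebraMap ℚ _ ((v 2).factorial : ℚ)⁻¹ * qFactInvC 1 2 (v 2)) *
      (algebraMap ℚ _ ((v 3).factorial : ℚ)⁻¹ * qFactInvC 1 2 (v 3))) * hE

/-- The Gaussian terms of the antipode. -/
def antiTerm : Fin 4 → GTerm 1 1 :=
  ![⟨.inr 0, .inr 0, -1, 1, 0⟩, ⟨.inl 0, .inl 0, -1, 1, ![-2]⟩, ⟨.inr 0, .inl 0, -1, 1, 0⟩,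
    ⟨.inr 0, .inl 0, 1, 1, ![-2]⟩]

section
variable {c : Type} [Fintype c] [DecidableEq c]

theorem PolyDeg.coord_add₃ (e₁ e₂ e₃ : c) :
    PolyDeg 1 fun v : c → ℕ => ((v e₁ + v e₂ + v e₃ : ℕ) : ℚ) :=
  ((PolyDeg.coord e₁).natCast_add (.coord e₂)).natCast_add (.coord e₃)

end

theorem neg_one_pow_add_add {R : Type} [CommRing R] (a b c d : ℕ) :
    (-1 : R) ^ (a + c + d + (b + c + d)) = (-1) ^ a * (-1) ^ b := by
  rw [← pow_add, show a + c + d + (b + c + d) = a + b + 2 * (c + d) by ring, pow_add, pow_mul,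
    neg_one_sq, one_pow, mul_one]

/-- The exponent of `q` in the antipode of an ordered monomial. -/
def antiExp (v : Fin 4 → ℕ) : ℚ :=
  ((v 0 * v 1 + (v 2).choose 2 + (v 0 + v 1) * v 2 : ℕ) : ℚ) +
    -1 * (((v 0 + v 2 + v 3) * v 1 + (v 0 + v 2 + v 3 + 1).choose 2 +
      ((v 1 + v 2 + v 3) * v 0 + (v 1 + v 2 + v 3).choose 2) : ℕ) : ℚ)

theorem polyDeg_antiExp : PolyDeg 2 antiExp :=
  .add ((((PolyDeg.coord 0).natCast_mul (.coord 1)).natCast_add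
      (polyDeg_choose_two (.coord 2))).natCast_add
        (((PolyDeg.coord 0).natCast_add (.coord 1)).natCast_mul (.coord 2)))
    (((((PolyDeg.coord_add₃ 0 2 3).natCast_mul (.coord 1)).natCast_add
      (polyDeg_choose_two ((PolyDeg.coord_add₃ 0 2 3).natCast_add
        (.mono (Nat.zero_le _) (.const ((1 : ℕ) : ℚ)))))).natCast_add
      (((PolyDeg.coord_add₃ 1 2 3).natCast_mul (.coord 0)).natCast_add
        (polyDeg_choose_two (PolyDeg.coord_add₃ 1 2 3)))).smul (-1))

/-- Every index shifts `a` by one, producing a factor `𝒜`, and `b` by `ε`, producing the small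
parameter `ε ħ β`. The powers of `q` from normal ordering and from the middle part add up to
`antiExp`. -/
theorem antiTerm_exponent (v : Fin 4 → ℕ) :
    cexp (uC 1 1 ((v 0 + v 2 + v 3) • (me * (ma 0 - v 1 • 1)) - (v 0 + v 2 + v 3 + 1).choose 2 • me +
        ((v 1 + v 2 + v 3) • (mb 0 - v 0 • me) - (v 1 + v 2 + v 3).choose 2 • me) +
          v 2 • wM 0 0)) * cexp (((v 0 * v 1 + (v 2).choose 2 + (v 0 + v 1) * v 2 : ℕ) : ℚ) •
        smallPar none) *
      cexp (∑ i : Fin 1, (MvPowerSeries.X (i, .b) *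
          uC 1 1 (-(mb 0 - (v 1 + v 2 + v 3 + v 0) • me)) +
        MvPowerSeries.X (i, .a) * abC 1 1 (-(ma 0 - (v 1 + v 2 + v 3 + v 0) • 1)))) =
    cexp (∑ t, v t • (antiTerm t).expo) * (cexp (antiExp v • smallPar none) *
      cexp (((v 0 + v 3 : ℕ) : ℚ) • smallPar (some (.inl 0))) *
      cexp (((v 1 + v 2 + v 3 + v 0 : ℕ) : ℚ) • smallPar (some (.inr 0)))) *
      cexp (quadForm (matSingle (.inl 0) (.inl 0) (-1) + matSingle (.inr 0) (.inr 0) (-1))) := by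
  rw [← cexp_add₃ (fil_smul _ (smallPar_mem _)) (fil_smul _ (smallPar_mem _))
    (fil_smul _ (smallPar_mem _)), ← cexp_add₃ (sum_nsmul_expo_mem _ _)
    (Ideal.add_mem _ (Ideal.add_mem _ (fil_smul _ (smallPar_mem _)) (fil_smul _ (smallPar_mem _)))
      (fil_smul _ (smallPar_mem _))) (quadForm_mem _),
    ← cexp_add₃ (uC_mem _) (fil_smul _ (smallPar_mem _)) (Ideal.sum_mem _ fun _ _ => Ideal.add_mem _
      (fil_mul_right _ (X_mem _)) (fil_mul_right _ (X_mem _)))]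
  refine congrArg cexp ?_
  have hs : smallPar (j := 1) (k := 1) (some (.inr 0)) =
      smallPar none * MvPowerSeries.X (0, .b) := rfl
  simp only [wM, zero_smul, mul_sub, map_sub, map_add, map_neg, map_nsmul, uC_mb, uC_me_ma, uC_me,
    abC_ma, map_one, map_zero, mul_smul_comm, mul_one, quadForm_add, hs,
    quadForm_single, Fin.sum_univ_one, Fin.sum_univ_four, GTerm.expo, antiTerm, antiExp,
    Matrix.cons_val, row₁, col₁, Sum.elim_inl, Sum.elim_inr, Pi.one_apply, Pi.zero_apply]
  norm_num [Algebra.smul_def, Var.cc]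
  ring

/-- Here `G = -β b - α a - 𝒜 ξ x - 𝒜 B⁻¹ y η + ħ⁻¹ 𝒜 (B⁻¹ - 1) ξ η`. The last bracket corresponds to
two indices, the contractions with `-A B` and with `1`. -/
theorem genFun_antiD_mem : ∃ F ∈ PGplus 1 1, IsGenFun antiD F := by
  refine genFun_mem (c := Fin 4) antiD (fun v _ => v 1 + v 2 + v 3) (fun v _ => v 0 + v 2 + v 3)
    (fun d => quads (d (0, .x)) (d (0, .y))) ?_
    (fun v => qFact (v 1 + v 2 + v 3) * qFact (v 0 + v 2 + v 3) *
      ((-1) ^ v 0 * (-1) ^ v 1 * (qf (v 0) * qf (v 1) * qf (v 2) * qf (v 3)) *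
        ((-1) ^ v 2 * q ^ (v 0 * v 1 + (v 2).choose 2 + (v 0 + v 1) * v 2)) * hb ^ v 1))
    (fun v => ![v 1]) (fun v => ![v 0])
    (fun v => (v 0 + v 2 + v 3) • (me * (ma 0 - v 1 • 1)) - (v 0 + v 2 + v 3 + 1).choose 2 • me +
        ((v 1 + v 2 + v 3) • (mb 0 - v 0 • me) - (v 1 + v 2 + v 3).choose 2 • me) + v 2 • wM 0 0)
    (fun v _ => -(mb 0 - (v 1 + v 2 + v 3 + v 0) • me))
    (fun v _ => -(ma 0 - (v 1 + v 2 + v 3 + v 0) • 1))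
    ?_ antiTerm ?_ (matSingle (.inl 0) (.inl 0) (-1) + matSingle (.inr 0) (.inr 0) (-1)) ?_
    ((((((((polyFam_qFactC (PolyDeg.coord_add₃ 1 2 3)).mul smallPar_mem
      (polyFam_qFactC (PolyDeg.coord_add₃ 0 2 3))).mul smallPar_mem
      (polyFam_qFactInvC (.coord 0))).mul smallPar_mem
      (polyFam_qFactInvC (.coord 1))).mul smallPar_mem
      (polyFam_qFactInvC (.coord 2))).mul smallPar_mem
      (polyFam_qFactInvC (.coord 3))).mul smallPar_mem
      (((polyFam_cexp none polyDeg_antiExp).mul smallPar_mem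
      (polyFam_cexp (some (.inl 0)) ((PolyDeg.coord 0).natCast_add (.coord 3)))).mul smallPar_mem
      (polyFam_cexp (some (.inr 0)) ((PolyDeg.coord_add₃ 1 2 3).natCast_add (.coord 0))))))
      fun v => ?_
  · intro d v
    rw [mem_quads, Fin.forall_fin_one, and_comm]
  · intro d
    rw [Fin.sum_univ_one, antiD_dBlock]
    refine sum_congr rfl fun v hv => ?_
    have hs := neg_one_pow_add_add (R := KK) (v 0) (v 1) (v 2) (v 3)
    rw [(mem_quads.1 hv).1, (mem_quads.1 hv).2] at hs
    rw [Fin.prod_univ_one, hs, quadCoeff, antiMid, (mem_quads.1 hv).1, (mem_quads.1 hv).2, yy_one,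
      xx_one, mul_comm ((-(ma 0 - (d (0, Gen.y) + v 0) • 1)) ^ _)]
    refine congrArg (· • _) ?_
    ring
  · intro t
    fin_cases t
    · exact .inl rfl
    · exact .inr rfl
    · exact .inl rfl
    · exact .inl rfl
  · rintro (r | r) (s | s) h
    · exact .inl rfl
    · exact .inl rfl
    · simp [matSingle] at h
    · exact .inr rfl
  · have hE := antiTerm_exponent v
    have h0 := inv_smul_kC_qFact (j := 1) (k := 1) 1 (v 1 + v 2 + v 3) (v 0 + v 2 + v 3)
    simp only [one_mul, inv_one, map_one] at h0
    rw [Fin.prod_univ_one, Fin.prod_univ_one, h0, expMon_gterm]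
    simp only [map_mul, kC_q_pow]
    generalize cexp (∑ t, v t • (antiTerm t).expo) = e₁ at hE ⊢
    simp only [Pi.mul_apply, kC_qf, map_pow, Fin.prod_univ_one, Fin.prod_univ_four,
      antiTerm, Matrix.cons_val, row₂, col₂, Sum.elim_inl, Sum.elim_inr, cc_y, cc_x, map_one,
      one_pow, map_neg (kC 1 1), map_neg (algebraMap ℚ (CC 1 1))]
    simp only [Var.cc]
    linear_combination (MvPowerSeries.X (0, .y) ^ (v 1 + v 2 + v 3) *
      MvPowerSeries.X (0, .x) ^ (v 0 + v 2 + v 3) *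
      (qFactC 1 1 (v 1 + v 2 + v 3) * qFactC 1 1 (v 0 + v 2 + v 3)) *
      ((-1) ^ v 0 * (-1) ^ v 1 * (-1) ^ v 2) *
      kC 1 1 hb ^ v 1 * latG 1 (0, .y) ^ v 1 * latG 1 (0, .x) ^ v 0 *
      (algebraMap ℚ _ ((v 0).factorial : ℚ)⁻¹ * qFactInvC 1 1 (v 0)) *
      (algebraMap ℚ _ ((v 1).factorial : ℚ)⁻¹ * qFactInvC 1 1 (v 1)) *
      (algebraMap ℚ _ ((v 2).factorial : ℚ)⁻¹ * qFactInvC 1 1 (v 2)) *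
      (algebraMap ℚ _ ((v 3).factorial : ℚ)⁻¹ * qFactInvC 1 1 (v 3))) * hE

/-- The Gaussian terms of the multiplication. -/
def mulTerm : Fin 6 → GTerm 2 1 :=
  ![⟨.inr 0, .inr 0, 1, ![0, -1], 0⟩, ⟨.inl 0, .inl 1, 1, ![-1, 0], 0⟩,
    ⟨.inr 0, .inl 1, -1, 0, ![2]⟩, ⟨.inr 0, .inl 1, 1, 0, 0⟩, ⟨.inl 0, .inl 0, 1, 0, 0⟩,
    ⟨.inr 1, .inr 0, 1, 0, 0⟩]

/-- The exponent of `q` in the product of two ordered monomials. -/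
def mulExp (v : Fin 6 → ℕ) : ℕ := v 0 * v 1 + (v 2).choose 2 + (v 0 + v 1) * v 2

theorem polyDeg_mulExp : PolyDeg 2 fun v => (mulExp v : ℚ) :=
  (((PolyDeg.coord 0).natCast_mul (.coord 1)).natCast_add
      (polyDeg_choose_two (.coord 2))).natCast_add
        (((PolyDeg.coord 0).natCast_add (.coord 1)).natCast_mul (.coord 2))

/-- The exponents of the summands of the product of two ordered monomials. -/
def mulExps (d : (Fin 2 × Gen) →₀ ℕ) : Finset (Fin 6 → ℕ) :=
  (quads (d (0, .x)) (d (1, .y))).image fun w => ![w 0, w 1, w 2, w 3, d (0, .y), d (1, .x)]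

theorem mem_mulExps (d : (Fin 2 × Gen) →₀ ℕ) (v : Fin 6 → ℕ) :
    v ∈ mulExps d ↔ ∀ i, (![v 4, v 1 + v 2 + v 3] : Fin 2 → ℕ) i = d (i, .y) ∧
      (![v 0 + v 2 + v 3, v 5] : Fin 2 → ℕ) i = d (i, .x) := by
  simp only [mulExps, mem_image, mem_quads, Fin.forall_fin_two, Matrix.cons_val]
  constructor
  · rintro ⟨w, ⟨h1, h2⟩, rfl⟩
    exact ⟨⟨rfl, h1⟩, h2, rfl⟩
  · rintro ⟨⟨h1, h2⟩, h3, h4⟩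
    refine ⟨![v 0, v 1, v 2, v 3], ⟨h2, h3⟩, ?_⟩
    rw [← h1, ← h4]
    funext t
    fin_cases t <;> rfl

theorem sum_mulExps {A : Type} [AddCommMonoid A] (d : (Fin 2 × Gen) →₀ ℕ) (f : (Fin 6 → ℕ) → A) :
    ∑ v ∈ mulExps d, f v = ∑ w ∈ quads (d (0, .x)) (d (1, .y)),
      f ![w 0, w 1, w 2, w 3, d (0, .y), d (1, .x)] := by
  refine sum_image fun w _ w' _ h => ?_
  funext t
  fin_cases t
  · exact congrFun h 0
  · exact congrFun h 1
  · exact congrFun h 2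
  · exact congrFun h 3

theorem dMon_eq_mid (d : (Fin 1 × Gen) →₀ ℕ) : dMon d = dz 0 Gen.y ^ d (0, .y) *
    mid 1 (PowerSeries.C (mb 0 ^ d (0, .b) * ma 0 ^ d (0, .a))) * dz 0 Gen.x ^ d (0, .x) := by
  rw [dMon_one, dBlock]
  simp only [map_mul, map_pow, mid_a, mid_b, mul_assoc]

/-- Only `x_0` and `y_1` are out of order. After `x_pow_mul_y_pow`, the surviving `y` shift the `a,
b` of the first monomial and the surviving `x` those of the second. -/
theorem mulD_dMon_eq_sum (d : (Fin 2 × Gen) →₀ ℕ) :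
    hb ^ (∑ i, d (i, .y)) • mulD (dMon d) = ∑ w ∈ quads (d (0, .x)) (d (1, .y)),
      (quadCoeff w * hb ^ (w 1 + d (0, .y))) • (dz 0 Gen.y ^ (d (0, .y) + w 1) *
        mid 1 (expH (w 2 • wM 0 0) * PowerSeries.C
          (((mb 0 - w 1 • me) ^ d (0, .b) * (ma 0 - w 1 • 1) ^ d (0, .a)) *
            ((mb 0 - w 0 • me) ^ d (1, .b) * (ma 0 - w 0 • 1) ^ d (1, .a)))) *
        dz 0 Gen.x ^ (w 0 + d (1, .x))) := by
  have hfac : ∀ (i : Fin 2) (g : Gen), facExp i d (0, g) = d (i, g) := fun _ _ => rfl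
  rw [mulD_dMon, dMon_eq_mid, dMon_eq_mid]
  simp only [hfac]
  generalize hf : PowerSeries.C (mb (0 : Fin 1) ^ d (0, Gen.b) * ma 0 ^ d (0, Gen.a)) = f
  generalize hg : PowerSeries.C (mb (0 : Fin 1) ^ d (1, Gen.b) * ma 0 ^ d (1, Gen.a)) = g
  have h1 : ∀ z w z' w' u u' : DD 1, z * u * w * (z' * u' * w') = z * u * (w * z') * (u' * w') := by
    intros; simp only [mul_assoc]
  rw [h1, Fin.sum_univ_two, pow_add, mul_smul, ← smul_mul_assoc (hb ^ d (1, Gen.y)),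
    ← mul_smul_comm (hb ^ d (1, Gen.y)), x_pow_mul_y_pow, mul_sum, sum_mul, smul_sum]
  refine sum_congr rfl fun w _ => ?_
  rw [mul_smul_comm, smul_mul_assoc, smul_smul]
  have h2 : ∀ z u y' u' x' g' x'' : DD 1,
      z * u * (y' * u' * x') * (g' * x'') = z * (u * y') * u' * (x' * g') * x'' := by
    intros; simp only [mul_assoc]
  have h3 : ∀ z y' f' u' g' x' x'' : DD 1,
      z * (y' * f') * u' * (g' * x') * x'' = (z * y') * (f' * u' * g') * (x' * x'') := by
    intros; simp only [mul_assoc]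
  rw [h2, mid_y_pow, x_pow_mid, h3, ← pow_add, ← pow_add, ← map_mul, ← map_mul, ← hf, ← hg,
    shMm_C, shMm_C]
  refine congrArg₂ (· • ·) (by ring) ?_
  refine congrArg (fun p => _ * mid 1 p * _) ?_
  simp only [map_mul, map_pow, shPm_a, shPm_b, me]
  ring

/-- The shift of `a` by the survivors produces `𝒜_0⁻¹` and `𝒜_1⁻¹`, that of `b` the corrections in
`ε ħ β_0` and `ε ħ β_1`; the powers of `A B` split into a Gaussian part `B` and a correction `A`. -/
theorem mulTerm_exponent (v : Fin 6 → ℕ) :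
    cexp (uC 2 1 (v 2 • wM 0 0)) * cexp ((mulExp v : ℚ) • smallPar none) *
      cexp (∑ i : Fin 2, (MvPowerSeries.X (i, .b) *
          uC 2 1 ((![mb 0 - v 1 • me, mb 0 - v 0 • me] : Fin 2 → _) i) +
        MvPowerSeries.X (i, .a) * abC 2 1 ((![ma 0 - v 1 • 1, ma 0 - v 0 • 1] : Fin 2 → _) i))) =
    cexp (∑ t, v t • (mulTerm t).expo) * (cexp ((mulExp v : ℚ) • smallPar none) *
      cexp (((-1 : ℚ) • fun v : Fin 6 → ℕ => (v 2 : ℚ)) v • smallPar (some (.inl 0))) *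
      cexp (((-1 : ℚ) • fun v : Fin 6 → ℕ => (v 1 : ℚ)) v • smallPar (some (.inr 0))) *
      cexp (((-1 : ℚ) • fun v : Fin 6 → ℕ => (v 0 : ℚ)) v • smallPar (some (.inr 1)))) *
      cexp (quadForm (matSingle (.inl 0) (.inl 0) 1 + matSingle (.inl 1) (.inl 0) 1 +
        matSingle (.inr 0) (.inr 0) 1 + matSingle (.inr 0) (.inr 1) 1)) := by
  rw [← cexp_add₄ (fil_smul _ (smallPar_mem _)) (fil_smul _ (smallPar_mem _))
    (fil_smul _ (smallPar_mem _)) (fil_smul _ (smallPar_mem _)),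
    ← cexp_add₃ (sum_nsmul_expo_mem _ _)
    (Ideal.add_mem _ (Ideal.add_mem _ (Ideal.add_mem _ (fil_smul _ (smallPar_mem _))
      (fil_smul _ (smallPar_mem _))) (fil_smul _ (smallPar_mem _))) (fil_smul _ (smallPar_mem _)))
    (quadForm_mem _),
    ← cexp_add₃ (uC_mem _) (fil_smul _ (smallPar_mem _)) (Ideal.sum_mem _ fun _ _ => Ideal.add_mem _
      (fil_mul_right _ (X_mem _)) (fil_mul_right _ (X_mem _)))]
  refine congrArg cexp ?_
  have hs : ∀ i, smallPar (j := 2) (k := 1) (some (.inr i)) =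
      smallPar none * MvPowerSeries.X (i, .b) := fun _ => rfl
  simp only [wM, zero_smul, map_sub, map_nsmul, uC_mb, uC_me_ma, uC_me,
    abC_ma, map_one, map_zero, quadForm_add, hs, Pi.smul_apply, Fin.sum_univ_two,
    quadForm_single, Fin.sum_univ_one, Fin.sum_univ_six, GTerm.expo, mulTerm,
    Matrix.cons_val, row₁, col₁, Sum.elim_inl, Sum.elim_inr, Pi.zero_apply]
  norm_num [Algebra.smul_def, Var.cc]
  ring

/-- Here `G = (β_0 + β_1) b + (α_0 + α_1) a + y (η_0 + 𝒜_0⁻¹ η_1) + (𝒜_1⁻¹ ξ_0 + ξ_1) x + ħ⁻¹ (1 -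
B) ξ_0 η_1`. The last two indices count the `y` and `x` already in place. -/
theorem genFun_mulD_mem : ∃ F ∈ PGplus 2 1, IsGenFun mulD F := by
  refine genFun_mem (c := Fin 6) mulD (fun v => ![v 4, v 1 + v 2 + v 3])
    (fun v => ![v 0 + v 2 + v 3, v 5]) mulExps mem_mulExps
    (fun v => qFact (v 0 + v 2 + v 3) * qFact (v 1 + v 2 + v 3) *
      ((qf (v 0) * qf (v 1) * qf (v 2) * qf (v 3)) *
        ((-1) ^ v 2 * q ^ mulExp v) * hb ^ (v 1 + v 4)))
    (fun v => ![v 4 + v 1]) (fun v => ![v 0 + v 5]) (fun v => v 2 • wM 0 0)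
    (fun v => ![mb 0 - v 1 • me, mb 0 - v 0 • me]) (fun v => ![ma 0 - v 1 • 1, ma 0 - v 0 • 1])
    ?_ mulTerm ?_ (matSingle (.inl 0) (.inl 0) 1 + matSingle (.inl 1) (.inl 0) 1 +
        matSingle (.inr 0) (.inr 0) 1 + matSingle (.inr 0) (.inr 1) 1) ?_
    ((((((((polyFam_qFactC (PolyDeg.coord_add₃ 0 2 3)).mul smallPar_mem
      (polyFam_qFactC (PolyDeg.coord_add₃ 1 2 3))).mul smallPar_mem
      (polyFam_qFactInvC (.coord 0))).mul smallPar_mem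
      (polyFam_qFactInvC (.coord 1))).mul smallPar_mem
      (polyFam_qFactInvC (.coord 2))).mul smallPar_mem
      (polyFam_qFactInvC (.coord 3))).mul smallPar_mem
      ((((polyFam_cexp none polyDeg_mulExp).mul smallPar_mem
      (polyFam_cexp (some (.inl 0)) ((PolyDeg.coord 2).smul (-1)))).mul smallPar_mem
      (polyFam_cexp (some (.inr 0)) ((PolyDeg.coord 1).smul (-1)))).mul smallPar_mem
      (polyFam_cexp (some (.inr 1)) ((PolyDeg.coord 0).smul (-1))))))
      fun v => ?_
  · intro d
    rw [mulD_dMon_eq_sum, sum_mulExps]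
    refine sum_congr rfl fun w hw => ?_
    simp only [Fin.prod_univ_two, yy_one, xx_one, Matrix.cons_val, quadCoeff, mulExp, mul_assoc]
  · intro t
    fin_cases t
    · exact .inl rfl
    · exact .inr rfl
    · exact .inl rfl
    · exact .inl rfl
    · exact .inr rfl
    · exact .inl rfl
  · rintro (r | r) (s | s) h
    · exact .inl rfl
    · exact .inl rfl
    · simp [matSingle] at h
    · exact .inr rfl
  · have hE := mulTerm_exponent v
    have hr : ∏ i : Fin 2, (((![v 4, v 1 + v 2 + v 3] : Fin 2 → ℕ) i).factorial : ℚ) *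
        ((![v 0 + v 2 + v 3, v 5] : Fin 2 → ℕ) i).factorial =
        ((v 4).factorial * (v 5).factorial : ℚ) *
          ((v 0 + v 2 + v 3).factorial * (v 1 + v 2 + v 3).factorial) := by
      simp only [Fin.prod_univ_two, Matrix.cons_val]
      ring
    rw [hr, inv_smul_kC_qFact, expMon_gterm]
    simp only [map_mul, kC_q_pow]
    generalize cexp (∑ t, v t • (mulTerm t).expo) = e₁ at hE ⊢
    simp only [Pi.mul_apply, map_mul, kC_qf, map_pow, Fin.prod_univ_one, Fin.prod_univ_two,
      Fin.prod_univ_six, mul_inv,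
      mulTerm, Matrix.cons_val, row₂, col₂, Sum.elim_inl, Sum.elim_inr, cc_y, cc_x, map_one,
      one_pow, map_neg (kC 2 1), map_neg (algebraMap ℚ (CC 2 1))]
    simp only [Var.cc]
    linear_combination (MvPowerSeries.X (0, .y) ^ v 4 *
        MvPowerSeries.X (0, .x) ^ (v 0 + v 2 + v 3) *
      (MvPowerSeries.X (1, .y) ^ (v 1 + v 2 + v 3) * MvPowerSeries.X (1, .x) ^ v 5) *
      (qFactC 2 1 (v 0 + v 2 + v 3) * qFactC 2 1 (v 1 + v 2 + v 3)) * (-1) ^ v 2 *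
      kC 2 1 hb ^ (v 1 + v 4) * latG 2 (0, .y) ^ (v 4 + v 1) * latG 2 (0, .x) ^ (v 0 + v 5) *
      (algebraMap ℚ _ ((v 0).factorial : ℚ)⁻¹ * qFactInvC 2 1 (v 0)) *
      (algebraMap ℚ _ ((v 1).factorial : ℚ)⁻¹ * qFactInvC 2 1 (v 1)) *
      (algebraMap ℚ _ ((v 2).factorial : ℚ)⁻¹ * qFactInvC 2 1 (v 2)) *
      (algebraMap ℚ _ ((v 3).factorial : ℚ)⁻¹ * qFactInvC 2 1 (v 3)) *
      (algebraMap ℚ _ ((v 4).factorial : ℚ)⁻¹ * algebraMap ℚ _ ((v 5).factorial : ℚ)⁻¹)) * hE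

theorem counitD_dMon (d : (Fin 1 × Gen) →₀ ℕ) : counitD (dMon d) =
    0 ^ d (0, .y) * 0 ^ d (0, .b) * 0 ^ d (0, .a) * 0 ^ d (0, .x) := by
  rw [dMon_one, dBlock]
  simp only [map_mul, map_pow, isCounit_counitD _]

/-- The counit kills all ordered monomials except `1`, so the generating function is `1`: the
Gaussian terms have coefficient zero and the exponents of `q` vanish. -/
theorem genFun_counitD_mem : ∃ F ∈ PGplus 1 0, IsGenFun counitD.toLinearMap F := by
  refine genFun_mem (c := Fin 2) counitD.toLinearMap (fun v _ => v 0) (fun v _ => v 1)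
    (fun d => {![d (0, .y), d (0, .x)]}) ?_ (fun v => 0 ^ v 0 * 0 ^ v 1) (fun _ => 0) (fun _ => 0)
    (fun _ => 0) (fun _ _ => 0) (fun _ _ => 0) ?_ (fun _ => ⟨.inr 0, .inl 0, 0, 0, 0⟩)
    (fun _ => .inl rfl) 0 (fun _ _ h => (h rfl).elim)
    (polyFam_cexp none (.mono (Nat.zero_le _) (.const 0))) fun v => ?_
  · intro d v
    rw [mem_singleton, Fin.forall_fin_one]
    constructor
    · rintro rfl
      exact ⟨rfl, rfl⟩
    · rintro ⟨h1, h2⟩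
      rw [← h1, ← h2]
      funext t
      fin_cases t <;> rfl
  · intro d
    rw [AlgHom.toLinearMap_apply, counitD_dMon, sum_singleton, Fin.sum_univ_one, Fin.prod_univ_one,
      expH_zero, one_mul, yy_zero, xx_zero, one_mul, mul_one]
    simp only [Matrix.cons_val, map_mul, map_pow, map_zero]
    rcases Nat.eq_zero_or_pos (d (0, .y)) with h | h
    · rcases Nat.eq_zero_or_pos (d (0, .x)) with h' | h'
      · simp [h, h']
      · simp [h, h'.ne']
    · simp [h.ne']
  · rw [quadForm_zero, cexp_zero, zero_smul, cexp_zero, mul_one, mul_one]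
    simp only [expMon, GTerm.cc, zero_smul, map_zero, mul_zero, add_zero, sum_const_zero, cexp_zero,
      Fin.prod_univ_two, Fin.prod_univ_one, prod_of_isEmpty, mul_one, map_mul, map_pow]
    rcases Nat.eq_zero_or_pos (v 0) with h | h
    · rcases Nat.eq_zero_or_pos (v 1) with h' | h'
      · simp [h, h']
      · simp [h, h'.ne']
    · simp [h.ne']

/-! ### The pairing -/

/-- The exponent of the monomial `ξ_0^m η_1^m β_1^n α_0^n`. -/
def pairMon (m n : ℕ) : (Fin 2 × Gen) →₀ ℕ :=
  .single (0, .x) m + .single (1, .y) m + (.single (1, .b) n + .single (0, .a) n)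

theorem pairMon_injective {m n m' n' : ℕ} (h : pairMon m n = pairMon m' n') : m = m' ∧ n = n' := by
  have h1 := DFunLike.congr_fun h (0, .x)
  have h2 := DFunLike.congr_fun h (0, .a)
  simpa [pairMon, Finsupp.single_apply] using And.intro h1 h2

theorem eq_pairMon_iff (d : (Fin 2 × Gen) →₀ ℕ) :
    d = pairMon (d (0, .x)) (d (0, .a)) ↔
      (d (0, .y) = 0 ∧ d (0, .b) = 0 ∧ d (1, .a) = 0 ∧ d (1, .x) = 0) ∧
        d (0, .a) = d (1, .b) ∧ d (0, .x) = d (1, .y) := by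
  rw [DFunLike.ext_iff, Prod.forall, Fin.forall_fin_two]
  constructor
  · rintro ⟨h, h'⟩
    have e1 := h .y
    have e2 := h .b
    have e3 := h' .a
    have e4 := h' .x
    have e5 := h' .b
    have e6 := h' .y
    simp [pairMon] at e1 e2 e3 e4 e5 e6
    exact ⟨⟨e1, e2, e3, e4⟩, e5.symm, e6.symm⟩
  · rintro ⟨⟨h1, h2, h3, h4⟩, h5, h6⟩
    constructor <;> intro g <;> cases g <;> simp [pairMon, *]

theorem monomial_pairMon (m n : ℕ) (c : LatSeries 0) :
    MvPowerSeries.monomial (pairMon m n) c = MvPowerSeries.C c * (MvPowerSeries.X (0, .x) ^ m *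
      MvPowerSeries.X (1, .y) ^ m * (MvPowerSeries.X (1, .b) ^ n *
        MvPowerSeries.X (0, .a) ^ n)) := by
  rw [MvPowerSeries.X_pow_eq, MvPowerSeries.X_pow_eq, MvPowerSeries.X_pow_eq,
    MvPowerSeries.X_pow_eq, ← MvPowerSeries.monomial_zero_eq_C_apply]
  simp only [MvPowerSeries.monomial_mul_monomial, mul_one, zero_add]
  rfl

theorem C_algebraMap (c : ℚ) :
    (MvPowerSeries.C (algebraMap ℚ (LatSeries 0) c) : CC 2 0) = algebraMap ℚ (CC 2 0) c :=
  DFunLike.congr_fun (RingHom.ext_rat (MvPowerSeries.C.comp (algebraMap ℚ (LatSeries 0)))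
    (algebraMap ℚ (CC 2 0))) c

/-- The coefficients of the rescaled generating function of the pairing. -/
def pairCoeff (m n : ℕ) : LatSeries 0 :=
  algebraMap ℚ _ (((m.factorial : ℚ)⁻¹) * (n.factorial : ℚ)⁻¹) *
    PowerSeries.map MvPolynomial.C (subT (qFactS m))

theorem rat_smul_ofPowerSeries (c : ℚ) (f : LatSeries 0) (g : LatLaurent 0) :
    c • (HahnSeries.ofPowerSeries ℤ (LatPoly 0) f * g) =
      HahnSeries.ofPowerSeries ℤ (LatPoly 0) (algebraMap ℚ _ c * f) * g := by
  have h : ∀ z : LatLaurent 0, c • z = algebraMap ℚ (LatLaurent 0) c * z := fun z => by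
    have e : algebraMap ℚ (LatLaurent 0) c = HahnSeries.C (algebraMap ℚ (LatPoly 0) c) :=
      DFunLike.congr_fun (RingHom.ext_rat (algebraMap ℚ (LatLaurent 0))
        (HahnSeries.C.comp (algebraMap ℚ (LatPoly 0)))) c
    rw [e, HahnSeries.C_mul_eq_smul]
    refine HahnSeries.ext (funext fun n => ?_)
    rw [HahnSeries.coeff_smul, HahnSeries.coeff_smul, Algebra.smul_def, smul_eq_mul]
  have h' : algebraMap ℚ (LatLaurent 0) c =
      HahnSeries.ofPowerSeries ℤ (LatPoly 0) (algebraMap ℚ (LatSeries 0) c) :=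
    DFunLike.congr_fun (RingHom.ext_rat (algebraMap ℚ (LatLaurent 0))
      ((HahnSeries.ofPowerSeries ℤ (LatPoly 0)).comp (algebraMap ℚ (LatSeries 0)))) c
  rw [h, h', map_mul, mul_assoc]

/-- The two Kronecker deltas leave only the monomials `pairMon`. On these the power of `ħ` in the
pairing is exactly the one created by `Psi`, and one factor `m!` turns `[m]!` into `[m]!/m!`. -/
theorem coeff_pairingGF (d : (Fin 2 × Gen) →₀ ℕ) : MvPowerSeries.coeff d pairingGF =
    if d = pairMon (d (0, .x)) (d (0, .a)) then
      hpow 0 (∑ p, d p * Var.wh (j := 2) (k := 0) (.inr p)) *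
        HahnSeries.ofPowerSeries ℤ (LatPoly 0) (pairCoeff (d (0, .x)) (d (0, .a))) else 0 := by
  change (if _ then _ else _) = _
  split_ifs with h h' h'
  · obtain ⟨-, h5, h6⟩ := (eq_pairMon_iff d).1 h'
    obtain ⟨h1, h2, h3, h4⟩ := h
    have hw : ∑ p, (d p : ℤ) * Var.wh (j := 2) (k := 0) (.inr p) =
        -((d (0, .x) : ℤ) + d (0, .a)) := by
      rw [Fintype.sum_prod_type, Fin.sum_univ_two, sum_gen, sum_gen, h1, h2, h3, h4, ← h5, ← h6]
      simp only [Var.wh]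
      push_cast
      ring
    have hd : ((∏ p, (d p).factorial : ℕ) : ℚ) = (((d (0, .x)).factorial : ℚ) *
        (d (0, .a)).factorial) * ((d (0, .x)).factorial * (d (0, .a)).factorial) := by
      rw [Fintype.prod_prod_type, Fin.prod_univ_two, prod_gen, prod_gen, h1, h2, h3, h4, ← h5, ← h6]
      simp only [Nat.factorial_zero]
      push_cast
      ring
    rw [pairing, if_pos ⟨h5, h6⟩, hw, hd, mul_comm (hpow 0 _), rat_smul_ofPowerSeries]
    refine congrArg (fun z => HahnSeries.ofPowerSeries ℤ (LatPoly 0) z * _) ?_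
    rw [pairCoeff, qFact_eq, map_mul, map_mul, map_natCast, ← mul_assoc, ← mul_assoc]
    refine congrArg (· * _) ?_
    have e : PowerSeries.map (MvPolynomial.C (σ := Fin 0 × Gen)) (algebraMap ℚ KK
        ((d (0, .x)).factorial : ℚ)) = algebraMap ℚ (LatSeries 0) (d (0, .x)).factorial := by
      rw [map_natCast, map_natCast, map_natCast]
    rw [e, ← map_natCast (algebraMap ℚ (LatSeries 0)), ← map_mul, ← map_mul]
    have hx : ((d (0, .x)).factorial : ℚ) ≠ 0 := by exact_mod_cast Nat.factorial_ne_zero _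
    have ha : ((d (0, .a)).factorial : ℚ) ≠ 0 := by exact_mod_cast Nat.factorial_ne_zero _
    refine congrArg _ ?_
    field_simp
  · rw [pairing, if_neg, smul_zero]
    exact fun h5 => h' ((eq_pairMon_iff d).2 ⟨h, h5⟩)
  · exact (h ((eq_pairMon_iff d).1 h').1).elim
  · rfl

/-- The Gaussian term of the pairing. -/
def pairTerm : GTerm 2 0 := ⟨.inr 0, .inl 1, 1, 0, 0⟩

/-- The generating function is `e^{α_0 β_1 / ħ}` times the sum over `m` of `(ξ_0 η_1 / ħ)^m / m!`
with correction `[m]!/m!`. The coefficients are matched before `Psi` is applied. -/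
theorem pairingGF_mem : pairingGF ∈ PGpm 2 0 := by
  have hg : PolyFam smallPar smallDeg fun i : Unit → ℕ => qFactC 2 0 (i ()) :=
    polyFam_qFactC polyDeg_coord_unit
  have hw : ∀ i : Unit → ℕ, expMon (fun _ => pairTerm.cc) i * qFactC 2 0 (i ()) ∈
      FilRing.Fil (A := CC 2 0) (∑ t, i t) := fun i =>
    fil_mul_right _ (expMon_mem (fun _ => pairTerm.cc_mem) i)
  obtain ⟨F, hF⟩ := FilRing.summable _ _ (finite_sum_lt (c := Unit)) hw
  set M := matSingle (j := 2) (k := 0) (.inl 1) (.inr 0) 1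
  have hM : ∀ r s, M r s ≠ 0 → Flavour.laurent.pairOK (row₁ (j := 2) (k := 0) r) (col₁ s) := by
    rintro (r | r) s -
    · exact .inl rfl
    · exact r.elim0
  have h1 := isPertGauss_of_hasSum (fl := .laurent) (c := Unit)
      (fun _ => pairTerm) (fun _ => .inl rfl) M hM 0
    hg hF
  rw [univ_eq_empty, prod_empty, one_mul] at h1
  have h2 := hasSum_mul_fil (β := Unit → ℕ) hF
      (hasSum_cexp (quadForm_mem M)) _ id (finite_sum_lt (c := Unit)) finite_lt_nat hw
    fun l => fil_smul _ (fil_pow (quadForm_mem M) l)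
  have hT : ∀ p : (Unit → ℕ) × ℕ, expMon (fun _ => pairTerm.cc) p.1 * qFactC 2 0 (p.1 ()) *
      (((p.2.factorial : ℚ)⁻¹) • quadForm M ^ p.2) =
      MvPowerSeries.monomial (pairMon (p.1 ()) p.2) (pairCoeff (p.1 ()) p.2) := by
    rintro ⟨v, n⟩
    have he : pairTerm.expo = 0 := by simp [GTerm.expo, pairTerm]
    rw [monomial_pairMon, pairCoeff, map_mul, expMon_gterm, he, quadForm_single, qFactC, kC]
    simp only [univ_unique, prod_singleton, smul_zero, sum_const_zero, cexp_zero, map_one,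
      pairTerm, one_pow, mul_one, row₁, row₂, col₁, col₂, Sum.elim_inl, Sum.elim_inr, Var.cc,
      RingHom.comp_apply, Algebra.smul_def, C_algebraMap, map_mul, mul_pow]
    ring
  suffices h : pairingGF = Psi (F * cexp (quadForm M)) by
    change IsPertGauss _ _
    rw [h]; exact h1
  ext1 d
  rw [coeff_pairingGF, coeff_Psi]
  rw [MvPowerSeries.WithPiTopology.hasSum_iff_hasSum_coeff] at h2
  have h3 := h2 d
  simp only [hT, MvPowerSeries.coeff_monomial] at h3
  split_ifs with h
  · refine congrArg (fun z => _ * HahnSeries.ofPowerSeries ℤ (LatPoly 0) z) ?_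
    refine HasSum.unique ?_ h3
    convert hasSum_single (fun _ : Unit => d (0, .x), d (0, .a)) ?_ using 1
    · exact (if_pos h).symm
    · rintro ⟨v, n⟩ hne
      refine if_neg fun h' => hne ?_
      obtain ⟨h₁, h₂⟩ := pairMon_injective (h'.symm.trans h)
      exact Prod.ext (funext fun _ => h₁) h₂
  · have h4 : ∀ p : (Unit → ℕ) × ℕ,
        (if d = pairMon (p.1 ()) p.2 then pairCoeff (p.1 ()) p.2 else 0) = 0 := fun p => by
      refine if_neg fun h' => h ((eq_pairMon_iff d).2 ?_)
      rw [h']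
      simp [pairMon]
    simp only [h4] at h3
    rw [h3.unique hasSum_zero, map_zero, mul_zero]

end PGauss

end

theorem theorem5p3 :
    (∀ n : ℕ, Function.Bijective (PGauss.OO n)) ∧
    ∃ (m : PGauss.DD 2 →ₗ[PGauss.KK] PGauss.DD 1) (Δ : PGauss.DD 1 →ₐ[PGauss.KK] PGauss.DD 2)
      (S : PGauss.DD 1 →ₗ[PGauss.KK] PGauss.DD 1) (e : PGauss.DD 1 →ₐ[PGauss.KK] PGauss.DD 0)
      (φ : PGauss.DD 2 →ₗ[PGauss.KK] PGauss.DD 1)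
      (R : (PGauss.DD 2)ˣ) (C v : (PGauss.DD 1)ˣ),
      (PGauss.IsMul m ∧ PGauss.IsComul Δ ∧ PGauss.IsAntipode S ∧ PGauss.IsCounit e ∧
        PGauss.IsAntipodeMulOp S φ ∧
        (R : PGauss.DD 2) = PGauss.Rmat ∧
        (C : PGauss.DD 1) = PGauss.spinner ∧
        (v : PGauss.DD 1) = (C⁻¹ : (PGauss.DD 1)ˣ) * φ PGauss.Rmat) ∧
      (PGauss.ElemPG (R : PGauss.DD 2) ∧ PGauss.ElemPG ((R⁻¹ : (PGauss.DD 2)ˣ) : PGauss.DD 2) ∧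
        PGauss.ElemPG (v : PGauss.DD 1) ∧ PGauss.ElemPG ((v⁻¹ : (PGauss.DD 1)ˣ) : PGauss.DD 1) ∧
        PGauss.ElemPG (C : PGauss.DD 1) ∧ PGauss.ElemPG ((C⁻¹ : (PGauss.DD 1)ˣ) : PGauss.DD 1)) ∧
      ((∃ F ∈ PGauss.PGplus 1 2, PGauss.IsGenFun Δ.toLinearMap F) ∧
        (∃ F ∈ PGauss.PGplus 2 1, PGauss.IsGenFun m F) ∧
        (∃ F ∈ PGauss.PGplus 1 1, PGauss.IsGenFun S F) ∧
        (∃ F ∈ PGauss.PGplus 1 0, PGauss.IsGenFun e.toLinearMap F)) ∧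
      PGauss.pairingGF ∈ PGauss.PGpm 2 0 := by
  obtain ⟨R, hR, hR'⟩ := PGauss.exists_unit_Rmat
  obtain ⟨C, hC, hC'⟩ := PGauss.exists_unit_spinner
  obtain ⟨v, hv, hv'⟩ := PGauss.exists_unit_ribbon
  refine ⟨PGauss.OO_bijective, PGauss.mulD, PGauss.comulD, PGauss.antiD, PGauss.counitD,
    PGauss.antiMulD, R, C, v, ⟨PGauss.isMul_mulD, PGauss.isComul_comulD, PGauss.isAntipode_antiD,
      PGauss.isCounit_counitD, PGauss.isAntipodeMulOp_antiMulD, hR, hC, ?_⟩, ?_,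
    ⟨PGauss.genFun_comulD_mem, PGauss.genFun_mulD_mem, PGauss.genFun_antiD_mem,
      PGauss.genFun_counitD_mem⟩, PGauss.pairingGF_mem⟩
  · rw [hv, hC', PGauss.spinner_inv_mul]
  · rw [hR, hR', hv, hv', hC, hC']
    exact ⟨PGauss.elemPG_Rmat, PGauss.elemPG_RmatInv, PGauss.elemPG_ribbon, PGauss.elemPG_ribbonInv,
      PGauss.elemPG_spinner, PGauss.elemPG_spinnerInv⟩
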